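/- **Theorem.** Let $\varepsilon>0$ be a constant. *Problems.* *Maximum Subarray*: given an $n\times n$ matrix $M$ ($n\ge 1$), output $\max_{i\le i',\,j\le j'}\sum_{a=i}^{i'}\sum_{b=j}^{j'}M[a,b]$. *All-Pairs Shortest Paths*: given an edge-weighted directed graph on $n\ge1$ vertices without negative cycles, decide for all vertices $u,v$ whether $v$ is reachable from $u$ and, if so, output the distance from $u$ to $v$ (the minimum total weight of a walk from $u$ to $v$) together with a walk attaining it; the walks have at most $2n$ edges each and are given jointly by an $n\times n$ matrix whose entry $(u,v)$, $u\ne v$, is either an intermediate vertex $p$ (follow the walk from $u$ to $p$, then the one from $p$ to $v$) or a mark for the single edge from $u$ to $v$. Undirected graphs with non-negative weights are the special case of symmetric weights. *Machine model.* A random access machine whose index words are bounded by a fixed polynomial in $n$, with unit-cost arithmetic and comparison on words, and unit-cost addition, subtraction and comparison of weights; arrays can be initialised to zero at unit cost. A single program serves all $n$, and running times are worst-case numbers of steps. (i) *Real weights.* If a randomized algorithm (correct with probability at least $2/3$ on every input; deterministic algorithms are a special case) solves Maximum Subarray on $n\times n$ matrices of arbitrary real numbers in time $O(n^{3-\varepsilon})$,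 then a randomized algorithm (correct with probability at least $2/3$ on every input) solves All-Pairs Shortest Paths on $n$-vertex graphs with arbitrary real weights in time $O(n^{3-\varepsilon/10})$. (ii) *Integer weights, deterministically.* If for every constant $c$ a deterministic algorithm solves Maximum Subarray on $n\times n$ matrices of integers of absolute value at most $n^c$ in time $O(n^{3-\varepsilon})$, then for every constant $c$ a deterministic algorithm solves All-Pairs Shortest Paths on $n$-vertex graphs with integer weights of absolute value at most $n^c$ in time $O(n^{3-\varepsilon/10})$. Here the weights handled by the algorithms also stay bounded by a fixed polynomial in $n$ (which may depend on $c$), i.e. the machine is a word RAM with words of $O(\log n)$ bits. -/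

import Mathlib

/-! ### The machine model

A random access machine with two kinds of cells. *Word* cells hold natural numbers (indices,
counters, flags) and have unit-cost arithmetic; they stay polynomially bounded in the size of the
input, i.e. they are words of logarithmically many bits. *Numeric* cells hold real numbers, on
which a program can only add, subtract and compare (the addition-comparison model that is usual
for shortest paths with real weights). Programs are finite; a program uses finitely many registers
and finitely many arrays, and arrays are indexed by the contents of word registers. -/

/-- A configuration of the machine. -/
structure RamState where
  /-- word registers -/
  wreg : ℕ → ℕ
  /-- numeric registers -/
  xreg : ℕ → ℝ
  /-- word arrays: `warr a m` is the entry with index `m` of array `a` -/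
  warr : ℕ → ℕ → ℕ
  /-- numeric arrays -/
  xarr : ℕ → ℕ → ℝ
  /-- the coin tosses that have not been used yet -/
  coins : ℕ → Bool

/-- Binary operations on words (subtraction is truncated, division rounds down). -/
inductive WordOp where
  | add | sub | mul | div | mod

def WordOp.eval : WordOp → ℕ → ℕ → ℕ
  | .add, p, q => p + q
  | .sub, p, q => p - q
  | .mul, p, q => p * q
  | .div, p, q => p / q
  | .mod, p, q => p % q

/-- Programs. Numbers `i j k` name registers and `a` names an array. -/
inductive RamProg where
  /-- do nothing -/
  | skip
  /-- word register `i` := the constant `c` -/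
  | wconst (i c : ℕ)
  /-- word register `i` := (word register `j`) `o` (word register `k`) -/
  | wop (o : WordOp) (i j k : ℕ)
  /-- word register `i` := word array `a` at the index in word register `j` -/
  | wload (i a j : ℕ)
  /-- word array `a` at the index in word register `j` := word register `i` -/
  | wstore (a j i : ℕ)
  /-- set word array `a` to zero (unit cost, by constant-time initialisation of arrays) -/
  | wclear (a : ℕ)
  /-- numeric register `i` := the integer constant `z` -/
  | xconst (i : ℕ) (z : ℤ)
  /-- numeric register `i` := numeric register `j` + numeric register `k` -/
  | xadd (i j k : ℕ)
  /-- numeric register `i` := numeric register `j` - numeric register `k` -/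
  | xsub (i j k : ℕ)
  /-- numeric register `i` := numeric array `a` at the index in word register `j` -/
  | xload (i a j : ℕ)
  /-- numeric array `a` at the index in word register `j` := numeric register `i` -/
  | xstore (a j i : ℕ)
  /-- set numeric array `a` to zero -/
  | xclear (a : ℕ)
  /-- word register `i` := the next coin toss (0 or 1) -/
  | flip (i : ℕ)
  /-- run `c`, then `d` -/
  | seq (c d : RamProg)
  /-- if word register `j` < word register `k` then `c` else `d` -/
  | ifw (j k : ℕ) (c d : RamProg)
  /-- if numeric register `j` < numeric register `k` then `c` else `d` -/
  | ifx (j k : ℕ) (c d : RamProg)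
  /-- while word register `j` < word register `k` do `c` -/
  | loop (j k : ℕ) (c : RamProg)

/-- The program tosses no coins. -/
def RamProg.CoinFree : RamProg → Prop
  | .flip _ => False
  | .seq c d => c.CoinFree ∧ d.CoinFree
  | .ifw _ _ c d => c.CoinFree ∧ d.CoinFree
  | .ifx _ _ c d => c.CoinFree ∧ d.CoinFree
  | .loop _ _ c => c.CoinFree
  | _ => True

namespace RamState

def setW (s : RamState) (i v : ℕ) : RamState :=
  { s with wreg := Function.update s.wreg i v }

def setX (s : RamState) (i : ℕ) (v : ℝ) : RamState :=
  { s with xreg := Function.update s.xreg i v }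

def storeW (s : RamState) (a m v : ℕ) : RamState :=
  { s with warr := Function.update s.warr a (Function.update (s.warr a) m v) }

def storeX (s : RamState) (a m : ℕ) (v : ℝ) : RamState :=
  { s with xarr := Function.update s.xarr a (Function.update (s.xarr a) m v) }

def clearW (s : RamState) (a : ℕ) : RamState :=
  { s with warr := Function.update s.warr a (fun _ => 0) }

def clearX (s : RamState) (a : ℕ) : RamState :=
  { s with xarr := Function.update s.xarr a (fun _ => 0) }

def toss (s : RamState) (i : ℕ) : RamState :=
  { s.setW i (if s.coins 0 then 1 else 0) with coins := fun m => s.coins (m + 1) }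

end RamState

/-- `RunsTo B N c s k s'`: started in `s`, the program `c` halts in `s'` after `k` steps, and on
the way every value written to a word register is at most `B` and every value written to a numeric
register lies in `N`. Each instruction and each evaluation of a test is one step. -/
inductive RunsTo (B : ℕ) (N : Set ℝ) : RamProg → RamState → ℕ → RamState → Prop
  | skip (s : RamState) : RunsTo B N .skip s 1 s
  | wconst (s : RamState) (i c : ℕ) (h : c ≤ B) :
      RunsTo B N (.wconst i c) s 1 (s.setW i c)
  | wop (s : RamState) (o : WordOp) (i j k : ℕ) (h : o.eval (s.wreg j) (s.wreg k) ≤ B) :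
      RunsTo B N (.wop o i j k) s 1 (s.setW i (o.eval (s.wreg j) (s.wreg k)))
  | wload (s : RamState) (i a j : ℕ) (h : s.warr a (s.wreg j) ≤ B) :
      RunsTo B N (.wload i a j) s 1 (s.setW i (s.warr a (s.wreg j)))
  | wstore (s : RamState) (a j i : ℕ) :
      RunsTo B N (.wstore a j i) s 1 (s.storeW a (s.wreg j) (s.wreg i))
  | wclear (s : RamState) (a : ℕ) :
      RunsTo B N (.wclear a) s 1 (s.clearW a)
  | xconst (s : RamState) (i : ℕ) (z : ℤ) (h : (z : ℝ) ∈ N) :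
      RunsTo B N (.xconst i z) s 1 (s.setX i z)
  | xadd (s : RamState) (i j k : ℕ) (h : s.xreg j + s.xreg k ∈ N) :
      RunsTo B N (.xadd i j k) s 1 (s.setX i (s.xreg j + s.xreg k))
  | xsub (s : RamState) (i j k : ℕ) (h : s.xreg j - s.xreg k ∈ N) :
      RunsTo B N (.xsub i j k) s 1 (s.setX i (s.xreg j - s.xreg k))
  | xload (s : RamState) (i a j : ℕ) (h : s.xarr a (s.wreg j) ∈ N) :
      RunsTo B N (.xload i a j) s 1 (s.setX i (s.xarr a (s.wreg j)))
  | xstore (s : RamState) (a j i : ℕ) :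
      RunsTo B N (.xstore a j i) s 1 (s.storeX a (s.wreg j) (s.xreg i))
  | xclear (s : RamState) (a : ℕ) :
      RunsTo B N (.xclear a) s 1 (s.clearX a)
  | flip (s : RamState) (i : ℕ) (h : 1 ≤ B) :
      RunsTo B N (.flip i) s 1 (s.toss i)
  | seq {c d : RamProg} {s s' s'' : RamState} {p q : ℕ}
      (hc : RunsTo B N c s p s') (hd : RunsTo B N d s' q s'') :
      RunsTo B N (.seq c d) s (p + q) s''
  | ifwTrue {j k : ℕ} {c d : RamProg} {s s' : RamState} {p : ℕ}
      (h : s.wreg j < s.wreg k) (hc : RunsTo B N c s p s') :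
      RunsTo B N (.ifw j k c d) s (p + 1) s'
  | ifwFalse {j k : ℕ} {c d : RamProg} {s s' : RamState} {p : ℕ}
      (h : ¬ s.wreg j < s.wreg k) (hd : RunsTo B N d s p s') :
      RunsTo B N (.ifw j k c d) s (p + 1) s'
  | ifxTrue {j k : ℕ} {c d : RamProg} {s s' : RamState} {p : ℕ}
      (h : s.xreg j < s.xreg k) (hc : RunsTo B N c s p s') :
      RunsTo B N (.ifx j k c d) s (p + 1) s'
  | ifxFalse {j k : ℕ} {c d : RamProg} {s s' : RamState} {p : ℕ}
      (h : ¬ s.xreg j < s.xreg k) (hd : RunsTo B N d s p s') :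
      RunsTo B N (.ifx j k c d) s (p + 1) s'
  | loopStop {j k : ℕ} {c : RamProg} {s : RamState}
      (h : ¬ s.wreg j < s.wreg k) :
      RunsTo B N (.loop j k c) s 1 s
  | loopStep {j k : ℕ} {c : RamProg} {s s' s'' : RamState} {p q : ℕ}
      (h : s.wreg j < s.wreg k) (hc : RunsTo B N c s p s')
      (hl : RunsTo B N (.loop j k c) s' q s'') :
      RunsTo B N (.loop j k c) s (p + q + 1) s''

/-! ### Computational problems and running times -/

/-- A computational problem whose instances come with a size: which instances are admissible, how
an instance is presented to the machine (given the coin tosses), and when a final configuration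
holds a correct answer. -/
structure RamProblem where
  Inst : ℕ → Type
  Valid : ∀ n, Inst n → Prop
  start : ∀ n, Inst n → (ℕ → Bool) → RamState
  Answers : ∀ n, Inst n → RamState → Prop

/-- A finite sequence of coin tosses, as a stream. -/
def coinStream {t : ℕ} (r : Fin t → Bool) : ℕ → Bool :=
  fun m => if h : m < t then r ⟨m, h⟩ else false

/-- `P` has a randomized algorithm with worst-case running time `O(n ^ e)` on the real RAM: on
every admissible instance of size `n ≥ 1` it always halts within `t n = O(n ^ e)` steps, and its
answer is correct with probability at least `2 / 3` over the at most `t n` coin tosses that it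
makes. Words stay polynomially bounded; numeric cells hold arbitrary reals. -/
def RamProblem.RandomizedTime (P : RamProblem) (e : ℝ) : Prop :=
  ∃ (prog : RamProg) (C : ℝ) (K d : ℕ) (t : ℕ → ℕ), ∀ n : ℕ, 1 ≤ n →
    (t n : ℝ) ≤ C * (n : ℝ) ^ e ∧
    ∀ I : P.Inst n, P.Valid n I →
      (∀ r : Fin (t n) → Bool, ∃ k ≤ t n, ∃ s,
        RunsTo (K * n ^ d) Set.univ prog (P.start n I (coinStream r)) k s) ∧
      2 * 2 ^ t n ≤ 3 * Set.ncard {r : Fin (t n) → Bool | ∃ k ≤ t n, ∃ s,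
        RunsTo (K * n ^ d) Set.univ prog (P.start n I (coinStream r)) k s ∧ P.Answers n I s}

/-- `P` has a deterministic algorithm with worst-case running time `O(n ^ e)` on the word RAM:
both words and numeric cells stay polynomially bounded in `n`. -/
def RamProblem.DeterministicTime (P : RamProblem) (e : ℝ) : Prop :=
  ∃ (prog : RamProg) (C : ℝ) (K d : ℕ) (t : ℕ → ℕ), prog.CoinFree ∧ ∀ n : ℕ, 1 ≤ n →
    (t n : ℝ) ≤ C * (n : ℝ) ^ e ∧
    ∀ I : P.Inst n, P.Valid n I → ∃ k ≤ t n, ∃ s,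
      RunsTo (K * n ^ d) {x : ℝ | |x| ≤ (K * n ^ d : ℕ)} prog
        (P.start n I (fun _ => false)) k s ∧ P.Answers n I s

/-- The contents of an array that stores the matrix `f` row by row, followed by zeros. -/
def rowMajor {α : Type} [Zero α] {n : ℕ} (f : Fin n → Fin n → α) : ℕ → α :=
  fun m => if h : m / n < n ∧ m % n < n then f ⟨m / n, h.1⟩ ⟨m % n, h.2⟩ else 0

/-- `x` is an integer of absolute value at most `n ^ c`. -/
def IsSmallInt (c n : ℕ) (x : ℝ) : Prop :=
  ∃ z : ℤ, x = z ∧ |z| ≤ (n : ℤ) ^ c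

/-! ### Maximum Subarray -/

/-- The sums of the contiguous non-empty rectangular subarrays of `M`. -/
def subarraySums {n : ℕ} (M : Fin n → Fin n → ℝ) : Set ℝ :=
  {x | ∃ i i' j j' : Fin n, i ≤ i' ∧ j ≤ j' ∧
    x = ∑ a ∈ Finset.Icc i i', ∑ b ∈ Finset.Icc j j', M a b}

/-- Maximum Subarray on `n × n` matrices with entries in `E n`. Input: `n` in word register `0`,
the matrix in numeric array `0`. Output: the largest sum of a subarray, in numeric register `0`. -/
def maxSubarray (E : ℕ → Set ℝ) : RamProblem where
  Inst n := Fin n → Fin n → ℝ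
  Valid n M := ∀ i j, M i j ∈ E n
  start n M r :=
    { wreg := fun i => if i = 0 then n else 0
      xreg := fun _ => 0
      warr := fun _ _ => 0
      xarr := fun a => if a = 0 then rowMajor M else fun _ => 0
      coins := r }
  Answers _ M s := IsGreatest (subarraySums M) (s.xreg 0)

/-! ### All-Pairs Shortest Paths -/

/-- `IsWalk w u v x`: some walk from `u` to `v` has total weight `x`, in the directed graph with
edge weights `w`, where `none` means that there is no edge. -/
inductive IsWalk {n : ℕ} (w : Fin n → Fin n → Option ℝ) : Fin n → Fin n → ℝ → Prop
  | nil (u : Fin n) : IsWalk w u u 0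
  | cons {u p v : Fin n} {a x : ℝ} (h : w u p = some a) (hp : IsWalk w p v x) :
      IsWalk w u v (a + x)

/-- No closed walk (equivalently, no cycle) has negative weight. -/
def NoNegativeCycle {n : ℕ} (w : Fin n → Fin n → Option ℝ) : Prop :=
  ∀ u x, IsWalk w u u x → 0 ≤ x

/-- `DecodesTo w mid u v x l`: the matrix `mid` of intermediate vertices encodes a walk from `u` to
`v` of weight `x` with `l` edges. For `u ≠ v` the encoded walk is the walk from `u` to `mid u v`
followed by the one from `mid u v` to `v`; an entry that is not the number of a vertex stands for
the edge from `u` to `v`. -/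
inductive DecodesTo {n : ℕ} (w : Fin n → Fin n → Option ℝ) (mid : Fin n → Fin n → ℕ) :
    Fin n → Fin n → ℝ → ℕ → Prop
  | nil (u : Fin n) : DecodesTo w mid u u 0 0
  | edge {u v : Fin n} {a : ℝ} (huv : u ≠ v) (hm : n ≤ mid u v) (h : w u v = some a) :
      DecodesTo w mid u v a 1
  | split {u p v : Fin n} {x y : ℝ} {l m : ℕ} (huv : u ≠ v) (hm : mid u v = p)
      (hu : DecodesTo w mid u p x l) (hv : DecodesTo w mid p v y m) :
      DecodesTo w mid u v (x + y) (l + m)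

/-- The entry in row `u` and column `v` of an `n × n` matrix that is stored row by row. -/
def entryAt {α : Type} {n : ℕ} (f : ℕ → α) (u v : Fin n) : α :=
  f (u * n + v)

/-- All-Pairs Shortest Paths on directed graphs with `n` vertices, edge weights in `E n` and no
negative cycle. Input: `n` in word register `0`, the adjacency matrix in word array `0`, the
weights in numeric array `0`. Output, for all vertices `u` and `v`: whether `v` can be reached from
`u` (`1` or `0`, in word array `1`), and if so, the distance from `u` to `v` (in numeric array `1`)
and a walk that attains it and has at most `2 n` edges (encoded in word array `2`). -/
def allPairsShortestPaths (E : ℕ → Set ℝ) : RamProblem where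
  Inst n := Fin n → Fin n → Option ℝ
  Valid n w := NoNegativeCycle w ∧ ∀ u v, ∀ x ∈ w u v, x ∈ E n
  start n w r :=
    { wreg := fun i => if i = 0 then n else 0
      xreg := fun _ => 0
      warr := fun a =>
        if a = 0 then rowMajor (fun u v => if (w u v).isSome then 1 else 0) else fun _ => 0
      xarr := fun a => if a = 0 then rowMajor (fun u v => (w u v).getD 0) else fun _ => 0
      coins := r }
  Answers n w s := ∀ u v : Fin n,
    ((∃ x, IsWalk w u v x) ∧ entryAt (s.warr 1) u v = 1 ∧
      IsLeast {x | IsWalk w u v x} (entryAt (s.xarr 1) u v) ∧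
      ∃ l ≤ 2 * n, DecodesTo w (entryAt (s.warr 2)) u v (entryAt (s.xarr 1) u v) l) ∨
    ((¬ ∃ x, IsWalk w u v x) ∧ entryAt (s.warr 1) u v = 0)

/-! ### Reasoning about programs -/

namespace RamState

section fields
variable (s : RamState) (i j v a b m : ℕ) (x : ℝ)

/-! For `ε > 1` the hypotheses are false. A run that is correct on the zero matrix behaves the same
on a matrix with a single `1` in a cell that it does not read, so about `n²` entries must be read,
also on average over the coin tosses (`not_deterministicTime`, `not_randomizedTime`). For `ε ≤ 1`
there is a reduction.

Distances are obtained by repeated min-plus squaring of a matrix that is padded to `N = 2 ^ lam`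
vertices. To square `D`, a matrix `T` of tentative values is lowered by relaxations `T i j ← min (T
i j) (D i k + D k j)`. The triples `i j k` are grouped into `g³` blocks of `s³` triples, where `s *
g = N` and `s ≈ N^(1/5)`. One Maximum Subarray query of size `2 s - 1` decides whether some triple
of a block improves `T` by more than `δ`, and only in that case are all its triples relaxed. The
query is possible since a rectangle sum of the mixed differences of a function is an alternating sum
over four corners, and a suitable function on a `2 s × 2 s` grid makes exactly the improving triples
exceed a known threshold (`lt_maxSubarray_iff`).

The cost is `g³` queries plus `s³` for each block with an improvement, so there may be at most about
`N² s` such blocks. This follows from a natural-number potential of every entry that drops at each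
improvement and starts at no more than `s` (`PassGood`, `pass_spec`). For real weights all pairs are
first relaxed through about `g log N` random vertices; with high probability each pair meets a
vertex for which fewer than `s` others are better, and the potential counts the better vertices
(`levelGood_randomized`). For integer weights the accuracies `δ` of successive passes are halved
down to `1` and then set to `0`; in each pass every entry is within two units of its target
(`exists_integer_potential`, `levelGood_deterministic`). With `s⁵ ≈ N` the total is `N^(3 - 1/5) +
N^(3 - ε/5)` up to a factor `log³ N` (`apspTime_le`, `exists_coreTime_le`).

A randomized subroutine is asked `O(log n)` times and the majority decides. Wrong majorities do no
harm to the running time, because the number of relaxed blocks is capped, and none to soundness,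
because the matrix is only changed by relaxations. The tosses for the votes are drawn once and
reused for all blocks and levels. This is legitimate: as long as no vote has failed, `D` is
determined by the input (`minPlusPow`) and the matrix of each query by `D` and the sampled vertices
(`sampledBlock`), so a union bound over matrices that do not depend on these tosses suffices
(`ave_ind_fails_le`).

Each entry remembers the intermediate vertex of its last strict decrease. If the final entries are
distances, both halves of such a split had already reached their final values one level earlier, so
the recursion ends and describes a walk with at most `N ≤ 2 n` edges (`Levels.correct`). `apsp_spec`
joins the parts for both reductions: halting in time always, a correct answer if the good event `G`
holds. -/

@[simp] theorem setW_wreg : (s.setW i v).wreg j = if j = i then v else s.wreg j := by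
  simp [setW, Function.update_apply]
@[simp] theorem setW_xreg : (s.setW i v).xreg = s.xreg := rfl
@[simp] theorem setW_warr : (s.setW i v).warr = s.warr := rfl
@[simp] theorem setW_xarr : (s.setW i v).xarr = s.xarr := rfl
@[simp] theorem setW_coins : (s.setW i v).coins = s.coins := rfl
@[simp] theorem setX_wreg : (s.setX i x).wreg = s.wreg := rfl
@[simp] theorem setX_xreg : (s.setX i x).xreg j = if j = i then x else s.xreg j := by
  simp [setX, Function.update_apply]
@[simp] theorem setX_warr : (s.setX i x).warr = s.warr := rfl
@[simp] theorem setX_xarr : (s.setX i x).xarr = s.xarr := rfl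
@[simp] theorem setX_coins : (s.setX i x).coins = s.coins := rfl
@[simp] theorem storeW_wreg : (s.storeW a m v).wreg = s.wreg := rfl
@[simp] theorem storeW_xreg : (s.storeW a m v).xreg = s.xreg := rfl
@[simp] theorem storeW_warr : (s.storeW a m v).warr b =
    if b = a then Function.update (s.warr a) m v else s.warr b := by
  simp [storeW, Function.update_apply]
@[simp] theorem storeW_xarr : (s.storeW a m v).xarr = s.xarr := rfl
@[simp] theorem storeW_coins : (s.storeW a m v).coins = s.coins := rfl
@[simp] theorem storeX_wreg : (s.storeX a m x).wreg = s.wreg := rfl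
@[simp] theorem storeX_xreg : (s.storeX a m x).xreg = s.xreg := rfl
@[simp] theorem storeX_warr : (s.storeX a m x).warr = s.warr := rfl
@[simp] theorem storeX_xarr : (s.storeX a m x).xarr b =
    if b = a then Function.update (s.xarr a) m x else s.xarr b := by
  simp [storeX, Function.update_apply]
@[simp] theorem storeX_coins : (s.storeX a m x).coins = s.coins := rfl
@[simp] theorem clearW_wreg : (s.clearW a).wreg = s.wreg := rfl
@[simp] theorem clearW_xreg : (s.clearW a).xreg = s.xreg := rfl
@[simp] theorem clearW_warr : (s.clearW a).warr b = if b = a then fun _ => 0 else s.warr b := by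
  simp [clearW, Function.update_apply]
@[simp] theorem clearW_xarr : (s.clearW a).xarr = s.xarr := rfl
@[simp] theorem clearW_coins : (s.clearW a).coins = s.coins := rfl
@[simp] theorem clearX_wreg : (s.clearX a).wreg = s.wreg := rfl
@[simp] theorem clearX_xreg : (s.clearX a).xreg = s.xreg := rfl
@[simp] theorem clearX_warr : (s.clearX a).warr = s.warr := rfl
@[simp] theorem clearX_xarr : (s.clearX a).xarr b = if b = a then fun _ => 0 else s.xarr b := by
  simp [clearX, Function.update_apply]
@[simp] theorem clearX_coins : (s.clearX a).coins = s.coins := rfl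
@[simp] theorem toss_wreg : (s.toss i).wreg j =
    if j = i then (if s.coins 0 then 1 else 0) else s.wreg j := by
  simp [toss]
@[simp] theorem toss_xreg : (s.toss i).xreg = s.xreg := rfl
@[simp] theorem toss_warr : (s.toss i).warr = s.warr := rfl
@[simp] theorem toss_xarr : (s.toss i).xarr = s.xarr := rfl
@[simp] theorem toss_coins : (s.toss i).coins = fun m => s.coins (m + 1) := rfl

end fields
end RamState

namespace RamProg

/-- The program does not write word register `i`. -/
def keepsW (i : ℕ) : RamProg → Bool
  | wconst j _ => i != j
  | wop _ j _ _ => i != j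
  | wload j _ _ => i != j
  | flip j => i != j
  | seq c d => c.keepsW i && d.keepsW i
  | ifw _ _ c d => c.keepsW i && d.keepsW i
  | ifx _ _ c d => c.keepsW i && d.keepsW i
  | loop _ _ c => c.keepsW i
  | _ => true

/-- The program does not write numeric register `i`. -/
def keepsX (i : ℕ) : RamProg → Bool
  | xconst j _ => i != j
  | xadd j _ _ => i != j
  | xsub j _ _ => i != j
  | xload j _ _ => i != j
  | seq c d => c.keepsX i && d.keepsX i
  | ifw _ _ c d => c.keepsX i && d.keepsX i
  | ifx _ _ c d => c.keepsX i && d.keepsX i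
  | loop _ _ c => c.keepsX i
  | _ => true

/-- The program does not write word array `a`. -/
def keepsWA (a : ℕ) : RamProg → Bool
  | wstore b _ _ => a != b
  | wclear b => a != b
  | seq c d => c.keepsWA a && d.keepsWA a
  | ifw _ _ c d => c.keepsWA a && d.keepsWA a
  | ifx _ _ c d => c.keepsWA a && d.keepsWA a
  | loop _ _ c => c.keepsWA a
  | _ => true

/-- The program does not write numeric array `a`. -/
def keepsXA (a : ℕ) : RamProg → Bool
  | xstore b _ _ => a != b
  | xclear b => a != b
  | seq c d => c.keepsXA a && d.keepsXA a
  | ifw _ _ c d => c.keepsXA a && d.keepsXA a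
  | ifx _ _ c d => c.keepsXA a && d.keepsXA a
  | loop _ _ c => c.keepsXA a
  | _ => true

/-- Weakest precondition of a program without loops. -/
def wp (B : ℕ) (N : Set ℝ) : RamProg → RamState → (RamState → Prop) → Prop
  | skip, s, Q => Q s
  | wconst i c, s, Q => c ≤ B ∧ Q (s.setW i c)
  | wop o i j k, s, Q => o.eval (s.wreg j) (s.wreg k) ≤ B ∧
      Q (s.setW i (o.eval (s.wreg j) (s.wreg k)))
  | wload i a j, s, Q => s.warr a (s.wreg j) ≤ B ∧ Q (s.setW i (s.warr a (s.wreg j)))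
  | wstore a j i, s, Q => Q (s.storeW a (s.wreg j) (s.wreg i))
  | wclear a, s, Q => Q (s.clearW a)
  | xconst i z, s, Q => (z : ℝ) ∈ N ∧ Q (s.setX i z)
  | xadd i j k, s, Q => s.xreg j + s.xreg k ∈ N ∧ Q (s.setX i (s.xreg j + s.xreg k))
  | xsub i j k, s, Q => s.xreg j - s.xreg k ∈ N ∧ Q (s.setX i (s.xreg j - s.xreg k))
  | xload i a j, s, Q => s.xarr a (s.wreg j) ∈ N ∧ Q (s.setX i (s.xarr a (s.wreg j)))
  | xstore a j i, s, Q => Q (s.storeX a (s.wreg j) (s.xreg i))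
  | xclear a, s, Q => Q (s.clearX a)
  | flip i, s, Q => 1 ≤ B ∧ Q (s.toss i)
  | seq c d, s, Q => c.wp B N s fun s' => d.wp B N s' Q
  | ifw j k c d, s, Q => (s.wreg j < s.wreg k → c.wp B N s Q) ∧
      (s.wreg k ≤ s.wreg j → d.wp B N s Q)
  | ifx j k c d, s, Q => (s.xreg j < s.xreg k → c.wp B N s Q) ∧
      (s.xreg k ≤ s.xreg j → d.wp B N s Q)
  | loop _ _ _, _, _ => False

/-- The largest number of steps of a program without loops. -/
def cost : RamProg → ℕ
  | seq c d => c.cost + d.cost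
  | ifw _ _ c d => max c.cost d.cost + 1
  | ifx _ _ c d => max c.cost d.cost + 1
  | _ => 1

end RamProg

/-- `p` halts in at most `k` steps in a state with property `Q`. -/
def Runs (B : ℕ) (N : Set ℝ) (p : RamProg) (s : RamState) (k : ℕ) (Q : RamState → Prop) : Prop :=
  ∃ k' ≤ k, ∃ s', RunsTo B N p s k' s' ∧ Q s'

/-- What `p` does not write is the same in `s` and `s'`. -/
structure Frame (p : RamProg) (s s' : RamState) : Prop where
  wreg : ∀ i, p.keepsW i = true → s'.wreg i = s.wreg i
  xreg : ∀ i, p.keepsX i = true → s'.xreg i = s.xreg i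
  warr : ∀ a, p.keepsWA a = true → s'.warr a = s.warr a
  xarr : ∀ a, p.keepsXA a = true → s'.xarr a = s.xarr a

section
variable {B : ℕ} {N : Set ℝ}

theorem Frame.rfl' {p : RamProg} {s : RamState} : Frame p s s :=
  ⟨fun _ _ => rfl, fun _ _ => rfl, fun _ _ => rfl, fun _ _ => rfl⟩

/-- The `keeps` functions are computed from the program text, so for a concrete program their values
are found by `rfl` or `simp`, and a specification need only describe what changes. -/
theorem RunsTo.frame {p : RamProg} {s s' : RamState} {k : ℕ} (h : RunsTo B N p s k s') :
    Frame p s s' := by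
  induction h with
  | skip | wconst | wop | wload | wstore | wclear | xconst | xadd | xsub | xload | xstore | xclear
  | flip =>
    constructor <;> intro a ha <;>
      simp_all [RamProg.keepsW, RamProg.keepsX, RamProg.keepsWA, RamProg.keepsXA]
  | seq _ _ h1 h2 =>
    constructor <;> intro a ha <;>
      simp only [RamProg.keepsW, RamProg.keepsX, RamProg.keepsWA, RamProg.keepsXA,
        Bool.and_eq_true] at ha
    · rw [h2.wreg a ha.2, h1.wreg a ha.1]
    · rw [h2.xreg a ha.2, h1.xreg a ha.1]
    · rw [h2.warr a ha.2, h1.warr a ha.1]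
    · rw [h2.xarr a ha.2, h1.xarr a ha.1]
  | ifwTrue _ _ h1 | ifxTrue _ _ h1 =>
    constructor <;> intro a ha <;>
      simp only [RamProg.keepsW, RamProg.keepsX, RamProg.keepsWA, RamProg.keepsXA,
        Bool.and_eq_true] at ha
    · exact h1.wreg a ha.1
    · exact h1.xreg a ha.1
    · exact h1.warr a ha.1
    · exact h1.xarr a ha.1
  | ifwFalse _ _ h1 | ifxFalse _ _ h1 =>
    constructor <;> intro a ha <;>
      simp only [RamProg.keepsW, RamProg.keepsX, RamProg.keepsWA, RamProg.keepsXA,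
        Bool.and_eq_true] at ha
    · exact h1.wreg a ha.2
    · exact h1.xreg a ha.2
    · exact h1.warr a ha.2
    · exact h1.xarr a ha.2
  | loopStop => exact Frame.rfl'
  | loopStep _ _ _ h1 h2 =>
    constructor <;> intro a ha
    · rw [h2.wreg a ha, h1.wreg a ha]
    · rw [h2.xreg a ha, h1.xreg a ha]
    · rw [h2.warr a ha, h1.warr a ha]
    · rw [h2.xarr a ha, h1.xarr a ha]

theorem Runs.weaken {p : RamProg} {s : RamState} {k l : ℕ} {Q R : RamState → Prop}
    (h : Runs B N p s k Q) (hkl : k ≤ l) (hQR : ∀ s', Frame p s s' → Q s' → R s') :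
    Runs B N p s l R := by
  obtain ⟨k', hk, s', hr, hQ⟩ := h
  exact ⟨k', hk.trans hkl, s', hr, hQR s' hr.frame hQ⟩

theorem Runs.seq {p q : RamProg} {s : RamState} {k l : ℕ} {Q R : RamState → Prop}
    (h : Runs B N p s k Q) (h' : ∀ s', Frame p s s' → Q s' → Runs B N q s' l R) :
    Runs B N (.seq p q) s (k + l) R := by
  obtain ⟨k1, hk1, s1, hr1, hQ⟩ := h
  obtain ⟨k2, hk2, s2, hr2, hR⟩ := h' s1 hr1.frame hQ
  exact ⟨_, add_le_add hk1 hk2, s2, .seq hr1 hr2, hR⟩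

theorem Runs.ifw {c d : RamProg} {s : RamState} {i j k : ℕ} {Q : RamState → Prop}
    (h : s.wreg i < s.wreg j → Runs B N c s k Q) (h' : s.wreg j ≤ s.wreg i → Runs B N d s k Q) :
    Runs B N (.ifw i j c d) s (k + 1) Q := by
  by_cases hij : s.wreg i < s.wreg j
  · obtain ⟨k1, hk1, s1, hr1, hQ⟩ := h hij
    exact ⟨_, Nat.succ_le_succ hk1, s1, .ifwTrue hij hr1, hQ⟩
  · obtain ⟨k1, hk1, s1, hr1, hQ⟩ := h' (not_lt.1 hij)
    exact ⟨_, Nat.succ_le_succ hk1, s1, .ifwFalse hij hr1, hQ⟩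

/-- Reduces loop-free code to evaluating `wp` by `simp`; the number of steps is then the closed term
`cost`. -/
theorem Runs.of_wp {p : RamProg} {s : RamState} {Q : RamState → Prop} (h : p.wp B N s Q) :
    Runs B N p s p.cost Q := by
  induction p generalizing s Q with
  | skip => exact ⟨1, le_rfl, s, .skip s, h⟩
  | wconst i c => exact ⟨1, le_rfl, _, .wconst s i c h.1, h.2⟩
  | wop o i j k => exact ⟨1, le_rfl, _, .wop s o i j k h.1, h.2⟩
  | wload i a j => exact ⟨1, le_rfl, _, .wload s i a j h.1, h.2⟩
  | wstore a j i => exact ⟨1, le_rfl, _, .wstore s a j i, h⟩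
  | wclear a => exact ⟨1, le_rfl, _, .wclear s a, h⟩
  | xconst i z => exact ⟨1, le_rfl, _, .xconst s i z h.1, h.2⟩
  | xadd i j k => exact ⟨1, le_rfl, _, .xadd s i j k h.1, h.2⟩
  | xsub i j k => exact ⟨1, le_rfl, _, .xsub s i j k h.1, h.2⟩
  | xload i a j => exact ⟨1, le_rfl, _, .xload s i a j h.1, h.2⟩
  | xstore a j i => exact ⟨1, le_rfl, _, .xstore s a j i, h⟩
  | xclear a => exact ⟨1, le_rfl, _, .xclear s a, h⟩
  | flip i => exact ⟨1, le_rfl, _, .flip s i h.1, h.2⟩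
  | seq c d hc hd => exact (hc h).seq fun s' _ h' => hd h'
  | ifw j k c d hc hd =>
    exact Runs.ifw (fun hl => (hc (h.1 hl)).weaken (le_max_left _ _) fun _ _ h => h)
      fun hl => (hd (h.2 hl)).weaken (le_max_right _ _) fun _ _ h => h
  | ifx j k c d hc hd =>
    by_cases hij : s.xreg j < s.xreg k
    · obtain ⟨k1, hk1, s1, hr1, hQ⟩ := hc (h.1 hij)
      exact ⟨_, Nat.succ_le_succ (hk1.trans (le_max_left _ _)), s1, .ifxTrue hij hr1, hQ⟩
    · obtain ⟨k1, hk1, s1, hr1, hQ⟩ := hd (h.2 (not_lt.1 hij))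
      exact ⟨_, Nat.succ_le_succ (hk1.trans (le_max_right _ _)), s1, .ifxFalse hij hr1, hQ⟩
  | loop => exact h.elim

/-- Run `body` with word register `i` set to `0, 1, …`, up to the number in word register `b`
(exclusive). Word register `1` has to contain `1`. -/
def forUpTo (i b : ℕ) (body : RamProg) : RamProg :=
  .seq (.wconst i 0) (.loop i b (.seq body (.wop .add i i 1)))

/-- The number `x` in the invariant `Inv q x s` pays for the bodies that take more than `c` steps. -/
theorem Runs.forUpTo_amortized (Inv : ℕ → ℕ → RamState → Prop) {body : RamProg} {s : RamState} {i b n c A : ℕ}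
    (hb : s.wreg b = n) (h1 : s.wreg 1 = 1) (hk : (body.keepsW i && body.keepsW b &&
      body.keepsW 1 && (i != b) && (i != 1)) = true) (hn : n ≤ B)
    (hA : ∀ q x s', Inv q x s' → x ≤ A) (h0 : Inv 0 0 (s.setW i 0))
    (hstep : ∀ q < n, ∀ x s', s'.wreg i = q → Frame (forUpTo i b body) s s' → Inv q x s' →
      ∃ y, Runs B N body s' (c + y) fun s'' => Inv (q + 1) (x + y) (s''.setW i (q + 1))) :
    Runs B N (forUpTo i b body) s (n * (c + 2) + 2 + A) fun s' => ∃ x, Inv n x s' := by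
  simp only [Bool.and_eq_true, bne_iff_ne] at hk
  obtain ⟨⟨⟨⟨hki, hkb⟩, hk1⟩, hib⟩, hi1⟩ := hk
  -- Induction on the number `d` of remaining rounds. A round takes the body, one step for the test
  -- and one for the increment; what exceeds this is moved from `x` to the final `X`.
  have key : ∀ d q, q + d = n → ∀ x s', s'.wreg i = q → Frame (_root_.forUpTo i b body) s s' →
      Inv q x s' → ∃ k' s'' X, RunsTo B N (.loop i b (.seq body (.wop .add i i 1))) s' k' s'' ∧
        Inv n X s'' ∧ k' + x ≤ d * (c + 2) + 1 + X := by
    intro d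
    induction d with
    | zero =>
      intro q hq x s' hi hF hI
      have hb' : s'.wreg b = n := by
        rw [hF.wreg b (by simp [_root_.forUpTo, RamProg.keepsW, hkb, hib.symm]), hb]
      obtain rfl : q = n := by omega
      exact ⟨1, s', x, .loopStop (by omega), hI, by omega⟩
    | succ d ih =>
      intro q hq x s' hi hF hI
      have hb' : s'.wreg b = n := by
        rw [hF.wreg b (by simp [_root_.forUpTo, RamProg.keepsW, hkb, hib.symm]), hb]
      have h1' : s'.wreg 1 = 1 := by
        rw [hF.wreg 1 (by simp [_root_.forUpTo, RamProg.keepsW, hk1, hi1.symm]), h1]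
      obtain ⟨y, k1, hk1', s1, hr1, hI1⟩ := hstep q (by omega) x s' hi hF hI
      have hF1 := hr1.frame
      have e1 : s1.wreg i = q := by rw [hF1.wreg i hki, hi]
      have e2 : s1.wreg 1 = 1 := by rw [hF1.wreg 1 hk1, h1']
      have hadd := RunsTo.wop (B := B) (N := N) s1 .add i i 1
        (by simp only [WordOp.eval, e1, e2]; omega)
      simp only [WordOp.eval, e1, e2] at hadd
      have hF2 := hadd.frame
      obtain ⟨k2, s2, X, hr2, hI2, hk2⟩ := ih (q + 1) (by omega) _ (s1.setW i (q + 1)) (by simp)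
        (by
          constructor
          · intro a ha
            have ha' := ha
            simp only [_root_.forUpTo, RamProg.keepsW, Bool.and_eq_true, bne_iff_ne] at ha'
            simp only [RamState.setW_wreg, if_neg ha'.1]
            rw [hF1.wreg a ha'.2.1, hF.wreg a ha]
          · intro a ha
            have ha' := ha
            simp only [_root_.forUpTo, RamProg.keepsX, Bool.and_eq_true] at ha'
            simp only [RamState.setW_xreg]
            rw [hF1.xreg a ha'.2.1, hF.xreg a ha]
          · intro a ha
            have ha' := ha
            simp only [_root_.forUpTo, RamProg.keepsWA, Bool.and_eq_true] at ha'
            simp only [RamState.setW_warr]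
            rw [hF1.warr a ha'.2.1, hF.warr a ha]
          · intro a ha
            have ha' := ha
            simp only [_root_.forUpTo, RamProg.keepsXA, Bool.and_eq_true] at ha'
            simp only [RamState.setW_xarr]
            rw [hF1.xarr a ha'.2.1, hF.xarr a ha]) hI1
      refine ⟨_, s2, X, .loopStep (by omega) (.seq hr1 hadd) hr2, hI2, ?_⟩
      ring_nf at hk2 ⊢
      omega
  obtain ⟨k', s', X, hr, hI, hk'⟩ := key n 0 (by omega) 0 (s.setW i 0) (by simp)
    (by
      constructor
      · intro a ha
        simp only [_root_.forUpTo, RamProg.keepsW, Bool.and_eq_true, bne_iff_ne] at ha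
        simp [ha.1]
      all_goals intros; rfl) h0
  have := hA _ _ _ hI
  exact ⟨_, by omega, s', .seq (.wconst s i 0 (Nat.zero_le _)) hr, X, hI⟩

theorem Runs.forUpTo (Inv : ℕ → RamState → Prop) {body : RamProg} {s : RamState} {i b n c : ℕ}
    (hb : s.wreg b = n) (h1 : s.wreg 1 = 1) (hk : (body.keepsW i && body.keepsW b &&
      body.keepsW 1 && (i != b) && (i != 1)) = true) (hn : n ≤ B)
    (h0 : Inv 0 (s.setW i 0))
    (hstep : ∀ q < n, ∀ s', s'.wreg i = q → Frame (forUpTo i b body) s s' → Inv q s' →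
      Runs B N body s' c fun s'' => Inv (q + 1) (s''.setW i (q + 1))) :
    Runs B N (forUpTo i b body) s (n * (c + 2) + 2) (Inv n) := by
  refine Runs.weaken (Runs.forUpTo_amortized (A := 0) (c := c) (fun q x s => x = 0 ∧ Inv q s) hb h1 hk
    hn (fun _ _ _ h => h.1.le) ⟨rfl, h0⟩ ?_) le_rfl fun s' _ h => h.elim fun _ h => h.2
  rintro q hq x s' hi hF ⟨rfl, hI⟩
  exact ⟨0, (hstep q hq s' hi hF hI).weaken le_rfl fun _ _ h => ⟨rfl, h⟩⟩

/-- Makes the answer of a vote a function of its input and tosses, so that separately obtained runs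
can be compared. -/
theorem RunsTo.deterministic {p : RamProg} {s s₁ s₂ : RamState} {k₁ k₂ : ℕ}
    (h₁ : RunsTo B N p s k₁ s₁) (h₂ : RunsTo B N p s k₂ s₂) : k₁ = k₂ ∧ s₁ = s₂ := by
  induction h₁ generalizing k₂ s₂ with
  | seq _ _ ih1 ih2 =>
    cases h₂ with
    | seq a b =>
      obtain ⟨rfl, rfl⟩ := ih1 a
      obtain ⟨rfl, rfl⟩ := ih2 b
      exact ⟨rfl, rfl⟩
  | ifwTrue h _ ih =>
    cases h₂ with
    | ifwTrue h' a => obtain ⟨rfl, rfl⟩ := ih a; exact ⟨rfl, rfl⟩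
    | ifwFalse h' a => exact absurd h h'
  | ifwFalse h _ ih =>
    cases h₂ with
    | ifwTrue h' a => exact absurd h' h
    | ifwFalse h' a => obtain ⟨rfl, rfl⟩ := ih a; exact ⟨rfl, rfl⟩
  | ifxTrue h _ ih =>
    cases h₂ with
    | ifxTrue h' a => obtain ⟨rfl, rfl⟩ := ih a; exact ⟨rfl, rfl⟩
    | ifxFalse h' a => exact absurd h h'
  | ifxFalse h _ ih =>
    cases h₂ with
    | ifxTrue h' a => exact absurd h' h
    | ifxFalse h' a => obtain ⟨rfl, rfl⟩ := ih a; exact ⟨rfl, rfl⟩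
  | loopStop h =>
    cases h₂ with
    | loopStop => exact ⟨rfl, rfl⟩
    | loopStep h' => exact absurd h' h
  | loopStep h _ _ ih1 ih2 =>
    cases h₂ with
    | loopStop h' => exact absurd h h'
    | loopStep h' a b =>
      obtain ⟨rfl, rfl⟩ := ih1 a
      obtain ⟨rfl, rfl⟩ := ih2 b
      exact ⟨rfl, rfl⟩
  | _ => cases h₂; exact ⟨rfl, rfl⟩

end

/-! ### Subroutines

A program is made into a subroutine by moving its registers and arrays out of the way and by
reading its coin tosses from word array `4`, at the index in word register `90`. -/

namespace RamProg

/-- All registers and arrays of the program have numbers below `m`. -/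
def Below (m : ℕ) : RamProg → Prop
  | skip => True
  | wconst i _ => i < m
  | wop _ i j k => i < m ∧ j < m ∧ k < m
  | wload i a j => i < m ∧ a < m ∧ j < m
  | wstore a j i => i < m ∧ a < m ∧ j < m
  | wclear a => a < m
  | xconst i _ => i < m
  | xadd i j k => i < m ∧ j < m ∧ k < m
  | xsub i j k => i < m ∧ j < m ∧ k < m
  | xload i a j => i < m ∧ a < m ∧ j < m
  | xstore a j i => i < m ∧ a < m ∧ j < m
  | xclear a => a < m
  | flip i => i < m
  | seq c d => c.Below m ∧ d.Below m
  | ifw j k c d => (j < m ∧ k < m) ∧ c.Below m ∧ d.Below m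
  | ifx j k c d => (j < m ∧ k < m) ∧ c.Below m ∧ d.Below m
  | loop j k c => (j < m ∧ k < m) ∧ c.Below m

theorem Below.mono {p : RamProg} {l m : ℕ} (h : p.Below l) (hlm : l ≤ m) : p.Below m := by
  induction p with
  | seq c d hc hd => exact ⟨hc h.1, hd h.2⟩
  | ifw j k c d hc hd | ifx j k c d hc hd =>
    exact ⟨⟨h.1.1.trans_le hlm, h.1.2.trans_le hlm⟩, hc h.2.1, hd h.2.2⟩
  | loop j k c hc => exact ⟨⟨h.1.1.trans_le hlm, h.1.2.trans_le hlm⟩, hc h.2⟩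
  | _ => simp only [Below] at h ⊢; try omega

theorem exists_below (p : RamProg) : ∃ m, p.Below m := by
  induction p with
  | skip => exact ⟨0, trivial⟩
  | wconst i | wclear i | xconst i | xclear i | flip i => exact ⟨i + 1, Nat.lt_succ_self i⟩
  | wop _ i j k | wload i j k | wstore i j k | xadd i j k | xsub i j k | xload i j k
  | xstore i j k => exact ⟨i + j + k + 1, by simp only [Below]; omega⟩
  | seq c d hc hd =>
    obtain ⟨a, ha⟩ := hc
    obtain ⟨b, hb⟩ := hd
    exact ⟨max a b, ha.mono (le_max_left _ _), hb.mono (le_max_right _ _)⟩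
  | ifw j k c d hc hd | ifx j k c d hc hd =>
    obtain ⟨a, ha⟩ := hc
    obtain ⟨b, hb⟩ := hd
    exact ⟨a + b + j + k + 1, ⟨by omega, by omega⟩, ha.mono (by omega), hb.mono (by omega)⟩
  | loop j k c hc =>
    obtain ⟨a, ha⟩ := hc
    exact ⟨a + j + k + 1, ⟨by omega, by omega⟩, ha.mono (by omega)⟩

/-- The program as a subroutine. -/
def reloc : RamProg → RamProg
  | skip => skip
  | wconst i c => wconst (i + 100) c
  | wop o i j k => wop o (i + 100) (j + 100) (k + 100)
  | wload i a j => wload (i + 100) (a + 100) (j + 100)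
  | wstore a j i => wstore (a + 100) (j + 100) (i + 100)
  | wclear a => wclear (a + 100)
  | xconst i z => xconst (i + 100) z
  | xadd i j k => xadd (i + 100) (j + 100) (k + 100)
  | xsub i j k => xsub (i + 100) (j + 100) (k + 100)
  | xload i a j => xload (i + 100) (a + 100) (j + 100)
  | xstore a j i => xstore (a + 100) (j + 100) (i + 100)
  | xclear a => xclear (a + 100)
  | flip i => seq (wload (i + 100) 4 90) (wop .add 90 90 1)
  | seq c d => seq c.reloc d.reloc
  | ifw j k c d => ifw (j + 100) (k + 100) c.reloc d.reloc
  | ifx j k c d => ifx (j + 100) (k + 100) c.reloc d.reloc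
  | loop j k c => loop (j + 100) (k + 100) c.reloc

-- Register `90` is excepted because a relocated coin toss advances the pointer that is kept there.
@[simp] theorem keepsW_reloc (p : RamProg) {i : ℕ} (h : i < 100 ∧ i ≠ 90) :
    p.reloc.keepsW i = true := by
  induction p <;> simp_all [reloc, keepsW] <;> omega

@[simp] theorem keepsX_reloc (p : RamProg) {i : ℕ} (h : i < 100) : p.reloc.keepsX i = true := by
  induction p <;> simp_all [reloc, keepsX] <;> omega

@[simp] theorem keepsWA_reloc (p : RamProg) {a : ℕ} (h : a < 100) :
    p.reloc.keepsWA a = true := by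
  induction p <;> simp_all [reloc, keepsWA] <;> omega

@[simp] theorem keepsXA_reloc (p : RamProg) {a : ℕ} (h : a < 100) :
    p.reloc.keepsXA a = true := by
  induction p <;> simp_all [reloc, keepsXA] <;> omega

/-- Tosses have become loads from an array; in the deterministic reduction that array is simply
zero. -/
theorem coinFree_reloc (p : RamProg) : p.reloc.CoinFree := by
  induction p <;> simp_all [reloc, CoinFree]

/-- Reset the first `m` registers and arrays of the subroutine. -/
def clearReloc : ℕ → RamProg
  | 0 => skip
  | m + 1 => seq (clearReloc m) (seq (wconst (m + 100) 0) (seq (xconst (m + 100) 0)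
      (seq (wclear (m + 100)) (xclear (m + 100)))))

@[simp] theorem keepsW_clearReloc (m : ℕ) {i : ℕ} (h : i < 100) :
    (clearReloc m).keepsW i = true := by
  induction m <;> simp_all [clearReloc, keepsW]; omega

@[simp] theorem keepsX_clearReloc (m : ℕ) {i : ℕ} (h : i < 100) :
    (clearReloc m).keepsX i = true := by
  induction m <;> simp_all [clearReloc, keepsX]; omega

@[simp] theorem keepsWA_clearReloc (m : ℕ) {i : ℕ} (h : i < 100) :
    (clearReloc m).keepsWA i = true := by
  induction m <;> simp_all [clearReloc, keepsWA]; omega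

@[simp] theorem keepsXA_clearReloc (m : ℕ) {i : ℕ} (h : i < 100) :
    (clearReloc m).keepsXA i = true := by
  induction m <;> simp_all [clearReloc, keepsXA]; omega

theorem coinFree_clearReloc (m : ℕ) : (clearReloc m).CoinFree := by
  induction m <;> simp_all [clearReloc, CoinFree]

end RamProg

/-- In `σ` the subroutine is where the program is in `s`, and finds at least `f` coin tosses. -/
structure Simulates (B m f : ℕ) (s σ : RamState) : Prop where
  wreg : ∀ i < m, σ.wreg (i + 100) = s.wreg i
  xreg : ∀ i < m, σ.xreg (i + 100) = s.xreg i
  warr : ∀ i < m, σ.warr (i + 100) = s.warr i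
  xarr : ∀ i < m, σ.xarr (i + 100) = s.xarr i
  coins : ∀ b < f, σ.warr 4 (σ.wreg 90 + b) = (s.coins b).toNat
  one : σ.wreg 1 = 1
  ptr : σ.wreg 90 + f ≤ B

section
variable {B : ℕ} {N : Set ℝ}

theorem Simulates.mono {m f f' : ℕ} {s σ : RamState} (h : Simulates B m f s σ) (hf : f' ≤ f) :
    Simulates B m f' s σ :=
  { h with
    coins := fun b hb => h.coins b (hb.trans_le hf)
    ptr := (Nat.add_le_add_left hf _).trans h.ptr }

/-- Every call must find the all-zero start configuration. As arrays are cleared at unit cost, this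
takes time independent of what earlier calls have written. -/
theorem RunsTo.clearReloc (h0 : (0 : ℝ) ∈ N) (m : ℕ) (s : RamState) :
    Runs B N (RamProg.clearReloc m) s (4 * m + 1) fun s' => ∀ i < m, s'.wreg (i + 100) = 0 ∧
      s'.xreg (i + 100) = 0 ∧ s'.warr (i + 100) = (fun _ => 0) ∧
      s'.xarr (i + 100) = fun _ => 0 := by
  induction m with
  | zero => exact ⟨1, by simp, s, .skip s, by simp⟩
  | succ m ih =>
    refine Runs.weaken (ih.seq (l := 4) (R := fun s' => ∀ i < m + 1, s'.wreg (i + 100) = 0 ∧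
      s'.xreg (i + 100) = 0 ∧ s'.warr (i + 100) = (fun _ => 0) ∧
      s'.xarr (i + 100) = fun _ => 0) fun s' _ hs' => Runs.of_wp ?_) (by omega) fun _ _ h => h
    simp only [RamProg.wp, Nat.zero_le, Int.cast_zero, h0, true_and]
    intro i hi
    obtain rfl | hi := Nat.lt_succ_iff_lt_or_eq.1 hi |>.symm
    · simp
    · have := hs' i hi
      simp [hi.ne, this]

/-- A run of `k` steps uses at most `k` tosses, so `k + j` tosses leave `j` for whatever follows;
this is the form that survives sequencing. The factor `2` is due to `flip`, which becomes a load and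
a pointer increment. -/
theorem RunsTo.reloc {B₀ m : ℕ} {N₀ : Set ℝ} (hB : B₀ ≤ B) (hN : N₀ ⊆ N)
    {p : RamProg} {s s' : RamState} {k : ℕ} (h : RunsTo B₀ N₀ p s k s') (hp : p.Below m)
    (j : ℕ) (σ : RamState) (hσ : Simulates B m (k + j) s σ) :
    Runs B N p.reloc σ (2 * k) fun σ' => Simulates B m j s' σ' := by
  induction h generalizing j σ with
  | skip s => exact ⟨1, by simp, σ, .skip σ, hσ.mono (by omega)⟩
  | wconst s i c h =>
    refine ⟨1, by simp, _, .wconst σ (i + 100) c (h.trans hB), ?_⟩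
    have := hσ.mono (f' := j) (by omega)
    exact { this with wreg := fun a ha => by simp [this.wreg a ha], coins := by simpa using this.coins,
                      one := by simp [this.one], ptr := by simpa using this.ptr }
  | wop s o i a b h =>
    have e := hσ.mono (f' := j) (by omega)
    have ha := e.wreg a hp.2.1
    have hb := e.wreg b hp.2.2
    refine ⟨1, by simp, _, .wop σ o (i + 100) (a + 100) (b + 100)
      (by rw [ha, hb]; exact h.trans hB), ?_⟩
    exact { e with wreg := fun a' ha' => by simp [e.wreg a' ha', ha, hb], coins := by simpa using e.coins,
                   one := by simp [e.one], ptr := by simpa using e.ptr }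
  | wload s i a b h =>
    have e := hσ.mono (f' := j) (by omega)
    have ha := e.warr a hp.2.1
    have hb := e.wreg b hp.2.2
    refine ⟨1, by simp, _, .wload σ (i + 100) (a + 100) (b + 100)
      (by rw [ha, hb]; exact h.trans hB), ?_⟩
    exact { e with wreg := fun a' ha' => by simp [e.wreg a' ha', ha, hb], coins := by simpa using e.coins,
                   one := by simp [e.one], ptr := by simpa using e.ptr }
  | wstore s a b i =>
    have e := hσ.mono (f' := j) (by omega)
    have ha := e.warr a hp.2.1
    have hb := e.wreg b hp.2.2
    have hi := e.wreg i hp.1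
    refine ⟨1, by simp, _, .wstore σ (a + 100) (b + 100) (i + 100), ?_⟩
    exact { e with warr := fun a' ha' => by simp [e.warr a' ha', ha, hb, hi], coins := by simpa using e.coins }
  | wclear s a =>
    have e := hσ.mono (f' := j) (by omega)
    refine ⟨1, by simp, _, .wclear σ (a + 100), ?_⟩
    exact { e with warr := fun a' ha' => by simp [e.warr a' ha'], coins := by simpa using e.coins }
  | xconst s i z h =>
    have e := hσ.mono (f' := j) (by omega)
    refine ⟨1, by simp, _, .xconst σ (i + 100) z (hN h), ?_⟩
    exact { e with xreg := fun a' ha' => by simp [e.xreg a' ha'] }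
  | xadd s i a b h =>
    have e := hσ.mono (f' := j) (by omega)
    have ha := e.xreg a hp.2.1
    have hb := e.xreg b hp.2.2
    refine ⟨1, by simp, _, .xadd σ (i + 100) (a + 100) (b + 100) (by rw [ha, hb]; exact hN h), ?_⟩
    exact { e with xreg := fun a' ha' => by simp [e.xreg a' ha', ha, hb] }
  | xsub s i a b h =>
    have e := hσ.mono (f' := j) (by omega)
    have ha := e.xreg a hp.2.1
    have hb := e.xreg b hp.2.2
    refine ⟨1, by simp, _, .xsub σ (i + 100) (a + 100) (b + 100) (by rw [ha, hb]; exact hN h), ?_⟩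
    exact { e with xreg := fun a' ha' => by simp [e.xreg a' ha', ha, hb] }
  | xload s i a b h =>
    have e := hσ.mono (f' := j) (by omega)
    have ha := e.xarr a hp.2.1
    have hb := e.wreg b hp.2.2
    refine ⟨1, by simp, _, .xload σ (i + 100) (a + 100) (b + 100) (by rw [ha, hb]; exact hN h), ?_⟩
    exact { e with xreg := fun a' ha' => by simp [e.xreg a' ha', ha, hb] }
  | xstore s a b i =>
    have e := hσ.mono (f' := j) (by omega)
    have ha := e.xarr a hp.2.1
    have hb := e.wreg b hp.2.2
    have hi := e.xreg i hp.1
    refine ⟨1, by simp, _, .xstore σ (a + 100) (b + 100) (i + 100), ?_⟩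
    exact { e with xarr := fun a' ha' => by simp [e.xarr a' ha', ha, hb, hi] }
  | xclear s a =>
    have e := hσ.mono (f' := j) (by omega)
    refine ⟨1, by simp, _, .xclear σ (a + 100), ?_⟩
    exact { e with xarr := fun a' ha' => by simp [e.xarr a' ha'] }
  | flip s i h =>
    have hc := hσ.coins 0 (by omega)
    have hptr := hσ.ptr
    simp only [add_zero] at hc
    refine (Runs.of_wp (p := RamProg.reloc (.flip i)) ?_ : Runs B N _ σ 2 _)
    simp only [RamProg.reloc, RamProg.wp, WordOp.eval]
    refine ⟨by rw [hc]; exact (Bool.toNat_le _).trans (h.trans hB), ?_, ?_⟩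
    · have := hσ.one
      simp [this]
      omega
    · have h1 := hσ.one
      constructor
      · intro a ha
        have := hσ.wreg a ha
        have h90 : a + 100 ≠ 90 := by omega
        cases h0 : s.coins 0 <;> simp [this, hc, h0]
      · intro a ha; simp [hσ.xreg a ha]
      · intro a ha; simp [hσ.warr a ha]
      · intro a ha; simp [hσ.xarr a ha]
      · intro b hb
        have := hσ.coins (1 + b) (by omega)
        rw [← add_assoc] at this
        have h90 : ¬ (90 = i + 100) := by omega
        simp [h1, this, add_comm 1 b]
      · simp [h1]
      · simp [h1]
        omega
  | @seq c d s s' s'' a b _ _ ihc ihd =>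
    refine Runs.weaken ((ihc hp.1 (b + j) σ (hσ.mono (by omega))).seq
      fun σ' _ hσ' => ihd hp.2 j σ' hσ') (by omega) fun _ _ h => h
  | @ifwTrue i l c d s s' a h _ ih =>
    obtain ⟨k', hk', σ', hr, hs⟩ := ih hp.2.1 j σ (hσ.mono (by omega))
    refine ⟨k' + 1, by omega, σ', .ifwTrue ?_ hr, hs⟩
    rwa [hσ.wreg _ hp.1.1, hσ.wreg _ hp.1.2]
  | @ifwFalse i l c d s s' a h _ ih =>
    obtain ⟨k', hk', σ', hr, hs⟩ := ih hp.2.2 j σ (hσ.mono (by omega))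
    refine ⟨k' + 1, by omega, σ', .ifwFalse ?_ hr, hs⟩
    rwa [hσ.wreg _ hp.1.1, hσ.wreg _ hp.1.2]
  | @ifxTrue i l c d s s' a h _ ih =>
    obtain ⟨k', hk', σ', hr, hs⟩ := ih hp.2.1 j σ (hσ.mono (by omega))
    refine ⟨k' + 1, by omega, σ', .ifxTrue ?_ hr, hs⟩
    rwa [hσ.xreg _ hp.1.1, hσ.xreg _ hp.1.2]
  | @ifxFalse i l c d s s' a h _ ih =>
    obtain ⟨k', hk', σ', hr, hs⟩ := ih hp.2.2 j σ (hσ.mono (by omega))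
    refine ⟨k' + 1, by omega, σ', .ifxFalse ?_ hr, hs⟩
    rwa [hσ.xreg _ hp.1.1, hσ.xreg _ hp.1.2]
  | @loopStop i l c s h =>
    refine ⟨1, by omega, σ, .loopStop ?_, hσ.mono (by omega)⟩
    rwa [hσ.wreg _ hp.1.1, hσ.wreg _ hp.1.2]
  | @loopStep i l c s s' s'' a b h _ _ ih1 ih2 =>
    obtain ⟨k1, hk1, σ1, hr1, hs1⟩ := ih1 hp.2 (b + j) σ (hσ.mono (by omega))
    obtain ⟨k2, hk2, σ2, hr2, hs2⟩ := ih2 hp j σ1 hs1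
    refine ⟨k1 + k2 + 1, by omega, σ2, .loopStep ?_ hr1 hr2, hs2⟩
    rwa [hσ.wreg _ hp.1.1, hσ.wreg _ hp.1.2]

end

/-! ### Negative triangles and maximum subarrays -/

/-- The mixed second difference of a function on the grid. -/
def mixedDiff (P : ℕ → ℕ → ℝ) (a b : ℕ) : ℝ :=
  P a b - P (a + 1) b - P a (b + 1) + P (a + 1) (b + 1)

theorem sum_Icc_fin {m : ℕ} (f : ℕ → ℝ) (i i' : Fin m) :
    ∑ a ∈ Finset.Icc i i', f a = ∑ a ∈ Finset.Ico (i : ℕ) (i' + 1), f a := by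
  have h : Finset.Ico (i : ℕ) (i' + 1) = (Finset.Icc i i').map Fin.valEmbedding := by
    rw [Fin.map_valEmbedding_Icc]; rfl
  rw [h, Finset.sum_map]
  rfl

/-- Telescoping in both directions leaves only the four corners. -/
theorem sum_mixedDiff {m : ℕ} (P : ℕ → ℕ → ℝ) {i i' j j' : Fin m} (hi : i ≤ i') (hj : j ≤ j') :
    ∑ a ∈ Finset.Icc i i', ∑ b ∈ Finset.Icc j j', mixedDiff P a b =
      P i j - P (i' + 1) j - P i (j' + 1) + P (i' + 1) (j' + 1) := by
  have h1 : ∀ a : ℕ, ∑ b ∈ Finset.Icc j j', mixedDiff P a b =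
      (P a j - P a (j' + 1)) - (P (a + 1) j - P (a + 1) (j' + 1)) := by
    intro a
    rw [sum_Icc_fin (fun b => mixedDiff P a b)]
    have : ∀ b, mixedDiff P a b =
        (P (a + 1) (b + 1) - P a (b + 1)) - (P (a + 1) b - P a b) := by
      intro b; unfold mixedDiff; ring
    simp only [this]
    rw [Finset.sum_Ico_sub (fun b => P (a + 1) b - P a b) (by have : (j : ℕ) ≤ j' := hj; omega)]
    ring
  simp only [h1]
  rw [sum_Icc_fin (fun a => (P a j - P a (j' + 1)) - (P (a + 1) j - P (a + 1) (j' + 1)))]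
  have : ∀ a, (P a j - P a (j' + 1)) - (P (a + 1) j - P (a + 1) (j' + 1)) =
      (P (a + 1) (j' + 1) - P (a + 1) j) - (P a (j' + 1) - P a j) := by intro a; ring
  simp only [this]
  rw [Finset.sum_Ico_sub (fun a => P a (j' + 1) - P a j) (by have : (i : ℕ) ≤ i' := hi; omega)]
  ring

/-- The potential whose mixed differences encode the triangles of three `s × s` matrices. -/
def trianglePotential (s : ℕ) (W : ℝ) (A B C : ℕ → ℕ → ℝ) (x y : ℕ) : ℝ :=
  if x < s then if y < s then 32 * W - A x y else -C x (y - s)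
  else if y < s then B y (x - s) else if x = y then 0 else -(4 * W)

/-- Needed to replace the current matrix by a canonical one that agrees with it only inside the
index range. -/
theorem trianglePotential_congr {s : ℕ} {W : ℝ} {A A' B B' C C' : ℕ → ℕ → ℝ}
    (hA : ∀ x < s, ∀ y < s, A x y = A' x y) (hB : ∀ x < s, ∀ y < s, B x y = B' x y)
    (hC : ∀ x < s, ∀ y < s, C x y = C' x y) {x y : ℕ} (hx : x < 2 * s) (hy : y < 2 * s) :
    trianglePotential s W A B C x y = trianglePotential s W A' B' C' x y := by
  unfold trianglePotential
  split_ifs with h1 h2 h2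
  · rw [hA x h1 y h2]
  · rw [hC x h1 _ (by omega)]
  · rw [hB y h2 _ (by omega)]
  all_goals rfl

theorem abs_trianglePotential_le {s : ℕ} {W : ℝ} {A B C : ℕ → ℕ → ℝ} (hW : 0 ≤ W)
    (hA : ∀ x < s, ∀ y < s, |A x y| ≤ W) (hB : ∀ x < s, ∀ y < s, |B x y| ≤ W)
    (hC : ∀ x < s, ∀ y < s, |C x y| ≤ 2 * W) {x y : ℕ} (hx : x < 2 * s) (hy : y < 2 * s) :
    |trianglePotential s W A B C x y| ≤ 33 * W := by
  unfold trianglePotential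
  split_ifs with h1 h2 h2
  · have := abs_le.1 (hA x h1 y h2); rw [abs_le]; constructor <;> linarith
  · have := hC x h1 (y - s) (by omega); rw [abs_neg]; linarith
  · have := hB y h2 (x - s) (by omega); linarith
  · simpa using hW
  · rw [abs_neg, abs_of_nonneg (by linarith)]; linarith

/-- `Λ` will be the integers or all of `ℝ`. Closure under addition keeps the queries of the
deterministic reduction integral. -/
theorem trianglePotential_mem {s : ℕ} {W : ℝ} {A B C : ℕ → ℕ → ℝ} {Λ : AddSubgroup ℝ}
    (hW : W ∈ Λ)
    (hA : ∀ x < s, ∀ y < s, A x y ∈ Λ) (hB : ∀ x < s, ∀ y < s, B x y ∈ Λ)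
    (hC : ∀ x < s, ∀ y < s, C x y ∈ Λ) {x y : ℕ} (hx : x < 2 * s) (hy : y < 2 * s) :
    trianglePotential s W A B C x y ∈ Λ := by
  have h32 : 32 * W ∈ Λ := by simpa using Λ.nsmul_mem hW 32
  have h4 : 4 * W ∈ Λ := by simpa using Λ.nsmul_mem hW 4
  unfold trianglePotential
  split_ifs with h1 h2 h2
  · exact Λ.sub_mem h32 (hA x h1 y h2)
  · exact Λ.neg_mem (hC x h1 _ (by omega))
  · exact hB y h2 _ (by omega)
  · exact Λ.zero_mem
  · exact Λ.neg_mem h4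

/-- A rectangle that starts in row `i` and column `k` and ends in row and column `s + j - 1` has sum
`32 W - A i k - B k j + C i j`. The summand `32 W` belongs to the upper left quadrant and survives
only if the four corners lie in four different quadrants. The penalty `4 W` off the diagonal of the
lower right quadrant outweighs any gain from `A`, `B`, `C`, so that both ends of the rectangle name
the same vertex `j`. -/
theorem lt_maxSubarray_iff {s : ℕ} {W : ℝ} {A B C : ℕ → ℕ → ℝ} (hs : 1 ≤ s) (hW : 0 ≤ W)
    (hA : ∀ x < s, ∀ y < s, |A x y| ≤ W) (hB : ∀ x < s, ∀ y < s, |B x y| ≤ W)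
    (hC : ∀ x < s, ∀ y < s, |C x y| ≤ 2 * W) {m : ℕ} (hm : m = 2 * s - 1) {z : ℝ}
    (hz : IsGreatest (subarraySums fun a b : Fin m =>
      mixedDiff (trianglePotential s W A B C) a b) z) :
    32 * W < z ↔ ∃ i < s, ∃ j < s, ∃ k < s, A i k + B k j < C i j := by
  subst hm
  constructor
  · intro h
    obtain ⟨⟨i, i', j, j', hi, hj, rfl⟩, -⟩ := hz
    rw [sum_mixedDiff _ hi hj] at h
    have hi2 := i'.2
    have hj2 := j'.2
    have hi' : (i : ℕ) ≤ i' := hi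
    have hj' : (j : ℕ) ≤ j' := hj
    generalize (i : ℕ) = t at *
    generalize hb : (i' : ℕ) + 1 = b at *
    generalize (j : ℕ) = l at *
    generalize hr : (j' : ℕ) + 1 = r at *
    have bb : b < 2 * s := by omega
    have br : r < 2 * s := by omega
    have tb : t < b := by omega
    have lr : l < r := by omega
    clear hb hr hi hj hi2 hj2 hi' hj' i' j' i j
    have hA' : ∀ x < s, ∀ y < s, -W ≤ A x y ∧ A x y ≤ W := fun x hx y hy => abs_le.1 (hA x hx y hy)
    have hB' : ∀ x < s, ∀ y < s, -W ≤ B x y ∧ B x y ≤ W := fun x hx y hy => abs_le.1 (hB x hx y hy)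
    have hC' : ∀ x < s, ∀ y, y < 2 * s → -(2 * W) ≤ C x (y - s) ∧ C x (y - s) ≤ 2 * W :=
      fun x hx y hy => abs_le.1 (hC x hx _ (by omega))
    have hB'' : ∀ x < s, ∀ y, y < 2 * s → -W ≤ B x (y - s) ∧ B x (y - s) ≤ W :=
      fun x hx y hy => hB' x hx _ (by omega)
    -- The condition says that the corners lie in four different quadrants.
    by_cases hcross : (t < s ∧ s ≤ b) ∧ (l < s ∧ s ≤ r)
    · obtain ⟨⟨h1, h2⟩, h3, h4⟩ := hcross
      refine ⟨t, h1, r - s, by omega, l, h3, ?_⟩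
      simp only [trianglePotential, if_pos h1, if_pos h3, if_neg (not_lt.2 h2),
        if_neg (not_lt.2 h4)] at h
      by_cases hbr : b = r
      · subst hbr
        simp only [if_true] at h
        linarith
      · rw [if_neg hbr] at h
        have e1 := hA' t h1 l h3
        have e2 := hB'' l h3 b bb
        have e3 := hC' t h1 r br
        linarith
    -- Otherwise the corners in the upper left quadrant are absent or occur in pairs of opposite
    -- sign. The multiples of `32 W` cancel, and four terms of size at most `4 W` remain.
    · exfalso
      have hP : ∀ x y, ¬ (x < s ∧ y < s) → x < 2 * s → y < 2 * s →
          |trianglePotential s W A B C x y| ≤ 4 * W := by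
        intro x y hxy hx hy
        unfold trianglePotential
        split_ifs with h1 h2 h2
        · exact absurd ⟨h1, h2⟩ hxy
        · rw [abs_neg]; have := hC x h1 (y - s) (by omega); linarith
        · have := hB y h2 (x - s) (by omega); linarith
        · simpa using hW
        · rw [abs_neg, abs_of_nonneg (by linarith)]
      have hQ : ∀ x y, x < s → y < s →
          |trianglePotential s W A B C x y - 32 * W| ≤ 4 * W := by
        intro x y hx hy
        have := hA x hx y hy
        simp only [trianglePotential, if_pos hx, if_pos hy]
        rw [show 32 * W - A x y - 32 * W = -A x y by ring, abs_neg]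
        linarith
      simp only [abs_le] at hP hQ
      have a1 := hP t l
      have a2 := hP b l
      have a3 := hP t r
      have a4 := hP b r
      have b1 := hQ t l
      have b2 := hQ b l
      have b3 := hQ t r
      have b4 := hQ b r
      by_cases c1 : t < s <;> by_cases c2 : b < s <;> by_cases c3 : l < s <;> by_cases c4 : r < s <;>
        first
          | omega
          | (have d1 : t < 2 * s := by omega
             have d2 : l < 2 * s := by omega
             simp only [c1, c2, c3, c4, d1, d2, bb, br, and_true, and_false, not_true,
               not_false_iff, forall_true_left, false_implies] at a1 a2 a3 a4 b1 b2 b3 b4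
             linarith)
  · rintro ⟨i, hi, j, hj, k, hk, h⟩
    have hle : (⟨i, by omega⟩ : Fin (2 * s - 1)) ≤ ⟨s + j - 1, by omega⟩ := by
      rw [Fin.mk_le_mk]; omega
    have hle' : (⟨k, by omega⟩ : Fin (2 * s - 1)) ≤ ⟨s + j - 1, by omega⟩ := by
      rw [Fin.mk_le_mk]; omega
    have := hz.2 ⟨_, _, _, _, hle, hle', rfl⟩
    rw [sum_mixedDiff _ hle hle'] at this
    simp only [show s + j - 1 + 1 = s + j by omega] at this
    refine lt_of_lt_of_le ?_ this
    simp only [trianglePotential, if_pos hi, if_pos hk, show ¬ (s + j < s) by omega, if_false, if_true,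
      Nat.add_sub_cancel_left]
    linarith

/-! ### Relaxation -/

/-- The matrix with rows of length `N` that is stored in an array. -/
def mat {α : Type} (N : ℕ) (f : ℕ → α) (i j : ℕ) : α :=
  f (i * N + j)

theorem mul_add_lt {N i j M : ℕ} (hi : i < M) (hj : j < N) : i * N + j < M * N := by
  calc i * N + j < i * N + N := by omega
    _ = (i + 1) * N := by ring
    _ ≤ M * N := Nat.mul_le_mul_right _ hi

theorem mul_add_inj {N i j i' j' : ℕ} (hj : j < N) (hj' : j' < N) :
    i * N + j = i' * N + j' ↔ i = i' ∧ j = j' := by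
  constructor
  · intro h
    have h1 : (i * N + j) / N = i := by
      rw [mul_comm, Nat.mul_add_div (by omega), Nat.div_eq_of_lt hj, add_zero]
    have h2 : (i' * N + j') / N = i' := by
      rw [mul_comm, Nat.mul_add_div (by omega), Nat.div_eq_of_lt hj', add_zero]
    have h3 : i = i' := by rw [← h1, ← h2, h]
    subst h3
    omega
  · rintro ⟨rfl, rfl⟩; rfl

theorem mat_update {α : Type} {N : ℕ} (f : ℕ → α) {i j i' j' : ℕ} (hj : j < N) (hj' : j' < N)
    (v : α) : mat N (Function.update f (i' * N + j') v) i j =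
      if i = i' ∧ j = j' then v else mat N f i j := by
  unfold mat
  rw [Function.update_apply]
  simp only [mul_add_inj hj hj']

/-- `(T', mid')` arises from `(T, mid)` by relaxing with the paths `i k j` for which `S i j k`. -/
def Relaxes (N : ℕ) (D : ℕ → ℕ → ℝ) (S : ℕ → ℕ → ℕ → Prop) (T : ℕ → ℕ → ℝ) (mid : ℕ → ℕ → ℕ)
    (T' : ℕ → ℕ → ℝ) (mid' : ℕ → ℕ → ℕ) : Prop :=
  ∀ i < N, ∀ j < N,
    ((T' i j = T i j ∧ mid' i j = mid i j) ∨
      (T' i j < T i j ∧ ∃ k < N, S i j k ∧ T' i j = D i k + D k j ∧ mid' i j = k)) ∧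
    ∀ k < N, S i j k → T' i j ≤ D i k + D k j

section
variable {N : ℕ} {D T T' T'' : ℕ → ℕ → ℝ} {mid mid' mid'' : ℕ → ℕ → ℕ} {S S' : ℕ → ℕ → ℕ → Prop}

theorem Relaxes.refl (hS : ∀ i < N, ∀ j < N, ∀ k < N, ¬ S i j k) : Relaxes N D S T mid T mid :=
  fun i hi j hj => ⟨.inl ⟨rfl, rfl⟩, fun k hk h => absurd h (hS i hi j hj k hk)⟩

theorem Relaxes.congr (h : Relaxes N D S T mid T' mid')
    (hS : ∀ i < N, ∀ j < N, ∀ k < N, (S i j k ↔ S' i j k)) : Relaxes N D S' T mid T' mid' := by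
  intro i hi j hj
  obtain ⟨h1, h2⟩ := h i hi j hj
  refine ⟨h1.imp_right ?_, fun k hk h => h2 k hk ((hS i hi j hj k hk).2 h)⟩
  rintro ⟨h3, k, hk, h4, h5⟩
  exact ⟨h3, k, hk, (hS i hi j hj k hk).1 h4, h5⟩

theorem Relaxes.le (h : Relaxes N D S T mid T' mid') {i j : ℕ} (hi : i < N) (hj : j < N) :
    T' i j ≤ T i j := by
  obtain ⟨h1 | h1, -⟩ := h i hi j hj
  · exact h1.1.le
  · exact h1.1.le

/-- All candidates are sums of entries of the same `D`, never of the current `T`. Hence successive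
relaxations amount to a single one with the union of the triples. -/
theorem Relaxes.trans (h : Relaxes N D S T mid T' mid') (h' : Relaxes N D S' T' mid' T'' mid'') :
    Relaxes N D (fun i j k => S i j k ∨ S' i j k) T mid T'' mid'' := by
  intro i hi j hj
  have hle := h'.le hi hj
  obtain ⟨h1, h2⟩ := h i hi j hj
  obtain ⟨h3, h4⟩ := h' i hi j hj
  refine ⟨?_, fun k hk => ?_⟩
  · rcases h3 with h3 | ⟨h3, k, hk, hS, h5⟩
    · rw [h3.1, h3.2]
      refine h1.imp_right ?_
      rintro ⟨h6, k, hk, hS, h7⟩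
      exact ⟨h6, k, hk, .inl hS, h7⟩
    · exact .inr ⟨h3.trans_le (h.le hi hj), k, hk, .inr hS, h5⟩
  · rintro (hS | hS)
    · exact hle.trans (h2 k hk hS)
    · exact h4 k hk hS

/-- Every entry is an old one or a sum of two entries of `D`, so the bound does not deteriorate with
the number of relaxations. -/
theorem Relaxes.abs_le (h : Relaxes N D S T mid T' mid') {V : ℝ}
    (hD : ∀ i < N, ∀ j < N, |D i j| ≤ V) (hT : ∀ i < N, ∀ j < N, |T i j| ≤ 2 * V) :
    ∀ i < N, ∀ j < N, |T' i j| ≤ 2 * V := by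
  intro i hi j hj
  obtain ⟨h1 | ⟨-, k, hk, -, h1, -⟩, -⟩ := h i hi j hj
  · rw [h1.1]; exact hT i hi j hj
  · rw [h1]
    have := abs_add_le (D i k) (D k j)
    linarith [hD i hi k hk, hD k hk j hj]

theorem Relaxes.mem (h : Relaxes N D S T mid T' mid') {Λ : AddSubgroup ℝ}
    (hD : ∀ i < N, ∀ j < N, D i j ∈ Λ) (hT : ∀ i < N, ∀ j < N, T i j ∈ Λ) :
    ∀ i < N, ∀ j < N, T' i j ∈ Λ := by
  intro i hi j hj
  obtain ⟨h1 | ⟨-, k, hk, -, h1, -⟩, -⟩ := h i hi j hj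
  · rw [h1.1]; exact hT i hi j hj
  · rw [h1]; exact Λ.add_mem (hD i hi k hk) (hD k hk j hj)

end

/-- One program after the other. -/
infixr:60 ";;" => RamProg.seq

open RamProg in
/-- Relax with the path `i k j`, for `i`, `j`, `k` in word registers `27`, `28`, `29`. -/
def relaxProg : RamProg :=
  wop .mul 30 27 2 ;; wop .add 31 30 29 ;; xload 10 2 31 ;; wop .mul 31 29 2 ;;
  wop .add 31 31 28 ;; xload 11 2 31 ;; xadd 10 10 11 ;; wop .add 30 30 28 ;; xload 11 3 30 ;;
  ifx 10 11 (xstore 3 30 10 ;; wstore 5 30 29) skip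

section
variable {B : ℕ} {Nm : Set ℝ}

/-- The intermediate vertex is stored only on a strict decrease, which the decoding of walks relies
on. -/
theorem relaxProg_spec {N : ℕ} {V : ℝ} {st : RamState} {i j k : ℕ} (hB : N * N ≤ B)
    (hV : ∀ x, |x| ≤ 2 * V → x ∈ Nm) (hV0 : 0 ≤ V) (h2 : st.wreg 2 = N)
    (h27 : st.wreg 27 = i) (h28 : st.wreg 28 = j) (h29 : st.wreg 29 = k)
    (hi : i < N) (hj : j < N) (hk : k < N)
    (hD : ∀ i < N, ∀ j < N, |mat N (st.xarr 2) i j| ≤ V)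
    (hT : ∀ i < N, ∀ j < N, |mat N (st.xarr 3) i j| ≤ 2 * V) :
    Runs B Nm relaxProg st 12 fun st' =>
      Relaxes N (mat N (st.xarr 2)) (fun i' j' k' => i = i' ∧ j = j' ∧ k = k')
        (mat N (st.xarr 3)) (mat N (st.warr 5)) (mat N (st'.xarr 3)) (mat N (st'.warr 5)) := by
  have b1 : i * N + k ≤ B := (mul_add_lt hi hk).le.trans hB
  have b2 : k * N + j ≤ B := (mul_add_lt hk hj).le.trans hB
  have b3 : i * N + j ≤ B := (mul_add_lt hi hj).le.trans hB
  have e1 : st.xarr 2 (i * N + k) = mat N (st.xarr 2) i k := rfl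
  have e2 : st.xarr 2 (k * N + j) = mat N (st.xarr 2) k j := rfl
  have e3 : st.xarr 3 (i * N + j) = mat N (st.xarr 3) i j := rfl
  have m1 := hD i hi k hk
  have m2 := hD k hk j hj
  have m3 := hT i hi j hj
  refine Runs.of_wp ?_
  simp only [relaxProg, RamProg.wp, WordOp.eval, RamState.setW_wreg, RamState.setW_xarr,
    RamState.setX_wreg, RamState.setX_xarr, RamState.setX_xreg, RamState.storeX_xarr,
    RamState.setX_warr, RamState.setW_warr, RamState.storeX_warr, RamState.storeW_xarr,
    RamState.storeX_wreg, RamState.storeW_warr, RamState.setW_xreg,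
    h27, h28, h29, h2, e1, e2, e3, reduceIte, Nat.reduceEqDiff]
  refine ⟨by omega, b1, hV _ (by linarith), by omega, b2, hV _ (by linarith),
    hV _ ((abs_add_le _ _).trans (by linarith)), b3, hV _ m3, fun hlt => ?_, fun hle => ?_⟩
  · intro i' hi' j' hj'
    rw [mat_update _ hj' hj, mat_update _ hj' hj]
    by_cases h : i' = i ∧ j' = j
    · obtain ⟨rfl, rfl⟩ := h
      rw [if_pos ⟨rfl, rfl⟩, if_pos ⟨rfl, rfl⟩]
      exact ⟨.inr ⟨hlt, k, hk, ⟨rfl, rfl, rfl⟩, rfl, rfl⟩, by rintro _ - ⟨-, -, rfl⟩; rfl⟩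
    · rw [if_neg h, if_neg h]
      exact ⟨.inl ⟨rfl, rfl⟩, by rintro _ - ⟨rfl, rfl, -⟩; exact absurd ⟨rfl, rfl⟩ h⟩
  · intro i' hi' j' hj'
    refine ⟨.inl ⟨rfl, rfl⟩, ?_⟩
    rintro _ - ⟨rfl, rfl, rfl⟩
    exact hle

/-- A loop of relaxations. -/
theorem relaxLoop_spec {N : ℕ} {V : ℝ} {st : RamState} {b n c : ℕ} {decode : RamProg}
    (fi fj fk : ℕ → ℕ) (hB : N * N ≤ B)
    (hV : ∀ x, |x| ≤ 2 * V → x ∈ Nm) (hV0 : 0 ≤ V) (h2 : st.wreg 2 = N) (h1 : st.wreg 1 = 1)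
    (hb : st.wreg b = n) (hn : n ≤ B) (hb' : b < 20)
    (hdec : decode.keepsW 23 && decode.keepsW b && decode.keepsW 1 && decode.keepsW 2 &&
      decode.keepsXA 2 && decode.keepsXA 3 && decode.keepsWA 5)
    (hf : ∀ e < n, fi e < N ∧ fj e < N ∧ fk e < N)
    (hD : ∀ i < N, ∀ j < N, |mat N (st.xarr 2) i j| ≤ V)
    (hT : ∀ i < N, ∀ j < N, |mat N (st.xarr 3) i j| ≤ 2 * V)
    (hdecode : ∀ e < n, ∀ st', st'.wreg 23 = e →
      Frame (forUpTo 23 b (decode ;; relaxProg)) st st' →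
      Runs B Nm decode st' c fun st'' => st''.wreg 27 = fi e ∧ st''.wreg 28 = fj e ∧
        st''.wreg 29 = fk e) :
    Runs B Nm (forUpTo 23 b (decode ;; relaxProg)) st (n * (c + 14) + 2) fun st' =>
      Relaxes N (mat N (st.xarr 2)) (fun i j k => ∃ e < n, fi e = i ∧ fj e = j ∧ fk e = k)
        (mat N (st.xarr 3)) (mat N (st.warr 5)) (mat N (st'.xarr 3)) (mat N (st'.warr 5)) := by
  simp only [Bool.and_eq_true] at hdec
  obtain ⟨⟨⟨⟨⟨⟨d23, db⟩, d1⟩, d2⟩, dX2⟩, dX3⟩, dW5⟩ := hdec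
  refine Runs.forUpTo (fun q st' => Relaxes N (mat N (st.xarr 2))
    (fun i j k => ∃ e < q, fi e = i ∧ fj e = j ∧ fk e = k)
        (mat N (st.xarr 3)) (mat N (st.warr 5)) (mat N (st'.xarr 3)) (mat N (st'.warr 5)))
    hb h1 ?_ hn ?_ ?_
  · have n1 : b ≠ 30 := by omega
    have n2 : b ≠ 31 := by omega
    have n3 : 23 ≠ b := by omega
    simp [relaxProg, RamProg.keepsW, d23, db, d1, n1, n2, n3]
  · exact Relaxes.refl (by simp)
  · intro q hq st' hst' hF hI
    have e2 : st'.wreg 2 = N := by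
      rw [hF.wreg 2 (by simp [forUpTo, relaxProg, RamProg.keepsW, d2]), h2]
    have eX2 : st'.xarr 2 = st.xarr 2 :=
      hF.xarr 2 (by simp [forUpTo, relaxProg, RamProg.keepsXA, dX2])
    obtain ⟨hi, hj, hk⟩ := hf q hq
    refine Runs.weaken ((hdecode q hq st' hst' hF).seq fun st1 hF1 h => ?_)
      (le_refl (c + 12)) fun _ _ h => h
    have f2 : st1.wreg 2 = N := by rw [hF1.wreg 2 d2, e2]
    have f3 : st1.xarr 2 = st.xarr 2 := by rw [hF1.xarr 2 dX2, eX2]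
    have f4 : st1.xarr 3 = st'.xarr 3 := hF1.xarr 3 dX3
    have f5 : st1.warr 5 = st'.warr 5 := hF1.warr 5 dW5
    refine (relaxProg_spec hB hV hV0 f2 h.1 h.2.1 h.2.2 hi hj hk (by rw [f3]; exact hD)
      (by rw [f4]; exact hI.abs_le hD hT)).weaken le_rfl fun st2 _ h2 => ?_
    rw [f3, f4, f5] at h2
    refine (hI.trans h2).congr fun i _ j _ k _ => ?_
    constructor
    · rintro (⟨e, he, h⟩ | h)
      · exact ⟨e, by omega, h⟩
      · exact ⟨q, by omega, h⟩
    · rintro ⟨e, he, hS⟩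
      rcases Nat.lt_succ_iff_lt_or_eq.1 he with he | rfl
      · exact .inl ⟨e, he, hS⟩
      · exact .inr hS

end

/-! ### The main program: one block -/

/-- The quantities that are fixed during the main part of the computation. -/
structure Cfg where
  n : ℕ
  lam : ℕ
  r : ℕ
  tau : ℕ
  rho : ℕ
  L : ℕ
  W : ℝ
  thr : ℝ

namespace Cfg
variable (c : Cfg)

/-- The padded number of vertices. -/
def N : ℕ := 2 ^ c.lam
/-- The size of a block. -/
def s : ℕ := 2 ^ (c.lam / 5 + 1)
/-- The number of blocks. -/
def g : ℕ := 2 ^ (c.lam - (c.lam / 5 + 1))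

end Cfg

/-- The registers that hold the fixed quantities. -/
structure Ctx (c : Cfg) (st : RamState) : Prop where
  n : st.wreg 0 = c.n
  one : st.wreg 1 = 1
  N : st.wreg 2 = c.N
  lam : st.wreg 3 = c.lam
  s : st.wreg 4 = c.s
  g : st.wreg 5 = c.g
  m : st.wreg 6 = 2 * c.s - 1
  s2 : st.wreg 7 = 2 * c.s
  r : st.wreg 8 = c.r
  tau : st.wreg 9 = c.tau
  rho : st.wreg 10 = c.rho
  L : st.wreg 11 = c.L
  cap : st.wreg 12 = c.N * c.N * c.s
  zero : st.wreg 13 = 0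
  NN : st.wreg 14 = c.N * c.N
  ggg : st.wreg 15 = c.g * c.g * c.g
  sss : st.wreg 16 = c.s * c.s * c.s
  mm : st.wreg 17 = (2 * c.s - 1) * (2 * c.s - 1)
  ss : st.wreg 18 = (2 * c.s) * (2 * c.s)
  rhoNN : st.wreg 19 = c.rho * (c.N * c.N)
  H : st.xreg 1 = 32 * c.W
  big : st.xreg 2 = 4 * c.W
  W : st.xreg 4 = c.W
  thr : st.xreg 5 = c.thr
  xzero : st.xreg 6 = 0

/-- The program does not write the registers with the fixed quantities. -/
def RamProg.keepsCtx (p : RamProg) : Bool :=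
  p.keepsW 0 && p.keepsW 1 && p.keepsW 2 && p.keepsW 3 && p.keepsW 4 && p.keepsW 5 &&
  p.keepsW 6 && p.keepsW 7 && p.keepsW 8 && p.keepsW 9 && p.keepsW 10 && p.keepsW 11 &&
  p.keepsW 12 && p.keepsW 13 && p.keepsW 14 && p.keepsW 15 && p.keepsW 16 && p.keepsW 17 &&
  p.keepsW 18 && p.keepsW 19 && p.keepsX 1 && p.keepsX 2 && p.keepsX 4 && p.keepsX 5 &&
  p.keepsX 6

theorem Ctx.frame {c : Cfg} {st st' : RamState} {p : RamProg} (h : Ctx c st)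
    (hF : Frame p st st') (hp : p.keepsCtx = true) : Ctx c st' := by
  simp only [RamProg.keepsCtx, Bool.and_eq_true] at hp
  constructor
  · rw [hF.wreg 0 (by tauto), h.n]
  · rw [hF.wreg 1 (by tauto), h.one]
  · rw [hF.wreg 2 (by tauto), h.N]
  · rw [hF.wreg 3 (by tauto), h.lam]
  · rw [hF.wreg 4 (by tauto), h.s]
  · rw [hF.wreg 5 (by tauto), h.g]
  · rw [hF.wreg 6 (by tauto), h.m]
  · rw [hF.wreg 7 (by tauto), h.s2]
  · rw [hF.wreg 8 (by tauto), h.r]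
  · rw [hF.wreg 9 (by tauto), h.tau]
  · rw [hF.wreg 10 (by tauto), h.rho]
  · rw [hF.wreg 11 (by tauto), h.L]
  · rw [hF.wreg 12 (by tauto), h.cap]
  · rw [hF.wreg 13 (by tauto), h.zero]
  · rw [hF.wreg 14 (by tauto), h.NN]
  · rw [hF.wreg 15 (by tauto), h.ggg]
  · rw [hF.wreg 16 (by tauto), h.sss]
  · rw [hF.wreg 17 (by tauto), h.mm]
  · rw [hF.wreg 18 (by tauto), h.ss]
  · rw [hF.wreg 19 (by tauto), h.rhoNN]
  · rw [hF.xreg 1 (by tauto), h.H]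
  · rw [hF.xreg 2 (by tauto), h.big]
  · rw [hF.xreg 4 (by tauto), h.W]
  · rw [hF.xreg 5 (by tauto), h.thr]
  · rw [hF.xreg 6 (by tauto), h.xzero]

/-- The words are long enough, and the numeric cells are large enough. -/
structure Room (c : Cfg) (B : ℕ) (Nm : Set ℝ) : Prop where
  lam_pos : 1 ≤ c.lam
  n_le : c.n ≤ c.N
  cube : 8 * (c.N * c.N * c.N) ≤ B
  rhoNN : c.rho * (c.N * c.N) ≤ B
  rtau : c.r * c.tau ≤ B
  r : 2 * c.r ≤ B
  L : c.L ≤ B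
  W : 0 ≤ c.W
  num : ∀ x : ℝ, |x| ≤ 200 * c.W → x ∈ Nm

/-! ### Consequences of the size bounds -/

namespace Room
variable {c : Cfg} {B : ℕ} {Nm : Set ℝ}

theorem s_mul_g (h : Room c B Nm) : c.s * c.g = c.N := by
  have := h.lam_pos
  unfold Cfg.s Cfg.g Cfg.N
  rw [← pow_add]
  congr 1
  omega

theorem two_le_s (c : Cfg) : 2 ≤ c.s := by
  unfold Cfg.s
  rw [pow_succ]
  have := Nat.one_le_two_pow (n := c.lam / 5)
  omega

theorem g_pos (c : Cfg) : 1 ≤ c.g := Nat.one_le_two_pow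

theorem s_le (h : Room c B Nm) : c.s ≤ c.N := by
  rw [← h.s_mul_g]
  exact Nat.le_mul_of_pos_right _ (g_pos c)

theorem g_le (h : Room c B Nm) : c.g ≤ c.N := by
  rw [← h.s_mul_g]
  exact Nat.le_mul_of_pos_left _ (by have := two_le_s c; omega)

theorem N_pos (c : Cfg) : 1 ≤ c.N := Nat.one_le_two_pow

theorem NN_le (h : Room c B Nm) : 8 * (c.N * c.N) ≤ B := by
  refine le_trans ?_ h.cube
  have := Nat.mul_le_mul_left (c.N * c.N) (N_pos c)
  omega

theorem N_le (h : Room c B Nm) : 8 * c.N ≤ B := by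
  refine le_trans ?_ h.NN_le
  have := Nat.mul_le_mul_left c.N (N_pos c)
  omega

theorem ss_le (h : Room c B Nm) : (2 * c.s) * (2 * c.s) ≤ B := by
  refine le_trans ?_ h.NN_le
  have := Nat.mul_le_mul h.s_le h.s_le
  nlinarith

theorem sss_le (h : Room c B Nm) : c.s * c.s * c.s ≤ B := by
  refine le_trans ?_ h.cube
  have := Nat.mul_le_mul (Nat.mul_le_mul h.s_le h.s_le) h.s_le
  omega

theorem ggg_le (h : Room c B Nm) : c.g * c.g * c.g ≤ B := by
  refine le_trans ?_ h.cube
  have := Nat.mul_le_mul (Nat.mul_le_mul h.g_le h.g_le) h.g_le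
  omega

theorem cap_le (h : Room c B Nm) : c.N * c.N * c.s ≤ B := by
  refine le_trans ?_ h.cube
  have := Nat.mul_le_mul_left (c.N * c.N) h.s_le
  omega

theorem block_lt (h : Room c B Nm) {I x : ℕ} (hI : I < c.g) (hx : x < c.s) :
    I * c.s + x < c.N := by
  rw [← h.s_mul_g, mul_comm c.s]
  exact mul_add_lt hI hx

end Room

open RamProg

/-- Fill the numeric array `4` with the potential of the block with corner in word registers
`35`, `36`, `37`. -/
def potentialBody : RamProg :=
  wop .div 30 23 7 ;; wop .mod 31 23 7 ;;
  ifw 30 4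
    (wop .add 32 35 30 ;; wop .mul 32 32 2 ;;
      ifw 31 4
        (wop .add 33 37 31 ;; wop .add 32 32 33 ;; xload 10 2 32 ;; xsub 10 1 10)
        (wop .sub 33 31 4 ;; wop .add 33 33 36 ;; wop .add 32 32 33 ;; xload 10 3 32 ;;
          xsub 10 3 10))
    (ifw 31 4
      (wop .add 32 37 31 ;; wop .mul 32 32 2 ;; wop .sub 33 30 4 ;; wop .add 33 33 36 ;;
        wop .add 32 32 33 ;; xload 10 2 32)
      (ifw 30 31 (xsub 10 6 2) (ifw 31 30 (xsub 10 6 2) (xconst 10 0)))) ;;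
  xstore 4 23 10

/-- Write the mixed differences of the potential to the input array of the subroutine. -/
def fillBody : RamProg :=
  wop .div 30 23 6 ;; wop .mod 31 23 6 ;; wop .mul 32 30 7 ;; wop .add 32 32 31 ;;
  xload 10 4 32 ;; wop .add 32 32 1 ;; xload 11 4 32 ;; xsub 10 10 11 ;;
  wop .add 33 32 7 ;; xload 11 4 33 ;; xadd 10 10 11 ;; wop .sub 33 33 1 ;; xload 11 4 33 ;;
  xsub 10 10 11 ;; xstore 100 23 10

section
variable {B : ℕ} {Nm : Set ℝ} {c : Cfg}

/-- The potential for the block of `D` and `T` with indices `I`, `J`, `K`. -/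
def blockPotential (c : Cfg) (δ : ℝ) (D T : ℕ → ℕ → ℝ) (I J K : ℕ) : ℕ → ℕ → ℝ :=
  trianglePotential c.s c.W (fun x y => D (I * c.s + x) (K * c.s + y))
    (fun x y => D (K * c.s + x) (J * c.s + y)) (fun x y => T (I * c.s + x) (J * c.s + y) - δ)

theorem potential_spec (hR : Room c B Nm) {st : RamState} (hc : Ctx c st) {D T : ℕ → ℕ → ℝ}
    (hD : D = mat c.N (st.xarr 2)) (hT : T = mat c.N (st.xarr 3)) {δ : ℝ} (hδ : st.xreg 3 = δ)
    (hδ0 : 0 ≤ δ) (hδW : δ ≤ c.W)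
    (hDW : ∀ i < c.N, ∀ j < c.N, |D i j| ≤ c.W) (hTW : ∀ i < c.N, ∀ j < c.N, |T i j| ≤ c.W)
    {I J K : ℕ} (hI : I < c.g) (hJ : J < c.g) (hK : K < c.g)
    (h35 : st.wreg 35 = I * c.s) (h36 : st.wreg 36 = J * c.s) (h37 : st.wreg 37 = K * c.s) :
    Runs B Nm (forUpTo 23 18 potentialBody) st ((2 * c.s) * (2 * c.s) * 20 + 2) fun st' =>
      ∀ x < 2 * c.s, ∀ y < 2 * c.s,
        mat (2 * c.s) (st'.xarr 4) x y = blockPotential c δ D T I J K x y := by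
  have hs := Room.two_le_s c
  have hW := hR.W
  refine Runs.weaken (Runs.forUpTo (c := 18) (fun q st' => ∀ e < q, st'.xarr 4 e =
    blockPotential c δ D T I J K (e / (2 * c.s)) (e % (2 * c.s))) hc.ss hc.one rfl hR.ss_le
    (by simp) ?_) le_rfl ?_
  · intro e he st1 he1 hF hI1
    have hc1 := hc.frame hF rfl
    have g35 : st1.wreg 35 = I * c.s := by rw [hF.wreg 35 rfl, h35]
    have g36 : st1.wreg 36 = J * c.s := by rw [hF.wreg 36 rfl, h36]
    have g37 : st1.wreg 37 = K * c.s := by rw [hF.wreg 37 rfl, h37]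
    have g3 : st1.xreg 3 = δ := by rw [hF.xreg 3 rfl, hδ]
    have g2 : st1.xarr 2 = st.xarr 2 := hF.xarr 2 rfl
    have gT : st1.xarr 3 = st.xarr 3 := hF.xarr 3 rfl
    have hx : e / (2 * c.s) < 2 * c.s := Nat.div_lt_of_lt_mul he
    have hy : e % (2 * c.s) < 2 * c.s := Nat.mod_lt _ (by omega)
    have key : ∀ v, v = blockPotential c δ D T I J K (e / (2 * c.s)) (e % (2 * c.s)) →
        ∀ e' < e + 1, Function.update (st1.xarr 4) e v e' =
          blockPotential c δ D T I J K (e' / (2 * c.s)) (e' % (2 * c.s)) := by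
      intro v hv e' he'
      rcases Nat.lt_succ_iff_lt_or_eq.1 he' with h | rfl
      · rw [Function.update_of_ne h.ne]; exact hI1 e' h
      · rw [Function.update_self]; exact hv
    have hN := hR.N_le
    have hNN := hR.NN_le
    have hsN := hR.s_le
    have dB : e / (2 * c.s) ≤ B := by omega
    have mB : e % (2 * c.s) ≤ B := by omega
    refine Runs.weaken (Runs.of_wp (p := potentialBody) ?_) (by decide) fun _ _ h => h
    have hN1 := Room.N_pos c
    have hadd : ∀ i < c.N, ∀ j < c.N, i * c.N ≤ B ∧ i * c.N + j ≤ B := by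
      intro i hi j hj
      have := mul_add_lt hi hj
      omega
    simp only [potentialBody, RamProg.wp, WordOp.eval, RamState.setW_wreg, RamState.setW_xarr,
      RamState.setX_wreg, RamState.setX_xarr, RamState.setX_xreg, RamState.storeX_xarr,
      RamState.setW_xreg, he1, hc1.s2, hc1.s, hc1.N, g35, g36, g37, g3, hc1.H, hc1.big, hc1.xzero, g2,
      gT, reduceIte, Nat.reduceEqDiff]
    set x := e / (2 * c.s)
    set y := e % (2 * c.s)
    have hDm : ∀ i j, st.xarr 2 (i * c.N + j) = D i j := fun i j => by rw [hD]; rfl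
    have hTm : ∀ i j, st.xarr 3 (i * c.N + j) = T i j := fun i j => by rw [hT]; rfl
    simp only [hDm, hTm]
    refine ⟨dB, mB, fun hxs => ?_, fun hxs => ?_⟩
    · have bx := hR.block_lt hI hxs
      refine ⟨by omega, (hadd _ bx 0 hN1).1, fun hys => ?_, fun hys => ?_⟩
      · have bk := hR.block_lt hK hys
        have hb := hDW _ bx _ bk
        refine ⟨by omega, (hadd _ bx _ bk).2, hR.num _ (by linarith), hR.num _ ?_, key _ ?_⟩
        · rw [abs_le] at hb ⊢; constructor <;> linarith
        · simp [blockPotential, trianglePotential, x, y] at hxs hys ⊢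
          simp [hxs, hys]
      · have hys' : y - c.s < c.s := by omega
        have bj := hR.block_lt hJ hys'
        rw [add_comm (y - c.s)]
        have hb := hTW _ bx _ bj
        refine ⟨by omega, by omega, (hadd _ bx _ bj).2, hR.num _ (by linarith), hR.num _ ?_,
          key _ ?_⟩
        · rw [abs_le] at hb ⊢; constructor <;> linarith
        · simp [blockPotential, trianglePotential, x, y] at hxs hys ⊢
          simp [hxs, not_lt.2 hys]
    · have hxs' : x - c.s < c.s := by omega
      refine ⟨fun hys => ?_, fun hys => ?_⟩
      · have bk := hR.block_lt hK hys
        have bj := hR.block_lt hJ hxs'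
        rw [add_comm (x - c.s)]
        have hb := hDW _ bk _ bj
        refine ⟨by omega, (hadd _ bk 0 hN1).1, by omega, by omega, (hadd _ bk _ bj).2,
          hR.num _ (by linarith), key _ ?_⟩
        simp [blockPotential, trianglePotential, x, y] at hxs hys ⊢
        simp [not_lt.2 hxs, hys]
      · have m4 : 0 - 4 * c.W ∈ Nm := hR.num _ (by
          rw [zero_sub, abs_neg, abs_of_nonneg (by linarith)]; linarith)
        have hne : x ≠ y → 0 - 4 * c.W = blockPotential c δ D T I J K x y := by
          intro h
          simp only [blockPotential, trianglePotential, if_neg (not_lt.2 hxs),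
            if_neg (not_lt.2 hys), if_neg h]
          ring
        refine ⟨fun h => ⟨m4, key _ (hne h.ne)⟩, fun h => ⟨fun h => ⟨m4, key _ (hne h.ne')⟩,
          fun h' => ⟨hR.num _ (by simpa using hW), key _ ?_⟩⟩⟩
        have hxy : x = y := le_antisymm h' h
        simp only [blockPotential, trianglePotential, if_neg (not_lt.2 hxs),
            if_neg (not_lt.2 hys), if_pos hxy, Int.cast_zero]
  · intro st' _ h x hx y hy
    have := h (x * (2 * c.s) + y) (mul_add_lt hx hy)
    rw [mul_comm x, Nat.mul_add_div (by omega), Nat.div_eq_of_lt hy, Nat.mul_add_mod,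
      Nat.mod_eq_of_lt hy, add_zero, mul_comm _ x] at this
    exact this

theorem fill_spec (hR : Room c B Nm) {st : RamState} (hc : Ctx c st) {P : ℕ → ℕ → ℝ}
    (hP : ∀ x < 2 * c.s, ∀ y < 2 * c.s, mat (2 * c.s) (st.xarr 4) x y = P x y)
    (hPW : ∀ x < 2 * c.s, ∀ y < 2 * c.s, |P x y| ≤ 33 * c.W) (h0 : st.xarr 100 = fun _ => 0) :
    Runs B Nm (forUpTo 23 17 fillBody) st ((2 * c.s - 1) * (2 * c.s - 1) * 20 + 2) fun st' =>
      st'.xarr 100 = rowMajor fun a b : Fin (2 * c.s - 1) => mixedDiff P a b := by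
  have hs := Room.two_le_s c
  have hW := hR.W
  have hBs := hR.ss_le
  have hmm : (2 * c.s - 1) * (2 * c.s - 1) ≤ (2 * c.s) * (2 * c.s) :=
    Nat.mul_le_mul (by omega) (by omega)
  -- The invariant speaks of all cells, because the start configuration of the subroutine prescribes
  -- zeros behind the matrix.
  refine Runs.weaken (Runs.forUpTo (c := 18) (fun q st' => ∀ e, st'.xarr 100 e =
    if e < q then mixedDiff P (e / (2 * c.s - 1)) (e % (2 * c.s - 1)) else 0) hc.mm hc.one rfl
    (by omega) (by simp [h0]) ?_) le_rfl ?_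
  · intro e he st1 he1 hF hI1
    have hc1 := hc.frame hF rfl
    have g4 : st1.xarr 4 = st.xarr 4 := hF.xarr 4 rfl
    have hx : e / (2 * c.s - 1) < 2 * c.s - 1 := Nat.div_lt_of_lt_mul he
    have hy : e % (2 * c.s - 1) < 2 * c.s - 1 := Nat.mod_lt _ (by omega)
    have key : ∀ v, v = mixedDiff P (e / (2 * c.s - 1)) (e % (2 * c.s - 1)) →
        ∀ e', Function.update (st1.xarr 100) e v e' =
          if e' < e + 1 then mixedDiff P (e' / (2 * c.s - 1)) (e' % (2 * c.s - 1)) else 0 := by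
      intro v hv e'
      rcases eq_or_ne e' e with rfl | h
      · simp [hv]
      · rw [Function.update_of_ne h, hI1]
        exact if_congr (by omega) rfl rfl
    refine Runs.weaken (Runs.of_wp (p := fillBody) ?_) (by decide) fun _ _ h => h
    simp only [fillBody, RamProg.wp, WordOp.eval, RamState.setW_wreg, RamState.setW_xarr,
      RamState.setX_wreg, RamState.setX_xarr, RamState.setX_xreg, RamState.storeX_xarr,
      RamState.setW_xreg, he1, hc1.s2, hc1.m, hc1.one, g4, reduceIte, Nat.reduceEqDiff]
    set x := e / (2 * c.s - 1)
    set y := e % (2 * c.s - 1)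
    have hPm : ∀ x < 2 * c.s, ∀ y < 2 * c.s, st.xarr 4 (x * (2 * c.s) + y) = P x y := hP
    have e2 : x * (2 * c.s) + y + 1 = x * (2 * c.s) + (y + 1) := by ring
    have e3 : x * (2 * c.s) + y + 1 + 2 * c.s = (x + 1) * (2 * c.s) + (y + 1) := by ring
    have e4 : x * (2 * c.s) + y + 1 + 2 * c.s - 1 = (x + 1) * (2 * c.s) + y := by
      rw [e3]; rfl
    rw [e4, e3, e2, hPm x (by omega) y (by omega), hPm x (by omega) (y + 1) (by omega),
      hPm (x + 1) (by omega) (y + 1) (by omega), hPm (x + 1) (by omega) y (by omega)]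
    have b1 := mul_add_lt (show x + 1 < 2 * c.s by omega) (show y + 1 < 2 * c.s by omega)
    have b2 : (x + 1) * (2 * c.s) = x * (2 * c.s) + 2 * c.s := by ring
    have p1 := abs_le.1 (hPW x (by omega) y (by omega))
    have p2 := abs_le.1 (hPW x (by omega) (y + 1) (by omega))
    have p3 := abs_le.1 (hPW (x + 1) (by omega) (y + 1) (by omega))
    have p4 := abs_le.1 (hPW (x + 1) (by omega) y (by omega))
    refine ⟨by omega, by omega, by omega, by omega, hR.num _ (abs_le.2 ⟨?_, ?_⟩), by omega,
      hR.num _ (abs_le.2 ⟨?_, ?_⟩), hR.num _ (abs_le.2 ⟨?_, ?_⟩), by omega,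
      hR.num _ (abs_le.2 ⟨?_, ?_⟩), hR.num _ (abs_le.2 ⟨?_, ?_⟩), by omega,
      hR.num _ (abs_le.2 ⟨?_, ?_⟩), hR.num _ (abs_le.2 ⟨?_, ?_⟩), key _ ?_⟩
    all_goals first | linarith | skip
    unfold mixedDiff
    ring
  · intro st' _ h
    funext e
    rw [h e]
    unfold rowMajor
    have hm : 0 < 2 * c.s - 1 := by omega
    by_cases he : e < (2 * c.s - 1) * (2 * c.s - 1)
    · rw [if_pos he, dif_pos ⟨Nat.div_lt_of_lt_mul he, Nat.mod_lt _ hm⟩]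
    · rw [if_neg he, dif_neg]
      rintro ⟨h1, -⟩
      exact he ((Nat.div_lt_iff_lt_mul hm).1 h1)

end

/-- `x` is the output of the program on the matrix `M` with the coin tosses `r`. -/
def MaxSubarrayOutput (prog : RamProg) (B₀ : ℕ) (N₀ : Set ℝ) {m : ℕ} (M : Fin m → Fin m → ℝ)
    (r : ℕ → Bool) (t : ℕ) (x : ℝ) : Prop :=
  ∃ k ≤ t, ∃ s', RunsTo B₀ N₀ prog ((maxSubarray fun _ => Set.univ).start m M r) k s' ∧
    s'.xreg 0 = x

/-- Ask the subroutine whether the maximum subarray exceeds the bound in numeric register `1`. -/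
def voteBody (mb : ℕ) (prog : RamProg) : RamProg :=
  clearReloc mb ;; wop .add 100 6 13 ;; wop .mul 90 24 9 ;; forUpTo 23 17 fillBody ;;
  prog.reloc ;; ifx 1 100 (wop .add 26 26 1) skip

section
variable {B : ℕ} {Nm : Set ℝ} {c : Cfg}

/-- Vote `q` reads its tosses from position `q * tau` on. Since `t ≤ tau`, different votes use
disjoint tosses, while all blocks use the same ones. With the answers `ans` given in advance, the
count is a statement about numbers only. -/
theorem vote_spec (hR : Room c B Nm) {st : RamState} (hc : Ctx c st) {P : ℕ → ℕ → ℝ}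
    (hP : ∀ x < 2 * c.s, ∀ y < 2 * c.s, mat (2 * c.s) (st.xarr 4) x y = P x y)
    (hPW : ∀ x < 2 * c.s, ∀ y < 2 * c.s, |P x y| ≤ 33 * c.W) {zb : ℕ → Bool}
    (hz : ∀ b < c.r * c.tau, st.warr 4 b = (zb b).toNat) {prog : RamProg} {mb : ℕ}
    (hmb : prog.Below mb) (hmb1 : 1 ≤ mb) {B₀ : ℕ} {N₀ : Set ℝ} (hB₀ : B₀ ≤ B) (hN₀ : N₀ ⊆ Nm)
    {t : ℕ} (ht : t ≤ c.tau) (ans : ℕ → ℝ)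
    (hans : ∀ q < c.r, MaxSubarrayOutput prog B₀ N₀
      (fun a b : Fin (2 * c.s - 1) => mixedDiff P a b)
      (coinStream fun b : Fin t => zb (q * c.tau + b)) t (ans q))
    (h26 : st.wreg 26 = 0) :
    Runs B Nm (forUpTo 24 8 (voteBody mb prog)) st
      (c.r * (4 * mb + (2 * c.s - 1) * (2 * c.s - 1) * 20 + 2 * t + 9) + 2)
      fun st' => st'.wreg 26 = ((Finset.range c.r).filter fun q => 32 * c.W < ans q).card := by
  have hs := Room.two_le_s c
  have hW := hR.W
  have hNB := hR.N_le
  have hsN := hR.s_le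
  have hrB := hR.r
  refine Runs.weaken (Runs.forUpTo
    (c := (4 * mb + 1) + (1 + (1 + (((2 * c.s - 1) * (2 * c.s - 1) * 20 + 2) + (2 * t + 2)))))
    (fun q st' => st'.wreg 26 =
      ((Finset.range q).filter fun q => 32 * c.W < ans q).card) hc.r hc.one ?_
    (by omega) (by simp [h26]) ?_) (by rw [Nat.add_le_add_iff_right]; exact Nat.mul_le_mul_left _ (by omega)) fun _ _ h => h
  · simp [voteBody, fillBody, forUpTo, RamProg.keepsW]
  · intro q hq st1 hq1 hF h1
    have hc1 : Ctx c st1 := hc.frame hF (by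
      simp [voteBody, fillBody, forUpTo, RamProg.keepsW, RamProg.keepsX, RamProg.keepsCtx])
    have g4 : st1.xarr 4 = st.xarr 4 := hF.xarr 4 (by
      simp [voteBody, fillBody, forUpTo, RamProg.keepsXA])
    have gz : st1.warr 4 = st.warr 4 := hF.warr 4 (by
      simp [voteBody, fillBody, forUpTo, RamProg.keepsWA])
    have hqt : (q + 1) * c.tau ≤ c.r * c.tau := Nat.mul_le_mul_right _ hq
    have hrt := hR.rtau
    rw [Nat.add_mul, one_mul] at hqt
    unfold voteBody
    have hclear := RunsTo.clearReloc (B := B) (N := Nm) (hR.num 0 (by simpa using hW)) mb st1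
    refine hclear.seq fun st2 hF2 h2 => ?_
    have hc2 : Ctx c st2 := hc1.frame hF2 (by simp [RamProg.keepsCtx])
    have k24 : st2.wreg 24 = q := by rw [hF2.wreg 24 (by simp), hq1]
    have k26 := hF2.wreg 26 (by simp)
    have k4 := hF2.xarr 4 (by simp)
    have kz := hF2.warr 4 (by simp)
    refine Runs.seq (Runs.of_wp (p := wop .add 100 6 13)
      (Q := fun s => s = st2.setW 100 (2 * c.s - 1)) ?_) ?_
    · simp only [RamProg.wp, WordOp.eval, hc2.m, hc2.zero, add_zero, and_true]
      omega
    rintro _ hF3 rfl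
    refine Runs.seq (Runs.of_wp (p := wop .mul 90 24 9)
      (Q := fun s => s = (st2.setW 100 (2 * c.s - 1)).setW 90 (q * c.tau)) ?_) ?_
    · simp only [RamProg.wp, WordOp.eval, RamState.setW_wreg, Nat.reduceEqDiff, if_false, k24,
        hc2.tau, and_true]
      omega
    rintro _ hF4 rfl
    have hc4 := (hc2.frame hF3 rfl).frame hF4 rfl
    generalize hst4 : (st2.setW 100 (2 * c.s - 1)).setW 90 (q * c.tau) = st4 at *
    have h4 : ∀ i < mb, st4.wreg (i + 100) = (if i = 0 then 2 * c.s - 1 else 0) ∧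
      st4.xreg (i + 100) = 0 ∧ st4.warr (i + 100) = (fun _ => 0) ∧
      st4.xarr (i + 100) = fun _ => 0 := by
      intro i hi
      have := h2 i hi
      subst hst4
      simp [this]
    have e90 : st4.wreg 90 = q * c.tau := by subst hst4; simp
    have e26 : st4.wreg 26 = st1.wreg 26 := by subst hst4; simp [k26]
    have e4 : st4.xarr 4 = st.xarr 4 := by subst hst4; simp [k4, g4]
    have ez : st4.warr 4 = st.warr 4 := by subst hst4; simp [kz, gz]
    refine Runs.seq (fill_spec hR hc4 (P := P) (by rw [e4]; exact hP) hPW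
      (h4 0 hmb1).2.2.2) fun st5 hF5 h5 => ?_
    obtain ⟨k', hk', s', hr, hx⟩ := hans q hq
    have hc5 := hc4.frame hF5 rfl
    have f26 : st5.wreg 26 = st1.wreg 26 := by rw [hF5.wreg 26 rfl, e26]
    have f90 : st5.wreg 90 = q * c.tau := by rw [hF5.wreg 90 rfl, e90]
    have fz : st5.warr 4 = st.warr 4 := by rw [hF5.warr 4 rfl, ez]
    -- Clearing, setting the size and filling the input array have produced the start configuration
    -- of the subroutine; no toss has to be left over afterwards.
    have hsim : Simulates B mb (k' + 0) ((maxSubarray fun _ => Set.univ).start _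
        (fun a b : Fin (2 * c.s - 1) => mixedDiff P a b)
        (coinStream fun b : Fin t => zb (q * c.tau + b))) st5 := by
      have kW : ∀ i, (forUpTo 23 17 fillBody).keepsW (i + 100) = true := fun i => by
        have : i + 100 ≠ 23 := by omega
        have : i + 100 ≠ 30 := by omega
        have : i + 100 ≠ 31 := by omega
        have : i + 100 ≠ 32 := by omega
        have : i + 100 ≠ 33 := by omega
        simp [forUpTo, fillBody, RamProg.keepsW, *]
      have kX : ∀ i, (forUpTo 23 17 fillBody).keepsX (i + 100) = true := fun i => by
        have : i + 100 ≠ 10 := by omega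
        have : i + 100 ≠ 11 := by omega
        simp [forUpTo, fillBody, RamProg.keepsX, *]
      constructor
      · intro i hi
        rw [hF5.wreg _ (kW i), (h4 i hi).1]
        rfl
      · intro i hi
        rw [hF5.xreg _ (kX i), (h4 i hi).2.1]
        rfl
      · intro i hi
        rw [hF5.warr _ (by simp [forUpTo, fillBody, RamProg.keepsWA]), (h4 i hi).2.2.1]
        rfl
      · intro i hi
        rcases Nat.eq_zero_or_pos i with rfl | hi0
        · exact h5
        · have h100 : i + 100 ≠ 100 := by omega
          rw [hF5.xarr _ (by simp [forUpTo, fillBody, RamProg.keepsXA, hi0.ne']),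
            (h4 i hi).2.2.2]
          simp [maxSubarray, hi0.ne']
      · intro b hb
        have hbt : b < t := by omega
        rw [fz, f90, hz _ (by omega)]
        simp [maxSubarray, coinStream, hbt]
      · exact hc5.one
      · rw [f90]; omega
    refine Runs.seq (Q := fun st6 => st6.xreg 100 = ans q) ((RunsTo.reloc hB₀ hN₀ hr hmb 0 st5
      hsim).weaken (Nat.mul_le_mul_left 2 hk') fun st6 _ h6 => ?_) fun st6 hF6 h6 => ?_
    · have := h6.xreg 0 hmb1
      rw [zero_add] at this
      rw [this, hx]
    have hc6 : Ctx c st6 := hc5.frame hF6 (by simp [RamProg.keepsCtx])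
    have l26 : st6.wreg 26 = ((Finset.range q).filter fun q => 32 * c.W < ans q).card := by
      rw [hF6.wreg 26 (by simp), f26, h1]
    have hcard : ((Finset.range q).filter fun q => 32 * c.W < ans q).card ≤ q := by
      simpa using Finset.card_filter_le (Finset.range q) fun q => 32 * c.W < ans q
    refine Runs.of_wp (p := ifx 1 100 (wop .add 26 26 1) skip) ?_
    simp only [RamProg.wp, WordOp.eval, hc6.H, hc6.one, h6, l26, RamState.setW_wreg,
      Nat.reduceEqDiff, if_false, if_true]
    rw [Finset.range_add_one, Finset.filter_insert]
    refine ⟨fun h => ⟨by omega, ?_⟩, fun h => ?_⟩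
    · rw [if_pos h, Finset.card_insert_of_notMem (by simp)]
    · rw [if_neg (not_lt.2 h)]

end

/-! ### The main program: one pass over all blocks -/

/-- The number of the block that contains the triple `i j k`. -/
def Cfg.code (c : Cfg) (i j k : ℕ) : ℕ :=
  (i / c.s * c.g + j / c.s) * c.g + k / c.s

/-- Compute the triple with number `e` in the current block. -/
def bruteDecode : RamProg :=
  wop .div 27 23 4 ;; wop .mod 29 23 4 ;; wop .mod 28 27 4 ;; wop .div 27 27 4 ;;
  wop .add 27 27 35 ;; wop .add 28 28 36 ;; wop .add 29 29 37

/-- Compute the corner of the block with number `q`. -/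
def blockDecode : RamProg :=
  wop .div 36 22 5 ;; wop .mod 37 22 5 ;; wop .div 35 36 5 ;; wop .mod 36 36 5 ;;
  wop .mul 35 35 4 ;; wop .mul 36 36 4 ;; wop .mul 37 37 4

/-- Ask the subroutine whether there is something to improve in the block, and if so, relax with
all its triples. -/
def tripleBody (mb : ℕ) (prog : RamProg) : RamProg :=
  blockDecode ;; forUpTo 23 18 potentialBody ;; wconst 26 0 ;; forUpTo 24 8 (voteBody mb prog) ;;
  wop .add 30 26 26 ;;
  ifw 8 30 (ifw 25 12 (wop .add 25 25 1 ;; forUpTo 23 16 (bruteDecode ;; relaxProg)) skip) skip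

/-- The matrix that is given to the subroutine for the block with number `q`. -/
def blockMatrix (c : Cfg) (δ : ℝ) (D T : ℕ → ℕ → ℝ) (q : ℕ) :
    Fin (2 * c.s - 1) → Fin (2 * c.s - 1) → ℝ :=
  fun a b => mixedDiff (blockPotential c δ D T (q / c.g / c.g) (q / c.g % c.g) (q % c.g)) a b

/-- What the analysis needs to know about the subroutine, in a run with the coin tosses `zb`. -/
structure OracleFor (c : Cfg) (B : ℕ) (Nm : Set ℝ) (Λ : AddSubgroup ℝ) (prog : RamProg)
    (mb B₀ : ℕ) (N₀ : Set ℝ) (t : ℕ) (zb : ℕ → Bool) : Prop where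
  below : prog.Below mb
  mb_pos : 1 ≤ mb
  B_le : B₀ ≤ B
  N_le : N₀ ⊆ Nm
  t_le : t ≤ c.tau
  halts : ∀ M : Fin (2 * c.s - 1) → Fin (2 * c.s - 1) → ℝ,
    (∀ a b, M a b ∈ Λ ∧ |M a b| ≤ 132 * c.W) → ∀ q < c.r, ∃ x,
      MaxSubarrayOutput prog B₀ N₀ M (coinStream fun b : Fin t => zb (q * c.tau + b)) t x

/-- Most answers for the matrix `M` are correct. -/
def Reliable (c : Cfg) (prog : RamProg) (B₀ : ℕ) (N₀ : Set ℝ) (t : ℕ) (zb : ℕ → Bool)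
    (M : Fin (2 * c.s - 1) → Fin (2 * c.s - 1) → ℝ) : Prop :=
  ∀ ans : ℕ → ℝ, (∀ q < c.r,
    MaxSubarrayOutput prog B₀ N₀ M (coinStream fun b : Fin t => zb (q * c.tau + b)) t (ans q)) →
    c.r < 2 * Set.ncard {q | q < c.r ∧ IsGreatest (subarraySums M) (ans q)}

/-- The good answers are a strict majority and all of them vote for the truth value of `v`; the
others cannot outweigh them. -/
theorem majority_iff {r : ℕ} {p good : ℕ → Prop} [DecidablePred p] {v : Prop}
    (h : ∀ q < r, good q → (p q ↔ v)) (hg : r < 2 * Set.ncard {q | q < r ∧ good q}) :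
    r < 2 * ((Finset.range r).filter p).card ↔ v := by
  classical
  have hcard : Set.ncard {q | q < r ∧ good q} = ((Finset.range r).filter good).card := by
    rw [← Set.ncard_coe_finset]
    congr 1
    ext q
    simp
  rw [hcard] at hg
  by_cases hv : v
  · refine iff_of_true ?_ hv
    have : ((Finset.range r).filter good).card ≤ ((Finset.range r).filter p).card := by
      apply Finset.card_le_card
      intro q hq
      simp only [Finset.mem_filter, Finset.mem_range] at hq ⊢
      exact ⟨hq.1, (h q hq.1 hq.2).2 hv⟩
    omega
  · refine iff_of_false ?_ hv
    have h1 := Finset.card_filter_add_card_filter_not (s := Finset.range r) p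
    have : ((Finset.range r).filter good).card ≤
        ((Finset.range r).filter fun q => ¬ p q).card := by
      apply Finset.card_le_card
      intro q hq
      simp only [Finset.mem_filter, Finset.mem_range] at hq ⊢
      exact ⟨hq.1, fun hp => hv ((h q hq.1 hq.2).1 hp)⟩
    rw [Finset.card_range] at h1
    omega

/-! ### One block: votes and relaxation -/

section
variable {B : ℕ} {Nm : Set ℝ} {c : Cfg}

theorem Cfg.code_lt (hR : Room c B Nm) {i j k : ℕ} (hi : i < c.N) (hj : j < c.N) (hk : k < c.N) :
    c.code i j k < c.g * c.g * c.g := by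
  have hd : ∀ x < c.N, x / c.s < c.g := fun x hx =>
    Nat.div_lt_of_lt_mul (by rw [hR.s_mul_g]; exact hx)
  exact mul_add_lt (mul_add_lt (hd i hi) (hd j hj)) (hd k hk)

/-- The digits of `e` in base `s` are the offsets inside the block and the digits of `q` in base `g`
are its coordinates, so division with remainder by `s` recovers both. -/
theorem brute_set (hR : Room c B Nm) {q : ℕ} {i j k : ℕ} (hi : i < c.N) (hj : j < c.N)
    (hk : k < c.N) :
    (∃ e < c.s * c.s * c.s, e / c.s / c.s + q / c.g / c.g * c.s = i ∧
      e / c.s % c.s + q / c.g % c.g * c.s = j ∧ e % c.s + q % c.g * c.s = k) ↔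
      c.code i j k = q := by
  have hs : 0 < c.s := by have := Room.two_le_s c; omega
  have hg : 0 < c.g := Room.g_pos c
  have hdm : ∀ {x y z : ℕ}, x < z → (x + y * z) / z = y ∧ (x + y * z) % z = x := by
    intro x y z hx
    have hz : 0 < z := by omega
    exact ⟨by rw [Nat.add_mul_div_right _ _ hz, Nat.div_eq_of_lt hx, zero_add],
      by rw [Nat.add_mul_mod_self_right, Nat.mod_eq_of_lt hx]⟩
  constructor
  · rintro ⟨e, he, rfl, rfl, rfl⟩
    have h1 : e / c.s / c.s < c.s :=
      Nat.div_lt_of_lt_mul (Nat.div_lt_of_lt_mul (by rwa [mul_comm c.s (c.s * c.s)]))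
    unfold Cfg.code
    rw [(hdm h1).1, (hdm (Nat.mod_lt _ hs)).1, (hdm (Nat.mod_lt _ hs)).1]
    rw [Nat.div_add_mod' (q / c.g) c.g, Nat.div_add_mod' q c.g]
  · rintro rfl
    have hd : ∀ x < c.N, x / c.s < c.g := fun x hx =>
      Nat.div_lt_of_lt_mul (by rw [hR.s_mul_g]; exact hx)
    have hm : ∀ x, x % c.s < c.s := fun x => Nat.mod_lt _ hs
    refine ⟨k % c.s + (j % c.s + i % c.s * c.s) * c.s, ?_, ?_⟩
    · rw [add_comm (k % c.s), add_comm (j % c.s)]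
      exact mul_add_lt (mul_add_lt (hm i) (hm j)) (hm k)
    · unfold Cfg.code
      rw [(hdm (hm k)).1, (hdm (hm k)).2, (hdm (hm j)).1, (hdm (hm j)).2,
        add_comm _ (k / c.s), (hdm (hd k hk)).1, (hdm (hd k hk)).2, add_comm _ (j / c.s),
        (hdm (hd j hj)).1, (hdm (hd j hj)).2]
      exact ⟨Nat.mod_add_div' i c.s, Nat.mod_add_div' j c.s, Nat.mod_add_div' k c.s⟩

/-- There is something to improve by more than `δ` in the block with number `q`. -/
def Improvable (c : Cfg) (δ : ℝ) (D T : ℕ → ℕ → ℝ) (q : ℕ) : Prop :=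
  ∃ i < c.N, ∃ j < c.N, ∃ k < c.N, c.code i j k = q ∧ D i k + D k j + δ < T i j

/-- The criterion for triangles is used with `C = T - δ`. The shift by `δ ≤ W` is the reason why
`lt_maxSubarray_iff` allows entries of `C` up to `2 W`. -/
theorem improvable_iff (hR : Room c B Nm) {δ : ℝ} {D T : ℕ → ℕ → ℝ} {q : ℕ}
    (hq : q < c.g * c.g * c.g) (hδ0 : 0 ≤ δ) (hδW : δ ≤ c.W)
    (hDW : ∀ i < c.N, ∀ j < c.N, |D i j| ≤ c.W) (hTW : ∀ i < c.N, ∀ j < c.N, |T i j| ≤ c.W)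
    {z : ℝ} (hz : IsGreatest (subarraySums (blockMatrix c δ D T q)) z) :
    32 * c.W < z ↔ Improvable c δ D T q := by
  have hs := Room.two_le_s c
  have hg : 0 < c.g := Room.g_pos c
  have hI : q / c.g / c.g < c.g :=
    Nat.div_lt_of_lt_mul (Nat.div_lt_of_lt_mul (by rwa [mul_comm c.g (c.g * c.g)]))
  have hJ : q / c.g % c.g < c.g := Nat.mod_lt _ hg
  have hK : q % c.g < c.g := Nat.mod_lt _ hg
  rw [lt_maxSubarray_iff (by omega) hR.W (fun x hx y hy => hDW _ (hR.block_lt hI hx) _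
    (hR.block_lt hK hy)) (fun x hx y hy => hDW _ (hR.block_lt hK hx) _ (hR.block_lt hJ hy))
    (fun x hx y hy => ?_) rfl hz]
  · constructor
    · rintro ⟨i, hi, j, hj, k, hk, h⟩
      refine ⟨_, hR.block_lt hI hi, _, hR.block_lt hJ hj, _, hR.block_lt hK hk, ?_,
        by linarith⟩
      unfold Cfg.code
      rw [mul_comm _ c.s, mul_comm _ c.s, mul_comm _ c.s, Nat.mul_add_div (by omega),
        Nat.mul_add_div (by omega), Nat.mul_add_div (by omega), Nat.div_eq_of_lt hi,
        Nat.div_eq_of_lt hj, Nat.div_eq_of_lt hk]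
      simp only [add_zero]
      rw [Nat.div_add_mod' (q / c.g) c.g, Nat.div_add_mod' q c.g]
    · rintro ⟨i, hi, j, hj, k, hk, hcode, h⟩
      obtain ⟨e, he, rfl, rfl, rfl⟩ := (brute_set hR hi hj hk).2 hcode
      refine ⟨e / c.s / c.s,
        Nat.div_lt_of_lt_mul (Nat.div_lt_of_lt_mul (by rwa [mul_comm c.s (c.s * c.s)])),
        e / c.s % c.s, Nat.mod_lt _ (by omega), e % c.s, Nat.mod_lt _ (by omega), ?_⟩
      simp only [add_comm _ (_ * c.s)] at h ⊢
      linarith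
  · have := hTW _ (hR.block_lt hI hx) _ (hR.block_lt hJ hy)
    rw [abs_le] at this ⊢
    constructor <;> linarith

/-- A mixed difference has four terms of size at most `33 W`, whence `132 W`. -/
theorem blockMatrix_mem (hR : Room c B Nm) {Λ : AddSubgroup ℝ} {δ : ℝ} {D T : ℕ → ℕ → ℝ} {q : ℕ}
    (hq : q < c.g * c.g * c.g) (hδ0 : 0 ≤ δ) (hδW : δ ≤ c.W) (hδΛ : δ ∈ Λ) (hWΛ : c.W ∈ Λ)
    (hDW : ∀ i < c.N, ∀ j < c.N, |D i j| ≤ c.W) (hTW : ∀ i < c.N, ∀ j < c.N, |T i j| ≤ c.W)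
    (hDΛ : ∀ i < c.N, ∀ j < c.N, D i j ∈ Λ) (hTΛ : ∀ i < c.N, ∀ j < c.N, T i j ∈ Λ) :
    (∀ a b, blockMatrix c δ D T q a b ∈ Λ ∧ |blockMatrix c δ D T q a b| ≤ 132 * c.W) ∧
    ∀ x < 2 * c.s, ∀ y < 2 * c.s,
      |blockPotential c δ D T (q / c.g / c.g) (q / c.g % c.g) (q % c.g) x y| ≤ 33 * c.W := by
  have hs := Room.two_le_s c
  have hg : 0 < c.g := Room.g_pos c
  have hI : q / c.g / c.g < c.g :=
    Nat.div_lt_of_lt_mul (Nat.div_lt_of_lt_mul (by rwa [mul_comm c.g (c.g * c.g)]))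
  have hJ : q / c.g % c.g < c.g := Nat.mod_lt _ hg
  have hK : q % c.g < c.g := Nat.mod_lt _ hg
  have h1 : ∀ x < 2 * c.s, ∀ y < 2 * c.s,
      |blockPotential c δ D T (q / c.g / c.g) (q / c.g % c.g) (q % c.g) x y| ≤ 33 * c.W := by
    intro x hx y hy
    refine abs_trianglePotential_le hR.W (fun x hx y hy => hDW _ (hR.block_lt hI hx) _
      (hR.block_lt hK hy)) (fun x hx y hy => hDW _ (hR.block_lt hK hx) _ (hR.block_lt hJ hy))
      (fun x hx y hy => ?_) hx hy
    have := hTW _ (hR.block_lt hI hx) _ (hR.block_lt hJ hy)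
    rw [abs_le] at this ⊢
    constructor <;> linarith
  have h2 : ∀ x < 2 * c.s, ∀ y < 2 * c.s,
      blockPotential c δ D T (q / c.g / c.g) (q / c.g % c.g) (q % c.g) x y ∈ Λ := by
    intro x hx y hy
    exact trianglePotential_mem hWΛ (fun x hx y hy => hDΛ _ (hR.block_lt hI hx) _
      (hR.block_lt hK hy)) (fun x hx y hy => hDΛ _ (hR.block_lt hK hx) _ (hR.block_lt hJ hy))
      (fun x hx y hy => Λ.sub_mem (hTΛ _ (hR.block_lt hI hx) _ (hR.block_lt hJ hy)) hδΛ) hx hy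
  refine ⟨fun a b => ?_, h1⟩
  have ha := a.2
  have hb := b.2
  unfold blockMatrix mixedDiff
  refine ⟨Λ.add_mem (Λ.sub_mem (Λ.sub_mem (h2 _ ?_ _ ?_) (h2 _ ?_ _ ?_)) (h2 _ ?_ _ ?_))
    (h2 _ ?_ _ ?_), ?_⟩
  any_goals omega
  have p1 := abs_le.1 (h1 a (by omega) b (by omega))
  have p2 := abs_le.1 (h1 (a + 1) (by omega) b (by omega))
  have p3 := abs_le.1 (h1 a (by omega) (b + 1) (by omega))
  have p4 := abs_le.1 (h1 (a + 1) (by omega) (b + 1) (by omega))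
  rw [abs_le]
  constructor <;> linarith

/-- The first two claims say what happens if the votes can be trusted and the cap permits. The last
alternative holds in any case: the block was left alone, or it was relaxed and counted. It suffices
for soundness and for the running time when the subroutine errs. -/
theorem triple_spec (hR : Room c B Nm) {Λ : AddSubgroup ℝ} {prog : RamProg} {mb B₀ : ℕ}
    {N₀ : Set ℝ} {t : ℕ} {zb : ℕ → Bool} (hO : OracleFor c B Nm Λ prog mb B₀ N₀ t zb)
    {st : RamState} (hc : Ctx c st) {D T : ℕ → ℕ → ℝ} {mid : ℕ → ℕ → ℕ}
    (hD : D = mat c.N (st.xarr 2)) (hT : T = mat c.N (st.xarr 3)) (hM : mid = mat c.N (st.warr 5))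
    {δ : ℝ} (hδ : st.xreg 3 = δ) (hδ0 : 0 ≤ δ) (hδW : δ ≤ c.W) (hδΛ : δ ∈ Λ) (hWΛ : c.W ∈ Λ)
    {V : ℝ} (hVW : 2 * V ≤ c.W) (hV0 : 0 ≤ V)
    (hDV : ∀ i < c.N, ∀ j < c.N, |D i j| ≤ V) (hTV : ∀ i < c.N, ∀ j < c.N, |T i j| ≤ 2 * V)
    (hDΛ : ∀ i < c.N, ∀ j < c.N, D i j ∈ Λ) (hTΛ : ∀ i < c.N, ∀ j < c.N, T i j ∈ Λ)
    (hz : ∀ b < c.r * c.tau, st.warr 4 b = (zb b).toNat)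
    {q : ℕ} (hq : q < c.g * c.g * c.g) (h22 : st.wreg 22 = q) {cnt : ℕ} (h25 : st.wreg 25 = cnt) :
    ∃ x, Runs B Nm (tripleBody mb prog) st
      (((2 * c.s) * (2 * c.s) * 20 + c.r * (4 * mb + (2 * c.s - 1) * (2 * c.s - 1) * 20 + 2 * t + 9)
        + 22) + x * (c.s * c.s * c.s * 21))
      fun st' => (Reliable c prog B₀ N₀ t zb (blockMatrix c δ D T q) ∧ Improvable c δ D T q ∧
          cnt < c.N * c.N * c.s → st'.wreg 25 = cnt + 1 ∧
          Relaxes c.N D (fun i j k => c.code i j k = q) T mid (mat c.N (st'.xarr 3))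
            (mat c.N (st'.warr 5))) ∧
        (Reliable c prog B₀ N₀ t zb (blockMatrix c δ D T q) ∧ ¬ Improvable c δ D T q →
          st'.wreg 25 = cnt ∧ mat c.N (st'.xarr 3) = T ∧ mat c.N (st'.warr 5) = mid) ∧
        ((x = 0 ∧ st'.wreg 25 = cnt ∧ mat c.N (st'.xarr 3) = T ∧ mat c.N (st'.warr 5) = mid) ∨
          (x = 1 ∧ cnt < c.N * c.N * c.s ∧ st'.wreg 25 = cnt + 1 ∧
          Relaxes c.N D (fun i j k => c.code i j k = q) T mid (mat c.N (st'.xarr 3))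
            (mat c.N (st'.warr 5)))) := by
  have hs := Room.two_le_s c
  have hg : 0 < c.g := Room.g_pos c
  have hI : q / c.g / c.g < c.g :=
    Nat.div_lt_of_lt_mul (Nat.div_lt_of_lt_mul (by rwa [mul_comm c.g (c.g * c.g)]))
  have hJ : q / c.g % c.g < c.g := Nat.mod_lt _ hg
  have hK : q % c.g < c.g := Nat.mod_lt _ hg
  have hN8 := hR.N_le
  have hgN := hR.g_le
  have hsN := hR.s_le
  have hggg := hR.ggg_le
  have hrB := hR.r
  have hDW : ∀ i < c.N, ∀ j < c.N, |D i j| ≤ c.W := fun i hi j hj =>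
    (hDV i hi j hj).trans (by linarith)
  have hTW : ∀ i < c.N, ∀ j < c.N, |T i j| ≤ c.W := fun i hi j hj =>
    (hTV i hi j hj).trans hVW
  have hqg : q / c.g ≤ q := Nat.div_le_self _ _
  obtain ⟨hmem, hpot⟩ := blockMatrix_mem hR hq hδ0 hδW hδΛ hWΛ hDW hTW hDΛ hTΛ
  have hbl : ∀ {I : ℕ}, I < c.g → I * c.s ≤ B := fun {I} hI => by
    have := hR.block_lt hI (show 0 < c.s by omega)
    omega
  -- The answers depend only on the block and on the stored tosses, so they can be fixed before the
  -- votes are simulated.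
  choose! ans hans using hO.halts (blockMatrix c δ D T q) hmem
  -- `x` is `1` exactly if the block is going to be relaxed; it pays for the `s³` relaxations.
  obtain ⟨x, hx1, hx0⟩ : ∃ x, (c.r < 2 * ((Finset.range c.r).filter fun q => 32 * c.W < ans q).card ∧
      cnt < c.N * c.N * c.s → x = 1) ∧ (¬ (c.r < 2 * ((Finset.range c.r).filter
      fun q => 32 * c.W < ans q).card ∧ cnt < c.N * c.N * c.s) → x = 0) := by
    by_cases h : c.r < 2 * ((Finset.range c.r).filter fun q => 32 * c.W < ans q).card ∧
      cnt < c.N * c.N * c.s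
    · exact ⟨1, fun _ => rfl, fun h' => absurd h h'⟩
    · exact ⟨0, fun h' => absurd h' h, fun _ => rfl⟩
  refine ⟨x, ?_⟩
  refine Runs.weaken (k := 7 + (((2 * c.s) * (2 * c.s) * 20 + 2) + (1 +
    ((c.r * (4 * mb + (2 * c.s - 1) * (2 * c.s - 1) * 20 + 2 * t + 9) + 2) + (1 +
      (((3 + x * (c.s * c.s * c.s * 21)) + 1) + 1))))))
    (Runs.seq (Q := fun s => s.wreg 35 = q / c.g / c.g * c.s ∧ s.wreg 36 = q / c.g % c.g * c.s ∧
      s.wreg 37 = q % c.g * c.s) (Runs.of_wp (p := blockDecode) ?_) ?_) (by omega) fun _ _ h => h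
  · simp only [blockDecode, RamProg.wp, WordOp.eval, RamState.setW_wreg, h22, hc.g, hc.s,
      reduceIte, Nat.reduceEqDiff, and_true]
    exact ⟨by omega, by omega, by omega, by omega, hbl hI, hbl hJ, hbl hK⟩
  rintro st1 hF1 ⟨a35, a36, a37⟩
  have hc1 := hc.frame hF1 rfl
  refine Runs.seq (potential_spec hR hc1 (D := D) (T := T) (by rw [hF1.xarr 2 rfl, hD])
    (by rw [hF1.xarr 3 rfl, hT]) (by rw [hF1.xreg 3 rfl, hδ]) hδ0 hδW hDW hTW hI hJ hK a35 a36 a37)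
    fun st2 hF2 hP => ?_
  have hc2 := hc1.frame hF2 rfl
  refine Runs.seq (Runs.of_wp (p := wconst 26 0) (Q := fun s => s = st2.setW 26 0)
    (by simp [RamProg.wp])) ?_
  rintro st3 hF3 rfl
  have hc3 := hc2.frame hF3 rfl
  refine Runs.seq (vote_spec hR hc3 (P := blockPotential c δ D T (q / c.g / c.g) (q / c.g % c.g)
    (q % c.g)) (by simpa using hP) hpot (zb := zb)
    (by rw [hF3.warr 4 rfl, hF2.warr 4 rfl, hF1.warr 4 rfl]; exact hz) hO.below hO.mb_pos hO.B_le
    hO.N_le hO.t_le ans hans (by simp)) fun st4 hF4 hv => ?_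
  have hc4 : Ctx c st4 := hc3.frame hF4 (by
      simp [voteBody, fillBody, forUpTo, RamProg.keepsW, RamProg.keepsX, RamProg.keepsCtx])
  have b2 : st4.xarr 2 = st.xarr 2 := by
    rw [hF4.xarr 2 (by simp [voteBody, fillBody, forUpTo, RamProg.keepsXA]), hF3.xarr 2 rfl,
      hF2.xarr 2 rfl, hF1.xarr 2 rfl]
  have b3 : st4.xarr 3 = st.xarr 3 := by
    rw [hF4.xarr 3 (by simp [voteBody, fillBody, forUpTo, RamProg.keepsXA]), hF3.xarr 3 rfl,
      hF2.xarr 3 rfl, hF1.xarr 3 rfl]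
  have b5 : st4.warr 5 = st.warr 5 := by
    rw [hF4.warr 5 (by simp [voteBody, fillBody, forUpTo, RamProg.keepsWA]), hF3.warr 5 rfl,
      hF2.warr 5 rfl, hF1.warr 5 rfl]
  have b25 : st4.wreg 25 = cnt := by
    rw [hF4.wreg 25 (by simp [voteBody, fillBody, forUpTo, RamProg.keepsW]), hF3.wreg 25 rfl,
      hF2.wreg 25 rfl, hF1.wreg 25 rfl, h25]
  have b35 : st4.wreg 35 = q / c.g / c.g * c.s := by
    rw [hF4.wreg 35 (by simp [voteBody, fillBody, forUpTo, RamProg.keepsW]), hF3.wreg 35 rfl,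
      hF2.wreg 35 rfl, a35]
  have b36 : st4.wreg 36 = q / c.g % c.g * c.s := by
    rw [hF4.wreg 36 (by simp [voteBody, fillBody, forUpTo, RamProg.keepsW]), hF3.wreg 36 rfl,
      hF2.wreg 36 rfl, a36]
  have b37 : st4.wreg 37 = q % c.g * c.s := by
    rw [hF4.wreg 37 (by simp [voteBody, fillBody, forUpTo, RamProg.keepsW]), hF3.wreg 37 rfl,
      hF2.wreg 37 rfl, a37]
  have hcard : ((Finset.range c.r).filter fun q => 32 * c.W < ans q).card ≤ c.r := by
    simpa using Finset.card_filter_le (Finset.range c.r) fun q => 32 * c.W < ans q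
  refine Runs.seq (Runs.of_wp (p := wop .add 30 26 26) (Q := fun s => s = st4.setW 30
    (2 * ((Finset.range c.r).filter fun q => 32 * c.W < ans q).card)) ?_) ?_
  · simp only [RamProg.wp, WordOp.eval, hv]
    exact ⟨by omega, by rw [two_mul]⟩
  rintro st5 hF5 rfl
  have hc5 := hc4.frame hF5 rfl
  have hmaj : Reliable c prog B₀ N₀ t zb (blockMatrix c δ D T q) →
      (c.r < 2 * ((Finset.range c.r).filter fun q => 32 * c.W < ans q).card ↔
        Improvable c δ D T q) := by
    intro hrel
    exact majority_iff (fun e _ hg => improvable_iff hR hq hδ0 hδW hDW hTW hg) (hrel ans hans)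
  have hskip : Runs B Nm skip (st4.setW 30
      (2 * ((Finset.range c.r).filter fun q => 32 * c.W < ans q).card)) 1
      fun st' => st'.wreg 25 = cnt ∧ mat c.N (st'.xarr 3) = T ∧ mat c.N (st'.warr 5) = mid := by
    refine Runs.of_wp (p := skip) ?_
    simp only [RamProg.wp, RamState.setW_wreg, RamState.setW_xarr, RamState.setW_warr,
      Nat.reduceEqDiff, if_false]
    exact ⟨b25, by rw [b3, hT], by rw [b5, hM]⟩
  refine Runs.ifw (fun hyes => ?_) fun hno => ?_
  · simp only [RamState.setW_wreg, Nat.reduceEqDiff, if_false, if_true, hc4.r] at hyes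
    refine Runs.ifw (fun hcap => ?_) fun hcap => ?_
    · simp only [RamState.setW_wreg, Nat.reduceEqDiff, if_false, hc4.cap, b25] at hcap
      have hcapB := hR.cap_le
      have hx := hx1 ⟨hyes, hcap⟩
      refine Runs.weaken (k := 1 + (c.s * c.s * c.s * 21 + 2)) (R := _) (Runs.seq (Runs.of_wp (p := wop .add 25 25 1) (Q := fun s => s = (st4.setW 30
        (2 * ((Finset.range c.r).filter fun q => 32 * c.W < ans q).card)).setW 25 (cnt + 1)) ?_) ?_) (by rw [hx]; omega) (fun _ _ h => h)
      · simp only [RamProg.wp, WordOp.eval, RamState.setW_wreg, Nat.reduceEqDiff, if_false, b25,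
          hc4.one, and_true]
        omega
      rintro st6 hF6 rfl
      have hc6 := hc5.frame hF6 rfl
      refine Runs.weaken (relaxLoop_spec (V := V) (st := (st4.setW 30
        (2 * ((Finset.range c.r).filter fun q => 32 * c.W < ans q).card)).setW 25 (cnt + 1))
        (c := 7) (fun e => e / c.s / c.s + q / c.g / c.g * c.s)
        (fun e => e / c.s % c.s + q / c.g % c.g * c.s) (fun e => e % c.s + q % c.g * c.s)
        (by have := hR.NN_le; omega : c.N * c.N ≤ B) (fun x hx => hR.num x (by
          have := hR.W; linarith)) hV0 hc6.N hc6.one hc6.sss hR.sss_le (by norm_num) rfl ?_ ?_ ?_ ?_)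
        le_rfl ?_
      · intro e he
        have h1 : e / c.s / c.s < c.s :=
          Nat.div_lt_of_lt_mul (Nat.div_lt_of_lt_mul (by rwa [mul_comm c.s (c.s * c.s)]))
        exact ⟨by rw [add_comm]; exact hR.block_lt hI h1,
          by rw [add_comm]; exact hR.block_lt hJ (Nat.mod_lt _ (by omega)),
          by rw [add_comm]; exact hR.block_lt hK (Nat.mod_lt _ (by omega))⟩
      · simpa [b2, ← hD] using hDV
      · simpa [b3, ← hT] using hTV
      · intro e he st7 h7 hF7
        have hc7 := hc6.frame hF7 rfl
        have d35 := hF7.wreg 35 rfl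
        have d36 := hF7.wreg 36 rfl
        have d37 := hF7.wreg 37 rfl
        simp only [RamState.setW_wreg, Nat.reduceEqDiff, if_false, b35, b36, b37] at d35 d36 d37
        have hsss := hR.sss_le
        have e1 : e / c.s ≤ e := Nat.div_le_self _ _
        have e2 : e / c.s / c.s < c.s :=
          Nat.div_lt_of_lt_mul (Nat.div_lt_of_lt_mul (by rwa [mul_comm c.s (c.s * c.s)]))
        have e3 := hR.block_lt hI e2
        have e4 : e / c.s % c.s < c.s := Nat.mod_lt _ (by omega)
        have e5 := hR.block_lt hJ e4
        have e6 : e % c.s < c.s := Nat.mod_lt _ (by omega)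
        have e7 := hR.block_lt hK e6
        refine Runs.of_wp (p := bruteDecode) ?_
        simp only [bruteDecode, RamProg.wp, WordOp.eval, RamState.setW_wreg, h7, hc7.s, d35, d36, d37,
          reduceIte, Nat.reduceEqDiff, and_true]
        exact ⟨by omega, by omega, by omega, by omega, by omega, by omega, by omega⟩
      · intro st8 hF8 h8
        have f25 := hF8.wreg 25 rfl
        simp only [RamState.setW_wreg, if_true] at f25
        have hrel := h8.congr fun i hi j hj k hk => brute_set hR hi hj hk
        simp only [RamState.setW_xarr, RamState.setW_warr, b2, b3, b5, ← hD, ← hT, ← hM] at hrel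
        refine ⟨fun _ => ⟨f25, hrel⟩, fun h => absurd ((hmaj h.1).1 hyes) h.2,
          .inr ⟨hx, hcap, f25, hrel⟩⟩
    · simp only [RamState.setW_wreg, Nat.reduceEqDiff, if_false, hc4.cap, b25] at hcap
      exact hskip.weaken (by omega) fun st' _ h => ⟨fun h' => by omega, fun _ => h,
        .inl ⟨hx0 (by omega), h⟩⟩
  · simp only [RamState.setW_wreg, Nat.reduceEqDiff, if_false, if_true, hc4.r] at hno
    exact hskip.weaken (by omega) fun st' _ h => ⟨fun h' => absurd ((hmaj h'.1).2 h'.2.1)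
      (not_lt.2 hno), fun _ => h, .inl ⟨hx0 (by omega), h⟩⟩

end

/-- Run through all blocks. -/
def passProg (mb : ℕ) (prog : RamProg) : RamProg :=
  xload 3 5 21 ;; wconst 25 0 ;; forUpTo 22 15 (tripleBody mb prog)

/-- `T` can occur in a pass that starts with `T₀`, when the blocks with numbers below `q` have been
treated. -/
def Stage (c : Cfg) (δ : ℝ) (D T₀ : ℕ → ℕ → ℝ) (q : ℕ) (T : ℕ → ℕ → ℝ) : Prop :=
  (∃ S mid₀ mid, (∀ i < c.N, ∀ j < c.N, ∀ k < c.N, S i j k → c.code i j k < q) ∧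
    Relaxes c.N D S T₀ mid₀ T mid) ∧
  ∀ i < c.N, ∀ j < c.N, ∀ k < c.N, c.code i j k < q → T i j ≤ D i k + D k j + δ

/-- The conditions under which a pass finds all improvements by more than `δ`. -/
structure PassGood (c : Cfg) (Λ : AddSubgroup ℝ)
    (Rel : (Fin (2 * c.s - 1) → Fin (2 * c.s - 1) → ℝ) → Prop) (δ : ℝ) (D T₀ : ℕ → ℕ → ℝ) :
    Prop where
  rel : ∀ q < c.g * c.g * c.g, ∀ T, Stage c δ D T₀ q T → Rel (blockMatrix c δ D T q)
  pot : ∃ φ : ℕ → ℕ → ℝ → ℕ, (∀ i < c.N, ∀ j < c.N, Monotone (φ i j)) ∧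
    (∀ i < c.N, ∀ j < c.N, ∀ k < c.N, ∀ x ∈ Λ, D i k + D k j + δ < x →
      φ i j (D i k + D k j) < φ i j x) ∧
    ∀ i < c.N, ∀ j < c.N, φ i j (T₀ i j) ≤ c.s

/-! ### Amortized analysis of a pass -/

section
variable {B : ℕ} {Nm : Set ℝ} {c : Cfg}

theorem potential_sum_le {N s : ℕ} {φ : ℕ → ℕ → ℝ → ℕ} {T : ℕ → ℕ → ℝ}
    (h : ∀ i < N, ∀ j < N, φ i j (T i j) ≤ s) :
    ∑ i ∈ Finset.range N, ∑ j ∈ Finset.range N, φ i j (T i j) ≤ N * N * s := by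
  calc ∑ i ∈ Finset.range N, ∑ j ∈ Finset.range N, φ i j (T i j)
      ≤ ∑ i ∈ Finset.range N, ∑ j ∈ Finset.range N, s :=
        Finset.sum_le_sum fun i hi => Finset.sum_le_sum fun j hj =>
          h i (Finset.mem_range.1 hi) j (Finset.mem_range.1 hj)
    _ = N * N * s := by simp [mul_assoc]

theorem potential_sum_lt {N : ℕ} {φ : ℕ → ℕ → ℝ → ℕ} {T T' : ℕ → ℕ → ℝ}
    (hφ : ∀ i < N, ∀ j < N, Monotone (φ i j)) (h : ∀ i < N, ∀ j < N, T' i j ≤ T i j)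
    {i j : ℕ} (hi : i < N) (hj : j < N) (hlt : φ i j (T' i j) < φ i j (T i j)) :
    ∑ i ∈ Finset.range N, ∑ j ∈ Finset.range N, φ i j (T' i j) <
      ∑ i ∈ Finset.range N, ∑ j ∈ Finset.range N, φ i j (T i j) := by
  refine Finset.sum_lt_sum (fun i hi => Finset.sum_le_sum fun j hj =>
    hφ i (Finset.mem_range.1 hi) j (Finset.mem_range.1 hj)
      (h i (Finset.mem_range.1 hi) j (Finset.mem_range.1 hj))) ⟨i, Finset.mem_range.2 hi, ?_⟩
  exact Finset.sum_lt_sum (fun j hj => hφ i hi j (Finset.mem_range.1 hj)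
    (h i hi j (Finset.mem_range.1 hj))) ⟨j, Finset.mem_range.2 hj, hlt⟩

theorem keepsCtx_tripleLoop (mb : ℕ) (prog : RamProg) :
    (forUpTo 22 15 (tripleBody mb prog)).keepsCtx = true := by
  simp [RamProg.keepsCtx, forUpTo, tripleBody, blockDecode, potentialBody, voteBody, fillBody,
    bruteDecode, relaxProg, RamProg.keepsW, RamProg.keepsX]

/-- The number of steps for one block, without relaxations. -/
def tripleTime (c : Cfg) (mb t : ℕ) : ℕ :=
  (2 * c.s) * (2 * c.s) * 20 + c.r * (4 * mb + (2 * c.s - 1) * (2 * c.s - 1) * 20 + 2 * t + 9) + 22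

/-- The number of steps for a pass over all blocks. -/
def passTime (c : Cfg) (mb t : ℕ) : ℕ :=
  c.g * c.g * c.g * (tripleTime c mb t + 2) + c.N * c.N * c.s * (c.s * c.s * c.s * 21) + 4

/-- Relaxed blocks are paid for by the counter, which the cap bounds by `N² s` without any
assumption. Under `G` the counter plus the total potential never increases, because a block is then
relaxed only if it is improvable, and this lowers the potential of some entry. The initial total is
at most the cap, so the cap never prevents a relaxation that is needed. -/
theorem pass_spec (hR : Room c B Nm) {Λ : AddSubgroup ℝ} {prog : RamProg} {mb B₀ : ℕ}
    {N₀ : Set ℝ} {t : ℕ} {zb : ℕ → Bool} (hO : OracleFor c B Nm Λ prog mb B₀ N₀ t zb)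
    {st : RamState} (hc : Ctx c st) {D T₀ : ℕ → ℕ → ℝ} {mid₀ : ℕ → ℕ → ℕ}
    (hD : D = mat c.N (st.xarr 2)) (hT : T₀ = mat c.N (st.xarr 3))
    (hM : mid₀ = mat c.N (st.warr 5))
    {δ : ℝ} (hδ : st.xarr 5 (st.wreg 21) = δ) (hδ0 : 0 ≤ δ) (hδW : δ ≤ c.W) (hδΛ : δ ∈ Λ)
    (hWΛ : c.W ∈ Λ) {V : ℝ} (hVW : 2 * V ≤ c.W) (hV0 : 0 ≤ V)
    (hDV : ∀ i < c.N, ∀ j < c.N, |D i j| ≤ V) (hTV : ∀ i < c.N, ∀ j < c.N, |T₀ i j| ≤ 2 * V)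
    (hDΛ : ∀ i < c.N, ∀ j < c.N, D i j ∈ Λ) (hTΛ : ∀ i < c.N, ∀ j < c.N, T₀ i j ∈ Λ)
    (hz : ∀ b < c.r * c.tau, st.warr 4 b = (zb b).toNat) {G : Prop}
    (hG : G → PassGood c Λ (Reliable c prog B₀ N₀ t zb) δ D T₀) :
    Runs B Nm (passProg mb prog) st (passTime c mb t) fun st' =>
      (∃ S, Relaxes c.N D S T₀ mid₀ (mat c.N (st'.xarr 3)) (mat c.N (st'.warr 5))) ∧
      (G → ∀ i < c.N, ∀ j < c.N, ∀ k < c.N,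
        mat c.N (st'.xarr 3) i j ≤ D i k + D k j + δ) := by
  have hW := hR.W
  unfold passTime
  refine Runs.weaken (k := 1 + (1 + (c.g * c.g * c.g * (tripleTime c mb t + 2) + 2 +
    c.N * c.N * c.s * (c.s * c.s * c.s * 21)))) (Runs.seq (Runs.of_wp (p := xload 3 5 21)
      (Q := fun s => s = st.setX 3 δ) ?_) ?_) (by omega) fun _ _ h => h
  · simp only [RamProg.wp, hδ, and_true]
    exact hR.num _ (by rw [abs_of_nonneg hδ0]; linarith)
  rintro st1 hF1 rfl
  have hc1 := hc.frame hF1 rfl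
  refine Runs.seq (Runs.of_wp (p := wconst 25 0) (Q := fun s => s = (st.setX 3 δ).setW 25 0)
    (by simp [RamProg.wp])) ?_
  rintro st2 hF2 rfl
  have hc2 := hc1.frame hF2 rfl
  generalize hst2 : (st.setX 3 δ).setW 25 0 = st2 at *
  have e2 : st2.xarr 2 = st.xarr 2 := by subst hst2; rfl
  have e3 : st2.xarr 3 = st.xarr 3 := by subst hst2; rfl
  have e5 : st2.warr 5 = st.warr 5 := by subst hst2; rfl
  have e4 : st2.warr 4 = st.warr 4 := by subst hst2; rfl
  have eδ : st2.xreg 3 = δ := by subst hst2; simp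
  have e25 : st2.wreg 25 = 0 := by subst hst2; simp
  -- The potential appears in the loop invariant and must be available before `G` is decided;
  -- without `G` any function will do.
  have hpot : ∃ φ : ℕ → ℕ → ℝ → ℕ, G → (∀ i < c.N, ∀ j < c.N, Monotone (φ i j)) ∧
    (∀ i < c.N, ∀ j < c.N, ∀ k < c.N, ∀ x ∈ Λ, D i k + D k j + δ < x →
      φ i j (D i k + D k j) < φ i j x) ∧
    ∀ i < c.N, ∀ j < c.N, φ i j (T₀ i j) ≤ c.s := by
    by_cases hg : G
    · obtain ⟨φ, hφ⟩ := (hG hg).pot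
      exact ⟨φ, fun _ => hφ⟩
    · exact ⟨fun _ _ _ => 0, fun h => absurd h hg⟩
  obtain ⟨φ, hφ⟩ := hpot
  refine Runs.weaken (Runs.forUpTo_amortized (c := tripleTime c mb t)
    (A := c.N * c.N * c.s * (c.s * c.s * c.s * 21)) (fun q x s =>
    (∃ S, (∀ i < c.N, ∀ j < c.N, ∀ k < c.N, S i j k → c.code i j k < q) ∧
      Relaxes c.N D S T₀ mid₀ (mat c.N (s.xarr 3)) (mat c.N (s.warr 5))) ∧
    s.wreg 25 ≤ c.N * c.N * c.s ∧ x = s.wreg 25 * (c.s * c.s * c.s * 21) ∧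
    (G → (∀ i < c.N, ∀ j < c.N, ∀ k < c.N, c.code i j k < q →
        mat c.N (s.xarr 3) i j ≤ D i k + D k j + δ) ∧
      s.wreg 25 + ∑ i ∈ Finset.range c.N, ∑ j ∈ Finset.range c.N, φ i j (mat c.N (s.xarr 3) i j) ≤
        ∑ i ∈ Finset.range c.N, ∑ j ∈ Finset.range c.N, φ i j (T₀ i j))) hc2.ggg hc2.one
    ?_ hR.ggg_le ?_ ?_ ?_) le_rfl ?_
  · simp [forUpTo, tripleBody, blockDecode, potentialBody, voteBody, fillBody,
      bruteDecode, relaxProg, RamProg.keepsW]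
  · rintro q x s' ⟨-, h1, rfl, -⟩
    exact Nat.mul_le_mul_right _ h1
  · refine ⟨⟨fun _ _ _ => False, by simp, ?_⟩, by simp [e25], by simp [e25], fun hg => ⟨by simp, ?_⟩⟩
    · simp only [RamState.setW_xarr, RamState.setW_warr, e3, e5, ← hT, ← hM]
      exact Relaxes.refl (by simp)
    · simp only [RamState.setW_xarr, RamState.setW_wreg, Nat.reduceEqDiff, if_false, e3, ← hT, e25,
        zero_add, le_refl]
  · rintro q hq x st3 h22 hF3 ⟨⟨S, hS, hrel⟩, hcnt, hx, hgood⟩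
    have hc3 := hc2.frame hF3 (keepsCtx_tripleLoop mb prog)
    have f2 : st3.xarr 2 = st.xarr 2 := by
      rw [hF3.xarr 2 (by simp [forUpTo, tripleBody, blockDecode, potentialBody, voteBody, fillBody,
        bruteDecode, relaxProg, RamProg.keepsXA]), e2]
    have f4 : st3.warr 4 = st.warr 4 := by
      rw [hF3.warr 4 (by simp [forUpTo, tripleBody, blockDecode, potentialBody, voteBody, fillBody,
        bruteDecode, relaxProg, RamProg.keepsWA]), e4]
    have fδ : st3.xreg 3 = δ := by
      rw [hF3.xreg 3 (by simp [forUpTo, tripleBody, blockDecode, potentialBody, voteBody, fillBody,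
        bruteDecode, relaxProg, RamProg.keepsX]), eδ]
    obtain ⟨y, hy⟩ := triple_spec hR hO hc3 (D := D) (by rw [f2, hD]) rfl rfl fδ hδ0 hδW hδΛ hWΛ
      hVW hV0 hDV (hrel.abs_le hDV hTV) hDΛ (hrel.mem hDΛ hTΛ) (by rw [f4]; exact hz) hq h22 rfl
    refine ⟨y * (c.s * c.s * c.s * 21), hy.weaken le_rfl fun st4 hF4 h4 => ?_⟩
    generalize hT3 : mat c.N (st3.xarr 3) = T at *
    generalize hM3 : mat c.N (st3.warr 5) = mid at *
    simp only [RamState.setW_xarr, RamState.setW_warr, RamState.setW_wreg, Nat.reduceEqDiff,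
      if_false]
    generalize hT4 : mat c.N (st4.xarr 3) = T' at *
    generalize hM4 : mat c.N (st4.warr 5) = mid' at *
    obtain ⟨himp, hnimp, hor⟩ := h4
    refine ⟨?_, ?_, ?_, fun hg => ?_⟩
    · rcases hor with ⟨-, -, rfl, rfl⟩ | ⟨-, -, -, h⟩
      · exact ⟨S, fun i hi j hj k hk h => (hS i hi j hj k hk h).trans (Nat.lt_succ_self q), hrel⟩
      · refine ⟨_, ?_, hrel.trans h⟩
        rintro i hi j hj k hk (h | h)
        · exact (hS i hi j hj k hk h).trans (Nat.lt_succ_self q)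
        · rw [h]; exact Nat.lt_succ_self q
    · rcases hor with ⟨-, h, -⟩ | ⟨-, h, h', -⟩ <;> omega
    · rcases hor with ⟨h0, h, -⟩ | ⟨h0, -, h, -⟩
      · rw [h0, h, hx]; ring
      · rw [h0, h, hx]; ring
    · obtain ⟨h5, h6⟩ := hgood hg
      obtain ⟨hφ1, hφ2, hφ3⟩ := hφ hg
      have hRel := (hG hg).rel q hq T ⟨⟨S, mid₀, mid, hS, hrel⟩, h5⟩
      have hΦ := potential_sum_le hφ3
      by_cases hI : Improvable c δ D T q
      · obtain ⟨i, hi, j, hj, k, hk, hcode, hlt⟩ := hI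
        -- An improvable block has an entry of positive potential, so the counter is strictly below
        -- the cap.
        have hsum : 1 ≤ ∑ i ∈ Finset.range c.N, ∑ j ∈ Finset.range c.N, φ i j (T i j) := by
          have h1 : φ i j (T i j) ≤ ∑ j ∈ Finset.range c.N, φ i j (T i j) :=
            Finset.single_le_sum (f := fun j => φ i j (T i j)) (fun _ _ => Nat.zero_le _)
              (Finset.mem_range.2 hj)
          have h2 : ∑ j ∈ Finset.range c.N, φ i j (T i j) ≤
              ∑ i ∈ Finset.range c.N, ∑ j ∈ Finset.range c.N, φ i j (T i j) :=
            Finset.single_le_sum (f := fun i => ∑ j ∈ Finset.range c.N, φ i j (T i j))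
              (fun _ _ => Nat.zero_le _) (Finset.mem_range.2 hi)
          have h3 := hφ2 i hi j hj k hk _ (hrel.mem hDΛ hTΛ i hi j hj) hlt
          omega
        obtain ⟨g1, g2⟩ := himp ⟨hRel, ⟨i, hi, j, hj, k, hk, hcode, hlt⟩, by omega⟩
        refine ⟨fun i' hi' j' hj' k' hk' hc' => ?_, ?_⟩
        · rcases Nat.lt_succ_iff_lt_or_eq.1 hc' with h | h
          · exact (g2.le hi' hj').trans (h5 i' hi' j' hj' k' hk' h)
          · exact ((g2 i' hi' j' hj').2 k' hk' h).trans (by linarith)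
        -- After the relaxation the improved entry is at most `D i k + D k j`, where its potential
        -- is strictly smaller than before; one unit of potential pays for the increment of the
        -- counter.
        · have h7 := potential_sum_lt hφ1 (fun i hi j hj => g2.le hi hj) hi hj
            ((hφ1 i hi j hj ((g2 i hi j hj).2 k hk hcode)).trans_lt
              (hφ2 i hi j hj k hk _ (hrel.mem hDΛ hTΛ i hi j hj) hlt))
          omega
      · obtain ⟨g1, rfl, rfl⟩ := hnimp ⟨hRel, hI⟩
        refine ⟨fun i' hi' j' hj' k' hk' hc' => ?_, by rw [g1]; exact h6⟩
        rcases Nat.lt_succ_iff_lt_or_eq.1 hc' with h | h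
        · exact h5 i' hi' j' hj' k' hk' h
        · by_contra hlt
          exact hI ⟨i', hi', j', hj', k', hk', h, not_le.1 hlt⟩
  · rintro st4 hF4 ⟨x, ⟨S, hS, hrel⟩, -, -, hgood⟩
    exact ⟨⟨S, hrel⟩, fun hg i hi j hj k hk => (hgood hg).1 i hi j hj k hk
      (Cfg.code_lt hR hi hj hk)⟩

end

/-! ### The main program: all levels -/

/-- Compute the sampled triple with number `e`. -/
def sampleDecode : RamProg :=
  wop .div 29 23 14 ;; wload 29 3 29 ;; wop .mod 28 23 14 ;; wop .div 27 28 2 ;; wop .mod 28 28 2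

/-- Copy numeric array `a` to numeric array `b`. -/
def copyProg (a b : ℕ) : RamProg :=
  forUpTo 23 14 (xload 10 a 23 ;; xstore b 23 10)

/-- One min-plus squaring. -/
def levelProg (mb : ℕ) (prog : RamProg) : RamProg :=
  copyProg 2 3 ;; forUpTo 23 19 (sampleDecode ;; relaxProg) ;; forUpTo 21 11 (passProg mb prog) ;;
  copyProg 3 2

/-- The number of steps for one min-plus squaring. -/
def levelTime (c : Cfg) (mb t : ℕ) : ℕ :=
  c.N * c.N * 8 + c.rho * (c.N * c.N) * 19 + c.L * (passTime c mb t + 2) + 8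

/-- The conditions under which a min-plus squaring is carried out correctly. -/
def LevelGood (c : Cfg) (Λ : AddSubgroup ℝ)
    (Rel : (Fin (2 * c.s - 1) → Fin (2 * c.s - 1) → ℝ) → Prop) (R : ℕ → ℕ) (δ : ℕ → ℝ)
    (D : ℕ → ℕ → ℝ) (mid : ℕ → ℕ → ℕ) : Prop :=
  ∀ T₀ mid₀, Relaxes c.N D (fun _ _ k => ∃ q < c.rho, R q = k) D mid T₀ mid₀ →
    ∀ p < c.L, ∀ T mid', (∃ S, Relaxes c.N D S T₀ mid₀ T mid') →
      (p = 0 → ∀ i < c.N, ∀ j < c.N, T i j = T₀ i j) →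
      (∀ p', p = p' + 1 → ∀ i < c.N, ∀ j < c.N, ∀ k < c.N, T i j ≤ D i k + D k j + δ p') →
      PassGood c Λ Rel (δ p) D T

section
variable {B : ℕ} {Nm : Set ℝ} {c : Cfg}

theorem copy_spec (hR : Room c B Nm) {a b : ℕ} (hab : a ≠ b) {st : RamState} (hc : Ctx c st)
    {f : ℕ → ℕ → ℝ} (hf : f = mat c.N (st.xarr a))
    (hfW : ∀ i < c.N, ∀ j < c.N, |f i j| ≤ c.W) :
    Runs B Nm (copyProg a b) st (c.N * c.N * 4 + 2) fun st' =>
      ∀ i < c.N, ∀ j < c.N, mat c.N (st'.xarr b) i j = f i j := by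
  have hW := hR.W
  have hNN := hR.NN_le
  refine Runs.weaken (Runs.forUpTo (c := 2) (fun q s => ∀ e < q, s.xarr b e = st.xarr a e)
    hc.NN hc.one rfl (by omega) (by simp) ?_) le_rfl ?_
  · intro e he st1 h23 hF hI
    have ea : st1.xarr a = st.xarr a := hF.xarr a (by simp [forUpTo, RamProg.keepsXA, hab])
    refine Runs.of_wp (p := xload 10 a 23 ;; xstore b 23 10) ?_
    simp only [RamProg.wp, RamState.setX_wreg, RamState.setX_xarr, RamState.setX_xreg, if_true,
      RamState.storeX_xarr, RamState.setW_xarr, h23, ea]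
    refine ⟨hR.num _ ?_, fun e' he' => ?_⟩
    · have hN : 0 < c.N := Room.N_pos c
      have := hfW (e / c.N) (Nat.div_lt_of_lt_mul he) (e % c.N) (Nat.mod_lt _ hN)
      rw [hf] at this
      unfold mat at this
      rw [Nat.div_add_mod'] at this
      linarith
    · rcases Nat.lt_succ_iff_lt_or_eq.1 he' with h | rfl
      · rw [Function.update_of_ne h.ne, hI e' h]
      · rw [Function.update_self]
  · intro st' _ h i hi j hj
    rw [hf]
    exact h _ (mul_add_lt hi hj)

/-- `G` restricts only the second claim, so that soundness and time are available without it. Each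
pass leaves the inequalities with its own accuracy, which the next pass starts from; the last
accuracy is `0`, which makes the squaring exact. -/
theorem level_spec (hR : Room c B Nm) {Λ : AddSubgroup ℝ} {prog : RamProg} {mb B₀ : ℕ}
    {N₀ : Set ℝ} {t : ℕ} {zb : ℕ → Bool} (hO : OracleFor c B Nm Λ prog mb B₀ N₀ t zb)
    {st : RamState} (hc : Ctx c st) {D : ℕ → ℕ → ℝ} {mid : ℕ → ℕ → ℕ}
    (hD : D = mat c.N (st.xarr 2)) (hM : mid = mat c.N (st.warr 5))
    {δ : ℕ → ℝ} (hδ : ∀ p < c.L, st.xarr 5 p = δ p) (hδ0 : ∀ p < c.L, 0 ≤ δ p)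
    (hδW : ∀ p < c.L, δ p ≤ c.W) (hδΛ : ∀ p < c.L, δ p ∈ Λ) (hδL : ∃ p, p + 1 = c.L ∧ δ p = 0)
    (hWΛ : c.W ∈ Λ) {V : ℝ} (hVW : 2 * V ≤ c.W) (hV0 : 0 ≤ V)
    (hDV : ∀ i < c.N, ∀ j < c.N, |D i j| ≤ V) (hDΛ : ∀ i < c.N, ∀ j < c.N, D i j ∈ Λ)
    (hz : ∀ b < c.r * c.tau, st.warr 4 b = (zb b).toNat) {R : ℕ → ℕ}
    (hRs : ∀ q < c.rho, st.warr 3 q = R q) (hRN : ∀ q < c.rho, R q < c.N) {G : Prop}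
    (hG : G → LevelGood c Λ (Reliable c prog B₀ N₀ t zb) R δ D mid) :
    Runs B Nm (levelProg mb prog) st (levelTime c mb t) fun st' =>
      (∃ S, Relaxes c.N D S D mid (mat c.N (st'.xarr 2)) (mat c.N (st'.warr 5))) ∧
      (G → ∀ i < c.N, ∀ j < c.N, ∀ k < c.N, mat c.N (st'.xarr 2) i j ≤ D i k + D k j) := by
  have hW := hR.W
  have hNN := hR.NN_le
  have hN0 := Room.N_pos c
  have hN8 := hR.N_le
  have hDW : ∀ i < c.N, ∀ j < c.N, |D i j| ≤ c.W := fun i hi j hj =>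
    (hDV i hi j hj).trans (by linarith)
  unfold levelTime
  refine Runs.weaken (k := (c.N * c.N * 4 + 2) + ((c.rho * (c.N * c.N) * (5 + 14) + 2) +
    ((c.L * (passTime c mb t + 2) + 2) + (c.N * c.N * 4 + 2))))
    (Runs.seq (copy_spec hR (by norm_num) hc hD hDW) ?_) (by omega) fun _ _ h => h
  intro st1 hF1 h1
  have hc1 := hc.frame hF1 rfl
  have a2 : st1.xarr 2 = st.xarr 2 := hF1.xarr 2 rfl
  have a5 : st1.warr 5 = st.warr 5 := hF1.warr 5 rfl
  refine Runs.seq (relaxLoop_spec (V := V) (c := 5) (fun e => e % (c.N * c.N) / c.N)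
    (fun e => e % (c.N * c.N) % c.N) (fun e => R (e / (c.N * c.N))) (by omega) (fun x hx => hR.num x
      (by linarith)) hV0 hc1.N hc1.one hc1.rhoNN hR.rhoNN (by norm_num) rfl ?_ ?_ ?_ ?_) ?_
  · intro e he
    have hNN0 : 0 < c.N * c.N := Nat.mul_pos hN0 hN0
    exact ⟨Nat.div_lt_of_lt_mul (Nat.mod_lt _ hNN0), Nat.mod_lt _ hN0,
      hRN _ (Nat.div_lt_of_lt_mul (by rwa [mul_comm (c.N * c.N)]))⟩
  · rw [a2, ← hD]; exact hDV
  · intro i hi j hj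
    rw [h1 i hi j hj]
    linarith [hDV i hi j hj]
  · intro e he st2 h23 hF2
    have hc2 := hc1.frame hF2 rfl
    have e3 : st2.warr 3 = st.warr 3 := by rw [hF2.warr 3 rfl, hF1.warr 3 rfl]
    have hq : e / (c.N * c.N) < c.rho := Nat.div_lt_of_lt_mul (by rwa [mul_comm (c.N * c.N)])
    have hNN0 : 0 < c.N * c.N := Nat.mul_pos hN0 hN0
    have b1 : e % (c.N * c.N) < c.N * c.N := Nat.mod_lt _ hNN0
    have b2 : e % (c.N * c.N) / c.N ≤ e % (c.N * c.N) := Nat.div_le_self _ _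
    have b3 : e % (c.N * c.N) % c.N < c.N := Nat.mod_lt _ hN0
    have b4 : e / (c.N * c.N) ≤ e := Nat.div_le_self _ _
    have b5 := hR.rhoNN
    have b6 := hRN _ hq
    refine Runs.of_wp (p := sampleDecode) ?_
    simp only [sampleDecode, RamProg.wp, WordOp.eval, RamState.setW_wreg, RamState.setW_warr,
      h23, hc2.NN, hc2.N, e3, hRs _ hq, reduceIte, Nat.reduceEqDiff, and_true]
    exact ⟨by omega, by omega, by omega, by omega, by omega⟩
  intro st2 hF2 h2
  have hc2 := hc1.frame hF2 rfl
  rw [a2, a5, ← hD, ← hM] at h2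
  have h2' : Relaxes c.N D (fun _ _ k => ∃ q < c.rho, R q = k) D mid (mat c.N (st2.xarr 3))
      (mat c.N (st2.warr 5)) := by
    have : Relaxes c.N D (fun _ _ k => ∃ q < c.rho, R q = k) (mat c.N (st1.xarr 3)) mid
        (mat c.N (st2.xarr 3)) (mat c.N (st2.warr 5)) := by
      refine h2.congr fun i hi j hj k hk => ?_
      constructor
      · rintro ⟨e, he, -, -, rfl⟩
        exact ⟨_, Nat.div_lt_of_lt_mul (by rwa [mul_comm (c.N * c.N)]), rfl⟩
      · rintro ⟨q, hq, rfl⟩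
        have hij := mul_add_lt hi hj
        refine ⟨q * (c.N * c.N) + (i * c.N + j), mul_add_lt hq hij, ?_⟩
        have hmod : (q * (c.N * c.N) + (i * c.N + j)) % (c.N * c.N) = i * c.N + j := by
          rw [mul_comm q, Nat.mul_add_mod, Nat.mod_eq_of_lt hij]
        rw [hmod, mul_comm q, Nat.mul_add_div (by omega),
          Nat.div_eq_of_lt hij, mul_comm i, Nat.mul_add_div (by omega), Nat.div_eq_of_lt hj,
          Nat.mul_add_mod, Nat.mod_eq_of_lt hj]
        exact ⟨by simp, rfl, by simp⟩
    intro i hi j hj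
    have := this i hi j hj
    rwa [h1 i hi j hj] at this
  clear h2
  generalize hT0 : mat c.N (st2.xarr 3) = T₀ at *
  generalize hM0 : mat c.N (st2.warr 5) = mid₀ at *
  have c2 : st2.xarr 2 = st.xarr 2 := by rw [hF2.xarr 2 rfl, a2]
  have hDV2 : ∀ i < c.N, ∀ j < c.N, |D i j| ≤ 2 * V := fun i hi j hj => by
    linarith [hDV i hi j hj]
  have hT0V := h2'.abs_le hDV hDV2
  have hT0Λ := h2'.mem hDΛ hDΛ
  refine Runs.seq (Runs.forUpTo (c := passTime c mb t) (fun p s =>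
    (∃ S, Relaxes c.N D S T₀ mid₀ (mat c.N (s.xarr 3)) (mat c.N (s.warr 5))) ∧
    (p = 0 → ∀ i < c.N, ∀ j < c.N, mat c.N (s.xarr 3) i j = T₀ i j) ∧
    (G → ∀ p', p = p' + 1 → ∀ i < c.N, ∀ j < c.N, ∀ k < c.N,
      mat c.N (s.xarr 3) i j ≤ D i k + D k j + δ p')) hc2.L hc2.one ?_ hR.L ?_ ?_) ?_
  · simp [passProg, forUpTo, tripleBody, blockDecode, potentialBody, voteBody, fillBody,
      bruteDecode, relaxProg, RamProg.keepsW]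
  · refine ⟨⟨fun _ _ _ => False, ?_⟩, by simp [hT0], by simp⟩
    simp only [RamState.setW_xarr, RamState.setW_warr, hT0, hM0]
    exact Relaxes.refl (by simp)
  · rintro p hp st3 h21 hF3 ⟨⟨S, hS⟩, hzero, hprev⟩
    have hc3 := hc2.frame hF3 (by
      simp [RamProg.keepsCtx, passProg, forUpTo, tripleBody, blockDecode, potentialBody, voteBody,
        fillBody, bruteDecode, relaxProg, RamProg.keepsW, RamProg.keepsX])
    have d2 : st3.xarr 2 = st.xarr 2 := by
      rw [hF3.xarr 2 (by simp [passProg, forUpTo, tripleBody, blockDecode, potentialBody, voteBody,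
        fillBody, bruteDecode, relaxProg, RamProg.keepsXA]), c2]
    have d5 : st3.xarr 5 = st.xarr 5 := by
      rw [hF3.xarr 5 (by simp [passProg, forUpTo, tripleBody, blockDecode, potentialBody, voteBody,
        fillBody, bruteDecode, relaxProg, RamProg.keepsXA]), hF2.xarr 5 rfl, hF1.xarr 5 rfl]
    have d4 : st3.warr 4 = st.warr 4 := by
      rw [hF3.warr 4 (by simp [passProg, forUpTo, tripleBody, blockDecode, potentialBody, voteBody,
        fillBody, bruteDecode, relaxProg, RamProg.keepsWA]), hF2.warr 4 rfl, hF1.warr 4 rfl]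
    refine (pass_spec hR hO hc3 (D := D) (by rw [d2, hD]) rfl rfl (δ := δ p)
      (by rw [h21, d5, hδ p hp]) (hδ0 p hp) (hδW p hp) (hδΛ p hp) hWΛ hVW hV0 hDV
      (hS.abs_le hDV hT0V) hDΛ (hS.mem hDΛ hT0Λ) (by rw [d4]; exact hz) (G := G)
      (fun hg => hG hg T₀ mid₀ h2' p hp _ _ ⟨S, hS⟩ hzero (hprev hg))).weaken le_rfl ?_
    rintro st4 hF4 ⟨⟨S', hS'⟩, hnext⟩
    refine ⟨⟨_, hS.trans hS'⟩, fun h => absurd h (Nat.succ_ne_zero p), fun hg p' hp' => ?_⟩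
    obtain rfl : p' = p := by omega
    exact hnext hg
  rintro st5 hF5 ⟨⟨S, hS⟩, -, hlast⟩
  have hc5 := hc2.frame hF5 (by
      simp [RamProg.keepsCtx, passProg, forUpTo, tripleBody, blockDecode, potentialBody, voteBody,
        fillBody, bruteDecode, relaxProg, RamProg.keepsW, RamProg.keepsX])
  have hS5 := h2'.trans hS
  refine (copy_spec hR (by norm_num) hc5 rfl (fun i hi j hj =>
    ((hS5.abs_le hDV hDV2) i hi j hj).trans hVW)).weaken le_rfl fun st6 hF6 h6 => ?_
  have e5 : st6.warr 5 = st5.warr 5 := hF6.warr 5 rfl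
  refine ⟨⟨fun i j k => (∃ q < c.rho, R q = k) ∨ S i j k, fun i hi j hj => ?_⟩,
    fun hg i hi j hj k hk => ?_⟩
  · rw [h6 i hi j hj, e5]
    exact hS5 i hi j hj
  · rw [h6 i hi j hj]
    obtain ⟨p, hp, hδp⟩ := hδL
    have := hlast hg p hp.symm i hi j hj k hk
    rwa [hδp, add_zero] at this

/-- The min-plus powers of a matrix. -/
noncomputable def minPlusPow (N : ℕ) (D : ℕ → ℕ → ℝ) : ℕ → ℕ → ℕ → ℝ
  | 0 => D
  | l + 1 => fun i j => sInf (insert (minPlusPow N D l i j)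
      ((fun k => minPlusPow N D l i k + minPlusPow N D l k j) '' Set.Iio N))

/-- Independent of which relaxations have taken place: an entry is one of the candidates and lies
below all of them. The old entry is a candidate of its own, since padding vertices have no zero on
the diagonal. -/
theorem minPlusPow_succ_eq {N : ℕ} {D D₁ D₂ : ℕ → ℕ → ℝ} {l : ℕ} {S : ℕ → ℕ → ℕ → Prop}
    {mid mid' : ℕ → ℕ → ℕ} (h : ∀ i < N, ∀ j < N, D₁ i j = minPlusPow N D l i j)
    (hS : Relaxes N D₁ S D₁ mid D₂ mid')
    (hle : ∀ i < N, ∀ j < N, ∀ k < N, D₂ i j ≤ D₁ i k + D₁ k j) :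
    ∀ i < N, ∀ j < N, D₂ i j = minPlusPow N D (l + 1) i j := by
  intro i hi j hj
  have : IsLeast (insert (minPlusPow N D l i j)
      ((fun k => minPlusPow N D l i k + minPlusPow N D l k j) '' Set.Iio N)) (D₂ i j) := by
    constructor
    · obtain ⟨h1 | ⟨-, k, hk, -, h1, -⟩, -⟩ := hS i hi j hj
      · left; rw [h1.1, h i hi j hj]
      · right
        exact ⟨k, hk, by rw [h1, h i hi k hk, h k hk j hj]⟩
    · rintro x (rfl | ⟨k, hk, rfl⟩)
      · rw [← h i hi j hj]; exact hS.le hi hj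
      · simp only
        rw [← h i hi k hk, ← h k hk j hj]
        exact hle i hi j hj k hk
  exact this.csInf_eq.symm

/-- A sequence of matrices of tentative distances with intermediate vertices. -/
structure Levels (N : ℕ) (G : Prop) (q : ℕ) (D : ℕ → ℕ → ℕ → ℝ) (mid : ℕ → ℕ → ℕ → ℕ) :
    Prop where
  relaxes : ∀ l < q, ∃ S, Relaxes N (D l) S (D l) (mid l) (D (l + 1)) (mid (l + 1))
  le : G → ∀ l < q, ∀ i < N, ∀ j < N, ∀ k < N, D (l + 1) i j ≤ D l i k + D l k j

/-- Absolute values at most double per level and end below `2 ^ lam * X = N * X ≤ W`. Under `G` each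
matrix equals a min-plus power of the initial one; the hypothesis on `G` can therefore be stated for
these powers, without reference to the run. -/
theorem levels_spec (hR : Room c B Nm) {Λ : AddSubgroup ℝ} {prog : RamProg} {mb B₀ : ℕ}
    {N₀ : Set ℝ} {t : ℕ} {zb : ℕ → Bool} (hO : OracleFor c B Nm Λ prog mb B₀ N₀ t zb)
    {st : RamState} (hc : Ctx c st) {D₀ : ℕ → ℕ → ℝ} {mid₀ : ℕ → ℕ → ℕ}
    (hD : D₀ = mat c.N (st.xarr 2)) (hM : mid₀ = mat c.N (st.warr 5))
    {δ : ℕ → ℝ} (hδ : ∀ p < c.L, st.xarr 5 p = δ p) (hδ0 : ∀ p < c.L, 0 ≤ δ p)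
    (hδW : ∀ p < c.L, δ p ≤ c.W) (hδΛ : ∀ p < c.L, δ p ∈ Λ) (hδL : ∃ p, p + 1 = c.L ∧ δ p = 0)
    (hWΛ : c.W ∈ Λ) {X : ℝ} (hXW : c.N * X ≤ c.W) (hX0 : 0 ≤ X)
    (hDX : ∀ i < c.N, ∀ j < c.N, |D₀ i j| ≤ X) (hDΛ : ∀ i < c.N, ∀ j < c.N, D₀ i j ∈ Λ)
    (hz : ∀ b < c.r * c.tau, st.warr 4 b = (zb b).toNat) {R : ℕ → ℕ}
    (hRs : ∀ q < c.rho, st.warr 3 q = R q) (hRN : ∀ q < c.rho, R q < c.N) {G : Prop}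
    (hG : G → ∀ l < c.lam, ∀ D mid, (∀ i < c.N, ∀ j < c.N, D i j = minPlusPow c.N D₀ l i j) →
      LevelGood c Λ (Reliable c prog B₀ N₀ t zb) R δ D mid) :
    Runs B Nm (forUpTo 20 3 (levelProg mb prog)) st (c.lam * (levelTime c mb t + 2) + 2) fun st' =>
      (∃ D mid, D 0 = D₀ ∧ mid 0 = mid₀ ∧ D c.lam = mat c.N (st'.xarr 2) ∧
        mid c.lam = mat c.N (st'.warr 5) ∧ Levels c.N G c.lam D mid) ∧
      ∀ i < c.N, ∀ j < c.N, |mat c.N (st'.xarr 2) i j| ≤ c.W := by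
  have hlam : c.lam ≤ c.N := Nat.lt_two_pow_self.le
  have hN8 := hR.N_le
  refine Runs.weaken (Runs.forUpTo (c := levelTime c mb t) (fun q s =>
    (∃ D mid, D 0 = D₀ ∧ mid 0 = mid₀ ∧ D q = mat c.N (s.xarr 2) ∧ mid q = mat c.N (s.warr 5) ∧
      Levels c.N G q D mid) ∧
    (∀ i < c.N, ∀ j < c.N, |mat c.N (s.xarr 2) i j| ≤ 2 ^ q * X) ∧
    (∀ i < c.N, ∀ j < c.N, mat c.N (s.xarr 2) i j ∈ Λ) ∧
    (G → ∀ i < c.N, ∀ j < c.N, mat c.N (s.xarr 2) i j = minPlusPow c.N D₀ q i j)) hc.lam hc.one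
    ?_ (by omega) ?_ ?_) le_rfl ?_
  · simp [levelProg, copyProg, sampleDecode, passProg, forUpTo, tripleBody, blockDecode,
      potentialBody, voteBody, fillBody, bruteDecode, relaxProg, RamProg.keepsW]
  · simp only [RamState.setW_xarr, RamState.setW_warr, ← hD, ← hM, pow_zero, one_mul]
    exact ⟨⟨fun _ => D₀, fun _ => mid₀, rfl, rfl, rfl, rfl, by simp, by simp⟩, hDX, hDΛ,
      fun _ i _ j _ => rfl⟩
  · rintro q hq st1 h20 hF1 ⟨⟨D, mid, hD0, hm0, hDq, hmq, hL⟩, hbd, hmem, hcan⟩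
    have hc1 := hc.frame hF1 (by
      simp [RamProg.keepsCtx, levelProg, copyProg, sampleDecode, passProg, forUpTo, tripleBody,
        blockDecode, potentialBody, voteBody, fillBody, bruteDecode, relaxProg, RamProg.keepsW,
        RamProg.keepsX])
    have d5 : st1.xarr 5 = st.xarr 5 := hF1.xarr 5 (by
      simp [levelProg, copyProg, sampleDecode, passProg, forUpTo, tripleBody, blockDecode,
        potentialBody, voteBody, fillBody, bruteDecode, relaxProg, RamProg.keepsXA])
    have d4 : st1.warr 4 = st.warr 4 := hF1.warr 4 (by
      simp [levelProg, copyProg, sampleDecode, passProg, forUpTo, tripleBody, blockDecode,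
        potentialBody, voteBody, fillBody, bruteDecode, relaxProg, RamProg.keepsWA])
    have d3 : st1.warr 3 = st.warr 3 := hF1.warr 3 (by
      simp [levelProg, copyProg, sampleDecode, passProg, forUpTo, tripleBody, blockDecode,
        potentialBody, voteBody, fillBody, bruteDecode, relaxProg, RamProg.keepsWA])
    have hpow : (2 : ℝ) ^ (q + 1) ≤ c.N := by
      unfold Cfg.N
      push_cast
      exact pow_le_pow_right₀ (by norm_num) hq
    have h2V : 2 * (2 ^ q * X) ≤ c.W := by
      refine le_trans ?_ hXW
      rw [← mul_assoc, ← pow_succ']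
      exact mul_le_mul_of_nonneg_right hpow hX0
    refine (level_spec hR hO hc1 (D := D q) (mid := mid q) hDq hmq (δ := δ)
      (by rw [d5]; exact hδ) hδ0 hδW hδΛ hδL hWΛ h2V (by positivity) (by rw [hDq]; exact hbd)
      (by rw [hDq]; exact hmem) (by rw [d4]; exact hz) (by rw [d3]; exact hRs) hRN (G := G)
      (fun hg => hG hg q hq _ _ (by rw [hDq]; exact hcan hg))).weaken le_rfl ?_
    rintro st2 hF2 ⟨⟨S, hS⟩, hle⟩
    simp only [RamState.setW_xarr, RamState.setW_warr]
    have hDq1 : ∀ i < c.N, ∀ j < c.N, |D q i j| ≤ 2 ^ q * X := by rw [hDq]; exact hbd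
    have hDq2 : ∀ i < c.N, ∀ j < c.N, D q i j ∈ Λ := by rw [hDq]; exact hmem
    -- The sequence is kept up to index `q`, and the new matrix takes over from `q + 1` on.
    refine ⟨⟨fun l => if l ≤ q then D l else mat c.N (st2.xarr 2),
      fun l => if l ≤ q then mid l else mat c.N (st2.warr 5), by simp [hD0], by simp [hm0],
      by simp, by simp, fun l hl => ?_, fun hg l hl => ?_⟩, ?_, hS.mem hDq2 hDq2, fun hg => ?_⟩
    · rcases Nat.lt_succ_iff_lt_or_eq.1 hl with h | rfl
      · simp only [h.le, Nat.succ_le_of_lt h, if_true]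
        exact hL.relaxes l h
      · simp only [le_refl, if_true, show ¬ (l + 1 ≤ l) by omega, if_false]
        exact ⟨S, hS⟩
    · rcases Nat.lt_succ_iff_lt_or_eq.1 hl with h | rfl
      · simp only [h.le, Nat.succ_le_of_lt h, if_true]
        exact hL.le hg l h
      · simp only [le_refl, if_true, show ¬ (l + 1 ≤ l) by omega, if_false]
        exact hle hg
    · have h0 : (0 : ℝ) ≤ 2 ^ q * X := by positivity
      intro i hi j hj
      have := hS.abs_le hDq1 (fun i hi j hj => (hDq1 i hi j hj).trans (by linarith)) i hi j hj
      rwa [pow_succ', mul_assoc]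
    · exact minPlusPow_succ_eq (D₁ := D q) (by rw [hDq]; exact hcan hg) hS (hle hg)
  · rintro st' - ⟨h1, h2, -, -⟩
    refine ⟨h1, fun i hi j hj => (h2 i hi j hj).trans ?_⟩
    refine le_trans (mul_le_mul_of_nonneg_right ?_ hX0) hXW
    unfold Cfg.N
    push_cast
    exact le_rfl

end

/-! ### Shortest walks -/

section
variable {n : ℕ} {w : Fin n → Fin n → Option ℝ}

theorem IsWalk.trans {u p v : Fin n} {x y : ℝ} (h : IsWalk w u p x) (h' : IsWalk w p v y) :
    IsWalk w u v (x + y) := by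
  induction h with
  | nil => simpa using h'
  | cons ha _ ih => rw [add_assoc]; exact .cons ha (ih h')

/-- `WalkN w k u v x`: some walk with `k` edges from `u` to `v` has weight `x`. -/
def WalkN (w : Fin n → Fin n → Option ℝ) : ℕ → Fin n → Fin n → ℝ → Prop
  | 0, u, v, x => u = v ∧ x = 0
  | k + 1, u, v, x => ∃ p a y, w u p = some a ∧ WalkN w k p v y ∧ x = a + y

theorem isWalk_iff {u v : Fin n} {x : ℝ} : IsWalk w u v x ↔ ∃ k, WalkN w k u v x := by
  constructor
  · intro h
    induction h with
    | nil u => exact ⟨0, rfl, rfl⟩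
    | cons ha _ ih =>
      obtain ⟨k, hk⟩ := ih
      exact ⟨k + 1, _, _, _, ha, hk, rfl⟩
  · rintro ⟨k, hk⟩
    induction k generalizing u x with
    | zero => obtain ⟨rfl, rfl⟩ := hk; exact .nil u
    | succ k ih =>
      obtain ⟨p, a, y, ha, hy, rfl⟩ := hk
      exact .cons ha (ih hy)

theorem WalkN.split {a b : ℕ} {u v : Fin n} {x : ℝ} (h : WalkN w (a + b) u v x) :
    ∃ p y z, WalkN w a u p y ∧ WalkN w b p v z ∧ x = y + z := by
  induction a generalizing u x with
  | zero => exact ⟨u, 0, x, ⟨rfl, rfl⟩, by simpa using h, by simp⟩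
  | succ a ih =>
    rw [Nat.succ_add] at h
    obtain ⟨p, c, y, hc, hy, rfl⟩ := h
    obtain ⟨q, y', z, h1, h2, rfl⟩ := ih hy
    exact ⟨q, c + y', z, ⟨p, c, y', hc, h1, rfl⟩, h2, by ring⟩

theorem WalkN.trans {a b : ℕ} {u p v : Fin n} {x y : ℝ} (h : WalkN w a u p x)
    (h' : WalkN w b p v y) : WalkN w (a + b) u v (x + y) := by
  induction a generalizing u x with
  | zero => obtain ⟨rfl, rfl⟩ := h; simpa using h'
  | succ a ih =>
    obtain ⟨q, c, z, hc, hz, rfl⟩ := h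
    rw [Nat.succ_add]
    exact ⟨q, c, z + y, hc, ih hz, by ring⟩

theorem WalkN.exists_path {k : ℕ} {u v : Fin n} {x : ℝ} (h : WalkN w k u v x) :
    ∃ (p : ℕ → Fin n) (s : ℕ → ℝ), p 0 = u ∧ p k = v ∧ s 0 = 0 ∧ s k = x ∧
      ∀ i < k, w (p i) (p (i + 1)) = some (s (i + 1) - s i) := by
  induction k generalizing u x with
  | zero =>
    obtain ⟨rfl, rfl⟩ := h
    exact ⟨fun _ => u, fun _ => 0, rfl, rfl, rfl, rfl, by simp⟩
  | succ k ih =>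
    obtain ⟨q, a, y, ha, hy, rfl⟩ := h
    obtain ⟨p, s, hp0, hpk, hs0, hsk, hps⟩ := ih hy
    refine ⟨fun i => if i = 0 then u else p (i - 1), fun i => if i = 0 then 0 else a + s (i - 1),
      rfl, by simp [hpk], rfl, by simp [hsk], fun i hi => ?_⟩
    rcases Nat.eq_zero_or_pos i with rfl | hi0
    · simp [hp0, hs0, ha]
    · have := hps (i - 1) (by omega)
      rw [Nat.sub_add_cancel hi0] at this
      simp [hi0.ne', this]

theorem walkN_segment {k : ℕ} {p : ℕ → Fin n} {s : ℕ → ℝ}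
    (h : ∀ i < k, w (p i) (p (i + 1)) = some (s (i + 1) - s i)) (d : ℕ) :
    ∀ i, i + d ≤ k → WalkN w d (p i) (p (i + d)) (s (i + d) - s i) := by
  induction d with
  | zero => intro i _; exact ⟨rfl, by simp⟩
  | succ d ih =>
    intro i hi
    have h1 := ih (i + 1) (by omega)
    rw [show i + 1 + d = i + (d + 1) by ring] at h1
    exact ⟨_, _, _, h i (by omega), h1, by ring⟩

/-- Cutting out a closed part, whose weight is not negative, shortens the walk without making it
heavier. -/
theorem NoNegativeCycle.exists_short (hw : NoNegativeCycle w) (k : ℕ) :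
    ∀ {u v : Fin n} {x : ℝ}, WalkN w k u v x → ∃ k' ≤ n, ∃ x' ≤ x, WalkN w k' u v x' := by
  induction k using Nat.strong_induction_on with
  | _ k ih =>
    intro u v x h
    by_cases hk : k ≤ n
    · exact ⟨k, hk, x, le_rfl, h⟩
    obtain ⟨p, s, rfl, rfl, hs0, rfl, hps⟩ := h.exists_path
    -- As `k > n`, the first `n + 1` vertices of the walk already contain a repetition.
    obtain ⟨i, j, hij, hp⟩ : ∃ i j : Fin (n + 1), i < j ∧ p i = p j := by
      obtain ⟨i, j, hij, hp⟩ := Fintype.exists_ne_map_eq_of_card_lt (fun i : Fin (n + 1) => p i)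
        (by simp)
      rcases lt_or_gt_of_ne hij with h | h
      · exact ⟨i, j, h, hp⟩
      · exact ⟨j, i, h, hp.symm⟩
    have hij' : (i : ℕ) < j := hij
    have hj := j.2
    generalize (i : ℕ) = a at *
    generalize (j : ℕ) = b at *
    have h1 := walkN_segment hps a 0 (by omega)
    have h2 := walkN_segment hps (b - a) a (by omega)
    have h3 := walkN_segment hps (k - b) b (by omega)
    rw [zero_add, hs0, sub_zero] at h1
    rw [show a + (b - a) = b by omega, ← hp] at h2
    rw [show b + (k - b) = k by omega, ← hp] at h3
    have hcyc := hw _ _ (isWalk_iff.2 ⟨_, h2⟩)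
    obtain ⟨k', hk', x', hx', h'⟩ := ih (a + (k - b)) (by omega) (h1.trans h3)
    exact ⟨k', hk', x', hx'.trans (by linarith), h'⟩

theorem WalkN.le {M : ℝ} (hM : ∀ u v, ∀ x ∈ w u v, |x| ≤ M) {k : ℕ} {u v : Fin n} {x : ℝ}
    (h : WalkN w k u v x) : x ≤ k * M := by
  induction k generalizing u x with
  | zero => obtain ⟨rfl, rfl⟩ := h; simp
  | succ k ih =>
    obtain ⟨p, a, y, ha, hy, rfl⟩ := h
    have h1 := ih hy
    have h2 := (le_abs_self a).trans (hM u p a ha)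
    push_cast
    linarith

/-- The initial matrix of tentative distances. -/
def initDist (w : Fin n → Fin n → Option ℝ) (X : ℝ) (i j : ℕ) : ℝ :=
  if h : i < n ∧ j < n then (if i = j then 0 else (w ⟨i, h.1⟩ ⟨j, h.2⟩).getD X) else X

/-! ### Distances and walks from a sequence of matrices -/

variable {lam : ℕ} {M X : ℝ} {D : ℕ → ℕ → ℕ → ℝ} {mid : ℕ → ℕ → ℕ → ℕ}

theorem Levels.antitone {N q : ℕ} {G : Prop} (hL : Levels N G q D mid) {l l' : ℕ} (hl : l ≤ l')
    (hq : l' ≤ q) {i j : ℕ} (hi : i < N) (hj : j < N) : D l' i j ≤ D l i j := by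
  induction l', hl using Nat.le_induction with
  | base => exact le_rfl
  | succ l' _ ih =>
    obtain ⟨S, hS⟩ := hL.relaxes l' hq
    exact (hS.le hi hj).trans (ih (by omega))

/-- A vertex is replaced only at a strict decrease, and entries never increase; equal values at both
ends exclude a change in between. -/
theorem Levels.mid_eq {N q : ℕ} {G : Prop} (hL : Levels N G q D mid) {l l' : ℕ} (hl : l ≤ l')
    (hq : l' ≤ q) {i j : ℕ} (hi : i < N) (hj : j < N) (h : D l i j = D l' i j) :
    mid l' i j = mid l i j := by
  induction l', hl using Nat.le_induction with
  | base => rfl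
  | succ l' hl ih =>
    obtain ⟨S, hS⟩ := hL.relaxes l' hq
    have h1 := hL.antitone hl (Nat.le_of_succ_le hq) hi hj
    have h2 := hS.le hi hj
    obtain ⟨h3 | ⟨h3, -⟩, -⟩ := hS i hi j hj
    · rw [h3.2]; exact ih (by omega) (by linarith)
    · linarith

/-- `X` plays the part of infinity. A sum of two entries is the weight of a walk if both summands
are; if one of them stems from `X`, it stays near `X` or above, since no entry of level `l` is less
than `-(2 ^ l * M)`. -/
theorem Levels.sound {G : Prop} (hL : Levels (2 ^ lam) G lam D mid)
    (h0 : ∀ i < 2 ^ lam, ∀ j < 2 ^ lam, D 0 i j = initDist w X i j)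
    (hM : ∀ u v, ∀ x ∈ w u v, |x| ≤ M) (hM0 : 0 ≤ M) (hX : 0 ≤ X) :
    ∀ l ≤ lam, ∀ i < 2 ^ lam, ∀ j < 2 ^ lam, -(2 ^ l * M) ≤ D l i j ∧
      ((D l i j ≤ 2 ^ l * M ∧ ∃ (hi : i < n) (hj : j < n), IsWalk w ⟨i, hi⟩ ⟨j, hj⟩ (D l i j)) ∨
        X - 2 ^ l * M ≤ D l i j) := by
  intro l
  induction l with
  | zero =>
    intro _ i hi j hj
    rw [h0 i hi j hj, pow_zero, one_mul]
    unfold initDist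
    split_ifs with h1 h2
    · subst h2
      exact ⟨by linarith, .inl ⟨hM0, h1.1, h1.1, .nil _⟩⟩
    · cases hw : w ⟨i, h1.1⟩ ⟨j, h1.2⟩ with
      | none => exact ⟨by simp; linarith, .inr (by simp; linarith)⟩
      | some a =>
        have := abs_le.1 (hM _ _ a hw)
        refine ⟨by simpa using this.1, .inl ⟨by simpa using this.2, h1.1, h1.2, ?_⟩⟩
        simpa using IsWalk.cons hw (.nil _)
    · exact ⟨by linarith, .inr (by linarith)⟩
  | succ l ih =>
    intro hl i hi j hj
    have hp : (0 : ℝ) ≤ 2 ^ l * M := by positivity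
    obtain ⟨S, hS⟩ := hL.relaxes l hl
    rw [pow_succ]
    obtain ⟨h1 | ⟨-, k, hk, -, h1, -⟩, -⟩ := hS i hi j hj
    · rw [h1.1]
      obtain ⟨h2, h3 | h3⟩ := ih (by omega) i hi j hj
      · exact ⟨by linarith, .inl ⟨by linarith, h3.2⟩⟩
      · exact ⟨by linarith, .inr (by linarith)⟩
    · rw [h1]
      obtain ⟨a1, a2⟩ := ih (by omega) i hi k hk
      obtain ⟨b1, b2⟩ := ih (by omega) k hk j hj
      refine ⟨by linarith, ?_⟩
      rcases a2 with ⟨a3, hi', hk', a4⟩ | a2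
      · rcases b2 with ⟨b3, _, hj', b4⟩ | b2
        · exact .inl ⟨by linarith, hi', hj', a4.trans b4⟩
        · exact .inr (by linarith)
      · exact .inr (by linarith)

/-- A walk with more than `2 ^ l` edges is cut after `2 ^ l` of them. At level `0` a loop at a
vertex is covered by the zero on the diagonal, as loops are not negative. -/
theorem Levels.complete {G : Prop} (hg : G) (hL : Levels (2 ^ lam) G lam D mid) (hn : n ≤ 2 ^ lam)
    (h0 : ∀ i < 2 ^ lam, ∀ j < 2 ^ lam, D 0 i j = initDist w X i j) (hw : NoNegativeCycle w) :
    ∀ l ≤ lam, ∀ k ≤ 2 ^ l, ∀ (u v : Fin n) x, WalkN w k u v x → D l u v ≤ x := by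
  intro l
  induction l with
  | zero =>
    intro _ k hk u v x h
    rw [h0 u (by omega) v (by omega)]
    unfold initDist
    rw [dif_pos ⟨u.2, v.2⟩]
    obtain rfl | rfl : k = 0 ∨ k = 1 := by rw [pow_zero] at hk; omega
    · obtain ⟨rfl, rfl⟩ := h
      simp
    · have hx := isWalk_iff.2 ⟨_, h⟩
      obtain ⟨p, a, y, ha, ⟨rfl, rfl⟩, rfl⟩ := h
      split_ifs with huv
      · have : u = p := Fin.ext huv
        subst this
        exact hw _ _ hx
      · simp [ha]
  | succ l ih =>
    intro hl k hk u v x h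
    have hu : (u : ℕ) < 2 ^ lam := u.2.trans_le hn
    have hv : (v : ℕ) < 2 ^ lam := v.2.trans_le hn
    by_cases hkl : k ≤ 2 ^ l
    · exact (hL.antitone (Nat.le_succ l) hl hu hv).trans (ih (by omega) k hkl u v x h)
    · rw [show k = 2 ^ l + (k - 2 ^ l) by omega] at h
      obtain ⟨p, y, z, h1, h2, rfl⟩ := h.split
      rw [pow_succ] at hk
      exact (hL.le hg l hl u hu v hv p (p.2.trans_le hn)).trans
        (add_le_add (ih (by omega) _ le_rfl _ _ _ h1) (ih (by omega) _ (by omega) _ _ _ h2))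

/-- The threshold `2 N M` separates two cases. A reachable vertex has a walk with at most `n ≤ N`
edges, of weight at most `N M`; an entry that stems from `X = 4 N M` is at least `3 N M`. -/
theorem Levels.correct {G : Prop} (hg : G) (hL : Levels (2 ^ lam) G lam D mid) (hn : n ≤ 2 ^ lam)
    (h0 : ∀ i < 2 ^ lam, ∀ j < 2 ^ lam, D 0 i j = initDist w X i j)
    (hmid : ∀ i < 2 ^ lam, ∀ j < 2 ^ lam, mid 0 i j = n)
    (hw : NoNegativeCycle w) (hM : ∀ u v, ∀ x ∈ w u v, |x| ≤ M) (hM1 : 1 ≤ M)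
    (hX : X = 4 * (2 ^ lam * M)) (u v : Fin n) :
    ((∃ x, IsWalk w u v x) ∧ D lam u v < 2 * (2 ^ lam * M) ∧
      IsLeast {x | IsWalk w u v x} (D lam u v) ∧
      ∃ l ≤ 2 ^ lam, DecodesTo w (fun u v => mid lam u v) u v (D lam u v) l) ∨
    ((¬ ∃ x, IsWalk w u v x) ∧ 2 * (2 ^ lam * M) ≤ D lam u v) := by
  have hNM : (0 : ℝ) < 2 ^ lam * M := by positivity
  have hX0 : 0 ≤ X := by linarith
  have hM0 : 0 ≤ M := by linarith
  have hpow : ∀ l ≤ lam, (2 : ℝ) ^ l * M ≤ 2 ^ lam * M := fun l hl =>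
    mul_le_mul_of_nonneg_right (pow_le_pow_right₀ (by norm_num) hl) hM0
  have hlt : ∀ u : Fin n, (u : ℕ) < 2 ^ lam := fun u => u.2.trans_le hn
  have sound := hL.sound h0 hM hM0 hX0
  have complete : ∀ (u v : Fin n) x, IsWalk w u v x → D lam u v ≤ x := by
    intro u v x h
    obtain ⟨k, hk⟩ := isWalk_iff.1 h
    obtain ⟨k', hk', x', hx', h'⟩ := hw.exists_short k hk
    exact (hL.complete hg hn h0 hw lam le_rfl k' (hk'.trans hn) u v x' h').trans hx'
  have real : ∀ l ≤ lam, ∀ i < 2 ^ lam, ∀ j < 2 ^ lam, D l i j < 3 * (2 ^ lam * M) →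
      D l i j ≤ 2 ^ l * M ∧ ∃ (hi : i < n) (hj : j < n), IsWalk w ⟨i, hi⟩ ⟨j, hj⟩ (D l i j) := by
    intro l hl i hi j hj h
    refine (sound l hl i hi j hj).2.resolve_right fun h' => ?_
    have := hpow l hl
    linarith
  -- Induction on a level at which the entry has its final value. This makes the recursive decoding
  -- terminate and bounds the number of edges by `2 ^ l`.
  have decode : ∀ l ≤ lam, ∀ u v : Fin n, D l u v = D lam u v → D lam u v < 2 * (2 ^ lam * M) →
      ∃ e ≤ 2 ^ l, DecodesTo w (fun u v => mid lam u v) u v (D lam u v) e := by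
    intro l
    induction l with
    | zero =>
      intro _ u v heq hthr
      have hm := hL.mid_eq (Nat.zero_le lam) le_rfl (hlt u) (hlt v) heq
      rw [← heq] at hthr ⊢
      rw [h0 u (hlt u) v (hlt v)] at hthr ⊢
      unfold initDist at hthr ⊢
      rw [dif_pos ⟨u.2, v.2⟩] at hthr ⊢
      split_ifs at hthr ⊢ with huv
      · have : u = v := Fin.ext huv
        subst this
        exact ⟨0, by simp, .nil u⟩
      · cases ha : w ⟨u, u.2⟩ ⟨v, v.2⟩ with
        | none => rw [ha] at hthr; simp at hthr; linarith
        | some a =>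
          refine ⟨1, by simp, .edge (fun h => huv (by rw [h])) ?_ ha⟩
          rw [hm, hmid u (hlt u) v (hlt v)]
    | succ l ih =>
      intro hl u v heq hthr
      have hl2 : (2 : ℝ) ^ (l + 1) * M ≤ 2 ^ lam * M := hpow (l + 1) hl
      have hl3 : (0 : ℝ) ≤ 2 ^ l * M := by positivity
      rw [pow_succ] at hl2
      obtain ⟨S, hS⟩ := hL.relaxes l hl
      obtain ⟨h1 | ⟨h1, k, hk, -, h2, h3⟩, -⟩ := hS u (hlt u) v (hlt v)
      · obtain ⟨e, he, h⟩ := ih (by omega) u v (by rw [← h1.1, heq]) hthr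
        exact ⟨e, he.trans (Nat.pow_le_pow_right (by norm_num) (Nat.le_succ l)), h⟩
      -- The diagonal starts at `0`, so a strict decrease there would end in a closed walk of
      -- negative weight.
      · have huv : u ≠ v := by
          rintro rfl
          have h4 := hL.antitone (Nat.zero_le l) (by omega) (hlt u) (hlt u)
          rw [h0 u (hlt u) u (hlt u)] at h4
          simp only [initDist, u.2, and_self, dif_pos, if_true] at h4
          obtain ⟨-, _, _, h5⟩ := real lam le_rfl u (hlt u) u (hlt u) (by linarith)
          have := hw _ _ h5
          linarith
        have a1 := sound l (by omega) u (hlt u) k hk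
        have a2 := sound l (by omega) k hk v (hlt v)
        have r1 := real l (by omega) u (hlt u) k hk (by linarith [a2.1])
        have r2 := real l (by omega) k hk v (hlt v) (by linarith [a1.1])
        obtain ⟨q1, -, hkn, -⟩ := r1
        have q2 := r2.1
        have m1 := hL.antitone (show l ≤ lam by omega) le_rfl (hlt u) hk
        have m2 := hL.antitone (show l ≤ lam by omega) le_rfl hk (hlt v)
        obtain ⟨-, _, _, w1⟩ := real lam le_rfl u (hlt u) k hk (by linarith)
        obtain ⟨-, _, _, w2⟩ := real lam le_rfl k hk v (hlt v) (by linarith)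
        -- If one of the halves decreased after level `l`, joining the final halves would give a
        -- walk lighter than the final entry. So both halves are final at level `l`, and the
        -- induction hypothesis applies to them.
        have tri := complete u v _ (w1.trans w2)
        have e1 : D l u k = D lam u k := by linarith
        have e2 : D l k v = D lam k v := by linarith
        obtain ⟨c1, hc1, d1⟩ := ih (by omega) u ⟨k, hkn⟩ e1 (by simp only; linarith)
        obtain ⟨c2, hc2, d2⟩ := ih (by omega) ⟨k, hkn⟩ v e2 (by simp only; linarith)
        have hm : mid lam u v = k := by
          rw [hL.mid_eq hl le_rfl (hlt u) (hlt v) heq, h3]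
        refine ⟨c1 + c2, by rw [pow_succ]; omega, ?_⟩
        have := DecodesTo.split (mid := fun u v : Fin n => mid lam u v) huv (p := ⟨k, hkn⟩) hm d1 d2
        rw [← heq, h2, e1, e2]
        exact this
  by_cases hreach : ∃ x, IsWalk w u v x
  · left
    obtain ⟨x, hx⟩ := hreach
    obtain ⟨k, hk⟩ := isWalk_iff.1 hx
    obtain ⟨k', hk', x', hx', h'⟩ := hw.exists_short k hk
    have h1 := complete u v x' (isWalk_iff.2 ⟨_, h'⟩)
    have h2 := h'.le hM
    have h3 : (k' : ℝ) * M ≤ 2 ^ lam * M :=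
      mul_le_mul_of_nonneg_right (by exact_mod_cast hk'.trans hn) hM0
    obtain ⟨h4, _, _, h5⟩ := real lam le_rfl u (hlt u) v (hlt v) (by linarith)
    exact ⟨⟨x, hx⟩, by linarith, ⟨h5, fun y hy => complete u v y hy⟩,
      decode lam le_rfl u v rfl (by linarith)⟩
  · right
    refine ⟨hreach, ?_⟩
    rcases (sound lam le_rfl u (hlt u) v (hlt v)).2 with ⟨-, _, _, h⟩ | h
    · exact absurd ⟨_, h⟩ hreach
    · linarith

end

/-! ### The main program: preparation and output -/

section
variable {B : ℕ} {Nm : Set ℝ}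

/-- Ensures that the preparation of the parameters starts with the very first toss. -/
theorem RunsTo.coins_eq {p : RamProg} {s s' : RamState} {k : ℕ} (h : RunsTo B Nm p s k s')
    (hp : p.CoinFree) : s'.coins = s.coins := by
  induction h with
  | flip => exact hp.elim
  | seq _ _ h1 h2 => rw [h2 hp.2, h1 hp.1]
  | ifwTrue _ _ h1 => exact h1 hp.1
  | ifxTrue _ _ h1 => exact h1 hp.1
  | ifwFalse _ _ h1 => exact h1 hp.2
  | ifxFalse _ _ h1 => exact h1 hp.2
  | loopStep _ _ _ h1 h2 => rw [h2 hp, h1 hp]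
  | _ => rfl

theorem Runs.coins_eq {p : RamProg} {s : RamState} {k : ℕ} {Q : RamState → Prop}
    (h : Runs B Nm p s k Q) (hp : p.CoinFree) :
    Runs B Nm p s k fun s' => Q s' ∧ s'.coins = s.coins := by
  obtain ⟨k', hk, s', hr, hQ⟩ := h
  exact ⟨k', hk, s', hr, hQ, hr.coins_eq hp⟩

/-- Compute the dimensions. -/
def dimsProg : RamProg :=
  wconst 1 1 ;; wconst 13 0 ;; wop .add 30 0 1 ;; wconst 2 1 ;; wconst 3 0 ;;
  forUpTo 23 0 (ifw 2 30 (wop .add 2 2 2 ;; wop .add 3 3 1) skip) ;;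
  (wconst 31 5 ;; wop .div 31 3 31 ;; wop .add 31 31 1 ;; wconst 4 1) ;;
  forUpTo 23 31 (wop .add 4 4 4) ;;
  (wop .div 5 2 4 ;; wop .add 7 4 4 ;; wop .sub 6 7 1 ;; wop .mul 14 2 2 ;; wop .mul 12 14 4 ;;
  wop .mul 15 5 5 ;; wop .mul 15 15 5 ;; wop .mul 16 4 4 ;; wop .mul 16 16 4 ;;
  wop .mul 17 6 6 ;; wop .mul 18 7 7)

/-- The registers that hold the dimensions. -/
structure Dims (c : Cfg) (st : RamState) : Prop where
  n : st.wreg 0 = c.n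
  one : st.wreg 1 = 1
  N : st.wreg 2 = c.N
  lam : st.wreg 3 = c.lam
  s : st.wreg 4 = c.s
  g : st.wreg 5 = c.g
  m : st.wreg 6 = 2 * c.s - 1
  s2 : st.wreg 7 = 2 * c.s
  cap : st.wreg 12 = c.N * c.N * c.s
  zero : st.wreg 13 = 0
  NN : st.wreg 14 = c.N * c.N
  ggg : st.wreg 15 = c.g * c.g * c.g
  sss : st.wreg 16 = c.s * c.s * c.s
  mm : st.wreg 17 = (2 * c.s - 1) * (2 * c.s - 1)
  ss : st.wreg 18 = (2 * c.s) * (2 * c.s)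

/-- The program does not write the registers with the dimensions. -/
def RamProg.keepsDims (p : RamProg) : Bool :=
  p.keepsW 0 && p.keepsW 1 && p.keepsW 2 && p.keepsW 3 && p.keepsW 4 && p.keepsW 5 &&
  p.keepsW 6 && p.keepsW 7 && p.keepsW 12 && p.keepsW 13 && p.keepsW 14 && p.keepsW 15 &&
  p.keepsW 16 && p.keepsW 17 && p.keepsW 18

theorem Dims.frame {c : Cfg} {st st' : RamState} {p : RamProg} (h : Dims c st)
    (hF : Frame p st st') (hp : p.keepsDims = true) : Dims c st' := by
  simp only [RamProg.keepsDims, Bool.and_eq_true] at hp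
  constructor
  · rw [hF.wreg 0 (by tauto), h.n]
  · rw [hF.wreg 1 (by tauto), h.one]
  · rw [hF.wreg 2 (by tauto), h.N]
  · rw [hF.wreg 3 (by tauto), h.lam]
  · rw [hF.wreg 4 (by tauto), h.s]
  · rw [hF.wreg 5 (by tauto), h.g]
  · rw [hF.wreg 6 (by tauto), h.m]
  · rw [hF.wreg 7 (by tauto), h.s2]
  · rw [hF.wreg 12 (by tauto), h.cap]
  · rw [hF.wreg 13 (by tauto), h.zero]
  · rw [hF.wreg 14 (by tauto), h.NN]
  · rw [hF.wreg 15 (by tauto), h.ggg]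
  · rw [hF.wreg 16 (by tauto), h.sss]
  · rw [hF.wreg 17 (by tauto), h.mm]
  · rw [hF.wreg 18 (by tauto), h.ss]

variable {c : Cfg}

/-- The padded size is the least power of two that exceeds `n`. Powers of two make the division into
blocks exact and allow uniform samples from coin tosses. -/
theorem dims_spec (hR : Room c B Nm) (hn : 1 ≤ c.n) (hlam : c.lam = Nat.log 2 c.n + 1)
    {st : RamState} (h0 : st.wreg 0 = c.n) :
    Runs B Nm dimsProg st (c.N * 20 + 40) (Dims c) := by
  have hN8 := hR.N_le
  have hnN := hR.n_le
  have hsN := hR.s_le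
  have hgN := hR.g_le
  have hlamN : c.lam < c.N := Nat.lt_two_pow_self
  unfold dimsProg
  refine Runs.weaken (k := 1 + (1 + (1 + (1 + (1 + ((c.n * (3 + 2) + 2) + (4 +
    (((c.lam / 5 + 1) * (1 + 2) + 2) + 11)))))))) (Runs.seq (Runs.of_wp (p := wconst 1 1)
      (Q := fun s => s = st.setW 1 1) (by simp only [RamProg.wp, and_true]; omega)) ?_)
    (by omega) fun _ _ h => h
  rintro _ - rfl
  refine Runs.seq (Runs.of_wp (p := wconst 13 0) (Q := fun s => s = (st.setW 1 1).setW 13 0)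
    (by simp [RamProg.wp])) ?_
  rintro _ - rfl
  refine Runs.seq (Runs.of_wp (p := wop .add 30 0 1)
    (Q := fun s => s = ((st.setW 1 1).setW 13 0).setW 30 (c.n + 1))
    (by simp [RamProg.wp, WordOp.eval, h0]; omega)) ?_
  rintro _ - rfl
  refine Runs.seq (Runs.of_wp (p := wconst 2 1)
    (Q := fun s => s = (((st.setW 1 1).setW 13 0).setW 30 (c.n + 1)).setW 2 1)
    (by simp [RamProg.wp]; omega)) ?_
  rintro _ - rfl
  refine Runs.seq (Runs.of_wp (p := wconst 3 0)
    (Q := fun s => s = ((((st.setW 1 1).setW 13 0).setW 30 (c.n + 1)).setW 2 1).setW 3 0)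
    (by simp [RamProg.wp])) ?_
  rintro _ - rfl
  generalize hst1 : ((((st.setW 1 1).setW 13 0).setW 30 (c.n + 1)).setW 2 1).setW 3 0 = st1
  have e0 : st1.wreg 0 = c.n := by subst hst1; simp [h0]
  have e1 : st1.wreg 1 = 1 := by subst hst1; simp
  have e13 : st1.wreg 13 = 0 := by subst hst1; simp
  have e30 : st1.wreg 30 = c.n + 1 := by subst hst1; simp
  have e2 : st1.wreg 2 = 1 := by subst hst1; simp
  have e3 : st1.wreg 3 = 0 := by subst hst1; simp
  clear hst1
  -- Before the power exceeds `n` it doubles in each round and hence exceeds the number `q` of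
  -- rounds, so that `n` rounds suffice.
  refine Runs.seq (Runs.forUpTo (c := 3) (fun q s => ∃ l, s.wreg 2 = 2 ^ l ∧ s.wreg 3 = l ∧
    2 ^ l ≤ 2 * c.n ∧ (q < 2 ^ l ∨ c.n < 2 ^ l)) e0 e1 rfl (by omega) ?_ ?_) ?_
  · exact ⟨0, by simp [e2], by simp [e3], by simp; omega, by simp⟩
  · rintro q hq st2 h23 hF2 ⟨l, h2, h3, hl, hor⟩
    have f1 : st2.wreg 1 = 1 := by rw [hF2.wreg 1 rfl, e1]
    have f30 : st2.wreg 30 = c.n + 1 := by rw [hF2.wreg 30 rfl, e30]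
    have hll : l < 2 ^ l := Nat.lt_two_pow_self
    refine Runs.of_wp (p := ifw 2 30 (wop .add 2 2 2 ;; wop .add 3 3 1) skip) ?_
    simp only [RamProg.wp, WordOp.eval, RamState.setW_wreg, h2, h3, f1, f30, reduceIte,
      Nat.reduceEqDiff]
    refine ⟨fun h => ⟨by omega, by omega, l + 1, by rw [pow_succ]; ring, rfl, by rw [pow_succ]; omega,
      .inl (by rw [pow_succ]; omega)⟩, fun h => ⟨l, rfl, rfl, hl, .inr (by omega)⟩⟩
  rintro st2 hF2 ⟨l, h2, h3, hl, hor⟩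
  have hl' : c.lam = l := by
    have h4 : c.n < 2 ^ l := by omega
    have hl1 : l ≠ 0 := by rintro rfl; simp at h4; omega
    obtain ⟨l, rfl⟩ := Nat.exists_eq_succ_of_ne_zero hl1
    have hl2 := hl
    rw [Nat.succ_eq_add_one, pow_succ] at hl2
    rw [hlam, Nat.log_eq_of_pow_le_of_lt_pow (m := l) (by omega) h4]
  subst hl'
  have g0 : st2.wreg 0 = c.n := by rw [hF2.wreg 0 rfl, e0]
  have g1 : st2.wreg 1 = 1 := by rw [hF2.wreg 1 rfl, e1]
  have g13 : st2.wreg 13 = 0 := by rw [hF2.wreg 13 rfl, e13]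
  refine Runs.seq (Runs.of_wp (p := wconst 31 5 ;; wop .div 31 3 31 ;; wop .add 31 31 1 ;;
    wconst 4 1) (Q := fun s => s.wreg 0 = c.n ∧ s.wreg 1 = 1 ∧ s.wreg 13 = 0 ∧ s.wreg 2 = c.N ∧
      s.wreg 3 = c.lam ∧ s.wreg 31 = c.lam / 5 + 1 ∧ s.wreg 4 = 1) ?_) ?_
  · simp only [RamProg.wp, WordOp.eval, RamState.setW_wreg, h2, h3, g0, g1, g13, reduceIte,
      Nat.reduceEqDiff, and_true, true_and]
    have := hR.ss_le
    have := Room.two_le_s c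
    have h8 : 8 ≤ B := by have := Room.N_pos c; omega
    exact ⟨by omega, by omega, by omega, by omega, rfl⟩
  rintro st3 - ⟨k0, k1, k13, k2, k3, k31, k4⟩
  have hlam1 := hR.lam_pos
  refine Runs.seq (Runs.forUpTo (c := 1) (fun q s => s.wreg 4 = 2 ^ q) k31 k1 rfl (by omega)
    (by simp [k4]) ?_) ?_
  · intro q hq st4 h23 hF4 h4
    have hle : 2 ^ (q + 1) ≤ c.N := Nat.pow_le_pow_right (by norm_num) (by omega)
    refine Runs.of_wp (p := wop .add 4 4 4) ?_
    rw [pow_succ] at hle ⊢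
    simp only [RamProg.wp, WordOp.eval, RamState.setW_wreg, h4, reduceIte, Nat.reduceEqDiff]
    exact ⟨by omega, by omega⟩
  intro st4 hF4 h4
  have l0 : st4.wreg 0 = c.n := by rw [hF4.wreg 0 rfl, k0]
  have l1 : st4.wreg 1 = 1 := by rw [hF4.wreg 1 rfl, k1]
  have l2 : st4.wreg 2 = c.N := by rw [hF4.wreg 2 rfl, k2]
  have l3 : st4.wreg 3 = c.lam := by rw [hF4.wreg 3 rfl, k3]
  have l13 : st4.wreg 13 = 0 := by rw [hF4.wreg 13 rfl, k13]
  have l4 : st4.wreg 4 = c.s := h4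
  have hs := Room.two_le_s c
  have hg : c.N / c.s = c.g := by
    rw [← hR.s_mul_g, Nat.mul_div_cancel_left _ (by omega)]
  have hNN := hR.NN_le
  have hmm : (2 * c.s - 1) * (2 * c.s - 1) ≤ 2 * c.s * (2 * c.s) :=
    Nat.mul_le_mul (by omega) (by omega)
  have hss := hR.ss_le
  have hgg : c.g * c.g ≤ c.N * c.N := Nat.mul_le_mul hgN hgN
  have hss' : c.s * c.s ≤ c.N * c.N := Nat.mul_le_mul hsN hsN
  refine Runs.of_wp (p := wop .div 5 2 4 ;; wop .add 7 4 4 ;; wop .sub 6 7 1 ;; wop .mul 14 2 2 ;;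
    wop .mul 12 14 4 ;; wop .mul 15 5 5 ;; wop .mul 15 15 5 ;; wop .mul 16 4 4 ;;
    wop .mul 16 16 4 ;; wop .mul 17 6 6 ;; wop .mul 18 7 7) ?_
  simp only [RamProg.wp, WordOp.eval, RamState.setW_wreg, l1, l2, l4, reduceIte,
    Nat.reduceEqDiff, hg, ← two_mul]
  refine ⟨by omega, by omega, by omega, by omega, hR.cap_le, by omega, hR.ggg_le, by omega,
    hR.sss_le, by omega, hss, ?_⟩
  constructor <;> simp only [RamState.setW_wreg, reduceIte, Nat.reduceEqDiff, l0, l1, l2, l3, l4, l13]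

/-- The largest absolute value in the first cells of an array, but at least `1`. -/
noncomputable def maxAbs (f : ℕ → ℝ) : ℕ → ℝ
  | 0 => 1
  | q + 1 => max (maxAbs f q) |f q|

theorem one_le_maxAbs (f : ℕ → ℝ) (q : ℕ) : 1 ≤ maxAbs f q := by
  induction q with
  | zero => exact le_rfl
  | succ q ih => exact ih.trans (le_max_left _ _)

theorem maxAbs_mono (f : ℕ → ℝ) {p q : ℕ} (h : p ≤ q) : maxAbs f p ≤ maxAbs f q := by
  induction q, h using Nat.le_induction with
  | base => exact le_rfl
  | succ q _ ih => exact ih.trans (le_max_left _ _)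

theorem abs_le_maxAbs (f : ℕ → ℝ) {p q : ℕ} (h : p < q) : |f p| ≤ maxAbs f q :=
  (le_max_right _ _).trans (maxAbs_mono f (Nat.succ_le_of_lt h))

theorem maxAbs_le {f : ℕ → ℝ} {q : ℕ} {Y : ℝ} (h1 : 1 ≤ Y) (h : ∀ p < q, |f p| ≤ Y) :
    maxAbs f q ≤ Y := by
  induction q with
  | zero => exact h1
  | succ q ih => exact max_le (ih fun p hp => h p (by omega)) (h q (by omega))

theorem maxAbs_mem {f : ℕ → ℝ} {q : ℕ} {Λ : AddSubgroup ℝ} (h1 : 1 ∈ Λ) (h : ∀ p < q, f p ∈ Λ) :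
    maxAbs f q ∈ Λ := by
  induction q with
  | zero => exact h1
  | succ q ih =>
    unfold maxAbs
    rcases max_choice (maxAbs f q) |f q| with h2 | h2
    · rw [h2]; exact ih fun p hp => h p (by omega)
    · rw [h2]
      rcases abs_choice (f q) with h3 | h3
      · rw [h3]; exact h q (by omega)
      · rw [h3]; exact Λ.neg_mem (h q (by omega))

/-- Fill the matrix of tentative distances. -/
def initBody : RamProg :=
  wop .div 30 23 2 ;; wop .mod 31 23 2 ;; xadd 10 7 6 ;;
  ifw 30 0 (ifw 31 0 (wop .mul 33 30 0 ;; wop .add 33 33 31 ;;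
    ifw 30 31 (wload 34 0 33 ;; ifw 13 34 (xload 10 0 33) skip)
      (ifw 31 30 (wload 34 0 33 ;; ifw 13 34 (xload 10 0 33) skip) (xconst 10 0))) skip) skip ;;
  xstore 2 23 10 ;; wstore 5 23 0

/-- Prepare the matrix of tentative distances and the bounds on its entries. -/
def initProg : RamProg :=
  (wop .mul 32 0 0 ;; xconst 6 0 ;; xconst 10 1) ;;
  forUpTo 23 32 (xload 11 0 23 ;; ifx 10 11 (xadd 10 11 6) skip ;; xsub 11 6 11 ;;
    ifx 10 11 (xadd 10 11 6) skip) ;;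
  forUpTo 23 3 (xadd 10 10 10) ;;
  (xadd 5 10 10 ;; xadd 7 5 5 ;; xadd 8 7 6) ;;
  forUpTo 23 14 initBody ;;
  forUpTo 23 3 (xadd 8 8 8)

theorem rowMajor_apply {α : Type} [Zero α] {n : ℕ} (f : Fin n → Fin n → α) (i j : Fin n) :
    rowMajor f (i * n + j) = f i j := by
  have hn : 0 < n := i.pos
  have h1 : ((i : ℕ) * n + j) / n = i := by
    rw [mul_comm, Nat.mul_add_div hn, Nat.div_eq_of_lt j.2, add_zero]
  have h2 : ((i : ℕ) * n + j) % n = j := by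
    rw [mul_comm, Nat.mul_add_mod, Nat.mod_eq_of_lt j.2]
  unfold rowMajor
  rw [dif_pos ⟨by rw [h1]; exact i.2, by rw [h2]; exact j.2⟩]
  congr 1
  · exact Fin.ext h1
  · exact Fin.ext h2

/-- Numeric cells cannot be multiplied, so each factor `N` is produced by `lam` doublings. The
initial intermediate entry `n` is not the number of a vertex and therefore stands for an edge. -/
theorem init_spec (hR : Room c B Nm) {st : RamState} (hd : Dims c st)
    {w : Fin c.n → Fin c.n → Option ℝ} (hA : st.warr 0 = rowMajor fun u v =>
      if (w u v).isSome then 1 else 0) (hX : st.xarr 0 = rowMajor fun u v => (w u v).getD 0)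
    {M : ℝ} (hM : M = maxAbs (st.xarr 0) (c.n * c.n)) (hW : 4 * (c.N * M) * c.N ≤ c.W) :
    Runs B Nm initProg st (c.N * c.N * 40) fun st' =>
      (∀ i < c.N, ∀ j < c.N, mat c.N (st'.xarr 2) i j = initDist w (4 * (c.N * M)) i j) ∧
      (∀ i < c.N, ∀ j < c.N, mat c.N (st'.warr 5) i j = c.n) ∧
      st'.xreg 5 = 2 * (c.N * M) ∧ st'.xreg 6 = 0 ∧ st'.xreg 8 = c.N * (4 * (c.N * M)) := by
  have hN8 := hR.N_le
  have hnN := hR.n_le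
  have hNN := hR.NN_le
  have hlamN : c.lam < c.N := Nat.lt_two_pow_self
  have hN2 : 2 ≤ c.N := by
    have : 2 ^ 1 ≤ 2 ^ c.lam := Nat.pow_le_pow_right (by norm_num) hR.lam_pos
    exact this
  have hN1 : (1 : ℝ) ≤ c.N := by exact_mod_cast Room.N_pos c
  have hM1 : 1 ≤ M := by rw [hM]; exact one_le_maxAbs _ _
  have hNM : M ≤ c.N * M := by nlinarith
  have hNM4 : 4 * (c.N * M) ≤ c.W := by nlinarith
  have hnn : c.n * c.n ≤ c.N * c.N := Nat.mul_le_mul hnN hnN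
  have hN4 : 2 * c.N ≤ c.N * c.N := Nat.mul_le_mul_right _ hN2
  unfold initProg
  refine Runs.weaken (k := 3 + ((c.n * c.n * (6 + 2) + 2) + ((c.lam * (1 + 2) + 2) + (3 +
    ((c.N * c.N * (16 + 2) + 2) + (c.lam * (1 + 2) + 2))))))
    (Runs.seq (Runs.of_wp (p := wop .mul 32 0 0 ;; xconst 6 0 ;; xconst 10 1)
      (Q := fun s => s = ((st.setW 32 (c.n * c.n)).setX 6 0).setX 10 1) ?_) ?_)
    (by omega) fun _ _ h => h
  · simp only [RamProg.wp, WordOp.eval, hd.n, Int.cast_zero, Int.cast_one, and_true]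
    exact ⟨by omega, hR.num _ (by simpa using hR.W), hR.num _ (by simp; linarith)⟩
  rintro _ hF1 rfl
  have hd1 := hd.frame hF1 rfl
  have ex : (((st.setW 32 (c.n * c.n)).setX 6 0).setX 10 1).xarr 0 = st.xarr 0 := rfl
  have eA : (((st.setW 32 (c.n * c.n)).setX 6 0).setX 10 1).warr 0 = st.warr 0 := rfl
  have e6 : (((st.setW 32 (c.n * c.n)).setX 6 0).setX 10 1).xreg 6 = 0 := by simp
  have e32 : (((st.setW 32 (c.n * c.n)).setX 6 0).setX 10 1).wreg 32 = c.n * c.n := by simp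
  have e10 : (((st.setW 32 (c.n * c.n)).setX 6 0).setX 10 1).xreg 10 = 1 := by simp
  generalize ((st.setW 32 (c.n * c.n)).setX 6 0).setX 10 1 = st1 at *
  refine Runs.seq (Runs.forUpTo (c := 6) (fun q s => s.xreg 10 = maxAbs (st.xarr 0) q) e32 hd1.one
    rfl (by omega) (by simp [e10, maxAbs]) ?_) ?_
  · intro q hq st2 h23 hF2 h10
    have f6 : st2.xreg 6 = 0 := by rw [hF2.xreg 6 rfl, e6]
    have fx : st2.xarr 0 = st.xarr 0 := by rw [hF2.xarr 0 rfl, ex]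
    have b1 : maxAbs (st.xarr 0) q ≤ M := by rw [hM]; exact maxAbs_mono _ hq.le
    have b2 : |st.xarr 0 q| ≤ M := by rw [hM]; exact abs_le_maxAbs _ hq
    have b3 := one_le_maxAbs (st.xarr 0) q
    have hin : ∀ x, |x| ≤ M → x ∈ Nm := fun x hx => hR.num _ (by linarith)
    have b4 : -st.xarr 0 q ∈ Nm := hin _ (by rwa [abs_neg])
    refine Runs.of_wp (p := xload 11 0 23 ;; ifx 10 11 (xadd 10 11 6) skip ;; xsub 11 6 11 ;;
      ifx 10 11 (xadd 10 11 6) skip) ?_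
    simp only [RamProg.wp, RamState.setX_xreg, RamState.setW_xreg, h23, h10, fx, f6, reduceIte, Nat.reduceEqDiff, add_zero, zero_sub,
      maxAbs]
    refine ⟨hin _ b2, fun h1 => ⟨hin _ b2, b4, fun h2 => ⟨b4, ?_⟩, fun h2 => ?_⟩, fun h1 =>
      ⟨b4, fun h2 => ⟨b4, ?_⟩, fun h2 => ?_⟩⟩
    · linarith
    · rw [abs_of_pos (by linarith), max_eq_right h1.le]
    · rw [abs_of_neg (by linarith), max_eq_right h2.le]
    · rw [max_eq_left (abs_le.2 ⟨by linarith, h1⟩)]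
  intro st2 hF2 h10
  have hd2 := hd1.frame hF2 rfl
  have f6 : st2.xreg 6 = 0 := by rw [hF2.xreg 6 rfl, e6]
  have fx : st2.xarr 0 = st.xarr 0 := by rw [hF2.xarr 0 rfl, ex]
  have fA : st2.warr 0 = st.warr 0 := by rw [hF2.warr 0 rfl, eA]
  have hdouble : ∀ (x : ℕ) (s0 : RamState) (Y : ℝ), Dims c s0 → s0.xreg x = Y → 0 ≤ Y →
      c.N * Y ≤ c.W → Runs B Nm (forUpTo 23 3 (xadd x x x)) s0 (c.lam * (1 + 2) + 2)
        fun s => s.xreg x = c.N * Y := by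
    intro x s0 Y hd0 hx hY hYW
    refine Runs.weaken (Runs.forUpTo (c := 1) (fun q s => s.xreg x = 2 ^ q * Y) hd0.lam hd0.one
      rfl (by omega) (by simp [hx]) ?_) le_rfl ?_
    · intro q hq s1 h23 hF hI
      refine Runs.of_wp (p := xadd x x x) ?_
      have hp : (2 : ℝ) ^ (q + 1) ≤ c.N := by
        unfold Cfg.N
        push_cast
        exact pow_le_pow_right₀ (by norm_num) hq
      have h1 : 2 ^ q * Y + 2 ^ q * Y = 2 ^ (q + 1) * Y := by ring
      have h2 : 2 ^ (q + 1) * Y ≤ c.W := (mul_le_mul_of_nonneg_right hp hY).trans hYW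
      have h3 : 0 ≤ 2 ^ (q + 1) * Y := by positivity
      simp only [RamProg.wp, hI, h1, RamState.setW_xreg, RamState.setX_xreg, if_true, and_true]
      exact hR.num _ (by rw [abs_of_nonneg h3]; linarith)
    · intro s1 _ h
      rw [h]
      unfold Cfg.N
      push_cast
      rfl
  refine Runs.seq (hdouble 10 st2 M hd2 (by rw [h10, hM]) (by linarith) (by linarith))
    fun st3 hF3 h3 => ?_
  have hd3 := hd2.frame hF3 rfl
  have g6 : st3.xreg 6 = 0 := by rw [hF3.xreg 6 rfl, f6]
  refine Runs.seq (Runs.of_wp (p := xadd 5 10 10 ;; xadd 7 5 5 ;; xadd 8 7 6) (Q := fun s =>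
    s.xreg 5 = 2 * (c.N * M) ∧ s.xreg 7 = 4 * (c.N * M) ∧ s.xreg 8 = 4 * (c.N * M)) ?_) ?_
  · have q1 : c.N * M + c.N * M = 2 * (c.N * M) := by ring
    have q2 : 2 * (c.N * M) + 2 * (c.N * M) = 4 * (c.N * M) := by ring
    have q3 : 4 * (c.N * M) ∈ Nm := hR.num _ (by rw [abs_of_nonneg (by linarith)]; linarith)
    simp only [RamProg.wp, RamState.setX_xreg, h3, g6, reduceIte, Nat.reduceEqDiff, q1, q2,
      add_zero, and_true]
    exact ⟨hR.num _ (by rw [abs_of_nonneg (by linarith)]; linarith), q3, q3⟩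
  rintro st4 hF4 ⟨k5, k7, k8⟩
  have hd4 := hd3.frame hF4 rfl
  have k6 : st4.xreg 6 = 0 := by rw [hF4.xreg 6 rfl, g6]
  have kx : st4.xarr 0 = st.xarr 0 := by rw [hF4.xarr 0 rfl, hF3.xarr 0 rfl, fx]
  have kA : st4.warr 0 = st.warr 0 := by rw [hF4.warr 0 rfl, hF3.warr 0 rfl, fA]
  refine Runs.seq (Runs.forUpTo (c := 16) (fun q s => (∀ e < q, s.xarr 2 e =
    initDist w (4 * (c.N * M)) (e / c.N) (e % c.N)) ∧ ∀ e < q, s.warr 5 e = c.n)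
    hd4.NN hd4.one rfl (by omega) (by simp) ?_) ?_
  · rintro e he st5 h23 hF5 ⟨hI1, hI2⟩
    have hd5 := hd4.frame hF5 rfl
    have l6 : st5.xreg 6 = 0 := by rw [hF5.xreg 6 rfl, k6]
    have l7 : st5.xreg 7 = 4 * (c.N * M) := by rw [hF5.xreg 7 rfl, k7]
    have lx : st5.xarr 0 = st.xarr 0 := by rw [hF5.xarr 0 rfl, kx]
    have lA : st5.warr 0 = st.warr 0 := by rw [hF5.warr 0 rfl, kA]
    have key : ∀ v, v = initDist w (4 * (c.N * M)) (e / c.N) (e % c.N) →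
        (∀ e' < e + 1, Function.update (st5.xarr 2) e v e' =
          initDist w (4 * (c.N * M)) (e' / c.N) (e' % c.N)) ∧
        ∀ e' < e + 1, Function.update (st5.warr 5) e c.n e' = c.n := by
      intro v hv
      constructor
      all_goals
        intro e' he'
        rcases Nat.lt_succ_iff_lt_or_eq.1 he' with h | rfl
        · rw [Function.update_of_ne h.ne]
          first | exact hI1 e' h | exact hI2 e' h
        · rw [Function.update_self]
          try exact hv
    have hj : e % c.N < c.N := Nat.mod_lt _ (by omega)
    have hi : e / c.N < c.N := Nat.div_lt_of_lt_mul he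
    have hXm : 4 * (c.N * M) ∈ Nm := hR.num _ (by rw [abs_of_nonneg (by linarith)]; linarith)
    refine Runs.weaken (Runs.of_wp (p := initBody) ?_) (by decide) fun _ _ h => h
    simp only [initBody, RamProg.wp, WordOp.eval, RamState.setW_wreg, RamState.setW_xarr,
      RamState.setW_xreg, RamState.setW_warr, RamState.setX_warr, RamState.storeX_warr,
      RamState.storeX_wreg, RamState.storeW_xarr, RamState.storeW_warr,
      RamState.setX_wreg, RamState.setX_xarr, RamState.setX_xreg, RamState.storeX_xarr,
      h23, hd5.N, hd5.n, hd5.zero, l6, l7, lx, lA, reduceIte, Nat.reduceEqDiff, add_zero]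
    set i := e / c.N
    set j := e % c.N
    refine ⟨by omega, by omega, hXm, fun hin => ⟨fun hjn => ?_, fun hjn => ?_⟩, fun hin => ?_⟩
    · have hij := mul_add_lt hin hjn
      have hA' : st.warr 0 (i * c.n + j) = if (w ⟨i, hin⟩ ⟨j, hjn⟩).isSome then 1 else 0 := by
        rw [hA]; exact rowMajor_apply _ ⟨i, hin⟩ ⟨j, hjn⟩
      have hX' : st.xarr 0 (i * c.n + j) = (w ⟨i, hin⟩ ⟨j, hjn⟩).getD 0 := by
        rw [hX]; exact rowMajor_apply _ ⟨i, hin⟩ ⟨j, hjn⟩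
      have hXn : st.xarr 0 (i * c.n + j) ∈ Nm := by
        have := abs_le_maxAbs (st.xarr 0) hij
        rw [← hM] at this
        exact hR.num _ (by linarith)
      have hoff : i ≠ j → st.warr 0 (i * c.n + j) ≤ B ∧
          (0 < st.warr 0 (i * c.n + j) → st.xarr 0 (i * c.n + j) ∈ Nm ∧
            (∀ e' < e + 1, Function.update (st5.xarr 2) e (st.xarr 0 (i * c.n + j)) e' =
              initDist w (4 * (c.N * M)) (e' / c.N) (e' % c.N)) ∧
            ∀ e' < e + 1, Function.update (st5.warr 5) e c.n e' = c.n) ∧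
          (st.warr 0 (i * c.n + j) ≤ 0 →
            (∀ e' < e + 1, Function.update (st5.xarr 2) e (4 * (c.N * M)) e' =
              initDist w (4 * (c.N * M)) (e' / c.N) (e' % c.N)) ∧
            ∀ e' < e + 1, Function.update (st5.warr 5) e c.n e' = c.n) := by
        intro hne
        refine ⟨by rw [hA']; split_ifs <;> omega, fun h => ⟨hXn, key _ ?_⟩, fun h => key _ ?_⟩
        · rw [hX']
          rw [hA'] at h
          simp only [initDist]
          rw [dif_pos ⟨hin, hjn⟩, if_neg hne]
          cases hw : w ⟨i, hin⟩ ⟨j, hjn⟩ with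
          | none => rw [hw] at h; simp at h
          | some a => rfl
        · rw [hA'] at h
          simp only [initDist]
          rw [dif_pos ⟨hin, hjn⟩, if_neg hne]
          cases hw : w ⟨i, hin⟩ ⟨j, hjn⟩ with
          | none => rfl
          | some a => rw [hw] at h; simp at h
      refine ⟨by omega, by omega, fun h => hoff h.ne, fun h => ⟨fun h' => hoff h'.ne', fun h' =>
        ⟨hR.num _ (by simpa using hR.W), key _ ?_⟩⟩⟩
      have : i = j := le_antisymm h' h
      simp only [initDist]
      rw [dif_pos ⟨hin, hjn⟩, if_pos this]
      simp
    · refine key _ ?_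
      simp only [initDist]
      rw [dif_neg (by omega)]
    · refine key _ ?_
      simp only [initDist]
      rw [dif_neg (by omega)]
  rintro st5 hF5 ⟨hI1, hI2⟩
  have hd5 := hd4.frame hF5 rfl
  refine (hdouble 8 st5 (4 * (c.N * M)) hd5 (by rw [hF5.xreg 8 rfl, k8]) (by linarith)
    (by linarith)).weaken le_rfl fun st6 hF6 h8 => ?_
  have hdm : ∀ i j, j < c.N → (i * c.N + j) / c.N = i ∧ (i * c.N + j) % c.N = j := by
    intro i j hj
    rw [mul_comm]
    exact ⟨by rw [Nat.mul_add_div (by omega), Nat.div_eq_of_lt hj, add_zero],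
      by rw [Nat.mul_add_mod, Nat.mod_eq_of_lt hj]⟩
  refine ⟨fun i hi j hj => ?_, fun i hi j hj => ?_, ?_, ?_, h8⟩
  · have := hI1 _ (mul_add_lt hi hj)
    rw [(hdm i j hj).1, (hdm i j hj).2] at this
    rw [hF6.xarr 2 rfl]
    exact this
  · rw [hF6.warr 5 rfl]
    exact hI2 _ (mul_add_lt hi hj)
  · rw [hF6.xreg 5 rfl, hF5.xreg 5 rfl, k5]
  · rw [hF6.xreg 6 rfl, hF5.xreg 6 rfl, k6]

/-- Write the answer. -/
def outputBody : RamProg :=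
  wop .div 30 23 0 ;; wop .mod 31 23 0 ;; wop .mul 32 30 2 ;; wop .add 32 32 31 ;;
  xload 10 2 32 ;; xstore 1 23 10 ;; wload 34 5 32 ;; wstore 2 23 34 ;;
  ifx 10 5 (wstore 1 23 1) skip

/-- Only entries below the threshold are marked as reachable, which is why the array of marks has to
be zero beforehand. -/
theorem output_spec (hR : Room c B Nm) {st : RamState} (hc : Ctx c st) {D : ℕ → ℕ → ℝ}
    {mid : ℕ → ℕ → ℕ} (hD : D = mat c.N (st.xarr 2)) (hmid : mid = mat c.N (st.warr 5))
    (hDW : ∀ i < c.N, ∀ j < c.N, |D i j| ≤ c.W)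
    (hmidN : ∀ i < c.N, ∀ j < c.N, mid i j ≤ c.N) (h1 : st.warr 1 = fun _ => 0) :
    Runs B Nm (wop .mul 33 0 0 ;; forUpTo 23 33 outputBody) st (c.n * c.n * 13 + 3) fun st' =>
      ∀ i < c.n, ∀ j < c.n, mat c.n (st'.xarr 1) i j = D i j ∧
        mat c.n (st'.warr 2) i j = mid i j ∧
        mat c.n (st'.warr 1) i j = if D i j < c.thr then 1 else 0 := by
  have hN8 := hR.N_le
  have hnN := hR.n_le
  have hNN := hR.NN_le
  have hW := hR.W
  have hnn : c.n * c.n ≤ c.N * c.N := Nat.mul_le_mul hnN hnN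
  refine Runs.weaken (k := 1 + (c.n * c.n * (11 + 2) + 2)) (Runs.seq (Runs.of_wp
    (p := wop .mul 33 0 0) (Q := fun s => s = st.setW 33 (c.n * c.n)) ?_) ?_)
    (by omega) fun _ _ h => h
  · simp only [RamProg.wp, WordOp.eval, hc.n, and_true]
    omega
  rintro st1 hF1 rfl
  have hc1 := hc.frame hF1 rfl
  refine Runs.weaken (Runs.forUpTo (c := 11) (fun q s => ∀ e < c.n * c.n,
    s.warr 1 e = (if e < q ∧ D (e / c.n) (e % c.n) < c.thr then 1 else 0) ∧
    (e < q → s.xarr 1 e = D (e / c.n) (e % c.n) ∧ s.warr 2 e = mid (e / c.n) (e % c.n)))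
    (n := c.n * c.n) (by simp) hc1.one rfl (by omega) (by simp [h1]) ?_) le_rfl ?_
  · intro e he st2 h23 hF2 hI
    have hc2 := hc1.frame hF2 rfl
    have f2 : st2.xarr 2 = st.xarr 2 := by rw [hF2.xarr 2 rfl, hF1.xarr 2 rfl]
    have f5 : st2.warr 5 = st.warr 5 := by rw [hF2.warr 5 rfl, hF1.warr 5 rfl]
    have hi : e / c.n < c.n := Nat.div_lt_of_lt_mul he
    have hj : e % c.n < c.n := Nat.mod_lt _ ((Nat.zero_le _).trans_lt hi)
    have hij := mul_add_lt (hi.trans_le hnN) (hj.trans_le hnN)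
    have hDm : ∀ i j, st.xarr 2 (i * c.N + j) = D i j := fun i j => by rw [hD]; rfl
    have hMm : ∀ i j, st.warr 5 (i * c.N + j) = mid i j := fun i j => by rw [hmid]; rfl
    have b1 := hDW _ (hi.trans_le hnN) _ (hj.trans_le hnN)
    have b2 := hmidN _ (hi.trans_le hnN) _ (hj.trans_le hnN)
    refine Runs.weaken (Runs.of_wp (p := outputBody) ?_) (by decide) fun _ _ h => h
    simp only [outputBody, RamProg.wp, WordOp.eval, RamState.setW_wreg, RamState.setW_xarr,
      RamState.setW_xreg, RamState.setW_warr, RamState.setX_warr, RamState.storeX_warr,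
      RamState.storeX_wreg, RamState.storeW_xarr, RamState.storeW_warr, RamState.storeW_wreg,
      RamState.storeX_xreg, RamState.storeW_xreg,
      RamState.setX_wreg, RamState.setX_xarr, RamState.setX_xreg, RamState.storeX_xarr,
      h23, hc2.N, hc2.n, hc2.one, hc2.thr, f2, f5, reduceIte, Nat.reduceEqDiff, hDm, hMm]
    have ei : e / c.n ≤ B := by
      generalize e / c.n = i at *
      omega
    have ej : e % c.n ≤ B := by
      generalize e % c.n = i at *
      omega
    generalize hi' : e / c.n = i at *
    generalize hj' : e % c.n = j at *
    refine ⟨ei, ej, by omega, by omega, hR.num _ (by linarith), by omega,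
      fun hlt e' he' => ?_, fun hle e' he' => ?_⟩
    · rcases eq_or_ne e' e with rfl | hne
      · simp [hi', hj', hlt]
      · simp only [Function.update_of_ne hne]
        have h3 : e' < e + 1 ↔ e' < e := by omega
        simp only [h3]
        exact hI e' he'
    · rcases eq_or_ne e' e with rfl | hne
      · simp [(hI e' he').1, hi', hj', hle]
      · simp only [Function.update_of_ne hne]
        have h3 : e' < e + 1 ↔ e' < e := by omega
        simp only [h3]
        exact hI e' he'
  · intro st2 _ h i hi j hj
    have hij := mul_add_lt hi hj
    obtain ⟨a1, a2⟩ := h _ hij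
    have hdm : (i * c.n + j) / c.n = i ∧ (i * c.n + j) % c.n = j := by
      rw [mul_comm]
      exact ⟨by rw [Nat.mul_add_div (by omega), Nat.div_eq_of_lt hj, add_zero],
        by rw [Nat.mul_add_mod, Nat.mod_eq_of_lt hj]⟩
    rw [hdm.1, hdm.2] at a1 a2
    refine ⟨(a2 hij).1, (a2 hij).2, ?_⟩
    unfold mat
    rw [a1]
    simp [hij]

end

/-! ### The whole program -/

/-- Compute the multiples of the bound on the distances. -/
def scaleProg : RamProg :=
  xadd 2 4 4 ;; xadd 2 2 2 ;; xadd 1 2 2 ;; xadd 1 1 1 ;; xadd 1 1 1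

/-- The reduction, with a program that prepares the parameters. -/
def apspProg (setup : RamProg) (mb : ℕ) (prog : RamProg) : RamProg :=
  dimsProg ;; initProg ;; setup ;; scaleProg ;; forUpTo 20 3 (levelProg mb prog) ;;
  (wop .mul 33 0 0 ;; forUpTo 23 33 outputBody)

/-- The number of steps of the reduction. -/
def apspTime (c : Cfg) (k mb t : ℕ) : ℕ :=
  c.N * c.N * 73 + 50 + k + c.lam * (levelTime c mb t + 2)

/-- The program prepares the parameters when numeric register `8` holds `Y`. -/
structure Prepares (c : Cfg) (B : ℕ) (Nm : Set ℝ) (setup : RamProg) (Y : ℝ) (zc : ℕ → Bool)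
    (k : ℕ) (δ : ℕ → ℝ) (zb : ℕ → Bool) (R : ℕ → ℕ) : Prop where
  keepsDims : setup.keepsDims = true
  keeps : (setup.keepsX 5 && setup.keepsX 6 && setup.keepsXA 2 && setup.keepsWA 5 &&
    setup.keepsWA 1) = true
  runs : ∀ st, Dims c st → st.xreg 8 = Y → st.xreg 6 = 0 → st.coins = zc →
    Runs B Nm setup st k fun st' => (st'.wreg 8 = c.r ∧ st'.wreg 9 = c.tau ∧
      st'.wreg 10 = c.rho ∧ st'.wreg 11 = c.L ∧ st'.wreg 19 = c.rho * (c.N * c.N) ∧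
      st'.xreg 4 = c.W) ∧ (∀ p < c.L, st'.xarr 5 p = δ p) ∧
      (∀ b < c.r * c.tau, st'.warr 4 b = (zb b).toNat) ∧ ∀ q < c.rho, st'.warr 3 q = R q

theorem minPlusPow_congr {N : ℕ} {D D' : ℕ → ℕ → ℝ} (h : ∀ i < N, ∀ j < N, D i j = D' i j) (l : ℕ) :
    ∀ i < N, ∀ j < N, minPlusPow N D l i j = minPlusPow N D' l i j := by
  induction l with
  | zero => exact h
  | succ l ih =>
    intro i hi j hj
    simp only [minPlusPow]
    rw [ih i hi j hj]
    congr 2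
    refine Set.image_congr fun k hk => ?_
    rw [ih i hi k hk, ih k hk j hj]

theorem abs_initDist_le {n : ℕ} {w : Fin n → Fin n → Option ℝ} {X : ℝ} (hX : 0 ≤ X)
    (hw : ∀ u v, ∀ x ∈ w u v, |x| ≤ X) (i j : ℕ) : |initDist w X i j| ≤ X := by
  unfold initDist
  split_ifs with h1 h2
  · simpa using hX
  · cases h : w ⟨i, h1.1⟩ ⟨j, h1.2⟩ with
    | none => simp [abs_of_nonneg hX]
    | some a => exact hw _ _ a h
  · exact (abs_of_nonneg hX).le

theorem initDist_mem {n : ℕ} {w : Fin n → Fin n → Option ℝ} {X : ℝ} {Λ : AddSubgroup ℝ}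
    (hX : X ∈ Λ) (hw : ∀ u v, ∀ x ∈ w u v, x ∈ Λ) (i j : ℕ) : initDist w X i j ∈ Λ := by
  unfold initDist
  split_ifs with h1 h2
  · exact Λ.zero_mem
  · cases h : w ⟨i, h1.1⟩ ⟨j, h1.2⟩ with
    | none => simpa using hX
    | some a => exact hw _ _ a h
  · exact hX

/-- The largest absolute value of a weight, but at least `1`. -/
noncomputable def maxWeight {n : ℕ} (w : Fin n → Fin n → Option ℝ) : ℝ :=
  maxAbs (rowMajor fun u v => (w u v).getD 0) (n * n)

theorem abs_le_maxWeight {n : ℕ} {w : Fin n → Fin n → Option ℝ} {u v : Fin n} {x : ℝ}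
    (hx : x ∈ w u v) : |x| ≤ maxWeight w := by
  have h := abs_le_maxAbs (rowMajor fun u v => (w u v).getD 0) (mul_add_lt u.2 v.2)
  rw [rowMajor_apply] at h
  rw [Option.mem_def] at hx
  rw [hx] at h
  exact h

theorem rowMajor_cases {α : Type} [Zero α] {n : ℕ} (f : Fin n → Fin n → α) (m : ℕ) :
    rowMajor f m = 0 ∨ ∃ i j, rowMajor f m = f i j := by
  unfold rowMajor
  split_ifs with h
  · exact .inr ⟨_, _, rfl⟩
  · exact .inl rfl

theorem maxWeight_le {n : ℕ} {w : Fin n → Fin n → Option ℝ} {Y : ℝ} (h1 : 1 ≤ Y)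
    (h : ∀ u v, ∀ x ∈ w u v, |x| ≤ Y) : maxWeight w ≤ Y := by
  refine maxAbs_le h1 fun p _ => ?_
  obtain h2 | ⟨i, j, h2⟩ := rowMajor_cases (fun u v => (w u v).getD 0) p
  · rw [h2, abs_zero]; linarith
  · rw [h2]
    cases h3 : w i j with
    | none => simp; linarith
    | some a => exact h i j a h3

theorem maxWeight_mem {n : ℕ} {w : Fin n → Fin n → Option ℝ} {Λ : AddSubgroup ℝ} (h1 : 1 ∈ Λ)
    (h : ∀ u v, ∀ x ∈ w u v, x ∈ Λ) : maxWeight w ∈ Λ := by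
  refine maxAbs_mem h1 fun p _ => ?_
  obtain h2 | ⟨i, j, h2⟩ := rowMajor_cases (fun u v => (w u v).getD 0) p
  · rw [h2]; exact Λ.zero_mem
  · rw [h2]
    cases h3 : w i j with
    | none => exact Λ.zero_mem
    | some a => exact h i j a h3

/-! ### The whole program, for given parameters -/

section
variable {B : ℕ} {Nm : Set ℝ} {c : Cfg}

/-- Common to both reductions, which differ only in `setup`, in the group `Λ` and in the event `G`.
The bound on `W` contains one factor `N` for the growth during `lam` squarings and another one for
the dummy value `X = 4 N M`. -/
theorem apsp_spec (hR : Room c B Nm) {Λ : AddSubgroup ℝ} {prog : RamProg} {mb B₀ : ℕ}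
    {N₀ : Set ℝ} {t : ℕ} {zb : ℕ → Bool} (hO : OracleFor c B Nm Λ prog mb B₀ N₀ t zb)
    {w : Fin c.n → Fin c.n → Option ℝ} (hw : NoNegativeCycle w) (hn : 1 ≤ c.n)
    (hlam : c.lam = Nat.log 2 c.n + 1) (hthr : c.thr = 2 * (c.N * maxWeight w))
    (hW : c.N * (4 * (c.N * maxWeight w)) ≤ c.W) {setup : RamProg} {zc : ℕ → Bool} {k : ℕ}
    {δ : ℕ → ℝ} {R : ℕ → ℕ}
    (hP : Prepares c B Nm setup (c.N * (4 * (c.N * maxWeight w))) zc k δ zb R)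
    (hδ0 : ∀ p < c.L, 0 ≤ δ p) (hδW : ∀ p < c.L, δ p ≤ c.W) (hδΛ : ∀ p < c.L, δ p ∈ Λ)
    (hδL : ∃ p, p + 1 = c.L ∧ δ p = 0) (hWΛ : c.W ∈ Λ) (h1Λ : 1 ∈ Λ)
    (hwΛ : ∀ u v, ∀ x ∈ w u v, x ∈ Λ) (hRN : ∀ q < c.rho, R q < c.N) {G : Prop}
    (hG : G → ∀ l < c.lam, ∀ D mid, (∀ i < c.N, ∀ j < c.N, D i j =
      minPlusPow c.N (initDist w (4 * (c.N * maxWeight w))) l i j) →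
      LevelGood c Λ (Reliable c prog B₀ N₀ t zb) R δ D mid) (E : ℕ → Set ℝ) :
    Runs B Nm (apspProg setup mb prog) ((allPairsShortestPaths E).start c.n w zc)
      (apspTime c k mb t) fun s' => G → (allPairsShortestPaths E).Answers c.n w s' := by
  have hM1 : 1 ≤ maxWeight w := one_le_maxAbs _ _
  have hMdef : maxWeight w =
    maxAbs (((allPairsShortestPaths E).start c.n w zc).xarr 0) (c.n * c.n) := rfl
  have hMΛ : maxWeight w ∈ Λ := maxWeight_mem h1Λ hwΛ
  have hMabs : ∀ u v, ∀ x ∈ w u v, |x| ≤ maxWeight w := fun u v x hx => abs_le_maxWeight hx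
  generalize maxWeight w = M at *
  have hN1 : (1 : ℝ) ≤ c.N := by exact_mod_cast Room.N_pos c
  have hMX : M ≤ 4 * (c.N * M) := by nlinarith
  have hX0 : 0 ≤ 4 * (c.N * M) := by linarith
  have hXΛ : 4 * (c.N * M) ∈ Λ := by
    have := Λ.nsmul_mem hMΛ (4 * c.N)
    rw [nsmul_eq_mul] at this
    push_cast at this
    rwa [mul_assoc] at this
  have hW0 := hR.W
  have hNN := hR.NN_le
  have hN0 := Room.N_pos c
  have hnN := hR.n_le
  have hnn : c.n * c.n ≤ c.N * c.N := Nat.mul_le_mul hnN hnN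
  have hNNN : c.N ≤ c.N * c.N := Nat.le_mul_of_pos_left _ hN0
  generalize hst : (allPairsShortestPaths E).start c.n w zc = st at *
  have s0 : st.wreg 0 = c.n := by rw [← hst]; rfl
  have sX : st.xarr 0 = rowMajor fun u v => (w u v).getD 0 := by rw [← hst]; rfl
  have sA : st.warr 0 = rowMajor fun u v => if (w u v).isSome then 1 else 0 := by rw [← hst]; rfl
  have s1 : st.warr 1 = fun _ => 0 := by rw [← hst]; rfl
  have sc : st.coins = zc := by rw [← hst]; rfl
  unfold apspProg apspTime
  refine Runs.weaken (k := (c.N * 20 + 40) + (c.N * c.N * 40 + (k + (5 +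
    ((c.lam * (levelTime c mb t + 2) + 2) + (c.n * c.n * 13 + 3))))))
    (Runs.seq ((dims_spec hR hn hlam s0).coins_eq ?_) ?_) (by omega) fun _ _ h => h
  · simp [dimsProg, forUpTo, RamProg.CoinFree]
  rintro st1 hF1 ⟨hd1, c1⟩
  refine Runs.seq ((init_spec hR hd1 (w := w) (M := M) (by rw [hF1.warr 0 rfl, sA])
    (by rw [hF1.xarr 0 rfl, sX]) (by rw [hF1.xarr 0 rfl]; exact hMdef)
    (by rw [mul_comm]; exact hW)).coins_eq ?_) ?_
  · simp [initProg, initBody, forUpTo, RamProg.CoinFree]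
  rintro st2 hF2 ⟨⟨a2, m2, x5, x6, x8⟩, c2⟩
  have hd2 := hd1.frame hF2 rfl
  refine Runs.seq (hP.runs st2 hd2 x8 x6 (by rw [c2, c1, sc])) ?_
  rintro st3 hF3 ⟨⟨r8, r9, r10, r11, r19, y4⟩, dδ, dz, dR⟩
  have hd3 := hd2.frame hF3 hP.keepsDims
  have hk := hP.keeps
  simp only [Bool.and_eq_true] at hk
  have y5 : st3.xreg 5 = c.thr := by rw [hF3.xreg 5 (by tauto), x5, hthr]
  have y6 : st3.xreg 6 = 0 := by rw [hF3.xreg 6 (by tauto), x6]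
  have hin : ∀ a : ℝ, 0 ≤ a → a ≤ 200 → a * c.W ∈ Nm := fun a ha ha' => hR.num _ (by
    rw [abs_of_nonneg (by positivity)]; nlinarith)
  refine Runs.seq (Runs.of_wp (p := scaleProg) (Q := fun s => s.xreg 1 = 32 * c.W ∧
    s.xreg 2 = 4 * c.W) ?_) ?_
  · have q1 : c.W + c.W = 2 * c.W := by ring
    have q2 : 2 * c.W + 2 * c.W = 4 * c.W := by ring
    have q3 : 4 * c.W + 4 * c.W = 8 * c.W := by ring
    have q4 : 8 * c.W + 8 * c.W = 16 * c.W := by ring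
    have q5 : 16 * c.W + 16 * c.W = 32 * c.W := by ring
    simp only [scaleProg, RamProg.wp, RamState.setX_xreg, y4, reduceIte, Nat.reduceEqDiff, q1, q2,
      q3, q4, q5, and_true]
    exact ⟨hin _ (by norm_num) (by norm_num), hin _ (by norm_num) (by norm_num),
      hin _ (by norm_num) (by norm_num), hin _ (by norm_num) (by norm_num),
      hin _ (by norm_num) (by norm_num)⟩
  rintro st4 hF4 ⟨z1, z2⟩
  have hd4 := hd3.frame hF4 rfl
  have hc4 : Ctx c st4 :=
    { n := hd4.n, one := hd4.one, N := hd4.N, lam := hd4.lam, s := hd4.s, g := hd4.g, m := hd4.m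
      s2 := hd4.s2, cap := hd4.cap, zero := hd4.zero, NN := hd4.NN, ggg := hd4.ggg
      sss := hd4.sss, mm := hd4.mm, ss := hd4.ss
      r := by rw [hF4.wreg 8 rfl, r8]
      tau := by rw [hF4.wreg 9 rfl, r9]
      rho := by rw [hF4.wreg 10 rfl, r10]
      L := by rw [hF4.wreg 11 rfl, r11]
      rhoNN := by rw [hF4.wreg 19 rfl, r19]
      H := z1
      big := z2
      W := by rw [hF4.xreg 4 rfl, y4]
      thr := by rw [hF4.xreg 5 rfl, y5]
      xzero := by rw [hF4.xreg 6 rfl, y6] }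
  have a4 : st4.xarr 2 = st2.xarr 2 := by rw [hF4.xarr 2 rfl, hF3.xarr 2 (by tauto)]
  have m4 : st4.warr 5 = st2.warr 5 := by rw [hF4.warr 5 rfl, hF3.warr 5 (by tauto)]
  have o4 : st4.warr 1 = fun _ => 0 := by
    rw [hF4.warr 1 rfl, hF3.warr 1 (by tauto), hF2.warr 1 rfl, hF1.warr 1 rfl, s1]
  refine Runs.seq (levels_spec hR hO hc4 rfl rfl (δ := δ) (by rw [hF4.xarr 5 rfl]; exact dδ) hδ0
    hδW hδΛ hδL hWΛ hW hX0 (fun i hi j hj => ?_) (fun i hi j hj => ?_)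
    (by rw [hF4.warr 4 rfl]; exact dz) (by rw [hF4.warr 3 rfl]; exact dR) hRN (G := G)
    (fun hg l hl D mid hD => hG hg l hl D mid fun i hi j hj => ?_)) ?_
  · rw [a4, a2 i hi j hj]
    exact abs_initDist_le hX0 (fun u v x hx => (hMabs u v x hx).trans hMX) i j
  · rw [a4, a2 i hi j hj]
    exact initDist_mem hXΛ hwΛ i j
  · rw [hD i hi j hj]
    refine minPlusPow_congr (fun i hi j hj => ?_) l i hi j hj
    rw [a4, a2 i hi j hj]
  rintro st5 hF5 ⟨⟨D, mid, hD0, hm0, hDl, hml, hL⟩, hbd⟩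
  have hc5 := hc4.frame hF5 (by
    simp [RamProg.keepsCtx, levelProg, copyProg, sampleDecode, passProg, forUpTo, tripleBody,
      blockDecode, potentialBody, voteBody, fillBody, bruteDecode, relaxProg, RamProg.keepsW,
      RamProg.keepsX])
  have o5 : st5.warr 1 = fun _ => 0 := by
    rw [hF5.warr 1 (by simp [levelProg, copyProg, sampleDecode, passProg, forUpTo, tripleBody,
        blockDecode, potentialBody, voteBody, fillBody, bruteDecode, relaxProg,
        RamProg.keepsWA]), o4]
  have hmid0 : ∀ i < c.N, ∀ j < c.N, mid 0 i j = c.n := by rw [hm0, m4]; exact m2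
  have hmidN : ∀ l ≤ c.lam, ∀ i < c.N, ∀ j < c.N, mid l i j ≤ c.N := by
    intro l
    induction l with
    | zero => intro _ i hi j hj; rw [hmid0 i hi j hj]; exact hnN
    | succ l ih =>
      intro hl i hi j hj
      obtain ⟨S, hS⟩ := hL.relaxes l hl
      obtain ⟨h1 | ⟨-, k, hk, -, -, h1⟩, -⟩ := hS i hi j hj
      · rw [h1.2]; exact ih (by omega) i hi j hj
      · rw [h1]; exact hk.le
  refine (output_spec hR hc5 hDl hml (by rw [hDl]; exact hbd) (hmidN _ le_rfl) o5).weaken le_rfl ?_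
  rintro st6 - hout hg
  have hNcast : ((2 : ℝ) ^ c.lam) = c.N := by unfold Cfg.N; push_cast; rfl
  have hcor := Levels.correct hg hL hnN (w := w) (X := 4 * (c.N * M)) (M := M)
    (by rw [hD0, a4]; exact a2) hmid0 hw hMabs hM1 (by rw [hNcast])
  rw [hNcast] at hcor
  -- Turns the bound `2 ^ lam` on the number of edges into the required `2 n`.
  have hNn : 2 ^ c.lam ≤ 2 * c.n := by
    rw [hlam, pow_succ, mul_comm]
    exact Nat.mul_le_mul_left 2 (Nat.pow_log_le_self 2 (by omega))
  intro u v
  obtain ⟨o1, o2, o3⟩ := hout u u.2 v v.2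
  have e1 : entryAt (st6.xarr 1) u v = D c.lam u v := o1
  have e2 : entryAt (st6.warr 2) = fun u v : Fin c.n => mid c.lam u v := by
    funext u v
    exact (hout u u.2 v v.2).2.1
  have e3 : entryAt (st6.warr 1) u v = if D c.lam u v < c.thr then 1 else 0 := o3
  rw [e1, e2, e3, hthr]
  rcases hcor u v with ⟨h1, h2, h3, l, hl, h4⟩ | ⟨h1, h2⟩
  · exact .inl ⟨h1, if_pos h2, h3, l, hl.trans hNn, h4⟩
  · exact .inr ⟨h1, if_neg (not_lt.2 h2)⟩

end

/-! ### Preparation of the parameters -/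

/-- The number with the binary digits `z 0, …, z (l - 1)`. -/
def binary (z : ℕ → Bool) : ℕ → ℕ
  | 0 => 0
  | l + 1 => binary z l + binary z l + (z l).toNat

theorem binary_lt (z : ℕ → Bool) (l : ℕ) : binary z l < 2 ^ l := by
  induction l with
  | zero => simp [binary]
  | succ l ih =>
    have := Bool.toNat_le (z l)
    rw [binary, pow_succ]
    omega

/-- Draw one sample. -/
def sampleProg : RamProg :=
  wconst 31 0 ;; forUpTo 24 3 (flip 32 ;; wop .add 31 31 31 ;; wop .add 31 31 32) ;; wstore 3 23 31

/-- The parameters of the randomized reduction. -/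
def randomSetup (C : ℕ) : RamProg :=
  (wop .add 8 3 1 ;; wconst 31 48 ;; wop .mul 8 8 31 ;; wconst 31 C ;; wop .mul 9 16 31 ;;
  wconst 31 3 ;; wop .mul 10 3 31 ;; wconst 31 4 ;; wop .add 10 10 31 ;; wop .mul 10 10 5 ;;
  wconst 11 1 ;; wop .mul 19 10 14 ;; xadd 4 8 6 ;; wop .mul 33 8 9 ;; xclear 5) ;;
  forUpTo 23 10 sampleProg ;; forUpTo 23 33 (flip 32 ;; wstore 4 23 32)

/-- The parameters of the deterministic reduction. -/
def deterministicSetup (C d : ℕ) : RamProg :=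
  (wconst 8 1 ;; wconst 31 C ;; wop .mul 9 16 31 ;; wconst 10 0 ;; wconst 31 (d + 2) ;;
  wop .mul 11 3 31 ;; wconst 31 6 ;; wop .add 11 11 31 ;; wconst 19 0 ;; wop .sub 32 11 1 ;;
  wclear 4 ;; xclear 5 ;; xconst 10 1) ;;
  forUpTo 23 32 (wop .sub 33 32 23 ;; wop .sub 33 33 1 ;; xstore 5 33 10 ;; xadd 10 10 10) ;;
  xadd 4 8 10

section
variable {B : ℕ} {Nm : Set ℝ} {c : Cfg}

/-- `lam` tosses form a binary number below `2 ^ lam = N`, so the samples are uniform without any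
rejection. -/
theorem sample_spec (hlam : 2 ^ c.lam ≤ B) {st : RamState} (hd : Dims c st) :
    Runs B Nm sampleProg st (c.lam * 5 + 4) fun st' =>
      st'.warr 3 = Function.update (st.warr 3) (st.wreg 23) (binary st.coins c.lam) ∧
      st'.coins = fun b => st.coins (c.lam + b) := by
  have hlB : c.lam < 2 ^ c.lam := Nat.lt_two_pow_self
  unfold sampleProg
  refine Runs.weaken (k := 1 + ((c.lam * (3 + 2) + 2) + 1)) (Runs.seq (Runs.of_wp
    (p := wconst 31 0) (Q := fun s => s = st.setW 31 0) (by simp [RamProg.wp])) ?_)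
    (by omega) fun _ _ h => h
  rintro st1 hF1 rfl
  have hd1 := hd.frame hF1 rfl
  refine Runs.seq (Runs.forUpTo (c := 3) (fun l s => s.wreg 31 = binary st.coins l ∧
    s.coins = fun b => st.coins (l + b)) hd1.lam hd1.one rfl (by omega) (by simp [binary]) ?_) ?_
  · rintro l hl st2 - - ⟨h31, hco⟩
    have h1 := binary_lt st.coins (l + 1)
    have h2 : 2 ^ (l + 1) ≤ 2 ^ c.lam := Nat.pow_le_pow_right (by norm_num) hl
    have h3 : (if st.coins l = true then 1 else 0) = (st.coins l).toNat := by
      cases st.coins l <;> rfl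
    rw [binary] at h1
    refine Runs.of_wp (p := flip 32 ;; wop .add 31 31 31 ;; wop .add 31 31 32) ?_
    simp only [RamProg.wp, WordOp.eval, RamState.toss_wreg, RamState.setW_wreg, h31, hco,
      reduceIte, Nat.reduceEqDiff, RamState.setW_coins, RamState.toss_coins, add_zero, h3, binary]
    refine ⟨by omega, by omega, by omega, trivial, ?_⟩
    funext b
    congr 1
    omega
  rintro st2 hF2 ⟨h31, hco⟩
  refine Runs.of_wp (p := wstore 3 23 31) ?_
  have e3 : st2.warr 3 = st.warr 3 := by rw [hF2.warr 3 rfl, hF1.warr 3 rfl]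
  have e23 : st2.wreg 23 = st.wreg 23 := by rw [hF2.wreg 23 rfl, hF1.wreg 23 rfl]
  simp only [RamProg.wp, RamState.storeW_warr, if_true, RamState.storeW_coins, h31, hco, e3, e23,
    and_true]

/-- The first `rho * lam` tosses go into the samples and the next `r * tau` into the array for the
votes, whence the offsets. Clearing the array of accuracies already provides the single accuracy
`0`. -/
theorem prepares_random (hR : Room c B Nm) {C : ℕ} (hC : C ≤ B) (hr : c.r = (c.lam + 1) * 48)
    (htau : c.tau = c.s * c.s * c.s * C) (hrho : c.rho = (c.lam * 3 + 4) * c.g) (hL : c.L = 1)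
    (zc : ℕ → Bool) :
    Prepares c B Nm (randomSetup C) c.W zc (c.rho * (c.lam * 5 + 6) + c.r * c.tau * 4 + 19)
      (fun _ => 0) (fun b => zc (c.rho * c.lam + b))
      (fun q => binary (fun b => zc (q * c.lam + b)) c.lam) := by
  refine ⟨rfl, rfl, fun st hd h8 h6 hco => ?_⟩
  have hrB := hR.r
  have hN8 := hR.N_le
  have hlamN : c.lam < c.N := Nat.lt_two_pow_self
  have hrt := hR.rtau
  have htr : c.tau ≤ c.r * c.tau := Nat.le_mul_of_pos_left _ (by omega)
  have hrr : c.rho ≤ c.rho * (c.N * c.N) :=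
    Nat.le_mul_of_pos_right _ (Nat.mul_pos (Room.N_pos c) (Room.N_pos c))
  have hrn := hR.rhoNN
  have hl4 : c.lam * 3 + 4 ≤ c.rho := by
    rw [hrho]; exact Nat.le_mul_of_pos_right _ (Room.g_pos c)
  have hsteps : c.rho * (c.lam * 5 + 4 + 2) = c.rho * (c.lam * 5 + 6) := rfl
  unfold randomSetup
  refine Runs.weaken (k := 15 + ((c.rho * (c.lam * 5 + 4 + 2) + 2) + (c.r * c.tau * (2 + 2) + 2)))
    (Runs.seq (Runs.of_wp (p := wop .add 8 3 1 ;; wconst 31 48 ;; wop .mul 8 8 31 ;;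
    wconst 31 C ;; wop .mul 9 16 31 ;;
    wconst 31 3 ;; wop .mul 10 3 31 ;; wconst 31 4 ;; wop .add 10 10 31 ;; wop .mul 10 10 5 ;;
    wconst 11 1 ;; wop .mul 19 10 14 ;; xadd 4 8 6 ;; wop .mul 33 8 9 ;; xclear 5)
    (Q := fun s => (s.wreg 8 = c.r ∧ s.wreg 9 = c.tau ∧
      s.wreg 10 = c.rho ∧ s.wreg 11 = c.L ∧ s.wreg 19 = c.rho * (c.N * c.N) ∧
      s.xreg 4 = c.W) ∧ s.xarr 5 = (fun _ => 0) ∧ s.wreg 33 = c.r * c.tau ∧ s.coins = zc) ?_) ?_)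
    (by omega) fun _ _ h => h
  · simp only [RamProg.wp, WordOp.eval, RamState.setX_wreg, RamState.setX_xreg, RamState.clearX_wreg,
      RamState.clearX_xreg, RamState.clearX_xarr, RamState.setW_wreg, RamState.setW_xreg,
      RamState.setW_coins, RamState.setX_coins, RamState.clearX_coins, hd.lam, hd.one, hd.sss,
      hd.g, hd.NN, h8, h6, hco, reduceIte, Nat.reduceEqDiff, ← hr, ← htau, ← hrho, hL, add_zero,
      and_true]
    refine ⟨by omega, by omega, by omega, by omega, by omega, by omega, by omega, by omega,
      by omega, by omega, by omega, by omega, ?_, by omega⟩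
    exact hR.num _ (by rw [abs_of_nonneg hR.W]; linarith [hR.W])
  rintro st1 hF1 ⟨h1, ha, h33, hc1⟩
  have hd1 := hd.frame hF1 rfl
  refine Runs.seq (Runs.forUpTo (c := c.lam * 5 + 4) (fun q s => (∀ e < q, s.warr 3 e =
    binary (fun b => zc (e * c.lam + b)) c.lam) ∧ s.coins = fun b => zc (q * c.lam + b))
    h1.2.2.1 hd1.one rfl (by omega) (by simp [hc1]) ?_) ?_
  · rintro q hq st2 h23 hF2 ⟨hI, hco2⟩
    refine (sample_spec (hR.N_le.trans' (by unfold Cfg.N; omega)) (hd1.frame hF2 rfl)).weaken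
      le_rfl ?_
    rintro st3 - ⟨e3, eco⟩
    constructor
    · intro e he
      rw [RamState.setW_warr, e3, h23, hco2]
      rcases Nat.lt_succ_iff_lt_or_eq.1 he with h | rfl
      · rw [Function.update_of_ne h.ne, hI e h]
      · rw [Function.update_self]
    · rw [RamState.setW_coins, eco, hco2]
      funext b
      change zc (q * c.lam + (c.lam + b)) = zc ((q + 1) * c.lam + b)
      congr 1
      ring
  rintro st2 hF2 ⟨hI2, hco2⟩
  have hd2 := hd1.frame hF2 rfl
  refine Runs.weaken (Runs.forUpTo (c := 2) (fun q s => (∀ e < q, s.warr 4 e =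
    (zc (c.rho * c.lam + e)).toNat) ∧ s.coins = fun b => zc (c.rho * c.lam + (q + b)))
    (by rw [hF2.wreg 33 rfl, h33]) hd2.one rfl hrt (by simp [hco2]) ?_) le_rfl ?_
  · rintro q hq st3 h23 hF3 ⟨hI, hco3⟩
    have h3 : (if zc (c.rho * c.lam + q) = true then 1 else 0) = (zc (c.rho * c.lam + q)).toNat := by
      cases zc (c.rho * c.lam + q) <;> rfl
    refine Runs.of_wp (p := flip 32 ;; wstore 4 23 32) ?_
    simp only [RamProg.wp, RamState.toss_wreg, RamState.toss_warr, RamState.toss_coins,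
      RamState.storeW_warr, RamState.storeW_coins, RamState.setW_warr, RamState.setW_coins,
      reduceIte, Nat.reduceEqDiff, hco3, h23, add_zero, h3]
    refine ⟨by omega, fun e he => ?_, ?_⟩
    · rcases Nat.lt_succ_iff_lt_or_eq.1 he with h | rfl
      · rw [Function.update_of_ne h.ne, hI e h]
      · rw [Function.update_self]
    · funext b
      congr 1
      omega
  · rintro st3 hF3 ⟨hI3, -⟩
    refine ⟨?_, ?_, hI3, ?_⟩
    · rw [hF3.wreg 8 rfl, hF3.wreg 9 rfl, hF3.wreg 10 rfl, hF3.wreg 11 rfl, hF3.wreg 19 rfl,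
        hF3.xreg 4 rfl, hF2.wreg 8 rfl, hF2.wreg 9 rfl, hF2.wreg 10 rfl, hF2.wreg 11 rfl,
        hF2.wreg 19 rfl, hF2.xreg 4 rfl]
      exact h1
    · intro p _
      rw [hF3.xarr 5 rfl, hF2.xarr 5 rfl, ha]
    · rw [hF3.warr 3 rfl]
      exact hI2

/-- The accuracies of the passes. -/
noncomputable def accuracy (L p : ℕ) : ℝ :=
  if p + 1 < L then 2 ^ (L - 2 - p) else 0

theorem prepares_deterministic (hR : Room c B Nm) {C d : ℕ} (hC : C ≤ B) (hr : c.r = 1)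
    (htau : c.tau = c.s * c.s * c.s * C) (hrho : c.rho = 0) (hL : c.L = c.lam * (d + 2) + 6)
    {Y : ℝ} (hY : 0 ≤ Y) (hW : c.W = Y + 2 ^ (c.L - 1)) (zc : ℕ → Bool) (R : ℕ → ℕ) :
    Prepares c B Nm (deterministicSetup C d) Y zc (c.L * 6 + 16)
      (accuracy c.L) (fun _ => false) R := by
  refine ⟨rfl, rfl, fun st hd h8 h6 hco => ?_⟩
  have hrt := hR.rtau
  have hLB := hR.L
  have hlam := hR.lam_pos
  have hdB : d + 2 ≤ c.lam * (d + 2) := Nat.le_mul_of_pos_left _ hlam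
  rw [hr, one_mul] at hrt
  unfold deterministicSetup
  refine Runs.weaken (k := 13 + (((c.L - 1) * (4 + 2) + 2) + 1))
    (Runs.seq (Runs.of_wp (p := wconst 8 1 ;; wconst 31 C ;; wop .mul 9 16 31 ;; wconst 10 0 ;;
    wconst 31 (d + 2) ;; wop .mul 11 3 31 ;; wconst 31 6 ;; wop .add 11 11 31 ;; wconst 19 0 ;;
    wop .sub 32 11 1 ;; wclear 4 ;; xclear 5 ;; xconst 10 1)
    (Q := fun s => (s.wreg 8 = c.r ∧ s.wreg 9 = c.tau ∧
      s.wreg 10 = c.rho ∧ s.wreg 11 = c.L ∧ s.wreg 19 = c.rho * (c.N * c.N)) ∧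
      s.xarr 5 = (fun _ => 0) ∧ s.warr 4 = (fun _ => 0) ∧ s.wreg 32 = c.L - 1 ∧ s.xreg 10 = 1) ?_) ?_)
    (by omega) fun _ _ h => h
  · have hone : ((1 : ℤ) : ℝ) ∈ Nm := by
      refine hR.num _ ?_
      have : (1 : ℝ) ≤ 2 ^ (c.L - 1) := one_le_pow₀ (by norm_num)
      simp
      linarith
    simp only [RamProg.wp, WordOp.eval, RamState.setX_wreg, RamState.setX_xreg, RamState.clearX_wreg,
      RamState.clearX_xarr, RamState.setW_wreg, RamState.clearW_wreg, RamState.clearW_warr,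
      RamState.setX_warr, RamState.setX_xarr, RamState.clearX_warr, hd.lam, hd.one, hd.sss,
      reduceIte, Nat.reduceEqDiff, ← htau, hr, hrho, ← hL, zero_mul, hone, and_true]
    refine ⟨by omega, by omega, by omega, by omega, by omega, by omega, by omega, by omega,
      by omega, by omega, trivial, by simp⟩
  rintro st1 hF1 ⟨h1, ha, hz, h32, h10⟩
  have hd1 := hd.frame hF1 rfl
  have h8' : st1.xreg 8 = Y := by rw [hF1.xreg 8 rfl, h8]
  have hpow : ∀ q ≤ c.L - 1, (2 : ℝ) ^ q ∈ Nm := by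
    intro q hq
    refine hR.num _ ?_
    have : (2 : ℝ) ^ q ≤ 2 ^ (c.L - 1) := pow_le_pow_right₀ (by norm_num) hq
    rw [abs_of_nonneg (by positivity)]
    have := hR.W
    linarith
  -- The accuracies are written from the end, while the power of two grows. After `q` rounds those
  -- with index at least `L - 1 - q` are in place; the last one is the `0` left by the clearing.
  refine Runs.seq (Runs.forUpTo (c := 4) (fun q s => s.xreg 10 = 2 ^ q ∧ ∀ p < c.L,
    s.xarr 5 p = if c.L ≤ p + q + 1 then accuracy c.L p else 0) h32 hd1.one rfl (by omega) ?_ ?_) ?_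
  · refine ⟨by simp [h10], fun p hp => ?_⟩
    simp only [RamState.setW_xarr, ha]
    split_ifs with h
    · simp only [accuracy]
      rw [if_neg (by omega)]
    · rfl
  · rintro q hq st2 h23 hF2 ⟨hI1, hI2⟩
    have hd2 := hd1.frame hF2 rfl
    have e32 : st2.wreg 32 = c.L - 1 := by rw [hF2.wreg 32 rfl, h32]
    refine Runs.of_wp (p := wop .sub 33 32 23 ;; wop .sub 33 33 1 ;; xstore 5 33 10 ;;
      xadd 10 10 10) ?_
    have hdbl : (2 : ℝ) ^ q + 2 ^ q = 2 ^ (q + 1) := by ring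
    simp only [RamProg.wp, WordOp.eval, RamState.setW_wreg, RamState.setW_xarr, RamState.setW_xreg,
      RamState.setX_xarr, RamState.setX_xreg, RamState.storeX_xreg, RamState.storeX_xarr, reduceIte,
      Nat.reduceEqDiff, e32, h23, hd2.one, hI1, hdbl]
    refine ⟨by omega, by omega, hpow _ (by omega), trivial, fun p hp => ?_⟩
    by_cases hpq : p = c.L - 1 - q - 1
    · rw [hpq, Function.update_self, if_pos (by omega)]
      simp only [accuracy]
      rw [if_pos (by omega)]
      congr 1
      omega
    · rw [Function.update_of_ne hpq, hI2 p hp]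
      have : c.L ≤ p + q + 1 ↔ c.L ≤ p + (q + 1) + 1 := by omega
      simp only [this]
  rintro st2 hF2 ⟨hI1, hI2⟩
  have e8 : st2.xreg 8 = Y := by rw [hF2.xreg 8 rfl, h8']
  refine Runs.of_wp (p := xadd 4 8 10) ?_
  simp only [RamProg.wp, RamState.setX_xreg, RamState.setX_wreg, RamState.setX_xarr,
    RamState.setX_warr, RamState.setX_xreg, if_true, e8, hI1, ← hW]
  refine ⟨hR.num _ (by rw [abs_of_nonneg hR.W]; linarith [hR.W]), ?_, fun p hp => ?_, ?_, ?_⟩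
  · rw [hF2.wreg 8 rfl, hF2.wreg 9 rfl, hF2.wreg 10 rfl, hF2.wreg 11 rfl, hF2.wreg 19 rfl]
    tauto
  · rw [hI2 p hp, if_pos (by omega)]
  · intro b _
    rw [hF2.warr 4 rfl, hz]
    rfl
  · rw [hrho]
    simp

end

/-! ### The deterministic passes -/

/-- The infimum is taken over a finite nonempty set and is attained. -/
theorem minPlusPow_succ_cases {N : ℕ} (D : ℕ → ℕ → ℝ) (l i j : ℕ) :
    minPlusPow N D (l + 1) i j = minPlusPow N D l i j ∨ ∃ k < N,
      minPlusPow N D (l + 1) i j = minPlusPow N D l i k + minPlusPow N D l k j := by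
  have h := Set.Nonempty.csInf_mem (Set.insert_nonempty (minPlusPow N D l i j)
      ((fun k => minPlusPow N D l i k + minPlusPow N D l k j) '' Set.Iio N))
      (((Set.finite_Iio N).image _).insert _)
  rcases h with h | ⟨k, hk, h⟩
  · exact .inl h
  · exact .inr ⟨k, hk, h.symm⟩

theorem abs_minPlusPow_le {N : ℕ} {D : ℕ → ℕ → ℝ} {X : ℝ} (hX : 0 ≤ X)
    (h : ∀ i < N, ∀ j < N, |D i j| ≤ X) (l : ℕ) :
    ∀ i < N, ∀ j < N, |minPlusPow N D l i j| ≤ 2 ^ l * X := by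
  induction l with
  | zero => simpa [minPlusPow] using h
  | succ l ih =>
    intro i hi j hj
    have hp : 0 ≤ 2 ^ l * X := by positivity
    have e : (2 : ℝ) ^ (l + 1) * X = 2 ^ l * X + 2 ^ l * X := by ring
    rw [e]
    rcases minPlusPow_succ_cases (N := N) D l i j with h1 | ⟨k, hk, h1⟩
    · rw [h1]; linarith [ih i hi j hj]
    · rw [h1]
      exact (abs_add_le _ _).trans (add_le_add (ih i hi k hk) (ih k hk j hj))

theorem minPlusPow_mem {N : ℕ} {D : ℕ → ℕ → ℝ} {Λ : AddSubgroup ℝ}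
    (h : ∀ i < N, ∀ j < N, D i j ∈ Λ) (l : ℕ) :
    ∀ i < N, ∀ j < N, minPlusPow N D l i j ∈ Λ := by
  induction l with
  | zero => simpa [minPlusPow] using h
  | succ l ih =>
    intro i hi j hj
    rcases minPlusPow_succ_cases (N := N) D l i j with h1 | ⟨k, hk, h1⟩
    · rw [h1]; exact ih i hi j hj
    · rw [h1]; exact Λ.add_mem (ih i hi k hk) (ih k hk j hj)

/-- The integers, as real numbers. -/
def intSubgroup : AddSubgroup ℝ := (Int.castAddHom ℝ).range

theorem accuracy_nonneg (L p : ℕ) : 0 ≤ accuracy L p := by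
  unfold accuracy; split_ifs <;> positivity

theorem accuracy_le (L p : ℕ) : accuracy L p ≤ 2 ^ (L - 1) := by
  unfold accuracy
  split_ifs
  · exact pow_le_pow_right₀ (by norm_num) (by omega)
  · positivity

theorem accuracy_mem (L p : ℕ) : accuracy L p ∈ intSubgroup := by
  unfold accuracy
  split_ifs
  · exact ⟨2 ^ (L - 2 - p), by simp⟩
  · exact intSubgroup.zero_mem

/-- The accuracies halve down to `1` and then drop to `0`. The maximum with `1` covers this drop,
since `1` is the least gain among integers. -/
theorem accuracy_le_succ (L p : ℕ) : accuracy L p ≤ 2 * max (accuracy L (p + 1)) 1 := by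
  have h1 := le_max_right (accuracy L (p + 1)) 1
  have h2 := le_max_left (accuracy L (p + 1)) 1
  by_cases hp : p + 1 + 1 < L
  · have e1 : accuracy L (p + 1) = 2 ^ (L - 2 - (p + 1)) := if_pos hp
    have e2 : accuracy L p = 2 ^ (L - 2 - (p + 1) + 1) := by
      rw [accuracy, if_pos (by omega)]
      congr 1
      omega
    rw [e2, pow_succ', ← e1]
    linarith
  · unfold accuracy at *
    split_ifs at * with h3
    · have : L - 2 - p = 0 := by omega
      rw [this]
      linarith [pow_zero (2 : ℝ)]
    · linarith

/-- The potential is the distance to a lower bound `μ i j` for all sums, rounded up in units of `max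
δ 1`. An improvement by more than `δ` gains at least one unit, because all numbers are integers. -/
theorem exists_integer_potential {N s : ℕ} {δ : ℝ} {D T : ℕ → ℕ → ℝ} (hs : 2 ≤ s)
    (hδ : 0 ≤ δ) (hD : ∀ i < N, ∀ j < N, D i j ∈ intSubgroup)
    (hT : ∀ i < N, ∀ j < N, ∃ μ, (∀ k < N, μ ≤ D i k + D k j) ∧ T i j ≤ μ + 2 * max δ 1) :
    ∃ φ : ℕ → ℕ → ℝ → ℕ, (∀ i < N, ∀ j < N, Monotone (φ i j)) ∧
      (∀ i < N, ∀ j < N, ∀ k < N, ∀ x ∈ intSubgroup, D i k + D k j + δ < x →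
        φ i j (D i k + D k j) < φ i j x) ∧
      ∀ i < N, ∀ j < N, φ i j (T i j) ≤ s := by
  choose! μ hμ hTμ using hT
  have hm : 0 < max δ 1 := by positivity
  refine ⟨fun i j x => ⌈(x - μ i j) / max δ 1⌉₊, fun i hi j hj x y hxy => ?_,
    fun i hi j hj k hk x hx hlt => ?_, fun i hi j hj => ?_⟩
  · exact Nat.ceil_mono (by gcongr)
  · have h1 : D i k + D k j + max δ 1 ≤ x := by
      rcases max_choice δ 1 with h | h
      · rw [h]; exact hlt.le
      · rw [h]
        have h2 := intSubgroup.add_mem (hD i hi k hk) (hD k hk j hj)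
        obtain ⟨a, ha⟩ := hx
        obtain ⟨b, hb⟩ := h2
        simp only [Int.coe_castAddHom] at ha hb
        rw [← ha, ← hb] at hlt ⊢
        have : (b : ℝ) < a := by linarith
        exact_mod_cast Int.add_one_le_of_lt (by exact_mod_cast this)
    have h2 : 0 ≤ (D i k + D k j - μ i j) / max δ 1 :=
      div_nonneg (sub_nonneg.2 (hμ i hi j hj k hk)) hm.le
    have h3 : (D i k + D k j - μ i j) / max δ 1 + 1 ≤ (x - μ i j) / max δ 1 := by
      rw [div_add_one hm.ne']
      gcongr
      linarith
    have h4 := Nat.ceil_mono h3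
    rw [Nat.ceil_add_one h2] at h4
    exact h4
  -- At the start an entry is at most two units above its lower bound, and `s ≥ 2`.
  · refine le_trans (Nat.ceil_le.2 ?_) hs
    rw [div_le_iff₀ hm]
    push_cast
    linarith [hTμ i hi j hj]

section
variable {B : ℕ} {Nm : Set ℝ} {c : Cfg}

/-- A pass inherits from its predecessor that every entry exceeds each sum by at most the previous
accuracy, which is at most two units of the present pass. The votes never fail, so only the size and
integrality of the queries matter. -/
theorem levelGood_deterministic (hR : Room c B Nm)
    {Rel : (Fin (2 * c.s - 1) → Fin (2 * c.s - 1) → ℝ) → Prop}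
    (hRel : ∀ M, (∀ a b, M a b ∈ intSubgroup ∧ |M a b| ≤ 132 * c.W) → Rel M) (R : ℕ → ℕ)
    {D : ℕ → ℕ → ℝ} {mid : ℕ → ℕ → ℕ} (hWΛ : c.W ∈ intSubgroup) {V : ℝ} (hVW : 2 * V ≤ c.W)
    (hL : 2 ≤ c.L) (hV : 3 * V ≤ 2 ^ (c.L - 1)) (hLW : 2 ^ (c.L - 1) ≤ c.W)
    (hDV : ∀ i < c.N, ∀ j < c.N, |D i j| ≤ V) (hDΛ : ∀ i < c.N, ∀ j < c.N, D i j ∈ intSubgroup) :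
    LevelGood c intSubgroup Rel R (accuracy c.L) D mid := by
  intro T₀ mid₀ hT₀ p hp T mid' ⟨S, hS⟩ h0 hprev
  have hDW : ∀ i < c.N, ∀ j < c.N, |D i j| ≤ 2 * V := fun i hi j hj => by
    linarith [abs_nonneg (D i j), hDV i hi j hj]
  have hT₀V := hT₀.abs_le hDV hDW
  have hTV := hS.abs_le hDV hT₀V
  have hTΛ := hS.mem hDΛ (hT₀.mem hDΛ hDΛ)
  refine ⟨fun q hq T' ⟨⟨S', m, m', _, hS'⟩, _⟩ => hRel _ fun a b => ?_,
    exists_integer_potential (Room.two_le_s c) (accuracy_nonneg _ _) hDΛ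
    fun i hi j hj => ?_⟩
  · exact (blockMatrix_mem hR hq (accuracy_nonneg _ _) ((accuracy_le _ _).trans hLW)
      (accuracy_mem _ _) hWΛ (fun i hi j hj => (hDW i hi j hj).trans hVW)
      (fun i hi j hj => (hS'.abs_le hDV hTV i hi j hj).trans hVW) hDΛ (hS'.mem hDΛ hTΛ)).1 a b
  · cases p with
    | zero =>
      -- The first pass has no predecessor; the sums are at least `-2 V` and the entries at most
      -- `V`, and `3 V` is within twice the first accuracy.
      refine ⟨-(2 * V), fun k hk => ?_, ?_⟩
      · linarith [(abs_le.1 (hDV i hi k hk)).1, (abs_le.1 (hDV k hk j hj)).1]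
      · have h1 := hS.le hi hj
        have h2 := hT₀.le hi hj
        have h3 := (abs_le.1 (hDV i hi j hj)).2
        have h4 : accuracy c.L 0 = 2 ^ (c.L - 2) := if_pos (by omega)
        have h5 : (2 : ℝ) ^ (c.L - 1) = 2 * 2 ^ (c.L - 2) := by
          rw [← pow_succ']
          congr 1
          omega
        linarith [le_max_left (accuracy c.L 0) 1]
    | succ p =>
      -- This is a lower bound for the sums by what the previous pass has achieved.
      refine ⟨T i j - accuracy c.L p, fun k hk => ?_, ?_⟩
      · linarith [hprev p rfl i hi j hj k hk]
      · linarith [accuracy_le_succ c.L p]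

end

/-! ### Every algorithm for Maximum Subarray reads the input -/

/-- The configurations agree, except for cells outside `R` of the numeric array `0`. -/
structure AgreeOn (R : Finset ℕ) (s s' : RamState) : Prop where
  wreg : s'.wreg = s.wreg
  xreg : s'.xreg = s.xreg
  warr : s'.warr = s.warr
  coins : s'.coins = s.coins
  xarr : ∀ a m, (a = 0 → m ∈ R) → s'.xarr a m = s.xarr a m

/-- Each load adds at most one cell. The claim for all larger sets `R'` is what allows consecutive
parts of a run to be combined. Stores preserve the agreement, since both runs write the same value
to the same cell. -/
theorem RunsTo.exists_reads {B : ℕ} {N : Set ℝ} {p : RamProg} {s s' : RamState} {k : ℕ}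
    (h : RunsTo B N p s k s') : ∃ R : Finset ℕ, R.card ≤ k ∧ ∀ R', R ⊆ R' → ∀ σ, AgreeOn R' s σ →
      ∃ σ', RunsTo B N p σ k σ' ∧ AgreeOn R' s' σ' := by
  induction h with
  | skip s => exact ⟨∅, by simp, fun R' _ σ hσ => ⟨σ, .skip σ, hσ⟩⟩
  | wconst s i c h =>
    exact ⟨∅, by simp, fun R' _ σ hσ => ⟨_, .wconst σ i c h, { hσ with
      wreg := by simp only [RamState.setW, hσ.wreg] }⟩⟩
  | wop s o i j k h =>
    refine ⟨∅, by simp, fun R' _ σ hσ => ⟨_, .wop σ o i j k (by rwa [hσ.wreg]), { hσ with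
      wreg := by simp only [RamState.setW, hσ.wreg] }⟩⟩
  | wload s i a j h =>
    refine ⟨∅, by simp, fun R' _ σ hσ => ⟨_, .wload σ i a j (by rwa [hσ.wreg, hσ.warr]), { hσ with
      wreg := by simp only [RamState.setW, hσ.wreg, hσ.warr] }⟩⟩
  | wstore s a j i =>
    refine ⟨∅, by simp, fun R' _ σ hσ => ⟨_, .wstore σ a j i, { hσ with
      warr := by simp only [RamState.storeW, hσ.wreg, hσ.warr] }⟩⟩
  | wclear s a =>
    refine ⟨∅, by simp, fun R' _ σ hσ => ⟨_, .wclear σ a, { hσ with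
      warr := by simp only [RamState.clearW, hσ.warr] }⟩⟩
  | xconst s i z h =>
    refine ⟨∅, by simp, fun R' _ σ hσ => ⟨_, .xconst σ i z h, { hσ with
      xreg := by simp only [RamState.setX, hσ.xreg] }⟩⟩
  | xadd s i j k h =>
    refine ⟨∅, by simp, fun R' _ σ hσ => ⟨_, .xadd σ i j k (by rwa [hσ.xreg]), { hσ with
      xreg := by simp only [RamState.setX, hσ.xreg] }⟩⟩
  | xsub s i j k h =>
    refine ⟨∅, by simp, fun R' _ σ hσ => ⟨_, .xsub σ i j k (by rwa [hσ.xreg]), { hσ with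
      xreg := by simp only [RamState.setX, hσ.xreg] }⟩⟩
  | xload s i a j h =>
    refine ⟨{s.wreg j}, by simp, fun R' hR σ hσ => ?_⟩
    have e : σ.xarr a (σ.wreg j) = s.xarr a (s.wreg j) := by
      rw [hσ.wreg]
      exact hσ.xarr a _ fun _ => hR (Finset.mem_singleton_self _)
    exact ⟨_, .xload σ i a j (by rwa [e]), { hσ with
      xreg := by simp only [RamState.setX, hσ.xreg, e] }⟩
  | xstore s a j i =>
    refine ⟨∅, by simp, fun R' _ σ hσ => ⟨_, .xstore σ a j i, { hσ with
      xarr := fun b m hm => ?_ }⟩⟩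
    simp only [RamState.storeX_xarr, hσ.wreg, hσ.xreg]
    split_ifs with h
    · subst h
      rcases eq_or_ne m (s.wreg j) with rfl | h
      · simp
      · rw [Function.update_of_ne h, Function.update_of_ne h, hσ.xarr b m hm]
    · exact hσ.xarr b m hm
  | xclear s a =>
    refine ⟨∅, by simp, fun R' _ σ hσ => ⟨_, .xclear σ a, { hσ with
      xarr := fun b m hm => ?_ }⟩⟩
    simp only [RamState.clearX_xarr]
    split_ifs with h
    · rfl
    · exact hσ.xarr b m hm
  | flip s i h =>
    refine ⟨∅, by simp, fun R' _ σ hσ => ⟨_, .flip σ i h, { hσ with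
      wreg := by simp only [RamState.toss, RamState.setW, hσ.wreg, hσ.coins]
      coins := by simp only [RamState.toss_coins, hσ.coins] }⟩⟩
  | seq _ _ h1 h2 =>
    obtain ⟨R1, c1, a1⟩ := h1
    obtain ⟨R2, c2, a2⟩ := h2
    refine ⟨R1 ∪ R2, (Finset.card_union_le _ _).trans (by omega), fun R' hR σ hσ => ?_⟩
    obtain ⟨σ', r1, b1⟩ := a1 R' (Finset.union_subset_left hR) σ hσ
    obtain ⟨σ'', r2, b2⟩ := a2 R' (Finset.union_subset_right hR) σ' b1
    exact ⟨σ'', r1.seq r2, b2⟩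
  | ifwTrue h _ h1 =>
    obtain ⟨R1, c1, a1⟩ := h1
    refine ⟨R1, by omega, fun R' hR σ hσ => ?_⟩
    obtain ⟨σ', r1, b1⟩ := a1 R' hR σ hσ
    exact ⟨σ', .ifwTrue (by rwa [hσ.wreg]) r1, b1⟩
  | ifwFalse h _ h1 =>
    obtain ⟨R1, c1, a1⟩ := h1
    refine ⟨R1, by omega, fun R' hR σ hσ => ?_⟩
    obtain ⟨σ', r1, b1⟩ := a1 R' hR σ hσ
    exact ⟨σ', .ifwFalse (by rwa [hσ.wreg]) r1, b1⟩
  | ifxTrue h _ h1 =>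
    obtain ⟨R1, c1, a1⟩ := h1
    refine ⟨R1, by omega, fun R' hR σ hσ => ?_⟩
    obtain ⟨σ', r1, b1⟩ := a1 R' hR σ hσ
    exact ⟨σ', .ifxTrue (by rwa [hσ.xreg]) r1, b1⟩
  | ifxFalse h _ h1 =>
    obtain ⟨R1, c1, a1⟩ := h1
    refine ⟨R1, by omega, fun R' hR σ hσ => ?_⟩
    obtain ⟨σ', r1, b1⟩ := a1 R' hR σ hσ
    exact ⟨σ', .ifxFalse (by rwa [hσ.xreg]) r1, b1⟩
  | loopStop h =>
    exact ⟨∅, by simp, fun R' _ σ hσ => ⟨σ, .loopStop (by rwa [hσ.wreg]), hσ⟩⟩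
  | loopStep h _ _ h1 h2 =>
    obtain ⟨R1, c1, a1⟩ := h1
    obtain ⟨R2, c2, a2⟩ := h2
    refine ⟨R1 ∪ R2, (Finset.card_union_le _ _).trans (by omega), fun R' hR σ hσ => ?_⟩
    obtain ⟨σ', r1, b1⟩ := a1 R' (Finset.union_subset_left hR) σ hσ
    obtain ⟨σ'', r2, b2⟩ := a2 R' (Finset.union_subset_right hR) σ' b1
    exact ⟨σ'', .loopStep (by rwa [hσ.wreg]) r1 r2, b2⟩

/-- The matrix with one entry `1` and all other entries `0`. -/
def unitMatrix {n : ℕ} (p : Fin n × Fin n) : Fin n → Fin n → ℝ :=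
  fun i j => if (i, j) = p then 1 else 0

theorem isGreatest_subarraySums_zero {n : ℕ} {x : ℝ}
    (h : IsGreatest (subarraySums (fun _ _ : Fin n => 0)) x) : x = 0 := by
  obtain ⟨i, i', j, j', -, -, hx⟩ := h.1
  simpa using hx

theorem isGreatest_subarraySums_unitMatrix {n : ℕ} {p : Fin n × Fin n} {x : ℝ}
    (h : IsGreatest (subarraySums (unitMatrix p)) x) : x ≠ 0 := by
  have h1 : (1 : ℝ) ∈ subarraySums (unitMatrix p) :=
    ⟨p.1, p.1, p.2, p.2, le_rfl, le_rfl, by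
      rw [Finset.Icc_self, Finset.Icc_self, Finset.sum_singleton, Finset.sum_singleton,
        unitMatrix, if_pos rfl]⟩
  have := h.2 h1
  linarith

/-- A run of `k` steps that is correct for the zero matrix has not read more than `k` entries, and
it is wrong for the unit matrices that belong to the other entries. -/
theorem exists_reads_of_runsTo {B : ℕ} {N : Set ℝ} {prog : RamProg} {n k : ℕ} (E : ℕ → Set ℝ)
    {r : ℕ → Bool} {s : RamState}
    (h : RunsTo B N prog ((maxSubarray E).start n (fun _ _ => (0 : ℝ)) r) k s) :
    ∃ R : Finset (Fin n × Fin n), R.card ≤ k ∧ ∀ p ∉ R, ∀ k' s',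
      RunsTo B N prog ((maxSubarray E).start n (unitMatrix p) r) k' s' → s'.xreg 0 = s.xreg 0 := by
  obtain ⟨R, hR, hag⟩ := h.exists_reads
  refine ⟨Finset.univ.filter fun p => (p.1 : ℕ) * n + p.2 ∈ R, ?_, fun p hp k' s' h' => ?_⟩
  · refine le_trans (Finset.card_le_card_of_injOn (fun p => (p.1 : ℕ) * n + p.2) ?_ ?_) hR
    · intro p hp
      simpa using hp
    · intro p _ q _ hpq
      have := (mul_add_inj p.2.2 q.2.2).1 hpq
      exact Prod.ext (Fin.ext this.1) (Fin.ext this.2)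
  · have hx : ∀ a m, (a = 0 → m ∈ R) → ((maxSubarray E).start n (unitMatrix p) r).xarr a m =
        ((maxSubarray E).start n (fun _ _ => (0 : ℝ)) r).xarr a m := by
      intro a m hm
      simp only [maxSubarray]
      split_ifs with ha
      · unfold rowMajor
        split_ifs with hmn
        · unfold unitMatrix
          rw [if_neg]
          rintro rfl
          apply hp
          simp only [Finset.mem_filter, Finset.mem_univ, true_and]
          rw [Nat.div_add_mod']
          exact hm ha
        · rfl
      · rfl
    obtain ⟨σ, h1, h2⟩ := hag R subset_rfl ((maxSubarray E).start n (unitMatrix p) r)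
      ⟨rfl, rfl, rfl, rfl, hx⟩
    rw [← (h1.deterministic h').2, h2.xreg]

/-! ### Lower bounds on the running time of Maximum Subarray -/

theorem exists_mul_rpow_lt {e : ℝ} (he : e < 2) (C : ℝ) :
    ∃ n : ℕ, 1 ≤ n ∧ 3 * (C * (n : ℝ) ^ e) < n * n := by
  have h := (tendsto_rpow_atTop (show 0 < 2 - e by linarith)).comp
    (tendsto_natCast_atTop_atTop (R := ℝ))
  obtain ⟨n, hn, hn1⟩ := ((h.eventually_gt_atTop (3 * C)).and
    (Filter.eventually_ge_atTop 1)).exists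
  refine ⟨n, hn1, ?_⟩
  have hn0 : (0 : ℝ) < n := by exact_mod_cast hn1
  have h1 : (n : ℝ) * n = (n : ℝ) ^ (2 - e) * (n : ℝ) ^ e := by
    rw [← Real.rpow_add hn0, sub_add_cancel, Real.rpow_two, sq]
  rw [h1, ← mul_assoc]
  exact mul_lt_mul_of_pos_right hn (by positivity)

/-- The run on the zero matrix must read every entry, since the matrix with a single `1` in an
unread cell would receive the same answer. The entries `0` and `1` are admissible even if `c = 0`.
-/
theorem not_deterministicTime {e : ℝ} (he : e < 2) (c : ℕ) :
    ¬ (maxSubarray fun n => {x | IsSmallInt c n x}).DeterministicTime e := by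
  rintro ⟨prog, C, K, d, t, -, h⟩
  obtain ⟨n, hn, hlt⟩ := exists_mul_rpow_lt he C
  obtain ⟨ht, hI⟩ := h n hn
  have hn0 : (0 : ℤ) < (n : ℤ) := by exact_mod_cast hn
  obtain ⟨k, hk, s, hr, hs⟩ := hI (fun _ _ => 0) fun i j => ⟨0, by simp, by simp⟩
  obtain ⟨R, hR, hout⟩ := exists_reads_of_runsTo _ hr
  have hall : ∀ p, p ∈ R := by
    intro p
    by_contra hp
    obtain ⟨k', hk', s', hr', hs'⟩ := hI (unitMatrix p) fun i j => by
      unfold unitMatrix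
      split_ifs
      · exact ⟨1, by simp, by rw [abs_one]; exact one_le_pow₀ (by omega)⟩
      · exact ⟨0, by simp, by simp⟩
    have h1 := hout p hp k' s' hr'
    rw [isGreatest_subarraySums_zero hs] at h1
    exact isGreatest_subarraySums_unitMatrix hs' h1
  have hcard : R.card = n * n := by
    rw [Finset.eq_univ_iff_forall.2 hall]
    simp
  have h2 : ((n * n : ℕ) : ℝ) ≤ t n := by exact_mod_cast (by omega : n * n ≤ t n)
  push_cast at h2
  nlinarith

/-- Each cell is read, on the zero matrix, for at least one third of the toss sequences. Double
counting of pairs of a cell and a toss sequence gives `n² ≤ 3 t n`. -/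
theorem not_randomizedTime {e : ℝ} (he : e < 2) :
    ¬ (maxSubarray fun _ => Set.univ).RandomizedTime e := by
  classical
  rintro ⟨prog, C, K, d, t, h⟩
  obtain ⟨n, hn, hlt⟩ := exists_mul_rpow_lt he C
  obtain ⟨ht, hI⟩ := h n hn
  set T := t n
  obtain ⟨hz, hzc⟩ := hI (fun _ _ => 0) fun _ _ => trivial
  have hu := fun p => (hI (unitMatrix p) fun _ _ => trivial).2
  have hreads : ∀ r : Fin T → Bool, ∃ R : Finset (Fin n × Fin n), R.card ≤ T ∧ ∀ p ∉ R,
      (∃ k ≤ T, ∃ s, RunsTo (K * n ^ d) Set.univ prog ((maxSubarray fun _ => Set.univ).start n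
        (fun _ _ => (0 : ℝ)) (coinStream r)) k s ∧ IsGreatest (subarraySums (fun _ _ : Fin n => 0))
        (s.xreg 0)) →
      ¬ ∃ k ≤ T, ∃ s, RunsTo (K * n ^ d) Set.univ prog ((maxSubarray fun _ => Set.univ).start n
        (unitMatrix p) (coinStream r)) k s ∧ IsGreatest (subarraySums (unitMatrix p))
        (s.xreg 0) := by
    intro r
    obtain ⟨k, hk, s, hr⟩ := hz r
    obtain ⟨R, hR, hout⟩ := exists_reads_of_runsTo _ hr
    refine ⟨R, hR.trans hk, ?_⟩
    rintro p hp ⟨k₁, -, s₁, hr₁, hs₁⟩ ⟨k', hk', s', hr', hs'⟩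
    have h1 := hout p hp k' s' hr'
    rw [(hr.deterministic hr₁).2, isGreatest_subarraySums_zero hs₁] at h1
    exact isGreatest_subarraySums_unitMatrix hs' h1
  choose R hR hout using hreads
  -- The sequences that are correct for the zero matrix and those that are correct for the unit
  -- matrix at `p` are two thirds each, so at least one third is correct for both. These have read
  -- `p`.
  have hp : ∀ p, 2 ^ T ≤ 3 * (Finset.univ.filter fun r => p ∈ R r).card := by
    intro p
    have h1 := hu p
    set G₀ := {r : Fin T → Bool | ∃ k ≤ T, ∃ s, RunsTo (K * n ^ d) Set.univ prog
      ((maxSubarray fun _ => Set.univ).start n (fun _ _ => (0 : ℝ)) (coinStream r)) k s ∧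
      (maxSubarray fun _ => Set.univ).Answers n (fun _ _ => (0 : ℝ)) s}
    set G₁ := {r : Fin T → Bool | ∃ k ≤ T, ∃ s, RunsTo (K * n ^ d) Set.univ prog
      ((maxSubarray fun _ => Set.univ).start n (unitMatrix p) (coinStream r)) k s ∧
      (maxSubarray fun _ => Set.univ).Answers n (unitMatrix p) s}
    have h2 := Set.ncard_union_add_ncard_inter G₀ G₁
    have h3 : (G₀ ∪ G₁).ncard ≤ 2 ^ T := by
      refine (Set.ncard_le_ncard (Set.subset_univ _)).trans ?_
      rw [Set.ncard_univ, Nat.card_eq_fintype_card]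
      simp
    have h4 : (G₀ ∩ G₁).ncard ≤ (Finset.univ.filter fun r => p ∈ R r).card := by
      rw [← Set.ncard_coe_finset]
      refine Set.ncard_le_ncard ?_
      rintro r ⟨h5, h6⟩
      simp only [Finset.coe_filter, Finset.mem_univ, true_and, Set.mem_ofPred_eq]
      by_contra h7
      exact hout r p h7 h5 h6
    omega
  have hsum : ∑ p : Fin n × Fin n, (Finset.univ.filter fun r => p ∈ R r).card =
      ∑ r : Fin T → Bool, (R r).card := by
    have := Finset.sum_card_bipartiteAbove_eq_sum_card_bipartiteBelow
      (s := (Finset.univ : Finset (Fin n × Fin n))) (t := (Finset.univ : Finset (Fin T → Bool)))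
      (fun p r => p ∈ R r)
    unfold Finset.bipartiteAbove Finset.bipartiteBelow at this
    rw [this]
    refine Finset.sum_congr rfl fun r _ => ?_
    congr 1
    ext p
    simp
  have h1 : n * n * 2 ^ T ≤ 3 * (2 ^ T * T) := by
    calc n * n * 2 ^ T = ∑ p : Fin n × Fin n, 2 ^ T := by simp
      _ ≤ ∑ p : Fin n × Fin n, 3 * (Finset.univ.filter fun r => p ∈ R r).card :=
          Finset.sum_le_sum fun p _ => hp p
      _ = 3 * ∑ r : Fin T → Bool, (R r).card := by rw [← Finset.mul_sum, hsum]
      _ ≤ 3 * ∑ r : Fin T → Bool, T := by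
          gcongr with r
          exact hR r
      _ = 3 * (2 ^ T * T) := by simp
  have h2 : n * n ≤ 3 * T := by
    have : 0 < 2 ^ T := by positivity
    nlinarith
  have h3 : ((n * n : ℕ) : ℝ) ≤ (3 * T : ℕ) := by exact_mod_cast h2
  push_cast at h3
  linarith

/-! ### The running time -/

namespace Cfg
variable (c : Cfg)

/-- The exponent `5 * (lam / 5 + 1)` lies between `lam` and `lam + 5`; this bound and the next one
say that `s` is the fifth root of `N` up to a factor `2`. -/
theorem s_pow_le : c.s ^ 5 ≤ 32 * c.N := by
  unfold s N
  rw [← pow_mul, show (32 : ℕ) = 2 ^ 5 by norm_num, ← pow_add]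
  exact Nat.pow_le_pow_right (by norm_num) (by omega)

theorem N_le_s_pow : c.N ≤ c.s ^ 5 := by
  unfold s N
  rw [← pow_mul]
  exact Nat.pow_le_pow_right (by norm_num) (by omega)

variable {c}

theorem s_mul_g (h : 1 ≤ c.lam) : c.s * c.g = c.N := by
  unfold s g N
  rw [← pow_add]
  congr 1
  omega

theorem N_le (hn : 1 ≤ c.n) (hlam : c.lam = Nat.log 2 c.n + 1) : c.N ≤ 2 * c.n := by
  unfold N
  rw [hlam, pow_succ, mul_comm]
  exact Nat.mul_le_mul_left 2 (Nat.pow_log_le_self 2 (by omega))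

theorem n_lt (hlam : c.lam = Nat.log 2 c.n + 1) : c.n < c.N := by
  unfold N
  rw [hlam]
  exact Nat.lt_pow_succ_log_self (by norm_num) _

end Cfg

/-- The order of magnitude of the running time. -/
def coreTime (c : Cfg) (t : ℕ) : ℕ :=
  (c.lam + 1) ^ 3 * (c.g ^ 3 * (c.s ^ 2 + t))

/-- The three logarithmic factors come from the levels, the passes and the votes. Everything else is
dominated by `g³` queries, which take `s² + t` steps each. -/
theorem apspTime_le {c : Cfg} {A k mb t : ℕ} (hlam : 1 ≤ c.lam) (hr : c.r ≤ A * (c.lam + 1))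
    (hrho : c.rho ≤ A * (c.g * (c.lam + 1))) (hL : c.L ≤ A * (c.lam + 1)) (hmb : mb ≤ A)
    (hk : k ≤ A * ((c.lam + 1) ^ 2 * (c.g ^ 3 * (c.s ^ 2 + t)))) :
    apspTime c k mb t ≤ (141 + 20 * A + A * (104 + A * (4 * A + 89) + 678)) * coreTime c t := by
  have hs : 1 ≤ c.s := (Room.two_le_s c).trans' (by norm_num)
  have hg : 1 ≤ c.g := Room.g_pos c
  have hsg := Cfg.s_mul_g hlam
  have hs4 : c.s ^ 4 ≤ 32 * c.g := by
    have h := c.s_pow_le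
    rw [← hsg] at h
    have h' : c.s * c.s ^ 4 ≤ c.s * (32 * c.g) := by
      calc c.s * c.s ^ 4 = c.s ^ 5 := by ring
        _ ≤ _ := h
        _ = _ := by ring
    exact Nat.le_of_mul_le_mul_left h' hs
  unfold apspTime levelTime passTime tripleTime coreTime
  rw [← hsg]
  generalize c.s = s at *
  generalize c.g = g at *
  generalize c.r = r at *
  generalize c.rho = rho at *
  generalize c.L = L at *
  have hlam' : c.lam ≤ c.lam + 1 := Nat.le_succ _
  generalize c.lam = l at *
  have hΛ : 1 ≤ l + 1 := by omega
  generalize l + 1 = Λ at *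
  have hs2 : 1 ≤ s ^ 2 := Nat.one_le_pow _ _ hs
  have hm : (2 * s - 1) * (2 * s - 1) ≤ 4 * s ^ 2 := by
    calc (2 * s - 1) * (2 * s - 1) ≤ (2 * s) * (2 * s) := Nat.mul_le_mul (by omega) (by omega)
      _ = 4 * s ^ 2 := by ring
  have h1 : (2 * s) * (2 * s) * 20 + r * (4 * mb + (2 * s - 1) * (2 * s - 1) * 20 + 2 * t + 9) +
      22 + 2 ≤ (104 + A * (4 * A + 89)) * (Λ * (s ^ 2 + t)) := by
    have a1 : 4 * mb + (2 * s - 1) * (2 * s - 1) * 20 + 2 * t + 9 ≤ (4 * A + 89) * (s ^ 2 + t) := by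
      have : 4 * A * 1 ≤ 4 * A * (s ^ 2 + t) := Nat.mul_le_mul_left _ (by omega)
      rw [add_mul]
      omega
    have a2 : s ^ 2 + t ≤ Λ * (s ^ 2 + t) := Nat.le_mul_of_pos_left _ hΛ
    have a3 := Nat.mul_le_mul hr a1
    have a4 : A * Λ * ((4 * A + 89) * (s ^ 2 + t)) = A * (4 * A + 89) * (Λ * (s ^ 2 + t)) := by
      ring
    have a5 : (2 * s) * (2 * s) = 4 * s ^ 2 := by ring
    rw [a4] at a3
    rw [add_mul, a5]
    omega
  generalize (2 * s) * (2 * s) * 20 + r * (4 * mb + (2 * s - 1) * (2 * s - 1) * 20 + 2 * t + 9) +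
    22 = T1 at *
  generalize hA1 : 104 + A * (4 * A + 89) = A1 at *
  set Q := g ^ 3 * (s ^ 2 + t) with hQ
  have hQ1 : g ^ 3 * s ^ 2 ≤ Q := Nat.mul_le_mul_left _ (by omega)
  have hNQ : s * g * (s * g) ≤ Q := by
    refine le_trans ?_ hQ1
    calc s * g * (s * g) = g ^ 2 * s ^ 2 := by ring
      _ ≤ g ^ 3 * s ^ 2 := Nat.mul_le_mul_right _ (Nat.pow_le_pow_right hg (by norm_num))
  have hQ0 : 1 ≤ Q := Nat.mul_pos (Nat.pow_pos hg) (by omega)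
  have hQΛ : Q ≤ Λ * Q := Nat.le_mul_of_pos_left _ hΛ
  have h2 : g * g * g * (T1 + 2) + s * g * (s * g) * s * (s * s * s * 21) + 4 + 2 ≤
      (A1 + 678) * (Λ * Q) := by
    have a1 : g * g * g * (T1 + 2) ≤ A1 * (Λ * Q) := by
      calc g * g * g * (T1 + 2) ≤ g * g * g * (A1 * (Λ * (s ^ 2 + t))) := Nat.mul_le_mul_left _ h1
        _ = A1 * (Λ * Q) := by rw [hQ]; ring
    -- The relaxed blocks cost `N² s⁴` up to a constant, and `s⁴ ≤ 32 g` turns this into `g³ s²`.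
    -- This balance is the reason for taking `s ≈ N^(1/5)`.
    have a2 : s * g * (s * g) * s * (s * s * s * 21) ≤ 672 * Q := by
      calc s * g * (s * g) * s * (s * s * s * 21) = 21 * (g ^ 2 * s ^ 2) * s ^ 4 := by ring
        _ ≤ 21 * (g ^ 2 * s ^ 2) * (32 * g) := Nat.mul_le_mul_left _ hs4
        _ = 672 * (g ^ 3 * s ^ 2) := by ring
        _ ≤ 672 * Q := Nat.mul_le_mul_left _ hQ1
    rw [add_mul]
    omega
  generalize g * g * g * (T1 + 2) + s * g * (s * g) * s * (s * s * s * 21) + 4 = T2 at *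
  have hQΛ2 : Λ * Q ≤ Λ ^ 2 * Q := Nat.mul_le_mul_right _ (Nat.le_self_pow (by norm_num) _)
  have h3 : s * g * (s * g) * 8 + rho * (s * g * (s * g)) * 19 + L * (T2 + 2) + 8 + 2 ≤
      (18 + 19 * A + A * (A1 + 678)) * (Λ ^ 2 * Q) := by
    have a1 : rho * (s * g * (s * g)) ≤ A * (Λ ^ 2 * Q) := by
      calc rho * (s * g * (s * g)) ≤ A * (g * Λ) * (s * g * (s * g)) := Nat.mul_le_mul_right _ hrho
        _ = A * (Λ * (g ^ 3 * s ^ 2)) := by ring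
        _ ≤ A * (Λ * Q) := by gcongr
        _ ≤ A * (Λ ^ 2 * Q) := by gcongr
    have a2 : L * (T2 + 2) ≤ A * (A1 + 678) * (Λ ^ 2 * Q) := by
      calc L * (T2 + 2) ≤ A * Λ * ((A1 + 678) * (Λ * Q)) := Nat.mul_le_mul hL h2
        _ = _ := by ring
    rw [add_mul, add_mul, mul_assoc 19 A]
    omega
  generalize s * g * (s * g) * 8 + rho * (s * g * (s * g)) * 19 + L * (T2 + 2) + 8 = T3 at *
  have hQΛ3 : Λ ^ 2 * Q ≤ Λ ^ 3 * Q :=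
    Nat.mul_le_mul_right _ (Nat.pow_le_pow_right hΛ (by norm_num))
  have a1 : l * (T3 + 2) ≤ (18 + 19 * A + A * (A1 + 678)) * (Λ ^ 3 * Q) := by
    calc l * (T3 + 2) ≤ Λ * ((18 + 19 * A + A * (A1 + 678)) * (Λ ^ 2 * Q)) :=
          Nat.mul_le_mul hlam' h3
      _ = _ := by ring
  have a2 : k ≤ A * (Λ ^ 3 * Q) := hk.trans (Nat.mul_le_mul_left _ hQΛ3)
  calc s * g * (s * g) * 73 + 50 + k + l * (T3 + 2)
      ≤ 123 * (Λ ^ 3 * Q) + A * (Λ ^ 3 * Q) +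
        (18 + 19 * A + A * (A1 + 678)) * (Λ ^ 3 * Q) := by omega
    _ = (141 + 20 * A + A * (A1 + 678)) * (Λ ^ 3 * Q) := by ring

theorem exists_pow_three_le {ρ : ℝ} (hρ : 0 < ρ) :
    ∃ K : ℝ, 0 < K ∧ ∀ m : ℕ, (m : ℝ) ^ 3 ≤ K * ((2 : ℝ) ^ m) ^ ρ := by
  have h1 : (1 : ℝ) < (2 : ℝ) ^ ρ := Real.one_lt_rpow (by norm_num) hρ
  obtain ⟨K, hK, h⟩ := Asymptotics.bound_of_isBigO_nat_atTop
    (isLittleO_pow_const_const_pow_of_one_lt (R := ℝ) 3 h1).isBigO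
  refine ⟨K, hK, fun m => ?_⟩
  have h2 := h (x := m) (by positivity)
  rw [Real.norm_of_nonneg (by positivity), Real.norm_of_nonneg (by positivity)] at h2
  rw [← Real.rpow_natCast 2 m, ← Real.rpow_mul (by norm_num), mul_comm (m : ℝ), Real.rpow_mul
    (by norm_num), Real.rpow_natCast]
  exact h2

/-- `g³ s^(3 - ε) = N³ s^(-ε) ≤ N^(3 - ε/5)` because `N ≤ s⁵`, and the logarithmic factors are
bounded by a constant times `n^(ε/10)`. The assumption `ε ≤ 1` lets the term `s²` be absorbed by
`s^(3 - ε)`. -/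
theorem exists_coreTime_le {ε : ℝ} (hε : 0 < ε) (hε1 : ε ≤ 1) {C : ℝ} {t : ℕ → ℕ}
    (ht : ∀ m, 1 ≤ m → (t m : ℝ) ≤ C * (m : ℝ) ^ (3 - ε)) :
    ∃ C' : ℝ, ∀ c : Cfg, 1 ≤ c.n → c.lam = Nat.log 2 c.n + 1 →
      (coreTime c (t (2 * c.s - 1)) : ℝ) ≤ C' * (c.n : ℝ) ^ (3 - ε / 10) := by
  obtain ⟨K, hK, hlog⟩ := exists_pow_three_le (show 0 < ε / 10 by positivity)
  refine ⟨K * 4 * ((1 + 8 * |C|) * 8), fun c hn hlam => ?_⟩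
  have hs : 1 ≤ c.s := (Room.two_le_s c).trans' (by norm_num)
  have hs1 : (1 : ℝ) ≤ c.s := by exact_mod_cast hs
  have hn1 : (1 : ℝ) ≤ c.n := by exact_mod_cast hn
  have hN : (c.N : ℝ) ≤ 2 * c.n := by exact_mod_cast Cfg.N_le hn hlam
  have hN0 : (0 : ℝ) < c.N := by exact_mod_cast Room.N_pos c
  have hsg : (c.s : ℝ) * c.g = c.N := by exact_mod_cast Cfg.s_mul_g (by omega)
  have hNs : (c.N : ℝ) ≤ (c.s : ℝ) ^ 5 := by exact_mod_cast c.N_le_s_pow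
  have two_pow_le : ∀ x : ℝ, x ≤ 3 → (2 : ℝ) ^ x ≤ 8 := by
    intro x hx
    calc (2 : ℝ) ^ x ≤ 2 ^ (3 : ℝ) := Real.rpow_le_rpow_of_exponent_le (by norm_num) hx
      _ = 8 := by norm_num
  have h1 : ((c.lam + 1 : ℕ) : ℝ) ^ 3 ≤ K * 4 * (c.n : ℝ) ^ (ε / 10) := by
    refine (hlog _).trans ?_
    rw [mul_assoc]
    refine mul_le_mul_of_nonneg_left ?_ hK.le
    have e1 : (2 : ℝ) ^ (c.lam + 1) ≤ 4 * c.n := by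
      have : (2 : ℝ) ^ c.lam = c.N := by unfold Cfg.N; push_cast; rfl
      rw [pow_succ, this]
      linarith
    calc ((2 : ℝ) ^ (c.lam + 1)) ^ (ε / 10) ≤ (4 * c.n) ^ (ε / 10) :=
          Real.rpow_le_rpow (by positivity) e1 (by positivity)
      _ = 4 ^ (ε / 10) * (c.n : ℝ) ^ (ε / 10) := Real.mul_rpow (by norm_num) (by positivity)
      _ ≤ 4 * (c.n : ℝ) ^ (ε / 10) := by
          refine mul_le_mul_of_nonneg_right ?_ (by positivity)
          calc (4 : ℝ) ^ (ε / 10) ≤ 4 ^ (1 : ℝ) :=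
                Real.rpow_le_rpow_of_exponent_le (by norm_num) (by linarith)
            _ = 4 := Real.rpow_one 4
  have h2 : (c.s : ℝ) ^ 2 + t (2 * c.s - 1) ≤ (1 + 8 * |C|) * (c.s : ℝ) ^ (3 - ε) := by
    have e1 : (c.s : ℝ) ^ 2 ≤ (c.s : ℝ) ^ (3 - ε) := by
      rw [← Real.rpow_two]
      exact Real.rpow_le_rpow_of_exponent_le hs1 (by linarith)
    have e2 : ((2 * c.s - 1 : ℕ) : ℝ) ≤ 2 * c.s := by exact_mod_cast Nat.sub_le _ _
    have e3 : (t (2 * c.s - 1) : ℝ) ≤ 8 * |C| * (c.s : ℝ) ^ (3 - ε) := by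
      calc (t (2 * c.s - 1) : ℝ) ≤ C * ((2 * c.s - 1 : ℕ) : ℝ) ^ (3 - ε) := ht _ (by omega)
        _ ≤ |C| * (2 * c.s) ^ (3 - ε) := by
            refine mul_le_mul (le_abs_self C) (Real.rpow_le_rpow (by positivity) e2 (by linarith))
              (by positivity) (abs_nonneg _)
        _ = |C| * (2 ^ (3 - ε) * (c.s : ℝ) ^ (3 - ε)) := by
            rw [Real.mul_rpow (by norm_num) (by positivity)]
        _ ≤ |C| * (8 * (c.s : ℝ) ^ (3 - ε)) := by
            refine mul_le_mul_of_nonneg_left ?_ (abs_nonneg _)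
            exact mul_le_mul_of_nonneg_right (two_pow_le _ (by linarith)) (by positivity)
        _ = 8 * |C| * (c.s : ℝ) ^ (3 - ε) := by ring
    linarith
  have h3 : (c.g : ℝ) ^ 3 * (c.s : ℝ) ^ (3 - ε) ≤ 8 * (c.n : ℝ) ^ (3 - ε / 5) := by
    have e1 : (c.s : ℝ) ^ (3 - ε) = (c.s : ℝ) ^ 3 * ((c.s : ℝ) ^ 5) ^ (-(ε / 5)) := by
      rw [← Real.rpow_natCast _ 3, ← Real.rpow_natCast _ 5, ← Real.rpow_mul (by positivity),
        ← Real.rpow_add (by positivity)]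
      congr 1
      push_cast
      ring
    have e2 : ((c.s : ℝ) ^ 5) ^ (-(ε / 5)) ≤ (c.N : ℝ) ^ (-(ε / 5)) :=
      Real.rpow_le_rpow_of_nonpos hN0 hNs (by linarith)
    calc (c.g : ℝ) ^ 3 * (c.s : ℝ) ^ (3 - ε) = (c.s * c.g) ^ 3 * ((c.s : ℝ) ^ 5) ^ (-(ε / 5)) := by
          rw [e1]; ring
      _ ≤ (c.N : ℝ) ^ 3 * (c.N : ℝ) ^ (-(ε / 5)) := by
          rw [hsg]; exact mul_le_mul_of_nonneg_left e2 (by positivity)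
      _ = (c.N : ℝ) ^ (3 - ε / 5) := by
          rw [← Real.rpow_natCast _ 3, ← Real.rpow_add hN0]
          congr 1
      _ ≤ (2 * c.n) ^ (3 - ε / 5) := Real.rpow_le_rpow hN0.le hN (by linarith)
      _ = 2 ^ (3 - ε / 5) * (c.n : ℝ) ^ (3 - ε / 5) := Real.mul_rpow (by norm_num) (by positivity)
      _ ≤ 8 * (c.n : ℝ) ^ (3 - ε / 5) :=
          mul_le_mul_of_nonneg_right (two_pow_le _ (by linarith)) (by positivity)
  have h4 : (c.n : ℝ) ^ (ε / 10) * (c.n : ℝ) ^ (3 - ε / 5) = (c.n : ℝ) ^ (3 - ε / 10) := by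
    rw [← Real.rpow_add (by positivity)]
    congr 1
    ring
  unfold coreTime
  push_cast at h1 ⊢
  calc ((c.lam : ℝ) + 1) ^ 3 * ((c.g : ℝ) ^ 3 * ((c.s : ℝ) ^ 2 + t (2 * c.s - 1)))
      ≤ (K * 4 * (c.n : ℝ) ^ (ε / 10)) * ((c.g : ℝ) ^ 3 * ((1 + 8 * |C|) * (c.s : ℝ) ^ (3 - ε))) := by
        gcongr
    _ = (K * 4 * (c.n : ℝ) ^ (ε / 10)) * ((1 + 8 * |C|) * ((c.g : ℝ) ^ 3 * (c.s : ℝ) ^ (3 - ε))) := by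
        ring
    _ ≤ (K * 4 * (c.n : ℝ) ^ (ε / 10)) * ((1 + 8 * |C|) * (8 * (c.n : ℝ) ^ (3 - ε / 5))) := by
        gcongr
    _ = K * 4 * ((1 + 8 * |C|) * 8) * ((c.n : ℝ) ^ (ε / 10) * (c.n : ℝ) ^ (3 - ε / 5)) := by ring
    _ = _ := by rw [h4]

/-! ### The deterministic reduction -/

theorem coinFree_apspProg {setup : RamProg} (h : setup.CoinFree) (mb : ℕ) (prog : RamProg) :
    (apspProg setup mb prog).CoinFree := by
  simp [apspProg, dimsProg, initProg, initBody, scaleProg, outputBody, levelProg, copyProg,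
    sampleDecode, passProg, forUpTo, tripleBody, blockDecode, potentialBody, voteBody, fillBody,
    bruteDecode, relaxProg, RamProg.CoinFree, coinFree_clearReloc, coinFree_reloc, h]

theorem coinStream_false (t : ℕ) : coinStream (fun _ : Fin t => false) = fun _ => false := by
  funext m
  unfold coinStream
  split_ifs <;> rfl

/-- The program has no access to the function `t`. It reserves a multiple of `s³` tosses for each
vote, a number that it can compute. -/
theorem le_of_mul_rpow_le {C ε : ℝ} (hε : 0 < ε) {m s t : ℕ} (hm : 1 ≤ m) (hms : m ≤ 2 * s)
    (h : (t : ℝ) ≤ C * (m : ℝ) ^ (3 - ε)) : t ≤ s * s * s * (8 * ⌈|C|⌉₊) := by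
  have h1 : (m : ℝ) ^ (3 - ε) ≤ (2 * s) ^ 3 := by
    calc (m : ℝ) ^ (3 - ε) ≤ (m : ℝ) ^ (3 : ℝ) :=
          Real.rpow_le_rpow_of_exponent_le (by exact_mod_cast hm) (by linarith)
      _ = (m : ℝ) ^ 3 := by norm_cast
      _ ≤ (2 * s) ^ 3 := by gcongr; exact_mod_cast hms
  have h2 : (t : ℝ) ≤ ((s * s * s * (8 * ⌈|C|⌉₊) : ℕ) : ℝ) := by
    calc (t : ℝ) ≤ C * (m : ℝ) ^ (3 - ε) := h
      _ ≤ ⌈|C|⌉₊ * (2 * s) ^ 3 := mul_le_mul ((le_abs_self C).trans (Nat.le_ceil _)) h1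
          (by positivity) (by positivity)
      _ = _ := by push_cast; ring
  exact_mod_cast h2

/-- The parameters of the deterministic reduction. -/
noncomputable def deterministicCfg (C d n : ℕ) (M : ℝ) : Cfg where
  n := n
  lam := Nat.log 2 n + 1
  r := 1
  tau := 2 ^ ((Nat.log 2 n + 1) / 5 + 1) * 2 ^ ((Nat.log 2 n + 1) / 5 + 1) *
    2 ^ ((Nat.log 2 n + 1) / 5 + 1) * C
  rho := 0
  L := (Nat.log 2 n + 1) * (d + 2) + 6
  W := ((2 ^ (Nat.log 2 n + 1) : ℕ) : ℝ) * (4 * (((2 ^ (Nat.log 2 n + 1) : ℕ) : ℝ) * M)) +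
    2 ^ ((Nat.log 2 n + 1) * (d + 2) + 5)
  thr := 2 * (((2 ^ (Nat.log 2 n + 1) : ℕ) : ℝ) * M)

/-! ### Sizes in the deterministic reduction -/

section
variable {C d n : ℕ} {M : ℝ}

theorem deterministicCfg_W : (deterministicCfg C d n M).W = (deterministicCfg C d n M).N *
    (4 * ((deterministicCfg C d n M).N * M)) + 32 * (deterministicCfg C d n M).N ^ (d + 2) := by
  have : (deterministicCfg C d n M).W = (deterministicCfg C d n M).N *
    (4 * ((deterministicCfg C d n M).N * M)) + 2 ^ ((Nat.log 2 n + 1) * (d + 2) + 5) := rfl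
  rw [this]
  congr 1
  rw [pow_add, pow_mul, mul_comm]
  norm_num [Cfg.N, deterministicCfg]

/-- The constant `36` is `4` from the bound `N * (4 * (N * M))` on the distances plus `32` from the
power of two that bounds the accuracies. -/
theorem deterministicCfg_W_le (hn : 1 ≤ n) (hM1 : 1 ≤ M) (hM : M ≤ (n : ℝ) ^ d) :
    (deterministicCfg C d n M).W ≤ 36 * (deterministicCfg C d n M).N ^ (d + 2) ∧
    0 ≤ (deterministicCfg C d n M).W ∧ M ≤ (deterministicCfg C d n M).N ^ d := by
  have h1 : (n : ℝ) ≤ (deterministicCfg C d n M).N := by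
    exact_mod_cast (Cfg.n_lt (c := deterministicCfg C d n M) rfl).le
  rw [deterministicCfg_W]
  generalize (deterministicCfg C d n M).N = N at *
  have h2 : M ≤ (N : ℝ) ^ d := hM.trans (by gcongr)
  have h0 : (0 : ℝ) ≤ N := by positivity
  refine ⟨?_, by positivity, h2⟩
  have h3 : (N : ℝ) * (N * M) ≤ N * (N * N ^ d) := by gcongr
  have h4 : (N : ℝ) * (N * N ^ d) = N ^ (d + 2) := by ring
  linarith

/-- A bound on the words and the numeric cells of the deterministic reduction. -/
def deterministicBound (C d K e n : ℕ) : ℕ :=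
  (64 + 8 * C + (2 * d + 10) + 7200 * 2 ^ (d + 2) + K * 4 ^ e) * n ^ (d + e + 3)

theorem deterministicBound_le {K e : ℕ} (hn : 1 ≤ n) :
    (64 + 8 * C) * n ^ 3 ≤ deterministicBound C d K e n ∧
    (2 * d + 10) * n ≤ deterministicBound C d K e n ∧
    7200 * 2 ^ (d + 2) * n ^ (d + 2) ≤ deterministicBound C d K e n ∧
    K * 4 ^ e * n ^ e ≤ deterministicBound C d K e n := by
  have h : ∀ i ≤ d + e + 3, n ^ i ≤ n ^ (d + e + 3) := fun i hi => Nat.pow_le_pow_right hn hi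
  have h1 := h 1 (by omega)
  rw [pow_one] at h1
  unfold deterministicBound
  exact ⟨Nat.mul_le_mul (by omega) (h _ (by omega)), Nat.mul_le_mul (by omega) h1,
    Nat.mul_le_mul (by omega) (h _ (by omega)), Nat.mul_le_mul (by omega) (h _ (by omega))⟩

theorem room_deterministic {K e : ℕ} (hn : 1 ≤ n) (hM1 : 1 ≤ M) (hM : M ≤ (n : ℝ) ^ d) :
    Room (deterministicCfg C d n M) (deterministicBound C d K e n)
      {x | |x| ≤ (deterministicBound C d K e n : ℕ)} := by
  obtain ⟨b1, b2, b3, -⟩ := deterministicBound_le (C := C) (d := d) (K := K) (e := e) hn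
  obtain ⟨hW, hW0, -⟩ := deterministicCfg_W_le (C := C) hn hM1 hM
  have hN := Cfg.N_le (c := deterministicCfg C d n M) hn rfl
  have hs : (deterministicCfg C d n M).s ≤ (deterministicCfg C d n M).N := by
    rw [← Cfg.s_mul_g (c := deterministicCfg C d n M) (Nat.le_add_left _ _)]
    exact Nat.le_mul_of_pos_right _ (Room.g_pos _)
  have hn3 : 1 ≤ n ^ 3 := Nat.one_le_pow _ _ hn
  have hcube : ∀ x ≤ 2 * n, x * x * x ≤ 8 * n ^ 3 := fun x hx => by
    calc x * x * x ≤ (2 * n) * (2 * n) * (2 * n) := Nat.mul_le_mul (Nat.mul_le_mul hx hx) hx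
      _ = 8 * n ^ 3 := by ring
  refine ⟨Nat.le_add_left _ _, (Cfg.n_lt rfl).le, ?_, ?_, ?_, ?_, ?_, hW0, fun x hx => ?_⟩
  · have := hcube _ hN
    have : 64 * n ^ 3 ≤ (64 + 8 * C) * n ^ 3 := Nat.mul_le_mul_right _ (by omega)
    omega
  · exact (Nat.zero_mul _).le.trans (Nat.zero_le _)
  · have h1 := hcube _ (hs.trans hN)
    have h2 : 1 * ((deterministicCfg C d n M).s * (deterministicCfg C d n M).s *
      (deterministicCfg C d n M).s * C) ≤ 8 * n ^ 3 * C := by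
      rw [one_mul]; exact Nat.mul_le_mul_right _ h1
    have h3 : 8 * n ^ 3 * C ≤ (64 + 8 * C) * n ^ 3 := by
      rw [add_mul]
      calc 8 * n ^ 3 * C = 8 * C * n ^ 3 := by ring
        _ ≤ _ := Nat.le_add_left _ _
    exact (h2.trans h3).trans b1
  · have : 64 * 1 ≤ (64 + 8 * C) * n ^ 3 := Nat.mul_le_mul (by omega) hn3
    exact le_trans (show 2 * 1 ≤ 64 * 1 by norm_num) (this.trans b1)
  · have h1 : Nat.log 2 n + 1 < 2 ^ (Nat.log 2 n + 1) := Nat.lt_two_pow_self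
    have h2 : Nat.log 2 n + 1 ≤ 2 * n := h1.le.trans hN
    have h3 : (Nat.log 2 n + 1) * (d + 2) ≤ 2 * n * (d + 2) := Nat.mul_le_mul_right _ h2
    have h4 : 2 * n * (d + 2) + 6 * n = (2 * d + 10) * n := by ring
    have h5 : (Nat.log 2 n + 1) * (d + 2) + 6 ≤ deterministicBound C d K e n := by omega
    exact h5
  · have h1 : ((deterministicCfg C d n M).N : ℝ) ≤ 2 * n := by exact_mod_cast hN
    -- `7200` is `200 * 36`: numeric values up to `200 W` have to fit, and `W ≤ 36 N^(d + 2)` with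
    -- `N ≤ 2 n`.
    have h2 : (7200 * 2 ^ (d + 2) * n ^ (d + 2) : ℝ) ≤ (deterministicBound C d K e n : ℕ) := by
      exact_mod_cast b3
    have h3 : ((deterministicCfg C d n M).N : ℝ) ^ (d + 2) ≤ (2 * n) ^ (d + 2) := by gcongr
    rw [mul_pow] at h3
    exact hx.trans (by nlinarith)

/-- The queries have size `2 s - 1`, only about the fifth root of `N`, so the exponent is multiplied
by `5`. The additional `13` absorbs the constant `132 * 36 = 4752`, as `2 s - 1 ≥ 3`. -/
theorem isSmallInt_of_abs_le {x : ℝ} (hn : 1 ≤ n) (hM1 : 1 ≤ M) (hM : M ≤ (n : ℝ) ^ d)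
    (hx : x ∈ intSubgroup) (hxW : |x| ≤ 132 * (deterministicCfg C d n M).W) :
    IsSmallInt (5 * (d + 2) + 13) (2 * (deterministicCfg C d n M).s - 1) x := by
  obtain ⟨z, rfl⟩ := hx
  refine ⟨z, rfl, ?_⟩
  obtain ⟨hW, -, -⟩ := deterministicCfg_W_le (C := C) hn hM1 hM
  have hs := Room.two_le_s (deterministicCfg C d n M)
  have hNs := (deterministicCfg C d n M).N_le_s_pow
  generalize (deterministicCfg C d n M).s = s at *
  generalize (deterministicCfg C d n M).N = N at *
  generalize (deterministicCfg C d n M).W = W at *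
  have h1 : 4752 * N ^ (d + 2) ≤ (2 * s - 1) ^ (5 * (d + 2) + 13) := by
    have h2 : N ≤ (2 * s - 1) ^ 5 := hNs.trans (Nat.pow_le_pow_left (by omega) _)
    have h3 : 3 ^ 13 ≤ (2 * s - 1) ^ 13 := Nat.pow_le_pow_left (by omega) _
    rw [pow_add (2 * s - 1), pow_mul, mul_comm]
    exact Nat.mul_le_mul (Nat.pow_le_pow_left h2 _) (le_trans (by norm_num) h3)
  have h2 : |(z : ℝ)| ≤ (((2 * s - 1) ^ (5 * (d + 2) + 13) : ℕ) : ℝ) := by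
    refine le_trans ?_ (Nat.cast_le.2 h1)
    push_cast
    exact hxW.trans (by linarith)
  exact_mod_cast h2

end

/-- The exponent for the entries of the subarray instances has to be fixed first, as it selects the
subroutine. The good event is `True`, because a single vote of a deterministic subroutine is always
right. -/
theorem deterministicTime_allPairsShortestPaths {ε : ℝ} (hε : 0 < ε) (hε1 : ε ≤ 1)
    (h : ∀ c : ℕ, (maxSubarray fun n => {x | IsSmallInt c n x}).DeterministicTime (3 - ε)) (d : ℕ) :
    (allPairsShortestPaths fun n => {x | IsSmallInt d n x}).DeterministicTime (3 - ε / 10) := by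
  obtain ⟨prog, C, K, e, t, hfree, h⟩ := h (5 * (d + 2) + 13)
  obtain ⟨m₀, hm₀⟩ := prog.exists_below
  set mb := m₀ + 1
  have hmb : prog.Below mb := hm₀.mono (Nat.le_succ _)
  set C' := 8 * ⌈|C|⌉₊
  obtain ⟨C₂, hC₂⟩ := exists_coreTime_le hε hε1 fun m hm => (h m hm).1
  set A := 6 * (d + 8) + 16 + mb
  set A' := 141 + 20 * A + A * (104 + A * (4 * A + 89) + 678)
  refine ⟨apspProg (deterministicSetup C' d) mb prog, A' * C₂,
    64 + 8 * C' + (2 * d + 10) + 7200 * 2 ^ (d + 2) + K * 4 ^ e, d + e + 3,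
    fun n => A' * coreTime (deterministicCfg C' d n 1)
      (t (2 * (deterministicCfg C' d n 1).s - 1)), coinFree_apspProg ?_ _ _, fun n hn => ⟨?_, ?_⟩⟩
  · simp [deterministicSetup, forUpTo, RamProg.CoinFree]
  · have := hC₂ (deterministicCfg C' d n 1) hn rfl
    push_cast
    rw [mul_assoc]
    exact mul_le_mul_of_nonneg_left this (by positivity)
  · rintro w ⟨hw, hwE⟩
    have hn1 : (1 : ℝ) ≤ n := by exact_mod_cast hn
    have hwabs : ∀ u v, ∀ x ∈ w u v, |x| ≤ (n : ℝ) ^ d := by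
      intro u v x hx
      obtain ⟨z, rfl, hz⟩ := hwE u v x hx
      exact_mod_cast hz
    have hwΛ : ∀ u v, ∀ x ∈ w u v, x ∈ intSubgroup := by
      intro u v x hx
      obtain ⟨z, rfl, -⟩ := hwE u v x hx
      exact ⟨z, rfl⟩
    have h1Λ : (1 : ℝ) ∈ intSubgroup := ⟨1, by simp⟩
    have hM1 : 1 ≤ maxWeight w := one_le_maxAbs _ _
    have hM : maxWeight w ≤ (n : ℝ) ^ d := maxWeight_le (one_le_pow₀ hn1) hwabs
    have hMΛ : maxWeight w ∈ intSubgroup := maxWeight_mem h1Λ hwΛ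
    have hR := room_deterministic (C := C') (K := K) (e := e) hn hM1 hM
    obtain ⟨hW, hW0, hMN⟩ := deterministicCfg_W_le (C := C') hn hM1 hM
    obtain ⟨b1, -, -, b4⟩ := deterministicBound_le (C := C') (d := d) (K := K) (e := e) hn
    have hWeq := deterministicCfg_W (C := C') (d := d) (n := n) (M := maxWeight w)
    have hsm := fun x => isSmallInt_of_abs_le (C := C') (x := x) hn hM1 hM
    -- The time bound was announced for `M = 1`. Only `W` and `thr` depend on `M`, so with the
    -- actual largest weight it is the same number.
    change ∃ k ≤ A' * coreTime (deterministicCfg C' d n (maxWeight w))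
      (t (2 * (deterministicCfg C' d n (maxWeight w)).s - 1)), _
    have hlam : (deterministicCfg C' d n (maxWeight w)).lam = Nat.log 2 n + 1 := rfl
    have hpow : (2 : ℝ) ^ ((deterministicCfg C' d n (maxWeight w)).L - 1) =
        32 * (deterministicCfg C' d n (maxWeight w)).N ^ (d + 2) := by
      have : (deterministicCfg C' d n (maxWeight w)).L - 1 =
        (deterministicCfg C' d n (maxWeight w)).lam * (d + 2) + 5 := rfl
      rw [this, pow_add, pow_mul, mul_comm]
      norm_num [Cfg.N]
    have hLΛ : (deterministicCfg C' d n (maxWeight w)).L ≤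
        (d + 8) * ((deterministicCfg C' d n (maxWeight w)).lam + 1) := by
      change (Nat.log 2 n + 1) * (d + 2) + 6 ≤ (d + 8) * (Nat.log 2 n + 1 + 1)
      nlinarith
    have hL2 : 6 ≤ (deterministicCfg C' d n (maxWeight w)).L := Nat.le_add_left _ _
    have htau : (deterministicCfg C' d n (maxWeight w)).tau =
      (deterministicCfg C' d n (maxWeight w)).s * (deterministicCfg C' d n (maxWeight w)).s *
      (deterministicCfg C' d n (maxWeight w)).s * C' := rfl
    have hr : (deterministicCfg C' d n (maxWeight w)).r = 1 := rfl
    have hrho : (deterministicCfg C' d n (maxWeight w)).rho = 0 := rfl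
    have hL : (deterministicCfg C' d n (maxWeight w)).L =
      (deterministicCfg C' d n (maxWeight w)).lam * (d + 2) + 6 := rfl
    have hthr : (deterministicCfg C' d n (maxWeight w)).thr =
      2 * ((deterministicCfg C' d n (maxWeight w)).N * maxWeight w) := rfl
    have hN2 : (deterministicCfg C' d n (maxWeight w)).N ≤ 2 * n := Cfg.N_le hn rfl
    have hsN : (deterministicCfg C' d n (maxWeight w)).s ≤
      (deterministicCfg C' d n (maxWeight w)).N := hR.s_le
    have hs2 := Room.two_le_s (deterministicCfg C' d n (maxWeight w))
    generalize hm : 2 * (deterministicCfg C' d n (maxWeight w)).s - 1 = m at *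
    have hm1 : 1 ≤ m := by omega
    obtain ⟨htm, hsolve⟩ := h m hm1
    have hWΛ : (deterministicCfg C' d n (maxWeight w)).W ∈ intSubgroup := by
      obtain ⟨z, hz⟩ := hMΛ
      refine ⟨(deterministicCfg C' d n (maxWeight w)).N *
        (4 * ((deterministicCfg C' d n (maxWeight w)).N * z)) +
        32 * (deterministicCfg C' d n (maxWeight w)).N ^ (d + 2), ?_⟩
      simp only [Int.coe_castAddHom] at hz ⊢
      push_cast
      rw [hWeq, hz]
    have hBle : K * m ^ e ≤ deterministicBound C' d K e n := by
      refine le_trans ?_ b4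
      rw [mul_assoc, ← mul_pow]
      exact Nat.mul_le_mul_left _ (Nat.pow_le_pow_left (by omega) _)
    have hout : ∀ M : Fin (2 * (deterministicCfg C' d n (maxWeight w)).s - 1) →
        Fin (2 * (deterministicCfg C' d n (maxWeight w)).s - 1) → ℝ,
        (∀ a b, M a b ∈ intSubgroup ∧ |M a b| ≤ 132 * (deterministicCfg C' d n (maxWeight w)).W) →
        ∃ k ≤ t m, ∃ s', RunsTo (K * m ^ e) {x : ℝ | |x| ≤ (K * m ^ e : ℕ)} prog
          ((maxSubarray fun _ => Set.univ).start _ M fun _ => false) k s' ∧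
          IsGreatest (subarraySums M) (s'.xreg 0) := by
      subst hm
      intro M hM
      exact hsolve M fun i j => hsm _ (hM i j).1 (hM i j).2
    have hO : OracleFor (deterministicCfg C' d n (maxWeight w)) (deterministicBound C' d K e n)
        {x | |x| ≤ (deterministicBound C' d K e n : ℕ)} intSubgroup prog mb (K * m ^ e)
        {x : ℝ | |x| ≤ (K * m ^ e : ℕ)} (t m) (fun _ => false) :=
      { below := hmb
        mb_pos := Nat.le_add_left _ _
        B_le := hBle
        N_le := fun x (hx : |x| ≤ _) => hx.trans (by exact_mod_cast hBle)
        t_le := le_of_mul_rpow_le (s := (deterministicCfg C' d n (maxWeight w)).s) hε hm1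
          (by omega) htm
        halts := fun M hM q hq => by
          obtain ⟨k, hk, s', hr', -⟩ := hout M hM
          rw [coinStream_false]
          exact ⟨_, k, hk, s', hr', rfl⟩ }
    have hRel : ∀ M, (∀ a b, M a b ∈ intSubgroup ∧
        |M a b| ≤ 132 * (deterministicCfg C' d n (maxWeight w)).W) →
        Reliable (deterministicCfg C' d n (maxWeight w)) prog (K * m ^ e)
        {x : ℝ | |x| ≤ (K * m ^ e : ℕ)} (t m) (fun _ => false) M := by
      intro M hM ans hans
      obtain ⟨k, hk, s', hr', hs'⟩ := hout M hM
      rw [hr] at hans ⊢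
      obtain ⟨k₁, -, s₁, hr₁, hs₁⟩ := hans 0 Nat.zero_lt_one
      rw [coinStream_false] at hr₁
      -- There is one vote; by determinism its answer is the one that the hypothesis declares
      -- correct.
      have : {q | q < 1 ∧ IsGreatest (subarraySums M) (ans q)} = {0} := by
        ext q
        simp only [Set.mem_ofPred_eq, Set.mem_singleton_iff, Nat.lt_one_iff]
        refine ⟨fun h => h.1, ?_⟩
        rintro rfl
        rw [← hs₁, ← (hr'.deterministic hr₁).2]
        exact ⟨rfl, hs'⟩
      rw [this, Set.ncard_singleton]
      norm_num
    have hN0 : (1 : ℝ) ≤ (deterministicCfg C' d n (maxWeight w)).N := by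
      exact_mod_cast Room.N_pos _
    have hNM : 0 ≤ (deterministicCfg C' d n (maxWeight w)).N *
      (4 * ((deterministicCfg C' d n (maxWeight w)).N * maxWeight w)) := by positivity
    have hpos : (0 : ℝ) ≤ 32 * (deterministicCfg C' d n (maxWeight w)).N ^ (d + 2) := by
      positivity
    have hCB : C' ≤ deterministicBound C' d K e n := by
      have : C' * 1 ≤ 8 * C' * n ^ 3 := Nat.mul_le_mul (by omega) (Nat.one_le_pow _ _ hn)
      rw [add_mul] at b1
      omega
    have hgood : ∀ l < (deterministicCfg C' d n (maxWeight w)).lam, ∀ D mid,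
        (∀ i < (deterministicCfg C' d n (maxWeight w)).N,
          ∀ j < (deterministicCfg C' d n (maxWeight w)).N, D i j =
          minPlusPow (deterministicCfg C' d n (maxWeight w)).N (initDist w
            (4 * ((deterministicCfg C' d n (maxWeight w)).N * maxWeight w))) l i j) →
        LevelGood (deterministicCfg C' d n (maxWeight w)) intSubgroup
          (Reliable (deterministicCfg C' d n (maxWeight w)) prog (K * m ^ e)
          {x : ℝ | |x| ≤ (K * m ^ e : ℕ)} (t m) (fun _ => false)) (fun _ => 0)
          (accuracy (deterministicCfg C' d n (maxWeight w)).L) D mid := by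
      intro l hl D mid hD
      have hX0 : (0 : ℝ) ≤ 4 * ((deterministicCfg C' d n (maxWeight w)).N * maxWeight w) := by
        positivity
      have hMX : maxWeight w ≤ 4 * ((deterministicCfg C' d n (maxWeight w)).N * maxWeight w) := by
        nlinarith
      have hXΛ : 4 * ((deterministicCfg C' d n (maxWeight w)).N * maxWeight w) ∈ intSubgroup := by
        obtain ⟨z, hz⟩ := hMΛ
        refine ⟨4 * ((deterministicCfg C' d n (maxWeight w)).N * z), ?_⟩
        simp only [Int.coe_castAddHom] at hz ⊢
        push_cast
        rw [hz]
      have hl2 : (2 : ℝ) * 2 ^ l ≤ (deterministicCfg C' d n (maxWeight w)).N := by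
        unfold Cfg.N
        push_cast
        rw [← pow_succ']
        exact pow_le_pow_right₀ (by norm_num) hl
      have hV : 2 * (2 ^ l * (4 * ((deterministicCfg C' d n (maxWeight w)).N * maxWeight w))) ≤
          (deterministicCfg C' d n (maxWeight w)).N *
          (4 * ((deterministicCfg C' d n (maxWeight w)).N * maxWeight w)) := by
        rw [← mul_assoc]
        exact mul_le_mul_of_nonneg_right hl2 hX0
      have hNN : (deterministicCfg C' d n (maxWeight w)).N *
          (4 * ((deterministicCfg C' d n (maxWeight w)).N * maxWeight w)) ≤
          4 * ((deterministicCfg C' d n (maxWeight w)).N : ℝ) ^ (d + 2) := by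
        have h3 : ((deterministicCfg C' d n (maxWeight w)).N : ℝ) *
          ((deterministicCfg C' d n (maxWeight w)).N * maxWeight w) ≤
          (deterministicCfg C' d n (maxWeight w)).N * ((deterministicCfg C' d n (maxWeight w)).N *
          (deterministicCfg C' d n (maxWeight w)).N ^ d) := by gcongr
        have h4 : ((deterministicCfg C' d n (maxWeight w)).N : ℝ) *
          ((deterministicCfg C' d n (maxWeight w)).N *
          (deterministicCfg C' d n (maxWeight w)).N ^ d) =
          (deterministicCfg C' d n (maxWeight w)).N ^ (d + 2) := by ring
        linarith
      refine levelGood_deterministic hR hRel _ hWΛ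
        (V := 2 ^ l * (4 * ((deterministicCfg C' d n (maxWeight w)).N * maxWeight w)))
        (by rw [hWeq]; linarith) (by omega) (by rw [hpow]; linarith) (by rw [hpow, hWeq]; linarith)
        (fun i hi j hj => ?_) (fun i hi j hj => ?_)
      · rw [hD i hi j hj]
        exact abs_minPlusPow_le hX0 (fun i _ j _ => abs_initDist_le hX0 (fun u v x hx =>
          (abs_le_maxWeight hx).trans hMX) i j) l i hi j hj
      · rw [hD i hi j hj]
        exact minPlusPow_mem (fun i _ j _ => initDist_mem hXΛ hwΛ i j) l i hi j hj
    obtain ⟨k, hk, s', hr', hs'⟩ := apsp_spec (c := deterministicCfg C' d n (maxWeight w)) hR hO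
      (w := w) hw hn rfl rfl
      ((le_add_of_nonneg_right hpos).trans hWeq.ge)
      (prepares_deterministic hR (d := d) (C := C') hCB rfl rfl rfl rfl hNM rfl (fun _ => false)
        fun _ => 0)
      (fun p _ => accuracy_nonneg _ p) (fun p _ => (accuracy_le _ p).trans (by
        rw [hpow, hWeq]; linarith)) (fun p _ => accuracy_mem _ p)
      ⟨(deterministicCfg C' d n (maxWeight w)).L - 1, by omega, if_neg (by omega)⟩ hWΛ h1Λ hwΛ
      (fun q hq => absurd hq (by rw [hrho]; exact Nat.not_lt_zero q)) (G := True)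
      (fun _ l hl D mid hD => hgood l hl D mid hD) (fun n => {x | IsSmallInt d n x})
    refine ⟨k, hk.trans (apspTime_le (Nat.le_add_left _ _) ?_ ?_ ?_ ?_ ?_), s', hr', hs' trivial⟩
    · rw [hr]; exact Nat.mul_pos (by omega) (Nat.succ_pos _)
    · rw [hrho]; exact Nat.zero_le _
    · exact hLΛ.trans (Nat.mul_le_mul_right _ (by omega))
    · omega
    · have h1 : 1 ≤ (deterministicCfg C' d n (maxWeight w)).g ^ 3 *
          ((deterministicCfg C' d n (maxWeight w)).s ^ 2 + t m) :=
        Nat.mul_pos (Nat.pow_pos (Room.g_pos _)) (Nat.add_pos_left (Nat.pow_pos (by omega)) _)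
      have h2 := Nat.le_self_pow two_ne_zero ((deterministicCfg C' d n (maxWeight w)).lam + 1)
      have h3 : (deterministicCfg C' d n (maxWeight w)).L * 6 + 16 ≤
          A * ((deterministicCfg C' d n (maxWeight w)).lam + 1) := by
        have : A * ((deterministicCfg C' d n (maxWeight w)).lam + 1) =
          6 * ((d + 8) * ((deterministicCfg C' d n (maxWeight w)).lam + 1)) +
          (16 + mb) * ((deterministicCfg C' d n (maxWeight w)).lam + 1) := by ring
        rw [this]
        have := Nat.le_mul_of_pos_right (16 + mb)
          (show 0 < (deterministicCfg C' d n (maxWeight w)).lam + 1 from Nat.succ_pos _)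
        omega
      exact h3.trans (Nat.mul_le_mul_left _ (h2.trans (Nat.le_mul_of_pos_right _ h1)))

/-! ### Averages over coin tosses -/

/-- The coin tosses `z`, preceded by `b`. -/
def consBit (b : Bool) (z : ℕ → Bool) : ℕ → Bool
  | 0 => b
  | m + 1 => z m

/-- The average of `F` over the first `T` coin tosses; the other tosses are `false`. -/
noncomputable def ave : ℕ → ((ℕ → Bool) → ℝ) → ℝ
  | 0, F => F fun _ => false
  | T + 1, F => (ave T (fun z => F (consBit false z)) + ave T fun z => F (consBit true z)) / 2

/-- The first `a` coin tosses of `x`, followed by `y`. -/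
def splice (a : ℕ) (x y : ℕ → Bool) : ℕ → Bool :=
  fun m => if m < a then x m else y (m - a)

theorem splice_of_lt {a m : ℕ} (h : m < a) (x y : ℕ → Bool) : splice a x y m = x m := if_pos h

@[simp] theorem splice_add (a m : ℕ) (x y : ℕ → Bool) : splice a x y (a + m) = y m := by
  simp [splice]

theorem ave_mono {T : ℕ} {F G : (ℕ → Bool) → ℝ} (h : ∀ z, F z ≤ G z) : ave T F ≤ ave T G := by
  induction T generalizing F G with
  | zero => exact h _
  | succ T ih =>
    have h1 := ih (F := fun z => F (consBit false z)) fun z => h _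
    have h2 := ih (F := fun z => F (consBit true z)) fun z => h _
    simp only [ave]
    linarith

theorem ave_const (T : ℕ) (c : ℝ) : ave T (fun _ => c) = c := by
  induction T with
  | zero => rfl
  | succ T ih => simp only [ave, ih]; ring

theorem ave_add_fun (T : ℕ) (F G : (ℕ → Bool) → ℝ) :
    ave T (fun z => F z + G z) = ave T F + ave T G := by
  induction T generalizing F G with
  | zero => rfl
  | succ T ih => simp only [ave, ih]; ring

theorem ave_mul_left (T : ℕ) (c : ℝ) (F : (ℕ → Bool) → ℝ) :
    ave T (fun z => c * F z) = c * ave T F := by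
  induction T generalizing F with
  | zero => rfl
  | succ T ih => simp only [ave, ih]; ring

theorem ave_sum {ι : Type*} (s : Finset ι) (T : ℕ) (F : ι → (ℕ → Bool) → ℝ) :
    ave T (fun z => ∑ i ∈ s, F i z) = ∑ i ∈ s, ave T (F i) := by
  classical
  induction s using Finset.induction_on with
  | empty => simp [ave_const]
  | insert i s hi ih =>
    simp only [Finset.sum_insert hi]
    rw [ave_add_fun, ih]

theorem ave_nonneg {T : ℕ} {F : (ℕ → Bool) → ℝ} (h : ∀ z, 0 ≤ F z) : 0 ≤ ave T F := by
  rw [← ave_const T 0]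
  exact ave_mono h

/-- Fubini for coin tosses: the first `a` tosses can be fixed while averaging over the others. -/
theorem ave_add (a b : ℕ) (F : (ℕ → Bool) → ℝ) :
    ave (a + b) F = ave a fun x => ave b fun y => F (splice a x y) := by
  induction a generalizing F with
  | zero =>
    have h : ∀ y, splice 0 (fun _ => false) y = y := fun y => by funext m; simp [splice]
    simp only [Nat.zero_add, ave, h]
  | succ a ih =>
    have h : ∀ c x y, consBit c (splice a x y) = splice (a + 1) (consBit c x) y := by
      intro c x y
      funext m
      cases m with
      | zero => simp [consBit, splice]
      | succ m => simp [consBit, splice]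
    rw [Nat.succ_add]
    simp only [ave, ih, h]

theorem ave_eq_of_depends {a b : ℕ} {F : (ℕ → Bool) → ℝ}
    (h : ∀ z z', (∀ i < a, z i = z' i) → F z = F z') : ave (a + b) F = ave a F := by
  rw [ave_add]
  congr 1
  funext x
  have : ∀ y, F (splice a x y) = F x := fun y => h _ _ fun i hi => splice_of_lt hi x y
  simp only [this, ave_const]

theorem coinStream_cons {T : ℕ} (b : Bool) (ω : Fin T → Bool) :
    coinStream (Fin.cons b ω : Fin (T + 1) → Bool) = consBit b (coinStream ω) := by
  funext m
  cases m with
  | zero => simp [coinStream, consBit]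
  | succ m =>
    simp only [coinStream, consBit, Nat.succ_lt_succ_iff]
    split_ifs with h
    · exact Fin.cons_succ (α := fun _ => Bool) b ω ⟨m, h⟩
    · rfl

theorem ave_eq_sum (T : ℕ) (F : (ℕ → Bool) → ℝ) :
    ave T F = (∑ ω : Fin T → Bool, F (coinStream ω)) / 2 ^ T := by
  induction T generalizing F with
  | zero =>
    simp only [ave, Fintype.sum_unique, pow_zero, div_one]
    congr 1
  | succ T ih =>
    rw [← (Fin.consEquiv fun _ => Bool).sum_comp, Fintype.sum_prod_type, Fintype.sum_bool]
    have h : ∀ b ω, coinStream ((Fin.consEquiv fun _ : Fin (T + 1) => Bool) (b, ω)) =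
      consBit b (coinStream ω) := fun b ω => coinStream_cons b ω
    simp only [h]
    simp only [ave, ih, pow_succ]
    field_simp
    ring

/-- Independence of disjoint blocks of tosses. The condition on `f` is needed because each factor
formally receives the whole remaining stream. -/
theorem ave_blocks (m b e : ℕ) {f : ℕ → (ℕ → Bool) → ℝ}
    (hf : ∀ q < m, ∀ z z', (∀ i < b, z i = z' i) → f q z = f q z') :
    ave (m * b + e) (fun z => ∏ q ∈ Finset.range m, f q fun i => z (q * b + i)) =
      ∏ q ∈ Finset.range m, ave b (f q) := by
  induction m generalizing f with
  | zero => simp [ave_const]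
  | succ m ih =>
    rw [show (m + 1) * b + e = b + (m * b + e) by ring, ave_add, Finset.prod_range_succ']
    have h : ∀ x y, ∏ q ∈ Finset.range (m + 1), f q (fun i => splice b x y (q * b + i)) =
        f 0 x * ∏ q ∈ Finset.range m, f (q + 1) fun i => y (q * b + i) := by
      intro x y
      rw [Finset.prod_range_succ', mul_comm]
      congr 1
      · refine hf 0 (Nat.succ_pos m) _ _ fun i hi => ?_
        rw [Nat.zero_mul, Nat.zero_add, splice_of_lt hi]
      · refine Finset.prod_congr rfl fun q _ => ?_
        congr 1
        funext i
        rw [show (q + 1) * b + i = b + (q * b + i) by ring, splice_add]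
    simp only [h, ave_mul_left]
    rw [ih fun q hq => hf (q + 1) (by omega)]
    have : ∀ x, f 0 x * ∏ q ∈ Finset.range m, ave b (f (q + 1)) =
      (∏ q ∈ Finset.range m, ave b (f (q + 1))) * f 0 x := fun x => mul_comm _ _
    simp only [this, ave_mul_left]

/-! ### Samples from coin tosses -/

theorem binary_consBit (b : Bool) (z : ℕ → Bool) (l : ℕ) :
    binary (consBit b z) (l + 1) = b.toNat * 2 ^ l + binary z l := by
  induction l with
  | zero => simp [binary, consBit]
  | succ l ih =>
    rw [binary, ih, binary, consBit, pow_succ]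
    ring

theorem binary_congr {z z' : ℕ → Bool} {l : ℕ} (h : ∀ i < l, z i = z' i) :
    binary z l = binary z' l := by
  induction l with
  | zero => rfl
  | succ l ih => rw [binary, binary, ih fun i hi => h i (by omega), h l (by omega)]

theorem ave_binary (l : ℕ) (f : ℕ → ℝ) :
    ave l (fun z => f (binary z l)) = (∑ k ∈ Finset.range (2 ^ l), f k) / 2 ^ l := by
  induction l generalizing f with
  | zero => simp [ave, binary]
  | succ l ih =>
    simp only [ave, binary_consBit, Bool.toNat_false, Bool.toNat_true, zero_mul, zero_add, one_mul]
    rw [ih, ih fun k => f (2 ^ l + k), show 2 ^ (l + 1) = 2 ^ l + 2 ^ l by ring,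
      Finset.sum_range_add]
    field_simp
    ring

/-! ### Probabilities of failure -/

open Classical in
/-- The indicator of a proposition. -/
noncomputable def ind (p : Prop) : ℝ := if p then 1 else 0

theorem ind_of_true {p : Prop} (h : p) : ind p = 1 := if_pos h

theorem ind_of_not {p : Prop} (h : ¬ p) : ind p = 0 := if_neg h

theorem ind_nonneg (p : Prop) : 0 ≤ ind p := by unfold ind; split_ifs <;> norm_num

theorem ind_forall (m : ℕ) (p : ℕ → Prop) :
    ind (∀ q < m, p q) = ∏ q ∈ Finset.range m, ind (p q) := by
  by_cases h : ∀ q < m, p q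
  · rw [ind_of_true h, Finset.prod_eq_one fun q hq => ind_of_true (h q (Finset.mem_range.1 hq))]
  · rw [ind_of_not h]
    push Not at h
    obtain ⟨q, hq, h⟩ := h
    exact (Finset.prod_eq_zero (Finset.mem_range.2 hq) (ind_of_not h)).symm

theorem sum_ind_eq_ncard {α : Type*} [Fintype α] (p : α → Prop) :
    ∑ x, ind (p x) = ({x | p x} : Set α).ncard := by
  classical
  have : ({x | p x} : Set α) = ((Finset.univ.filter p : Finset α) : Set α) := by
    ext; simp
  rw [this, Set.ncard_coe_finset, Finset.card_filter]
  push_cast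
  refine Finset.sum_congr rfl fun x _ => ?_
  unfold ind
  split_ifs <;> rfl

theorem ave_ind_miss (rho lam e : ℕ) {A : Finset ℕ} (hA : A ⊆ Finset.range (2 ^ lam)) :
    ave (rho * lam + e) (fun z => ind (∀ q < rho, binary (fun i => z (q * lam + i)) lam ∉ A)) =
      (1 - A.card / 2 ^ lam) ^ rho := by
  simp only [ind_forall]
  rw [ave_blocks rho lam e (f := fun _ z => ind (binary z lam ∉ A))
    fun q _ z z' h => by rw [binary_congr h]]
  rw [Finset.prod_const, Finset.card_range, ave_binary lam fun k => ind (k ∉ A)]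
  congr 1
  have h1 : ∀ k ∈ Finset.range (2 ^ lam), ind (k ∉ A) = 1 - if k ∈ A then 1 else 0 := by
    intro k _
    unfold ind
    split_ifs <;> simp_all
  rw [Finset.sum_congr rfl h1, Finset.sum_sub_distrib, Finset.sum_ite_mem,
    Finset.inter_eq_right.2 hA]
  simp only [Finset.sum_const, Finset.card_range, nsmul_eq_mul, mul_one]
  push_cast
  field_simp

/-- `(1 - 1/g)^g ≤ 1/e ≤ 1/2`; so `m * g` samples that hit with probability `1/g` all miss with
probability at most `2^(-m)`. -/
theorem pow_one_sub_inv_le {g m : ℕ} (hg : 1 ≤ g) : (1 - 1 / g : ℝ) ^ (m * g) ≤ (1 / 2) ^ m := by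
  have h1 : (1 - 1 / g : ℝ) ^ g ≤ 1 / 2 := by
    have h2 := Real.one_sub_div_pow_le_exp_neg (n := g) (t := 1) (by exact_mod_cast hg)
    refine h2.trans ?_
    rw [Real.exp_neg, inv_eq_one_div]
    exact one_div_le_one_div_of_le (by norm_num) (by linarith [Real.add_one_le_exp (1 : ℝ)])
  have h0 : (0 : ℝ) ≤ 1 - 1 / g := by
    rw [sub_nonneg, div_le_one (by positivity)]
    exact_mod_cast hg
  rw [mul_comm, pow_mul]
  exact pow_le_pow_left₀ (by positivity) h1 m

/-- At least `s` numbers have fewer than `s` numbers below them. -/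
theorem le_card_small_rank {N s : ℕ} (hsN : s ≤ N) (f : ℕ → ℝ) :
    s ≤ ((Finset.range N).filter fun k =>
      ((Finset.range N).filter fun k' => f k' < f k).card < s).card := by
  by_contra! h
  set A := (Finset.range N).filter fun k =>
    ((Finset.range N).filter fun k' => f k' < f k).card < s with hA
  have hne : ((Finset.range N) \ A).Nonempty := by
    rw [← Finset.card_pos]
    have := Finset.le_card_sdiff A (Finset.range N)
    rw [Finset.card_range] at this
    omega
  obtain ⟨k, hk, hmin⟩ := Finset.exists_min_image _ f hne
  rw [Finset.mem_sdiff] at hk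
  refine hk.2 ?_
  rw [hA, Finset.mem_filter]
  refine ⟨hk.1, lt_of_le_of_lt (Finset.card_le_card ?_) h⟩
  intro k' hk'
  rw [Finset.mem_filter] at hk'
  by_contra h'
  exact absurd (hmin k' (Finset.mem_sdiff.2 ⟨hk'.1, h'⟩)) (not_le.2 hk'.2)

/-- The answer of the program with the first `t` coin tosses of `z` is correct. -/
def Correct (prog : RamProg) (B₀ : ℕ) (N₀ : Set ℝ) (t : ℕ) {m : ℕ} (M : Fin m → Fin m → ℝ)
    (z : ℕ → Bool) : Prop :=
  ∃ k ≤ t, ∃ s, RunsTo B₀ N₀ prog ((maxSubarray fun _ => Set.univ).start m M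
    (coinStream fun b : Fin t => z b)) k s ∧ IsGreatest (subarraySums M) (s.xreg 0)

theorem Correct.congr {prog : RamProg} {B₀ : ℕ} {N₀ : Set ℝ} {t m : ℕ} {M : Fin m → Fin m → ℝ}
    {z z' : ℕ → Bool} (h : ∀ i < t, z i = z' i) :
    Correct prog B₀ N₀ t M z ↔ Correct prog B₀ N₀ t M z' := by
  unfold Correct
  rw [show (fun b : Fin t => z b) = fun b : Fin t => z' b from funext fun b => h b b.2]

/-- The quantity averaged is `2` for a wrong answer and `1` for a right one, prepared for an
exponential Markov inequality. Surplus tosses beyond `t` are averaged out. -/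
theorem ave_ind_not_correct_le {prog : RamProg} {B₀ : ℕ} {N₀ : Set ℝ} {t m tau : ℕ}
    {M : Fin m → Fin m → ℝ} (ht : t ≤ tau)
    (h : 2 * 2 ^ t ≤ 3 * Set.ncard {r : Fin t → Bool | ∃ k ≤ t, ∃ s, RunsTo B₀ N₀ prog
      ((maxSubarray fun _ => Set.univ).start m M (coinStream r)) k s ∧
      IsGreatest (subarraySums M) (s.xreg 0)}) :
    ave tau (fun z => 1 + ind (¬ Correct prog B₀ N₀ t M z)) ≤ 4 / 3 := by
  obtain ⟨e, rfl⟩ := Nat.exists_eq_add_of_le ht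
  rw [ave_eq_of_depends fun z z' hz => by rw [Correct.congr hz]]
  have h1 : ∀ z, 1 + ind (¬ Correct prog B₀ N₀ t M z) = 2 + -1 * ind (Correct prog B₀ N₀ t M z) := by
    intro z
    unfold ind
    by_cases hc : Correct prog B₀ N₀ t M z <;> simp [hc] <;> norm_num
  simp only [h1]
  rw [ave_add_fun, ave_const, ave_mul_left, ave_eq_sum, sum_ind_eq_ncard]
  have h2 : ∀ r : Fin t → Bool, (fun b : Fin t => coinStream r b) = r := by
    intro r
    funext b
    simp [coinStream]
  unfold Correct
  simp only [h2]
  have h3 : (2 * 2 ^ t : ℝ) ≤ 3 * (Set.ncard {r : Fin t → Bool | ∃ k ≤ t, ∃ s, RunsTo B₀ N₀ prog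
      ((maxSubarray fun _ => Set.univ).start m M (coinStream r)) k s ∧
      IsGreatest (subarraySums M) (s.xreg 0)} : ℝ) := by exact_mod_cast h
  have h4 : (2 / 3 : ℝ) ≤ (Set.ncard {r : Fin t → Bool | ∃ k ≤ t, ∃ s, RunsTo B₀ N₀ prog
      ((maxSubarray fun _ => Set.univ).start m M (coinStream r)) k s ∧
      IsGreatest (subarraySums M) (s.xreg 0)} : ℝ) / 2 ^ t := by
    rw [le_div_iff₀ (by positivity)]
    linarith
  linarith

/-- If the votes are not reliable, at least `h` of the `2 h` answers are wrong, and each of them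
contributes a factor `2`. -/
theorem two_pow_mul_ind_not_reliable_le {c : Cfg} {h : ℕ} (hr : c.r = 2 * h) {prog : RamProg} {B₀ : ℕ}
    {N₀ : Set ℝ} {t : ℕ} {M : Fin (2 * c.s - 1) → Fin (2 * c.s - 1) → ℝ} (z : ℕ → Bool) :
    2 ^ h * ind (¬ Reliable c prog B₀ N₀ t z M) ≤
      ∏ q ∈ Finset.range c.r, (1 + ind (¬ Correct prog B₀ N₀ t M fun i => z (q * c.tau + i))) := by
  classical
  by_cases hrel : Reliable c prog B₀ N₀ t z M
  · rw [ind_of_not (not_not.2 hrel), mul_zero]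
    exact Finset.prod_nonneg fun q _ => by linarith [ind_nonneg (¬ Correct prog B₀ N₀ t M fun i =>
      z (q * c.tau + i))]
  · rw [ind_of_true hrel, mul_one]
    unfold Reliable at hrel
    push Not at hrel
    obtain ⟨ans, hans, hcard⟩ := hrel
    have h1 : ∀ q < c.r, 1 + ind (¬ Correct prog B₀ N₀ t M fun i => z (q * c.tau + i)) =
        if IsGreatest (subarraySums M) (ans q) then 1 else 2 := by
      intro q hq
      have : Correct prog B₀ N₀ t M (fun i => z (q * c.tau + i)) ↔
          IsGreatest (subarraySums M) (ans q) := by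
        obtain ⟨k, hk, s, hs, hx⟩ := hans q hq
        constructor
        · rintro ⟨k', -, s', hs', hx'⟩
          rw [← hx, (hs.deterministic hs').2]
          exact hx'
        · intro h
          exact ⟨k, hk, s, hs, by rwa [hx]⟩
      rw [this]
      unfold ind
      split_ifs <;> norm_num
    rw [Finset.prod_congr rfl fun q hq => h1 q (Finset.mem_range.1 hq), Finset.prod_ite]
    simp only [Finset.prod_const, one_pow, one_mul]
    have h2 : Set.ncard {q | q < c.r ∧ IsGreatest (subarraySums M) (ans q)} =
        ((Finset.range c.r).filter fun q => IsGreatest (subarraySums M) (ans q)).card := by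
      rw [← Set.ncard_coe_finset]
      congr 1
      ext q
      simp
    have h3 := Finset.card_filter_add_card_filter_not (s := Finset.range c.r)
      fun q => IsGreatest (subarraySums M) (ans q)
    rw [Finset.card_range] at h3
    exact pow_le_pow_right₀ (by norm_num) (by omega)

/-- By independence the product has average at most `(4/3)^(2 h)`; dividing by `2^h` gives
`(8/9)^h`. -/
theorem ave_ind_not_reliable_le {c : Cfg} {h : ℕ} (hr : c.r = 2 * h) {prog : RamProg} {B₀ : ℕ}
    {N₀ : Set ℝ} {t : ℕ} {M : Fin (2 * c.s - 1) → Fin (2 * c.s - 1) → ℝ} (ht : t ≤ c.tau) (e : ℕ)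
    (hM : 2 * 2 ^ t ≤ 3 * Set.ncard {r : Fin t → Bool | ∃ k ≤ t, ∃ s, RunsTo B₀ N₀ prog
      ((maxSubarray fun _ => Set.univ).start _ M (coinStream r)) k s ∧
      IsGreatest (subarraySums M) (s.xreg 0)}) :
    ave (c.r * c.tau + e) (fun z => ind (¬ Reliable c prog B₀ N₀ t z M)) ≤ (8 / 9) ^ h := by
  have h1 := ave_mono (T := c.r * c.tau + e) fun z =>
    two_pow_mul_ind_not_reliable_le hr (prog := prog) (B₀ := B₀) (N₀ := N₀) (t := t) (M := M) z
  rw [ave_mul_left, ave_blocks c.r c.tau e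
    (f := fun _ z => 1 + ind (¬ Correct prog B₀ N₀ t M z)) fun q _ z z' hz => by
      rw [Correct.congr fun i hi => hz i (hi.trans_le ht)]] at h1
  rw [Finset.prod_const, Finset.card_range] at h1
  have h2 : ave c.tau (fun z => 1 + ind (¬ Correct prog B₀ N₀ t M z)) ^ c.r ≤ (4 / 3) ^ (2 * h) := by
    rw [hr]
    refine pow_le_pow_left₀ (ave_nonneg fun z => ?_) (ave_ind_not_correct_le ht hM) _
    linarith [ind_nonneg (¬ Correct prog B₀ N₀ t M z)]
  have h3 : (2 : ℝ) ^ h * (8 / 9) ^ h = (4 / 3) ^ (2 * h) := by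
    rw [← mul_pow, pow_mul]
    norm_num
  have h4 := h1.trans h2
  rw [← h3] at h4
  exact le_of_mul_le_mul_left h4 (by positivity)

/-! ### The randomized pass -/

/-- The matrix that arises from `D` by relaxing with the triples `i j k` for which `P i j k`. -/
noncomputable def relaxed (N : ℕ) (D : ℕ → ℕ → ℝ) (P : ℕ → ℕ → ℕ → Prop) (i j : ℕ) : ℝ :=
  sInf (insert (D i j) ((fun k => D i k + D k j) '' {k | k < N ∧ P i j k}))

theorem eq_relaxed {N : ℕ} {D : ℕ → ℕ → ℝ} {P : ℕ → ℕ → ℕ → Prop} {i j : ℕ} {x : ℝ}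
    (h : x = D i j ∨ ∃ k < N, P i j k ∧ x = D i k + D k j) (h1 : x ≤ D i j)
    (h2 : ∀ k < N, P i j k → x ≤ D i k + D k j) : x = relaxed N D P i j := by
  refine (IsLeast.csInf_eq ⟨?_, ?_⟩).symm
  · obtain h | ⟨k, hk, hP, h⟩ := h
    · exact .inl h
    · exact .inr ⟨k, ⟨hk, hP⟩, h.symm⟩
  · rintro y (rfl | ⟨k, ⟨hk, hP⟩, rfl⟩)
    · exact h1
    · exact h2 k hk hP

/-- The matrix for the block with number `q`, if the samples are `R`. -/
noncomputable def sampledBlock (c : Cfg) (D : ℕ → ℕ → ℝ) (R : ℕ → ℕ) (q : ℕ) :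
    Fin (2 * c.s - 1) → Fin (2 * c.s - 1) → ℝ :=
  blockMatrix c 0 D (relaxed c.N D fun i j k => (∃ q' < c.rho, R q' = k) ∨ c.code i j k < q) q

/-- The vertices through which fewer than `s` vertices improve the path from `i` to `j`. -/
noncomputable def smallRank (N s : ℕ) (D : ℕ → ℕ → ℝ) (i j : ℕ) : Finset ℕ :=
  (Finset.range N).filter fun k =>
    ((Finset.range N).filter fun k' => D i k' + D k' j < D i k + D k j).card < s

/-! ### Fixed queries and the union bound -/

section
variable {B : ℕ} {Nm : Set ℝ} {c : Cfg}

theorem blockMatrix_congr (hR : Room c B Nm) {δ : ℝ} {D D' T T' : ℕ → ℕ → ℝ} {q : ℕ}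
    (hq : q < c.g * c.g * c.g) (hD : ∀ i < c.N, ∀ j < c.N, D i j = D' i j)
    (hT : ∀ i < c.N, ∀ j < c.N, T i j = T' i j) :
    blockMatrix c δ D T q = blockMatrix c δ D' T' q := by
  have hg : 0 < c.g := Room.g_pos c
  have hI : q / c.g / c.g < c.g :=
    Nat.div_lt_of_lt_mul (Nat.div_lt_of_lt_mul (by rwa [mul_comm c.g (c.g * c.g)]))
  have hJ : q / c.g % c.g < c.g := Nat.mod_lt _ hg
  have hK : q % c.g < c.g := Nat.mod_lt _ hg
  have h : ∀ x < 2 * c.s, ∀ y < 2 * c.s,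
      blockPotential c δ D T (q / c.g / c.g) (q / c.g % c.g) (q % c.g) x y =
      blockPotential c δ D' T' (q / c.g / c.g) (q / c.g % c.g) (q % c.g) x y := by
    intro x hx y hy
    refine trianglePotential_congr (fun x hx y hy => ?_) (fun x hx y hy => ?_)
      (fun x hx y hy => ?_) hx hy
    · exact hD _ (hR.block_lt hI hx) _ (hR.block_lt hK hy)
    · exact hD _ (hR.block_lt hK hx) _ (hR.block_lt hJ hy)
    · rw [hT _ (hR.block_lt hI hx) _ (hR.block_lt hJ hy)]
  funext a b
  have ha := a.2
  have hb := b.2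
  unfold blockMatrix mixedDiff
  rw [h _ (by omega) _ (by omega), h _ (by omega) _ (by omega), h _ (by omega) _ (by omega),
    h _ (by omega) _ (by omega)]

/-- The potential of a value is the number of vertices with a smaller sum; a sampled vertex of small
rank bounds it by `s`. With `δ = 0` the matrix before block `q` is the minimum over `D`, the sampled
sums and all sums in earlier blocks. It does not depend on how the votes brought it about, which
makes the queries equal to `sampledBlock`. -/
theorem levelGood_randomized (hR : Room c B Nm) (hL : c.L = 1)
    {Rel : (Fin (2 * c.s - 1) → Fin (2 * c.s - 1) → ℝ) → Prop} {R : ℕ → ℕ}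
    {D D' : ℕ → ℕ → ℝ} {mid : ℕ → ℕ → ℕ} (hD : ∀ i < c.N, ∀ j < c.N, D i j = D' i j)
    (hsample : ∀ i < c.N, ∀ j < c.N, ∃ q < c.rho, R q ∈ smallRank c.N c.s D' i j)
    (hRel : ∀ q < c.g * c.g * c.g, Rel (sampledBlock c D' R q)) :
    LevelGood c ⊤ Rel R (fun _ => 0) D mid := by
  intro T₀ mid₀ hT₀ p hp T mid' _ h0 _
  obtain rfl : p = 0 := by omega
  have hT := h0 rfl
  refine ⟨fun q hq T' hT' => ?_, fun i j x =>
    ((Finset.range c.N).filter fun k => D i k + D k j < x).card, fun i _ j _ x y hxy => ?_,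
    fun i _ j _ k hk x _ hx => ?_, fun i hi j hj => ?_⟩
  · obtain ⟨⟨S, m, m', hcode, hS⟩, hle⟩ := hT'
    have : blockMatrix c 0 D T' q = sampledBlock c D' R q := by
      refine blockMatrix_congr hR hq hD fun i hi j hj => ?_
      refine eq_relaxed ?_ ?_ ?_
      · obtain ⟨h1 | ⟨-, k, hk, hSk, h1, -⟩, -⟩ := hS i hi j hj
        · obtain ⟨h2 | ⟨-, k, hk, hRk, h2, -⟩, -⟩ := hT₀ i hi j hj
          · left
            rw [h1.1, hT i hi j hj, h2.1, hD i hi j hj]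
          · right
            exact ⟨k, hk, .inl hRk, by rw [h1.1, hT i hi j hj, h2, hD i hi k hk, hD k hk j hj]⟩
        · right
          exact ⟨k, hk, .inr (hcode i hi j hj k hk hSk), by rw [h1, hD i hi k hk, hD k hk j hj]⟩
      · rw [← hD i hi j hj]
        exact (hS.le hi hj).trans ((hT i hi j hj).le.trans (hT₀.le hi hj))
      · rintro k hk (h1 | h1)
        · rw [← hD i hi k hk, ← hD k hk j hj]
          exact (hS.le hi hj).trans ((hT i hi j hj).le.trans ((hT₀ i hi j hj).2 k hk h1))
        · rw [← hD i hi k hk, ← hD k hk j hj, ← add_zero (D i k + D k j)]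
          exact hle i hi j hj k hk h1
    rw [this]
    exact hRel q hq
  · exact Finset.card_le_card fun k hk => by
      rw [Finset.mem_filter] at hk ⊢
      exact ⟨hk.1, hk.2.trans_le hxy⟩
  · rw [add_zero] at hx
    refine Finset.card_lt_card (Finset.ssubset_iff_of_subset (fun k' hk' => ?_) |>.2 ⟨k, ?_, ?_⟩)
    · rw [Finset.mem_filter] at hk' ⊢
      exact ⟨hk'.1, hk'.2.trans hx⟩
    · exact Finset.mem_filter.2 ⟨Finset.mem_range.2 hk, hx⟩
    · simp
  · obtain ⟨q, hq, hRq⟩ := hsample i hi j hj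
    rw [smallRank, Finset.mem_filter, Finset.mem_range] at hRq
    refine le_trans (Finset.card_le_card fun k hk => ?_) hRq.2.le
    rw [Finset.mem_filter] at hk ⊢
    refine ⟨hk.1, ?_⟩
    have h1 := (hT₀ i hi j hj).2 _ hRq.1 ⟨q, hq, rfl⟩
    rw [← hD i hi k (Finset.mem_range.1 hk.1), ← hD k (Finset.mem_range.1 hk.1) j hj,
      ← hD i hi _ hRq.1, ← hD _ hRq.1 j hj]
    rw [hT i hi j hj] at hk
    exact hk.2.trans_le h1

/-- The samples that are drawn with the coin tosses `z`. -/
def samples (lam : ℕ) (z : ℕ → Bool) (q : ℕ) : ℕ :=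
  binary (fun b => z (q * lam + b)) lam

/-- Something goes wrong with the coin tosses `z`, if the levels start with the matrices `D`. -/
def Fails (c : Cfg) (prog : RamProg) (B₀ : ℕ) (N₀ : Set ℝ) (t : ℕ) (D : ℕ → ℕ → ℕ → ℝ)
    (z : ℕ → Bool) : Prop :=
  ∃ l < c.lam, (∃ i < c.N, ∃ j < c.N, ∀ q < c.rho,
      samples c.lam z q ∉ smallRank c.N c.s (D l) i j) ∨
    ∃ q < c.g * c.g * c.g, ¬ Reliable c prog B₀ N₀ t (fun b => z (c.rho * c.lam + b))
      (sampledBlock c (D l) (samples c.lam z) q)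

/-- Union bound over `lam N²` events of probability at most `2^(-(3 lam + 4))` for the samples and
`lam g³` events of probability at most `2^(-(4 lam + 4))` for the votes; each of the two groups
contributes at most `1/16`. -/
theorem ave_ind_fails_le (hR : Room c B Nm) (hrho : c.rho = (c.lam * 3 + 4) * c.g)
    (hr : c.r = (c.lam + 1) * 48) {prog : RamProg} {B₀ : ℕ} {N₀ : Set ℝ} {t : ℕ}
    (ht : t ≤ c.tau) (hM : ∀ M : Fin (2 * c.s - 1) → Fin (2 * c.s - 1) → ℝ,
      2 * 2 ^ t ≤ 3 * Set.ncard {r : Fin t → Bool | ∃ k ≤ t, ∃ s, RunsTo B₀ N₀ prog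
      ((maxSubarray fun _ => Set.univ).start _ M (coinStream r)) k s ∧
      IsGreatest (subarraySums M) (s.xreg 0)}) (D : ℕ → ℕ → ℕ → ℝ) (e : ℕ) :
    ave (c.rho * c.lam + (c.r * c.tau + e)) (fun z => ind (Fails c prog B₀ N₀ t D z)) ≤ 1 / 8 := by
  have hg : 0 < c.g := Room.g_pos c
  have hs := Room.two_le_s c
  have hsg := hR.s_mul_g
  have hsample : ∀ l i j, ave (c.rho * c.lam + (c.r * c.tau + e)) (fun z => ind (∀ q < c.rho,
      samples c.lam z q ∉ smallRank c.N c.s (D l) i j)) ≤ (1 / 2) ^ (c.lam * 3 + 4) := by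
    intro l i j
    have hsub : smallRank c.N c.s (D l) i j ⊆ Finset.range (2 ^ c.lam) := Finset.filter_subset _ _
    have hcard : c.s ≤ (smallRank c.N c.s (D l) i j).card :=
      le_card_small_rank hR.s_le fun k => D l i k + D l k j
    refine (ave_ind_miss c.rho c.lam (c.r * c.tau + e) hsub).le.trans ?_
    refine le_trans ?_ (pow_one_sub_inv_le (g := c.g) (m := c.lam * 3 + 4) hg)
    rw [hrho]
    have hN : (2 : ℝ) ^ c.lam = c.s * c.g := by
      rw [← Nat.cast_mul, hsg]
      unfold Cfg.N
      push_cast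
      rfl
    have h1 := Finset.card_le_card hsub
    rw [Finset.card_range] at h1
    refine pow_le_pow_left₀ ?_ ?_ _
    · rw [sub_nonneg, div_le_one (by positivity)]
      exact_mod_cast h1
    · rw [hN]
      refine sub_le_sub_left ?_ 1
      rw [div_le_div_iff₀ (by positivity) (by positivity), one_mul]
      exact mul_le_mul_of_nonneg_right (by exact_mod_cast hcard) (by positivity)
  have hvote : ∀ l q, ave (c.rho * c.lam + (c.r * c.tau + e)) (fun z => ind (¬ Reliable c prog B₀ N₀ t
      (fun b => z (c.rho * c.lam + b)) (sampledBlock c (D l) (samples c.lam z) q))) ≤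
      (1 / 2) ^ (c.lam * 4 + 4) := by
    intro l q
    rw [ave_add]
    have h1 : ∀ x y, samples c.lam (splice (c.rho * c.lam) x y) =
        fun q => if q < c.rho then samples c.lam x q else
          samples c.lam (splice (c.rho * c.lam) x y) q := by
      intro x y
      funext q
      split_ifs with h
      · exact binary_congr fun b hb => splice_of_lt (mul_add_lt h hb) x y
      · rfl
    have h2 : ∀ x y, sampledBlock c (D l) (samples c.lam (splice (c.rho * c.lam) x y)) q =
        sampledBlock c (D l) (samples c.lam x) q := by
      intro x y
      unfold sampledBlock
      congr 2
      funext i j k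
      congr 1
      refine propext (exists_congr fun q' => and_congr_right fun h => ?_)
      rw [h1]
      simp only [h, if_true]
    -- The query depends only on the first `rho * lam` tosses. Once these are fixed, the votes are
    -- taken on a fixed matrix with fresh tosses, and the bound holds for every choice of the
    -- samples.
    simp only [h2, splice_add]
    refine le_trans (ave_mono fun x => ave_ind_not_reliable_le (h := (c.lam + 1) * 24)
      (by rw [hr]; ring) ht e (hM _)) ?_
    rw [ave_const]
    -- The `48` votes per unit of `lam + 1` are chosen such that `(8/9)^6 ≤ 1/2` can be applied `4
    -- lam + 4` times.
    calc (8 / 9 : ℝ) ^ ((c.lam + 1) * 24) = ((8 / 9) ^ 6) ^ (c.lam * 4 + 4) := by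
          rw [← pow_mul]; congr 1; ring
      _ ≤ (1 / 2) ^ (c.lam * 4 + 4) := pow_le_pow_left₀ (by norm_num) (by norm_num) _
  have hunion : ∀ z, ind (Fails c prog B₀ N₀ t D z) ≤
      (∑ l ∈ Finset.range c.lam, ∑ i ∈ Finset.range c.N, ∑ j ∈ Finset.range c.N,
        ind (∀ q < c.rho, samples c.lam z q ∉ smallRank c.N c.s (D l) i j)) +
      ∑ l ∈ Finset.range c.lam, ∑ q ∈ Finset.range (c.g * c.g * c.g),
        ind (¬ Reliable c prog B₀ N₀ t (fun b => z (c.rho * c.lam + b))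
          (sampledBlock c (D l) (samples c.lam z) q)) := by
    intro z
    have n1 : ∀ l ∈ Finset.range c.lam, 0 ≤ ∑ i ∈ Finset.range c.N, ∑ j ∈ Finset.range c.N,
        ind (∀ q < c.rho, samples c.lam z q ∉ smallRank c.N c.s (D l) i j) := fun l _ =>
      Finset.sum_nonneg fun i _ => Finset.sum_nonneg fun j _ => ind_nonneg _
    have n2 : ∀ l ∈ Finset.range c.lam, 0 ≤ ∑ q ∈ Finset.range (c.g * c.g * c.g),
        ind (¬ Reliable c prog B₀ N₀ t (fun b => z (c.rho * c.lam + b))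
          (sampledBlock c (D l) (samples c.lam z) q)) := fun l _ =>
      Finset.sum_nonneg fun q _ => ind_nonneg _
    by_cases hf : Fails c prog B₀ N₀ t D z
    · rw [ind_of_true hf]
      obtain ⟨l, hl, ⟨i, hi, j, hj, h⟩ | ⟨q, hq, h⟩⟩ := hf
      · refine le_trans ?_ (le_add_of_nonneg_right (Finset.sum_nonneg n2))
        refine le_trans ?_ (Finset.single_le_sum n1 (Finset.mem_range.2 hl))
        refine le_trans ?_ (Finset.single_le_sum (fun i _ => Finset.sum_nonneg fun j _ =>
          ind_nonneg _) (Finset.mem_range.2 hi))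
        refine le_trans ?_ (Finset.single_le_sum (fun j _ => ind_nonneg _) (Finset.mem_range.2 hj))
        rw [ind_of_true h]
      · refine le_trans ?_ (le_add_of_nonneg_left (Finset.sum_nonneg n1))
        refine le_trans ?_ (Finset.single_le_sum n2 (Finset.mem_range.2 hl))
        refine le_trans ?_ (Finset.single_le_sum (fun q _ => ind_nonneg _) (Finset.mem_range.2 hq))
        rw [ind_of_true h]
    · rw [ind_of_not hf]
      exact add_nonneg (Finset.sum_nonneg n1) (Finset.sum_nonneg n2)
  refine (ave_mono hunion).trans ?_
  rw [ave_add_fun, ave_sum, ave_sum]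
  have hl : (c.lam : ℝ) ≤ 2 ^ c.lam := by exact_mod_cast Nat.lt_two_pow_self.le
  have hgN : (c.g : ℝ) ≤ 2 ^ c.lam := by exact_mod_cast hR.g_le
  have s1 : ∑ l ∈ Finset.range c.lam, ave (c.rho * c.lam + (c.r * c.tau + e)) (fun z =>
      ∑ i ∈ Finset.range c.N, ∑ j ∈ Finset.range c.N,
        ind (∀ q < c.rho, samples c.lam z q ∉ smallRank c.N c.s (D l) i j)) ≤ 1 / 16 := by
    calc _ ≤ ∑ l ∈ Finset.range c.lam, ∑ i ∈ Finset.range c.N, ∑ j ∈ Finset.range c.N,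
            (1 / 2 : ℝ) ^ (c.lam * 3 + 4) := by
          refine Finset.sum_le_sum fun l _ => ?_
          rw [ave_sum]
          refine Finset.sum_le_sum fun i _ => ?_
          rw [ave_sum]
          exact Finset.sum_le_sum fun j _ => hsample l i j
      _ = c.lam * (2 ^ c.lam * (2 ^ c.lam * (1 / 2 : ℝ) ^ (c.lam * 3 + 4))) := by
          simp [Cfg.N]
      _ ≤ 2 ^ c.lam * (2 ^ c.lam * (2 ^ c.lam * (1 / 2 : ℝ) ^ (c.lam * 3 + 4))) := by gcongr
      _ = (2 ^ c.lam * (1 / 2)) ^ 3 / (2 ^ c.lam * (1 / 2)) ^ 3 * (1 / 16) := by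
          rw [div_self (by positivity)]
          rw [pow_add, pow_mul, one_div_pow, one_div_pow]
          field_simp
          norm_num
      _ = 1 / 16 := by rw [div_self (by positivity), one_mul]
  have s2 : ∑ l ∈ Finset.range c.lam, ave (c.rho * c.lam + (c.r * c.tau + e)) (fun z =>
      ∑ q ∈ Finset.range (c.g * c.g * c.g),
        ind (¬ Reliable c prog B₀ N₀ t (fun b => z (c.rho * c.lam + b))
          (sampledBlock c (D l) (samples c.lam z) q))) ≤ 1 / 16 := by
    calc _ ≤ ∑ l ∈ Finset.range c.lam, ∑ q ∈ Finset.range (c.g * c.g * c.g),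
            (1 / 2 : ℝ) ^ (c.lam * 4 + 4) := by
          refine Finset.sum_le_sum fun l _ => ?_
          rw [ave_sum]
          exact Finset.sum_le_sum fun q _ => hvote l q
      _ = c.lam * (c.g * c.g * c.g * (1 / 2 : ℝ) ^ (c.lam * 4 + 4)) := by simp
      _ ≤ 2 ^ c.lam * (2 ^ c.lam * 2 ^ c.lam * 2 ^ c.lam * (1 / 2 : ℝ) ^ (c.lam * 4 + 4)) := by
          gcongr
      _ = 1 / 16 := by
          rw [pow_add, pow_mul, one_div_pow, one_div_pow]
          field_simp
          norm_num
  linarith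

end

/-! ### The randomized reduction -/

/-- A bound on the words of the randomized reduction. -/
def randomBound (C K e n : ℕ) : ℕ :=
  (320 + 768 * C + K * 4 ^ e) * n ^ (e + 4)

theorem randomBound_le {C K e n : ℕ} (hn : 1 ≤ n) :
    (320 + 768 * C) * n ^ 4 ≤ randomBound C K e n ∧ K * 4 ^ e * n ^ e ≤ randomBound C K e n := by
  have h : ∀ i ≤ e + 4, n ^ i ≤ n ^ (e + 4) := fun i hi => Nat.pow_le_pow_right hn hi
  unfold randomBound
  exact ⟨Nat.mul_le_mul (by omega) (h _ (by omega)), Nat.mul_le_mul (by omega) (h _ (by omega))⟩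

/-! ### Sizes and times in the randomized reduction -/

section
variable {c : Cfg} {C K e : ℕ}

theorem room_random (hn : 1 ≤ c.n) (hlam : c.lam = Nat.log 2 c.n + 1)
    (hr : c.r = (c.lam + 1) * 48) (htau : c.tau = c.s * c.s * c.s * C)
    (hrho : c.rho = (c.lam * 3 + 4) * c.g) (hL : c.L = 1) (hW : 0 ≤ c.W) :
    Room c (randomBound C K e c.n) Set.univ := by
  obtain ⟨b1, -⟩ := randomBound_le (C := C) (K := K) (e := e) hn
  have hN := Cfg.N_le hn hlam
  have hsg := Cfg.s_mul_g (c := c) (by omega)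
  have hs : c.s ≤ 2 * c.n := by
    refine le_trans ?_ hN
    rw [← hsg]
    exact Nat.le_mul_of_pos_right _ (Room.g_pos _)
  have hg : c.g ≤ 2 * c.n := by
    refine le_trans ?_ hN
    rw [← hsg]
    exact Nat.le_mul_of_pos_left _ ((Room.two_le_s c).trans' (by norm_num))
  have hl : c.lam + 1 ≤ 2 * c.n := (Nat.lt_two_pow_self (n := c.lam)).trans_le hN
  have e1 : (320 + 768 * C) * c.n ^ 4 = 320 * c.n ^ 4 + 768 * C * c.n ^ 4 := by ring
  have e2 : c.n ^ 1 ≤ c.n ^ 4 := Nat.pow_le_pow_right hn (by norm_num)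
  have e3 : c.n ^ 3 ≤ c.n ^ 4 := Nat.pow_le_pow_right hn (by norm_num)
  rw [pow_one] at e2
  have hcube : ∀ x ≤ 2 * c.n, x * x * x ≤ 8 * c.n ^ 3 := fun x hx => by
    calc x * x * x ≤ (2 * c.n) * (2 * c.n) * (2 * c.n) := Nat.mul_le_mul (Nat.mul_le_mul hx hx) hx
      _ = 8 * c.n ^ 3 := by ring
  refine ⟨by omega, (Cfg.n_lt hlam).le, ?_, ?_, ?_, ?_, ?_, hW, fun x _ => trivial⟩
  · have := hcube _ hN
    omega
  · have h1 : c.rho * (c.N * c.N) ≤ 4 * (2 * c.n) * (2 * c.n) * ((2 * c.n) * (2 * c.n)) := by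
      rw [hrho]
      exact Nat.mul_le_mul (Nat.mul_le_mul (by omega) hg) (Nat.mul_le_mul hN hN)
    have h2 : 4 * (2 * c.n) * (2 * c.n) * ((2 * c.n) * (2 * c.n)) = 64 * c.n ^ 4 := by ring
    omega
  · have h1 : c.r * c.tau ≤ 2 * c.n * 48 * (8 * c.n ^ 3 * C) := by
      rw [hr, htau]
      exact Nat.mul_le_mul (Nat.mul_le_mul_right _ hl) (Nat.mul_le_mul_right _ (hcube _ hs))
    have h2 : 2 * c.n * 48 * (8 * c.n ^ 3 * C) = 768 * C * c.n ^ 4 := by ring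
    omega
  · omega
  · omega

/-- Drawing the tosses takes about `(lam + 1) * s³` steps, which is harmless because `s ≤ 32 g³`. -/
theorem randomSetup_time_le {t : ℕ} (hlam : 1 ≤ c.lam) (hr : c.r = (c.lam + 1) * 48)
    (htau : c.tau = c.s * c.s * c.s * C) (hrho : c.rho = (c.lam * 3 + 4) * c.g) :
    c.rho * (c.lam * 5 + 6) + c.r * c.tau * 4 + 19 ≤
      (43 + 6144 * C) * ((c.lam + 1) ^ 2 * (c.g ^ 3 * (c.s ^ 2 + t))) := by
  have hs : 1 ≤ c.s := (Room.two_le_s c).trans' (by norm_num)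
  have hg : 1 ≤ c.g := Room.g_pos c
  have hsg := Cfg.s_mul_g hlam
  have hs4 : c.s ^ 4 ≤ 32 * c.g := by
    have h := c.s_pow_le
    rw [← hsg] at h
    have h' : c.s * c.s ^ 4 ≤ c.s * (32 * c.g) := by
      calc c.s * c.s ^ 4 = c.s ^ 5 := by ring
        _ ≤ _ := h
        _ = _ := by ring
    exact Nat.le_of_mul_le_mul_left h' hs
  have hss : c.s ≤ 32 * c.g ^ 3 :=
    (Nat.le_self_pow (by norm_num) _).trans (hs4.trans (Nat.mul_le_mul_left _
      (Nat.le_self_pow (by norm_num) _)))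
  have hs2 : 1 ≤ c.s ^ 2 := Nat.one_le_pow _ _ hs
  have hg3 : c.g ≤ c.g ^ 3 := Nat.le_self_pow (by norm_num) _
  set X := (c.lam + 1) ^ 2 * (c.g ^ 3 * (c.s ^ 2 + t)) with hX
  have h1 : c.rho * (c.lam * 5 + 6) ≤ 24 * X := by
    calc c.rho * (c.lam * 5 + 6) ≤ (4 * (c.lam + 1) * c.g ^ 3) * (6 * (c.lam + 1)) := by
          rw [hrho]
          exact Nat.mul_le_mul (Nat.mul_le_mul (by omega) hg3) (by omega)
      _ = 24 * ((c.lam + 1) ^ 2 * (c.g ^ 3 * 1)) := by ring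
      _ ≤ 24 * X := Nat.mul_le_mul_left _ (Nat.mul_le_mul_left _ (Nat.mul_le_mul_left _ (by omega)))
  have h2 : c.r * c.tau * 4 ≤ 6144 * C * X := by
    calc c.r * c.tau * 4 = 192 * C * ((c.lam + 1) * (c.s * c.s ^ 2)) := by rw [hr, htau]; ring
      _ ≤ 192 * C * ((c.lam + 1) ^ 2 * ((32 * c.g ^ 3) * (c.s ^ 2 + t))) :=
          Nat.mul_le_mul_left _ (Nat.mul_le_mul (Nat.le_self_pow two_ne_zero _)
            (Nat.mul_le_mul hss (Nat.le_add_right _ _)))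
      _ = 6144 * C * X := by rw [hX]; ring
  have h3 : 1 ≤ X := Nat.mul_pos (Nat.pow_pos (Nat.succ_pos _))
    (Nat.mul_pos (Nat.pow_pos hg) (Nat.add_pos_left hs2 _))
  have h4 : (43 + 6144 * C) * X = 24 * X + 6144 * C * X + 19 * X := by ring
  omega

/-- Every sequence of tosses outside `Fails` gives a correct answer. Those inside are at most one
eighth of all, well below the permitted third. -/
theorem apspProg_random_spec {prog : RamProg} {mb t T : ℕ} (hn : 1 ≤ c.n)
    (hlam : c.lam = Nat.log 2 c.n + 1) (hr : c.r = (c.lam + 1) * 48)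
    (htau : c.tau = c.s * c.s * c.s * C) (hrho : c.rho = (c.lam * 3 + 4) * c.g) (hL : c.L = 1)
    {w : Fin c.n → Fin c.n → Option ℝ} (hw : NoNegativeCycle w)
    (hthr : c.thr = 2 * (c.N * maxWeight w)) (hW : c.W = c.N * (4 * (c.N * maxWeight w)))
    (hmb : prog.Below mb) (hmb1 : 1 ≤ mb) (ht : t ≤ c.tau)
    (hsolve : ∀ M : Fin (2 * c.s - 1) → Fin (2 * c.s - 1) → ℝ,
      (∀ r : Fin t → Bool, ∃ k ≤ t, ∃ s, RunsTo (K * (2 * c.s - 1) ^ e) Set.univ prog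
        ((maxSubarray fun _ => Set.univ).start _ M (coinStream r)) k s) ∧
      2 * 2 ^ t ≤ 3 * Set.ncard {r : Fin t → Bool | ∃ k ≤ t, ∃ s,
        RunsTo (K * (2 * c.s - 1) ^ e) Set.univ prog
        ((maxSubarray fun _ => Set.univ).start _ M (coinStream r)) k s ∧
        IsGreatest (subarraySums M) (s.xreg 0)})
    (hT : apspTime c (c.rho * (c.lam * 5 + 6) + c.r * c.tau * 4 + 19) mb t ≤ T) :
    (∀ ω : Fin T → Bool, ∃ k ≤ T, ∃ s, RunsTo (randomBound C K e c.n) Set.univ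
      (apspProg (randomSetup C) mb prog)
      ((allPairsShortestPaths fun _ => Set.univ).start c.n w (coinStream ω)) k s) ∧
    2 * 2 ^ T ≤ 3 * Set.ncard {ω : Fin T → Bool | ∃ k ≤ T, ∃ s,
      RunsTo (randomBound C K e c.n) Set.univ (apspProg (randomSetup C) mb prog)
      ((allPairsShortestPaths fun _ => Set.univ).start c.n w (coinStream ω)) k s ∧
      (allPairsShortestPaths fun _ => Set.univ).Answers c.n w s} := by
  have hM1 : 1 ≤ maxWeight w := one_le_maxAbs _ _
  have hW0 : 0 ≤ c.W := by rw [hW]; positivity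
  have hR := room_random (C := C) (K := K) (e := e) hn hlam hr htau hrho hL hW0
  obtain ⟨b1, b2⟩ := randomBound_le (C := C) (K := K) (e := e) hn
  have hB : K * (2 * c.s - 1) ^ e ≤ randomBound C K e c.n := by
    have hN2 : c.N ≤ 2 * c.n := Cfg.N_le hn hlam
    have hsN : c.s ≤ c.N := hR.s_le
    refine le_trans ?_ b2
    rw [mul_assoc, ← mul_pow]
    exact Nat.mul_le_mul_left _ (Nat.pow_le_pow_left (by omega) _)
  have hCB : C ≤ randomBound C K e c.n := by
    have : C * 1 ≤ 768 * C * c.n ^ 4 := Nat.mul_le_mul (by omega) (Nat.one_le_pow _ _ hn)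
    rw [add_mul] at b1
    omega
  have hO : ∀ zb, OracleFor c (randomBound C K e c.n) Set.univ ⊤ prog mb (K * (2 * c.s - 1) ^ e)
      Set.univ t zb := fun zb =>
    { below := hmb
      mb_pos := hmb1
      B_le := hB
      N_le := fun _ h => h
      t_le := ht
      halts := fun M _ q _ => by
        obtain ⟨k, hk, s', hr'⟩ := (hsolve M).1 fun b => zb (q * c.tau + b)
        exact ⟨_, k, hk, s', hr', rfl⟩ }
  set D : ℕ → ℕ → ℕ → ℝ := minPlusPow c.N (initDist w (4 * (c.N * maxWeight w)))
  have hrun : ∀ z, Runs (randomBound C K e c.n) Set.univ (apspProg (randomSetup C) mb prog)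
      ((allPairsShortestPaths fun _ => Set.univ).start c.n w z) T fun s' =>
      ¬ Fails c prog (K * (2 * c.s - 1) ^ e) Set.univ t D z →
      (allPairsShortestPaths fun _ => Set.univ).Answers c.n w s' := by
    intro z
    have hgood : ¬ Fails c prog (K * (2 * c.s - 1) ^ e) Set.univ t D z → ∀ l < c.lam, ∀ D' mid,
        (∀ i < c.N, ∀ j < c.N, D' i j = D l i j) →
        LevelGood c ⊤ (Reliable c prog (K * (2 * c.s - 1) ^ e) Set.univ t
          fun b => z (c.rho * c.lam + b)) (samples c.lam z) (fun _ => 0) D' mid := by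
      intro hf l hl D' mid hD
      refine levelGood_randomized hR hL hD (fun i hi j hj => ?_) fun q hq => ?_
      · by_contra! h
        exact hf ⟨l, hl, .inl ⟨i, hi, j, hj, h⟩⟩
      · by_contra h
        exact hf ⟨l, hl, .inr ⟨q, hq, h⟩⟩
    have hP := prepares_random hR hCB hr htau hrho hL z
    rw [hW] at hP
    obtain ⟨k, hk, s', hr', hs'⟩ := apsp_spec hR (hO _) hw hn hlam hthr hW.ge hP
      (fun _ _ => le_rfl) (fun _ _ => hW0) (fun _ _ => AddSubgroup.mem_top _)
      ⟨0, by omega, rfl⟩ (AddSubgroup.mem_top _) (AddSubgroup.mem_top _)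
      (fun _ _ _ _ => AddSubgroup.mem_top _) (fun q _ => binary_lt _ _) hgood
      (fun _ => Set.univ)
    exact ⟨k, hk.trans hT, s', hr', hs'⟩
  refine ⟨fun ω => ?_, ?_⟩
  · obtain ⟨k, hk, s', hr', -⟩ := hrun (coinStream ω)
    exact ⟨k, hk, s', hr'⟩
  · obtain ⟨e', rfl⟩ : ∃ e', T = c.rho * c.lam + (c.r * c.tau + e') := by
      have h1 : c.rho * c.lam ≤ c.rho * (c.lam * 5 + 6) := Nat.mul_le_mul_left _ (by omega)
      unfold apspTime at hT
      exact ⟨T - (c.rho * c.lam + c.r * c.tau), by omega⟩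
    set T := c.rho * c.lam + (c.r * c.tau + e') with hTdef
    have h1 := ave_ind_fails_le hR hrho hr ht (fun M => (hsolve M).2) D e'
    rw [← hTdef, ave_eq_sum, div_le_iff₀ (by positivity)] at h1
    have h2 : (2 : ℝ) ^ T ≤ (∑ ω : Fin T → Bool, ind (Fails c prog (K * (2 * c.s - 1) ^ e) Set.univ
        t D (coinStream ω))) + ∑ ω : Fin T → Bool, ind (∃ k ≤ T, ∃ s,
        RunsTo (randomBound C K e c.n) Set.univ (apspProg (randomSetup C) mb prog)
        ((allPairsShortestPaths fun _ => Set.univ).start c.n w (coinStream ω)) k s ∧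
        (allPairsShortestPaths fun _ => Set.univ).Answers c.n w s) := by
      have h3 : (2 : ℝ) ^ T = ∑ ω : Fin T → Bool, (1 : ℝ) := by simp
      rw [h3, ← Finset.sum_add_distrib]
      refine Finset.sum_le_sum fun ω _ => ?_
      by_cases hf : Fails c prog (K * (2 * c.s - 1) ^ e) Set.univ t D (coinStream ω)
      · rw [ind_of_true hf]
        exact le_add_of_nonneg_right (ind_nonneg _)
      · obtain ⟨k, hk, s', hr', hs'⟩ := hrun (coinStream ω)
        exact (ind_of_true ⟨k, hk, s', hr', hs' hf⟩).ge.trans (le_add_of_nonneg_left (ind_nonneg _))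
    rw [sum_ind_eq_ncard (fun ω : Fin T → Bool => ∃ k ≤ T, ∃ s, _)] at h2
    have h4 : (0 : ℝ) < 2 ^ T := by positivity
    have h5 := mul_le_mul_of_nonneg_left (h2.trans (add_le_add_left h1 _)) (zero_le_three (α := ℝ))
    have h6 : (2 : ℝ) * 2 ^ T ≤ 3 * (Set.ncard {ω : Fin T → Bool | ∃ k ≤ T, ∃ s,
        RunsTo (randomBound C K e c.n) Set.univ (apspProg (randomSetup C) mb prog)
        ((allPairsShortestPaths fun _ => Set.univ).start c.n w (coinStream ω)) k s ∧
        (allPairsShortestPaths fun _ => Set.univ).Answers c.n w s} : ℝ) := by linarith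
    exact_mod_cast h6

end

/-- The parameters of the randomized reduction. -/
noncomputable def randomCfg (C n : ℕ) (M : ℝ) : Cfg where
  n := n
  lam := Nat.log 2 n + 1
  r := (Nat.log 2 n + 1 + 1) * 48
  tau := 2 ^ ((Nat.log 2 n + 1) / 5 + 1) * 2 ^ ((Nat.log 2 n + 1) / 5 + 1) *
    2 ^ ((Nat.log 2 n + 1) / 5 + 1) * C
  rho := ((Nat.log 2 n + 1) * 3 + 4) * 2 ^ (Nat.log 2 n + 1 - ((Nat.log 2 n + 1) / 5 + 1))
  L := 1
  W := ((2 ^ (Nat.log 2 n + 1) : ℕ) : ℝ) * (4 * (((2 ^ (Nat.log 2 n + 1) : ℕ) : ℝ) * M))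
  thr := 2 * (((2 ^ (Nat.log 2 n + 1) : ℕ) : ℝ) * M)

theorem randomizedTime_allPairsShortestPaths {ε : ℝ} (hε : 0 < ε) (hε1 : ε ≤ 1)
    (h : (maxSubarray fun _ => Set.univ).RandomizedTime (3 - ε)) :
    (allPairsShortestPaths fun _ => Set.univ).RandomizedTime (3 - ε / 10) := by
  obtain ⟨prog, C, K, e, t, h⟩ := h
  obtain ⟨m₀, hm₀⟩ := prog.exists_below
  have hmb : prog.Below (m₀ + 1) := hm₀.mono (Nat.le_succ _)
  set C' := 8 * ⌈|C|⌉₊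
  obtain ⟨C₂, hC₂⟩ := exists_coreTime_le hε hε1 fun m hm => (h m hm).1
  set A := 48 + 6144 * C' + (m₀ + 1) with hA
  set A' := 141 + 20 * A + A * (104 + A * (4 * A + 89) + 678)
  refine ⟨apspProg (randomSetup C') (m₀ + 1) prog, A' * C₂, 320 + 768 * C' + K * 4 ^ e, e + 4,
    fun n => A' * coreTime (randomCfg C' n 1) (t (2 * (randomCfg C' n 1).s - 1)),
    fun n hn => ⟨?_, ?_⟩⟩
  · have := hC₂ (randomCfg C' n 1) hn rfl
    push_cast
    rw [mul_assoc]
    exact mul_le_mul_of_nonneg_left this (by positivity)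
  · rintro w ⟨hw, -⟩
    have hs2 := Room.two_le_s (randomCfg C' n (maxWeight w))
    have hm1 : 1 ≤ 2 * (randomCfg C' n (maxWeight w)).s - 1 := by omega
    obtain ⟨htm, hsolve⟩ := h _ hm1
    have hlam : 1 ≤ (randomCfg C' n (maxWeight w)).lam := Nat.le_add_left _ _
    refine apspProg_random_spec (c := randomCfg C' n (maxWeight w)) (C := C') (K := K) (e := e)
      (t := t (2 * (randomCfg C' n (maxWeight w)).s - 1)) hn rfl rfl rfl rfl rfl hw rfl rfl
      hmb (Nat.le_add_left _ _) (le_of_mul_rpow_le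
      (s := (randomCfg C' n (maxWeight w)).s) hε hm1 (by omega) htm)
      (fun M => hsolve M fun _ _ => trivial) ?_
    refine apspTime_le (c := randomCfg C' n (maxWeight w)) hlam ?_ ?_ ?_ ?_ ?_
    · have : (randomCfg C' n (maxWeight w)).r = ((randomCfg C' n (maxWeight w)).lam + 1) * 48 := rfl
      rw [this, mul_comm]
      exact Nat.mul_le_mul_right _ (by omega)
    · have : (randomCfg C' n (maxWeight w)).rho = ((randomCfg C' n (maxWeight w)).lam * 3 + 4) *
        (randomCfg C' n (maxWeight w)).g := rfl
      rw [this, mul_comm (randomCfg C' n (maxWeight w)).g, ← mul_assoc]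
      refine Nat.mul_le_mul_right _ (le_trans ?_ (Nat.mul_le_mul_right _ (show 4 ≤ A by omega)))
      omega
    · exact Nat.mul_pos (by omega) (Nat.succ_pos _)
    · omega
    · exact (randomSetup_time_le hlam rfl rfl rfl).trans (Nat.mul_le_mul_right _ (by omega))

theorem mainTheorem3 (ε : ℝ) (hε : 0 < ε) :
    ((maxSubarray fun _ => Set.univ).RandomizedTime (3 - ε) →
      (allPairsShortestPaths fun _ => Set.univ).RandomizedTime (3 - ε / 10)) ∧
    ((∀ c : ℕ, (maxSubarray fun n => {x | IsSmallInt c n x}).DeterministicTime (3 - ε)) →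
      ∀ c : ℕ,
        (allPairsShortestPaths fun n => {x | IsSmallInt c n x}).DeterministicTime (3 - ε / 10)) := by
  -- For `ε > 1` the exponent `3 - ε` is below `2`, and no algorithm for Maximum Subarray is that
  -- fast.
  by_cases hε1 : ε ≤ 1
  · exact ⟨randomizedTime_allPairsShortestPaths hε hε1,
      deterministicTime_allPairsShortestPaths hε hε1⟩
  · exact ⟨fun h => absurd h (not_randomizedTime (by linarith)),
      fun h => absurd (h 0) (not_deterministicTime (by linarith) 0)⟩
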